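/- **Setting.** Let $\mathrm{ThCartSp}$ be the category of thickened Cartesian spaces $\mathbb R^k\times\mathbb D$, the opposite of the category of algebras $C^\infty(\mathbb R^k)\otimes W$ with $W=\mathcal O(\mathbb D)$ a Weil algebra (a finite-dimensional commutative real algebra $\mathbb R\oplus V$ with every element of $V$ nilpotent), and let $\mathrm{ThSmthSet}$ be the category of thickened smooth sets: the sheaves on $\mathrm{ThCartSp}$ with respect to differentiably good open covers of the factors $\mathbb R^k$, extended trivially along the factors $\mathbb D$. A smooth manifold $N$ is regarded as the thickened smooth set $y(N)$ whose plots over $X=\mathbb R^k\times\mathbb D$ are the algebra maps $C^\infty(N)\to\mathcal O(X)=C^\infty(\mathbb R^k)\otimes\mathcal O(\mathbb D)$. The synthetic tangent bundle of $G\in\mathrm{ThSmthSet}$ is $TG=[\mathbb D^1(1),G]$ with $\mathcal O(\mathbb D^1(1))=\mathbb R[\epsilon]/\epsilon^2$, that is, $TG(X)=G(X\times\mathbb D^1(1))$; it has a projection $TG\to G$ and a zero section $0_G:G\to TG$. Two tangent plots $v,w$ over the same plot of $G$ have sum $z$ if some map $X\times\mathbb D^2(1)\to G$, where $\mathcal O(\mathbb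 D^2(1))=\mathbb R[\epsilon_1,\epsilon_2]/(\epsilon_1,\epsilon_2)^2$, restricts to $v$, $w$ on the two axes and to $z$ on the diagonal; functions $r\in\mathcal O(X)$ act by rescaling $\epsilon\mapsto r\epsilon$. For a manifold $N$ with tangent bundle $TN$ let $\kappa_N:y(TN)\to T(y(N))$ be the canonical map induced by $C^\infty(N)\to C^\infty(TN)\otimes\mathbb R[\epsilon]/\epsilon^2$, $f\mapsto f\circ\pi+\epsilon\, df$. Let $\pi:F\to M$ be a smooth fibre bundle of finite-dimensional (Hausdorff, second countable) smooth manifolds, with a typical fibre $N$, let $VF=\ker(d\pi)\subset TF$ be its vertical bundle, and let $J^n_MF$ be the manifold of $n$-jets of local smooth sections of $\pi$. Put $J^\infty_MF:=\lim_n y(J^n_MF)$ in $\mathrm{ThSmthSet}$, with projections $\pi^\infty_n:J^\infty_MF\to J^n_MF$ and $\pi_M:J^\infty_MF\to M$. Define $J^\infty_MVF$ likewise from the bundle $VF\to M$. The vertical bundle $VJ^\infty_MF\hookrightarrow TJ^\infty_MF$ is the pullback of $T\pi_M:TJ^\infty_MF\to TM$ along the zero section $0_M:M\to TM$. **Proposition.**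 The maps $\kappa_M$ and $\kappa_{J^n_MF}$, $n\ge 0$, are isomorphisms; identify $y(TN)$ with $T(y(N))$ along them. Then the following hold. 1. There is an isomorphism $T(J^\infty_MF)\cong\lim_n y(T J^n_MF)$ in $\mathrm{ThSmthSet}$ under which the $n$-th limit projection is the synthetic differential $T\pi^\infty_n$, for every $n$. 2. There are smooth maps $\theta_n:J^n_M(VF)\to T(J^n_MF)$ such that, for every smooth one-parameter family $s_t$ of local sections of $\pi$ near $p\in M$ with velocity $\sigma(q)=\frac{d}{dt}\big|_0 s_t(q)$, one has $\theta_n(j^n_p\sigma)=\frac{d}{dt}\big|_0 j^n_ps_t$; and there is an isomorphism $VJ^\infty_MF\cong J^\infty_MVF$ of bundles of thickened smooth sets over $F$, hence over $M$, whose inverse, followed by $VJ^\infty_MF\hookrightarrow TJ^\infty_MF\xrightarrow{T\pi^\infty_n}T(J^n_MF)$, is $J^\infty_MVF\to J^n_MVF\xrightarrow{\theta_n}T(J^n_MF)$ for every $n$. 3. There are smooth maps $H^n:J^{n+1}_MF\times_MTM\to T(J^n_MF)$ with $H^n(j^{n+1}_ps,X)=d(j^ns)_p(X)$ for every local section $s$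 of $\pi$ near $p$ and every $X\in T_pM$. The canonical maps identify the manifolds $J^n_MF\times_MTM$ with the corresponding fibre products in $\mathrm{ThSmthSet}$. There is exactly one map of thickened smooth sets $$H:J^\infty_MF\times_MTM\longrightarrow T(J^\infty_MF)\qquad\text{with}\qquad T\pi^\infty_n\circ H=H^n\circ(\pi^\infty_{n+1}\times\mathrm{id})\quad\text{for all }n .$$ It is a section of the map $(\mathrm{pr},T\pi_M):TJ^\infty_MF\to J^\infty_MF\times_MTM$, and it splits the exact sequence $$0\to VJ^\infty_MF\hookrightarrow TJ^\infty_MF\to J^\infty_MF\times_MTM\to 0$$ over $J^\infty_MF$: the map $VJ^\infty_MF\to TJ^\infty_MF$ is a monomorphism, and for every probe $X$ and every plot $s\in J^\infty_MF(X)$ the fibres of $TJ^\infty_MF$ over $s$ and of $TM$ over $\pi_M(s)$ are $\mathcal O(X)$-modules under the operations above, $T\pi_M$ is $\mathcal O(X)$-linear between them with kernel the plots of $VJ^\infty_MF$ over $s$, the map $H$ gives an $\mathcal O(X)$-linear right inverse of it, and the kernel of the one and the image of the other are complementary submodules. The plot-wise image $HJ^\infty_MF\subset TJ^\infty_MF$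 of $H$ is a thickened smooth set, and there is an isomorphism $$TJ^\infty_MF\;\cong\;VJ^\infty_MF\oplus HJ^\infty_MF$$ over $J^\infty_MF$, where $\oplus$ is the fibre product over $J^\infty_MF$ and the inverse isomorphism is fibrewise addition $(v,w)\mapsto v+w$ in $TJ^\infty_MF$. -/

import Mathlib

open CategoryTheory Limits Opposite
open scoped Manifold ContDiff Topology TensorProduct

set_option linter.unusedSectionVars false

noncomputable section

/-- Weil algebras: finite-dimensional real algebras `ℝ ⊕ V` with all elements of `V` nilpotent. -/
class IsWeilAlgebra (W : Type) [CommRing W] [Algebra ℝ W] : Prop where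
  nontrivial : Nontrivial W
  finite : Module.Finite ℝ W
  exists_isNilpotent_sub : ∀ w : W, ∃ r : ℝ, IsNilpotent (w - algebraMap ℝ W r)

attribute [instance] IsWeilAlgebra.nontrivial IsWeilAlgebra.finite

/-- The Cartesian space `ℝ^k`. -/
abbrev Cart (k : ℕ) : Type := EuclideanSpace ℝ (Fin k)

/-- The algebra `C^∞(ℝ^k)`. -/
abbrev CartFun (k : ℕ) : Type := C^∞⟮𝓘(ℝ, Cart k), Cart k; ℝ⟯

/-- Thickened Cartesian spaces `ℝ^k × 𝔻`, where `W` is the function algebra of the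
infinitesimally thickened point `𝔻`. -/
structure ThCartSp : Type 1 where
  k : ℕ
  W : Type
  [commRing : CommRing W]
  [algebra : Algebra ℝ W]
  [isWeil : IsWeilAlgebra W]

namespace ThCartSp

attribute [instance] commRing algebra isWeil

/-- The function algebra `C^∞(ℝ^k) ⊗ W` of `ℝ^k × 𝔻`. -/
abbrev O (X : ThCartSp) : Type := CartFun X.k ⊗[ℝ] X.W

/-- Morphisms of thickened Cartesian spaces: algebra maps in the opposite direction. -/
@[ext]
structure Hom (X Y : ThCartSp) : Type where
  comorphism : Y.O →ₐ[ℝ] X.O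

instance : Category ThCartSp where
  Hom := Hom
  id X := ⟨AlgHom.id ℝ X.O⟩
  comp f g := ⟨f.comorphism.comp g.comorphism⟩

@[ext]
theorem hom_ext {X Y : ThCartSp} {f g : X ⟶ Y} (h : f.comorphism = g.comorphism) : f = g :=
  Hom.ext h

@[simp] theorem id_comorphism (X : ThCartSp) : Hom.comorphism (𝟙 X) = AlgHom.id ℝ X.O := rfl

@[simp] theorem comp_comorphism {X Y Z : ThCartSp} (f : X ⟶ Y) (g : Y ⟶ Z) :
    (f ≫ g).comorphism = f.comorphism.comp g.comorphism := rfl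

end ThCartSp

/-- `u` is a diffeomorphism from `ℝ^k` onto an open subset of `ℝ^k`. -/
structure IsOpenSmoothEmbedding {k : ℕ} (u : Cart k → Cart k) : Prop where
  contDiff : ContDiff ℝ ∞ u
  isOpen_range : IsOpen (Set.range u)
  exists_inverse : ∃ v : Cart k → Cart k, ContDiffOn ℝ ∞ v (Set.range u) ∧ Function.LeftInverse v u

/-- Differentiably good open covers of `ℝ^k`: the members `U i` and all their nonempty finite
intersections are diffeomorphic to `ℝ^k`; `u i` is a parametrization of `U i`. -/
structure GoodOpenCover (k : ℕ) : Type 1 where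
  ι : Type
  u : ι → Cart k → Cart k
  isEmb : ∀ i, IsOpenSmoothEmbedding (u i)
  covers : ∀ x, ∃ i, x ∈ Set.range (u i)
  good : ∀ s : Finset ι, s.Nonempty → (⋂ i ∈ s, Set.range (u i)).Nonempty →
    ∃ w : Cart k → Cart k, IsOpenSmoothEmbedding w ∧ Set.range w = ⋂ i ∈ s, Set.range (u i)

/-- Pullback of smooth functions along a smooth map, as an algebra map. -/
def smoothPullback {E H N E' H' N' : Type} [NormedAddCommGroup E] [NormedSpace ℝ E]
    [TopologicalSpace H] {I : ModelWithCorners ℝ E H} [TopologicalSpace N] [ChartedSpace H N]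
    [NormedAddCommGroup E'] [NormedSpace ℝ E'] [TopologicalSpace H']
    {I' : ModelWithCorners ℝ E' H'} [TopologicalSpace N'] [ChartedSpace H' N']
    (f : C^∞⟮I, N; I', N'⟯) : C^∞⟮I', N'; ℝ⟯ →ₐ[ℝ] C^∞⟮I, N; ℝ⟯ where
  toFun g := g.comp f
  map_one' := rfl
  map_mul' _ _ := rfl
  map_zero' := rfl
  map_add' _ _ := rfl
  commutes' _ := rfl

/-- A smooth map `ℝ^k → ℝ^k` as an element of the bundled type of smooth maps. -/
def cartMap {k : ℕ} (u : Cart k → Cart k) (hu : ContDiff ℝ ∞ u) :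
    C^∞⟮𝓘(ℝ, Cart k), Cart k; 𝓘(ℝ, Cart k), Cart k⟯ := ⟨u, hu.contMDiff⟩

namespace GoodOpenCover

/-- The inclusion `U i × 𝔻 ⟶ ℝ^k × 𝔻`, with `U i` identified with `ℝ^k` along `u i`. -/
def incl (X : ThCartSp) (c : GoodOpenCover X.k) (i : c.ι) : X ⟶ X :=
  ⟨Algebra.TensorProduct.map (smoothPullback (cartMap (c.u i) (c.isEmb i).contDiff))
    (AlgHom.id ℝ X.W)⟩

/-- The covering family of `ℝ^k × 𝔻` obtained from a good open cover of `ℝ^k`. -/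
def presieve (X : ThCartSp) (c : GoodOpenCover X.k) : Presieve X :=
  Presieve.ofArrows (fun _ : c.ι => X) (c.incl X)

end GoodOpenCover

/-- The sheaf condition with respect to good open covers, extended trivially along the
infinitesimal directions. -/
def IsThickenedSmoothSet : ObjectProperty (ThCartSpᵒᵖ ⥤ Type) := fun F =>
  ∀ (X : ThCartSp) (c : GoodOpenCover X.k), Presieve.IsSheafFor F (c.presieve X)

/-- The category of thickened smooth sets. -/
abbrev ThSmthSet : Type 1 := IsThickenedSmoothSet.FullSubcategory

/-- The set of `X`-plots of a thickened smooth set. -/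
abbrev Plots (G : ThSmthSet) (X : ThCartSp) : Type := G.obj.obj (op X)

/-- The action of a map of thickened smooth sets on plots. -/
abbrev ap {G H : ThSmthSet} (f : G ⟶ H) {X : ThCartSp} (x : Plots G X) : Plots H X :=
  f.hom.app (op X) x

/-- Restriction of plots along a map of probes. -/
abbrev res (G : ThSmthSet) {X Y : ThCartSp} (f : Y ⟶ X) (x : Plots G X) : Plots G Y :=
  G.obj.map f.op x

instance {J : Type} [SmallCategory J] : IsThickenedSmoothSet.IsClosedUnderLimitsOfShape J where
  limitsOfShape_le := by
    rintro F ⟨p⟩ X c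
    rw [GoodOpenCover.presieve, Presieve.isSheafFor_arrows_iff]
    intro x hx
    have hlim (Y : ThCartSpᵒᵖ) := isLimitOfPreserves ((evaluation _ _).obj Y) p.isLimit
    have nat : ∀ (j : J) {Y Z : ThCartSpᵒᵖ} (f : Y ⟶ Z) (a : F.obj Y),
        (p.π.app j).app Z (F.map f a) = (p.diag.obj j).map f ((p.π.app j).app Y a) :=
      fun j _ _ f a => NatTrans.naturality_apply (p.π.app j) f a
    have cone : ∀ {j j' : J} (f : j ⟶ j') (Y : ThCartSpᵒᵖ) (a : F.obj Y),
        (p.diag.map f).app Y ((p.π.app j).app Y a) = (p.π.app j').app Y a := by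
      intro j j' f Y a
      have h2 : ((p.π.app j) ≫ p.diag.map f) = p.π.app j' := by
        simpa using (p.π.naturality f).symm
      rw [← h2]; rfl
    have ext : ∀ {Y : ThCartSpᵒᵖ} (a b : F.obj Y),
        (∀ j, (p.π.app j).app Y a = (p.π.app j).app Y b) → a = b := by
      intro Y a b h
      exact ((Types.isLimit_iff _).1 ⟨hlim Y⟩ (fun j => (p.π.app j).app Y b)
        (fun f => cone f Y b)).unique h (fun j => rfl)
    have key : ∀ j, ∃! t : (p.diag.obj j).obj (op X), ∀ i,
        (p.diag.obj j).map (c.incl X i).op t = (p.π.app j).app (op X) (x i) := by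
      intro j
      have := p.prop_diag_obj j X c
      rw [GoodOpenCover.presieve, Presieve.isSheafFor_arrows_iff] at this
      refine this (fun i => (p.π.app j).app (op X) (x i)) ?_
      intro i i' Z gi gj h
      exact (nat j gi.op (x i)).symm.trans
        ((congrArg ((p.π.app j).app (op Z)) (hx i i' Z gi gj h)).trans (nat j gj.op (x i')))
    choose t ht hu using key
    have hc : ∀ {j j' : J} (f : j ⟶ j'), (p.diag.map f).app (op X) (t j) = t j' := by
      intro j j' f
      apply hu
      intro i
      have h1 := congrArg ((p.diag.map f).app (op X)) (ht j i)
      rw [NatTrans.naturality_apply] at h1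
      exact h1.trans (cone f _ _)
    obtain ⟨s, hs, -⟩ := (Types.isLimit_iff _).1 ⟨hlim (op X)⟩ t
      (fun f => hc f)
    have hs : ∀ j, (p.π.app j).app (op X) s = t j := hs
    refine ⟨s, fun i => ext _ _ fun j => ?_, fun s' hs' => ext _ _ fun j => ?_⟩
    · exact (nat j (c.incl X i).op s).trans ((congrArg _ (hs j)).trans (ht j i))
    · refine Eq.trans ?_ (hs j).symm
      apply hu
      intro i
      exact (nat j (c.incl X i).op s').symm.trans (congrArg ((p.π.app j).app (op X)) (hs' i))

instance {J : Type} [SmallCategory J] : HasLimitsOfShape J ThSmthSet :=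
  hasLimitsOfShape_of_closedUnderLimits J _

/-! ### Formal duals of algebras as thickened smooth sets -/

/-- Evaluation of smooth functions at a point. -/
def evalFun {k : ℕ} (p : Cart k) : CartFun k →ₐ[ℝ] ℝ where
  toFun f := f p
  map_one' := rfl
  map_mul' _ _ := rfl
  map_zero' := rfl
  map_add' _ _ := rfl
  commutes' _ := rfl

/-- Evaluation at a point `p` of `ℝ^k`, leaving the infinitesimal directions. -/
def evalPoint (X : ThCartSp) (p : Cart X.k) : X.O →ₐ[ℝ] X.W :=
  Algebra.TensorProduct.lift ((Algebra.ofId ℝ X.W).comp (evalFun p))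
    (AlgHom.id ℝ X.W) (fun _ _ => Commute.all _ _)

@[simp] theorem evalPoint_tmul (X : ThCartSp) (p : Cart X.k) (f : CartFun X.k) (w : X.W) :
    evalPoint X p (f ⊗ₜ w) = f p • w := by
  simp [evalPoint, Algebra.smul_def, Algebra.ofId_apply]
  rfl

theorem evalPoint_incl (X : ThCartSp) (c : GoodOpenCover X.k) (i : c.ι) (p : Cart X.k) (a : X.O) :
    evalPoint X p ((c.incl X i).comorphism a) = evalPoint X (c.u i p) a := by
  induction a using TensorProduct.induction_on with
  | zero => simp
  | add a b ha hb => simp [ha, hb]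
  | tmul f w =>
    simp only [GoodOpenCover.incl, Algebra.TensorProduct.map_tmul, evalPoint_tmul]
    rfl

theorem exists_evalPoint (X : ThCartSp) (g : Cart X.k → X.W)
    (hg : ∀ ℓ : X.W →ₗ[ℝ] ℝ, ContDiff ℝ ∞ fun p => ℓ (g p)) :
    ∃ a : X.O, ∀ p, evalPoint X p a = g p := by
  let b := Module.finBasis ℝ X.W
  refine ⟨∑ j, (⟨fun p => b.coord j (g p), (hg (b.coord j)).contMDiff⟩ : CartFun X.k) ⊗ₜ b j,
    fun p => ?_⟩
  rw [map_sum]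
  refine (Finset.sum_congr rfl fun j _ => ?_).trans (b.sum_repr (g p))
  exact evalPoint_tmul X p _ _

theorem evalPoint_contDiff (X : ThCartSp) (a : X.O) (ℓ : X.W →ₗ[ℝ] ℝ) :
    ContDiff ℝ ∞ fun p => ℓ (evalPoint X p a) := by
  induction a using TensorProduct.induction_on with
  | zero => simpa using contDiff_const
  | add a b ha hb => simpa using ha.add hb
  | tmul f w => simpa using f.contMDiff.contDiff.mul contDiff_const

theorem evalPoint_ext (X : ThCartSp) {a b : X.O} (h : ∀ p, evalPoint X p a = evalPoint X p b) :
    a = b := by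
  let β := Module.finBasis ℝ X.W
  obtain ⟨f, rfl⟩ := (TensorProduct.equivFinsuppOfBasisRight (M := CartFun X.k) β).symm.surjective a
  obtain ⟨g, rfl⟩ := (TensorProduct.equivFinsuppOfBasisRight (M := CartFun X.k) β).symm.surjective b
  congr 1
  ext j p
  have key : ∀ f : Fin (Module.finrank ℝ X.W) →₀ CartFun X.k,
      β.coord j (evalPoint X p ((TensorProduct.equivFinsuppOfBasisRight β).symm f)) = f j p := by
    intro f
    rw [TensorProduct.equivFinsuppOfBasisRight_symm_apply]
    rw [Finsupp.sum_fintype _ _ (by simp)]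
    simp [Finsupp.single_apply]
  rw [← key f, ← key g, h]

/-- The presheaf `Hom(A, 𝒪(-))` on thickened Cartesian spaces. -/
def algPresheaf (A : Type) [CommRing A] [Algebra ℝ A] : ThCartSpᵒᵖ ⥤ Type where
  obj X := A →ₐ[ℝ] X.unop.O
  map f := ↾fun φ => f.unop.comorphism.comp φ

theorem isThickenedSmoothSet_algPresheaf (A : Type) [CommRing A] [Algebra ℝ A] :
    IsThickenedSmoothSet (algPresheaf A) := by
  intro X c
  rw [GoodOpenCover.presieve, Presieve.isSheafFor_arrows_iff]
  intro x hx
  change ∀ i : c.ι, A →ₐ[ℝ] X.O at x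
  -- compatibility at points
  have hpt : ∀ (f : A) (i j : c.ι) (p q : Cart X.k), c.u i p = c.u j q →
      evalPoint X p (x i f) = evalPoint X q (x j f) := by
    intro f i j p q hpq
    let Z : ThCartSp := ⟨0, X.W⟩
    let pt : Cart X.k → (Z ⟶ X) := fun p =>
      ⟨(Algebra.TensorProduct.includeRight : X.W →ₐ[ℝ] Z.O).comp (evalPoint X p)⟩
    have h1 : pt p ≫ c.incl X i = pt q ≫ c.incl X j := by
      refine ThCartSp.hom_ext (AlgHom.ext fun a => ?_)
      change (Algebra.TensorProduct.includeRight : X.W →ₐ[ℝ] Z.O)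
          (evalPoint X p ((c.incl X i).comorphism a)) =
        (Algebra.TensorProduct.includeRight : X.W →ₐ[ℝ] Z.O)
          (evalPoint X q ((c.incl X j).comorphism a))
      rw [evalPoint_incl, evalPoint_incl, hpq]
    have h2 := congrArg (fun φ : A →ₐ[ℝ] Z.O => φ f) (hx i j Z (pt p) (pt q) h1)
    have h3 := congrArg (evalPoint Z 0) h2
    change evalPoint Z 0 ((1 : CartFun 0) ⊗ₜ _) = evalPoint Z 0 ((1 : CartFun 0) ⊗ₜ _) at h3
    simpa using h3
  choose i hi using c.covers
  choose r hr using hi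
  have hval : ∀ (f : A) (j : c.ι) (q : Cart X.k),
      evalPoint X (r (c.u j q)) (x (i (c.u j q)) f) = evalPoint X q (x j f) :=
    fun f j q => hpt f _ _ _ _ (hr _)
  have hglue : ∀ f : A, ∃ a : X.O, ∀ p, evalPoint X p a = evalPoint X (r p) (x (i p) f) := by
    intro f
    refine exists_evalPoint X _ fun ℓ => ?_
    rw [contDiff_iff_contDiffAt]
    intro p
    obtain ⟨v, hv, hvu⟩ := (c.isEmb (i p)).exists_inverse
    have hmem : Set.range (c.u (i p)) ∈ 𝓝 p :=
      (c.isEmb (i p)).isOpen_range.mem_nhds ⟨r p, hr p⟩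
    have h1 : ContDiffAt ℝ ∞ (fun z => ℓ (evalPoint X (v z) (x (i p) f))) p :=
      (evalPoint_contDiff X (x (i p) f) ℓ).contDiffAt.comp p (hv.contDiffAt hmem)
    refine h1.congr_of_eventuallyEq ?_
    filter_upwards [hmem] with z ⟨q, hq⟩
    subst hq
    rw [hval, hvu]
  choose t ht using hglue
  have hloc : ∀ f (j : c.ι), (c.incl X j).comorphism (t f) = x j f := by
    intro f j
    refine evalPoint_ext X fun p => ?_
    rw [evalPoint_incl, ht, hval]
  let T : A →ₐ[ℝ] X.O :=
    { toFun := t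
      map_one' := evalPoint_ext X fun p => by simp [ht]
      map_mul' := fun f g => evalPoint_ext X fun p => by simp [ht]
      map_zero' := evalPoint_ext X fun p => by simp [ht]
      map_add' := fun f g => evalPoint_ext X fun p => by simp [ht]
      commutes' := fun s => evalPoint_ext X fun p => by
        rw [ht, AlgHom.commutes, AlgHom.commutes, AlgHom.commutes] }
  refine ⟨T, fun j => AlgHom.ext fun f => hloc f j, fun T' hT' => AlgHom.ext fun f => ?_⟩
  refine evalPoint_ext X fun p => ?_
  refine Eq.trans ?_ (ht f p).symm
  have h1 := congrArg (fun φ : A →ₐ[ℝ] X.O => φ f) (hT' (i p))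
  have h2 := congrArg (evalPoint X (r p)) h1
  rw [← h2]
  refine Eq.trans ?_ (evalPoint_incl X c (i p) (r p) ((show A →ₐ[ℝ] X.O from T') f)).symm
  rw [hr]

/-- The thickened smooth set `Hom(A, 𝒪(-))` represented from outside by the algebra `A`. -/
def algSpec (A : Type) [CommRing A] [Algebra ℝ A] : ThSmthSet :=
  ⟨algPresheaf A, isThickenedSmoothSet_algPresheaf A⟩

/-- The map of thickened smooth sets dual to an algebra map. -/
def algSpecMap {A B : Type} [CommRing A] [Algebra ℝ A] [CommRing B] [Algebra ℝ B]
    (f : A →ₐ[ℝ] B) : algSpec B ⟶ algSpec A :=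
  ObjectProperty.homMk { app := fun _ => ↾fun φ => φ.comp f }
/-! ### Infinitesimal thickenings of probes and synthetic tangent bundles -/

instance isWeilAlgebra_tensorProduct (W D : Type) [CommRing W] [Algebra ℝ W] [IsWeilAlgebra W]
    [CommRing D] [Algebra ℝ D] [IsWeilAlgebra D] : IsWeilAlgebra (W ⊗[ℝ] D) where
  nontrivial := inferInstance
  finite := inferInstance
  exists_isNilpotent_sub x := by
    induction x using TensorProduct.induction_on with
    | zero => exact ⟨0, by simp⟩
    | add x y hx hy =>
      obtain ⟨r, hr⟩ := hx
      obtain ⟨s, hs⟩ := hy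
      refine ⟨r + s, ?_⟩
      have := (Commute.all _ _).isNilpotent_add hr hs
      rwa [map_add, add_sub_add_comm]
    | tmul w d =>
      obtain ⟨r, hr⟩ := IsWeilAlgebra.exists_isNilpotent_sub w
      obtain ⟨s, hs⟩ := IsWeilAlgebra.exists_isNilpotent_sub d
      refine ⟨r * s, ?_⟩
      have h1 : IsNilpotent ((w - algebraMap ℝ W r) ⊗ₜ[ℝ] d) := by
        obtain ⟨n, hn⟩ := hr
        exact ⟨n, by rw [Algebra.TensorProduct.tmul_pow, hn, TensorProduct.zero_tmul]⟩
      have h2 : IsNilpotent ((algebraMap ℝ W r) ⊗ₜ[ℝ] (d - algebraMap ℝ D s)) := by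
        obtain ⟨n, hn⟩ := hs
        exact ⟨n, by rw [Algebra.TensorProduct.tmul_pow, hn, TensorProduct.tmul_zero]⟩
      have h3 := (Commute.all _ _).isNilpotent_add h1 h2
      convert h3 using 1
      rw [TensorProduct.sub_tmul, TensorProduct.tmul_sub,
        Algebra.TensorProduct.algebraMap_apply]
      simp only [Algebra.algebraMap_eq_smul_one, TensorProduct.smul_tmul, smul_smul,
        TensorProduct.tmul_smul]
      rw [mul_comm]
      abel

instance isWeilAlgebra_trivSqZeroExt (Q : Type) [AddCommGroup Q] [Module ℝ Q] [Module ℝᵐᵒᵖ Q]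
    [IsCentralScalar ℝ Q] [Module.Finite ℝ Q] : IsWeilAlgebra (TrivSqZeroExt ℝ Q) where
  nontrivial := inferInstance
  finite := inferInstanceAs (Module.Finite ℝ (ℝ × Q))
  exists_isNilpotent_sub x := by
    refine ⟨x.fst, 2, ?_⟩
    rw [TrivSqZeroExt.algebraMap_eq_inl]
    ext <;> simp [pow_two]

/-- The function algebra `ℝ[ε]/ε²` of the infinitesimal line `𝔻¹(1)`. -/
abbrev D1 : Type := TrivSqZeroExt ℝ ℝ

/-- The function algebra `ℝ[ε₁, ε₂]/(ε₁, ε₂)²` of the infinitesimal disk `𝔻²(1)`;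
`(a, b) : ℝ × ℝ` stands for `a ε₁ + b ε₂`. -/
abbrev D2 : Type := TrivSqZeroExt ℝ (ℝ × ℝ)

/-- The generator `ε`. -/
abbrev eps : D1 := TrivSqZeroExt.inr 1

namespace ThCartSp

variable (D : Type) [CommRing D] [Algebra ℝ D] [IsWeilAlgebra D]
  {D' : Type} [CommRing D'] [Algebra ℝ D'] [IsWeilAlgebra D']

/-- The product `X × 𝔻` of a probe with the thickened point with function algebra `D`. -/
abbrev ext (X : ThCartSp) : ThCartSp := ⟨X.k, X.W ⊗[ℝ] D⟩

/-- The projection `X × 𝔻 ⟶ X`. -/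
def fst (X : ThCartSp) : X.ext D ⟶ X :=
  ⟨Algebra.TensorProduct.map (AlgHom.id ℝ _) Algebra.TensorProduct.includeLeft⟩

variable {D}

/-- The projection `X × 𝔻 ⟶ 𝔻`, as an algebra map. -/
def snd (X : ThCartSp) : D →ₐ[ℝ] (X.ext D).O :=
  (Algebra.TensorProduct.includeRight : X.W ⊗[ℝ] D →ₐ[ℝ] CartFun X.k ⊗[ℝ] (X.W ⊗[ℝ] D)).comp
    Algebra.TensorProduct.includeRight

/-- The map `Z ⟶ X × 𝔻` with given components. -/
def pair {Z X : ThCartSp} (f : Z ⟶ X) (g : D →ₐ[ℝ] Z.O) : Z ⟶ X.ext D :=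
  ⟨(Algebra.TensorProduct.lift f.comorphism g (fun _ _ => Commute.all _ _)).comp
    (Algebra.TensorProduct.assoc ℝ ℝ ℝ (CartFun X.k) X.W D).symm.toAlgHom⟩

@[simp] theorem pair_fst {Z X : ThCartSp} (f : Z ⟶ X) (g : D →ₐ[ℝ] Z.O) :
    pair f g ≫ X.fst D = f := by
  refine hom_ext (Algebra.TensorProduct.ext' fun a w => ?_)
  change (pair f g).comorphism ((X.fst D).comorphism (a ⊗ₜ w)) = _
  refine (Algebra.TensorProduct.lift_tmul f.comorphism g (fun _ _ => Commute.all _ _)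
    (a ⊗ₜ w) 1).trans ?_
  rw [map_one, mul_one]

@[simp] theorem pair_snd {Z X : ThCartSp} (f : Z ⟶ X) (g : D →ₐ[ℝ] Z.O) :
    (pair f g).comorphism.comp X.snd = g := by
  ext d
  change (pair f g).comorphism (1 ⊗ₜ (1 ⊗ₜ d)) = _
  refine (Algebra.TensorProduct.lift_tmul f.comorphism g (fun _ _ => Commute.all _ _)
    (1 ⊗ₜ 1) d).trans ?_
  rw [← Algebra.TensorProduct.one_def, map_one, one_mul]

theorem ext_hom {Z X : ThCartSp} {f g : Z ⟶ X.ext D} (h1 : f ≫ X.fst D = g ≫ X.fst D)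
    (h2 : f.comorphism.comp X.snd = g.comorphism.comp X.snd) : f = g := by
  refine hom_ext (AlgHom.ext fun a => ?_)
  change CartFun X.k ⊗[ℝ] (X.W ⊗[ℝ] D) at a
  induction a using TensorProduct.induction_on with
  | zero => exact (map_zero _).trans (map_zero _).symm
  | add a b ha hb => exact (map_add _ _ _).trans ((congrArg₂ _ ha hb).trans (map_add _ _ _).symm)
  | tmul a x =>
    induction x using TensorProduct.induction_on with
    | zero => 
      rw [TensorProduct.tmul_zero]
      exact (map_zero _).trans (map_zero _).symm
    | add x y hx hy =>
      rw [TensorProduct.tmul_add]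
      exact (map_add _ _ _).trans ((congrArg₂ _ hx hy).trans (map_add _ _ _).symm)
    | tmul w d =>
      have e : a ⊗ₜ[ℝ] (w ⊗ₜ[ℝ] d) = (X.fst D).comorphism (a ⊗ₜ w) * X.snd d := by
        change _ = (a ⊗ₜ[ℝ] (w ⊗ₜ[ℝ] (1 : D))) * ((1 : CartFun X.k) ⊗ₜ[ℝ] ((1 : X.W) ⊗ₜ[ℝ] d))
        simp
      have e1 := congrArg (fun h : Z ⟶ X => h.comorphism (a ⊗ₜ w)) h1
      have e2 := DFunLike.congr_fun h2 d
      rw [e]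
      refine (map_mul _ _ _).trans (Eq.trans ?_ (map_mul _ _ _).symm)
      exact congrArg₂ _ e1 e2

/-- The map `X × 𝔻 ⟶ Y × 𝔻'` induced by maps `X ⟶ Y` and `𝔻 ⟶ 𝔻'`. -/
def extMap {X Y : ThCartSp} (f : X ⟶ Y) (φ : D' →ₐ[ℝ] D) : X.ext D ⟶ Y.ext D' :=
  pair (X.fst D ≫ f) (X.snd.comp φ)

theorem extMap_snd {X Y : ThCartSp} (f : X ⟶ Y) (φ : D' →ₐ[ℝ] D) :
    (extMap f φ).comorphism.comp Y.snd = X.snd.comp φ := pair_snd _ _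

variable (D)

theorem extMap_id (X : ThCartSp) : extMap (𝟙 X) (AlgHom.id ℝ D) = 𝟙 (X.ext D) :=
  ext_hom (by simp [extMap]) (by simp [extMap])

theorem extMap_comp {X Y Z : ThCartSp} (f : X ⟶ Y) (g : Y ⟶ Z) :
    extMap (f ≫ g) (AlgHom.id ℝ D) = extMap f (AlgHom.id ℝ D) ≫ extMap g (AlgHom.id ℝ D) :=
  ext_hom
    (by
      rw [Category.assoc]
      simp only [extMap, pair_fst]
      rw [← Category.assoc (pair _ _), pair_fst, Category.assoc])
    (by
      rw [comp_comorphism, AlgHom.comp_assoc]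
      simp only [extMap, pair_snd]
      simp)

/-- The functor `X ↦ X × 𝔻` on probes. -/
def extFunctor : ThCartSp ⥤ ThCartSp where
  obj X := X.ext D
  map f := extMap f (AlgHom.id ℝ D)
  map_id := extMap_id D
  map_comp := extMap_comp D

variable {D}

/-- The inclusion `X ⟶ X × 𝔻` at the point of `𝔻` given by `aug : D → ℝ`. -/
def point (X : ThCartSp) (aug : D →ₐ[ℝ] ℝ) : X ⟶ X.ext D :=
  pair (𝟙 X) ((Algebra.ofId ℝ X.O).comp aug)

theorem point_naturality {X Y : ThCartSp} (f : X ⟶ Y) (aug : D →ₐ[ℝ] ℝ) :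
    X.point aug ≫ extMap f (AlgHom.id ℝ D) = f ≫ Y.point aug := by
  refine ext_hom ?_ ?_
  · rw [Category.assoc, Category.assoc]
    simp only [extMap, point, pair_fst]
    rw [← Category.assoc, pair_fst, Category.id_comp, Category.comp_id]
  · rw [comp_comorphism, AlgHom.comp_assoc, comp_comorphism, AlgHom.comp_assoc]
    simp only [extMap, point, pair_snd, AlgHom.comp_id]
    refine AlgHom.ext fun d => ?_
    exact (AlgHom.commutes f.comorphism (aug d)).symm

/-- The scaling map `X × 𝔻¹(1) ⟶ X × 𝔻¹(1)`, `(x, ε) ↦ (x, r(x) ε)`, for `r ∈ 𝒪(X)`. -/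
def scale (X : ThCartSp) (r : X.O) : X.ext D1 ⟶ X.ext D1 :=
  pair (X.fst D1) (DualNumber.lift ⟨(Algebra.ofId ℝ _, (X.fst D1).comorphism r * X.snd eps), by
    constructor
    · have h : X.snd eps * X.snd eps = 0 := by
        rw [← map_mul, TrivSqZeroExt.inr_mul_inr, map_zero]
      change (X.fst D1).comorphism r * X.snd eps * ((X.fst D1).comorphism r * X.snd eps) = 0
      rw [mul_mul_mul_comm, h, mul_zero]
    · intro a
      exact Commute.all _ _⟩)

end ThCartSp

theorem GoodOpenCover.extMap_incl (D : Type) [CommRing D] [Algebra ℝ D] [IsWeilAlgebra D]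
    (X : ThCartSp) (c : GoodOpenCover X.k) (i : c.ι) :
    ThCartSp.extMap (c.incl X i) (AlgHom.id ℝ D) = GoodOpenCover.incl (X.ext D) c i := by
  refine ThCartSp.ext_hom ?_ ?_
  · simp only [ThCartSp.extMap, ThCartSp.pair_fst]
    refine ThCartSp.hom_ext (Algebra.TensorProduct.ext' fun a w => ?_)
    rw [ThCartSp.comp_comorphism, ThCartSp.comp_comorphism, AlgHom.comp_apply, AlgHom.comp_apply]
    simp only [GoodOpenCover.incl, ThCartSp.fst, Algebra.TensorProduct.map_tmul, AlgHom.id_apply]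
  · simp only [ThCartSp.extMap, ThCartSp.pair_snd]
    refine AlgHom.ext fun d => ?_
    rw [AlgHom.comp_apply, AlgHom.comp_apply]
    simp only [GoodOpenCover.incl, ThCartSp.snd, AlgHom.comp_apply,
      Algebra.TensorProduct.includeRight_apply, Algebra.TensorProduct.map_tmul, AlgHom.id_apply,
      map_one]

theorem isSheafFor_comp_of_factors {C : Type*} [Category C] (P : Cᵒᵖ ⥤ Type) (E : C ⥤ C)
    {ι : Type*} {X : C} {Y : ι → C} (a : ∀ i, Y i ⟶ X)
    (hE : ∀ (i j : ι) (Z : C) (gi : Z ⟶ E.obj (Y i)) (gj : Z ⟶ E.obj (Y j)),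
      gi ≫ E.map (a i) = gj ≫ E.map (a j) → ∃ (Z' : C) (s : Z ⟶ E.obj Z') (hi : Z' ⟶ Y i)
        (hj : Z' ⟶ Y j), gi = s ≫ E.map hi ∧ gj = s ≫ E.map hj ∧ hi ≫ a i = hj ≫ a j)
    (hP : Presieve.IsSheafFor P (Presieve.ofArrows (fun i => E.obj (Y i)) fun i => E.map (a i))) :
    Presieve.IsSheafFor (E.op ⋙ P) (Presieve.ofArrows Y a) := by
  rw [Presieve.isSheafFor_arrows_iff] at hP ⊢
  intro x hx
  refine hP x ?_
  intro i j Z gi gj h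
  obtain ⟨Z', s, hi, hj, rfl, rfl, h'⟩ := hE i j Z gi gj h
  rw [op_comp, op_comp, P.map_comp, P.map_comp]
  exact congrArg (P.map s.op) (hx i j Z' hi hj h')

theorem isThickenedSmoothSet_ext (D : Type) [CommRing D] [Algebra ℝ D] [IsWeilAlgebra D]
    (G : ThSmthSet) : IsThickenedSmoothSet ((ThCartSp.extFunctor D).op ⋙ G.obj) := by
  intro X c
  refine isSheafFor_comp_of_factors G.obj (ThCartSp.extFunctor D) (c.incl X) ?_ ?_
  · intro i j Z gi gj h
    change Z ⟶ X.ext D at gi gj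
    have h4 : ∀ g : Z ⟶ X.ext D, g = ThCartSp.pair (𝟙 Z) (g.comorphism.comp X.snd) ≫
        ThCartSp.extMap (g ≫ X.fst D) (AlgHom.id ℝ D) := by
      intro g
      refine ThCartSp.ext_hom ?_ ?_
      · rw [Category.assoc]
        simp only [ThCartSp.extMap, ThCartSp.pair_fst]
        rw [← Category.assoc, ThCartSp.pair_fst, Category.id_comp]
      · rw [ThCartSp.comp_comorphism, AlgHom.comp_assoc]
        simp [ThCartSp.extMap]
    have h : gi ≫ ThCartSp.extMap (c.incl X i) (AlgHom.id ℝ D) =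
      gj ≫ ThCartSp.extMap (c.incl X j) (AlgHom.id ℝ D) := h
    have h2 : gi.comorphism.comp X.snd = gj.comorphism.comp X.snd := by
      have h3 : ∀ (g : Z ⟶ X.ext D) (e : X ⟶ X),
          (g ≫ ThCartSp.extMap e (AlgHom.id ℝ D)).comorphism.comp X.snd
            = g.comorphism.comp X.snd := by
        intro g e
        rw [ThCartSp.comp_comorphism, AlgHom.comp_assoc, ThCartSp.extMap_snd, AlgHom.comp_id]
      exact (h3 gi _).symm.trans ((congrArg (fun t : Z ⟶ X.ext D => t.comorphism.comp X.snd) h).trans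
        (h3 gj _))
    refine ⟨Z, ThCartSp.pair (𝟙 Z) (gi.comorphism.comp X.snd), gi ≫ X.fst D, gj ≫ X.fst D,
      h4 gi, ?_, ?_⟩
    · rw [h2]
      exact h4 gj
    · have := congrArg (fun t : Z ⟶ X.ext D => t ≫ X.fst D) h
      simpa [ThCartSp.extMap] using this
  · have h := G.property (X.ext D) c
    have e : (fun i => (ThCartSp.extFunctor D).map (c.incl X i)) =
        GoodOpenCover.incl (X.ext D) c := funext fun i => GoodOpenCover.extMap_incl D X c i
    rw [e]
    exact h

/-- The mapping space `[𝔻, G]` out of the thickened point with function algebra `D`: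
its `X`-plots are the maps `X × 𝔻 ⟶ G`, i.e. the `X × 𝔻`-plots of `G`. -/
def mapSpace (D : Type) [CommRing D] [Algebra ℝ D] [IsWeilAlgebra D] : ThSmthSet ⥤ ThSmthSet where
  obj G := ⟨(ThCartSp.extFunctor D).op ⋙ G.obj, isThickenedSmoothSet_ext D G⟩
  map f := ObjectProperty.homMk (Functor.whiskerLeft _ f.hom)

/-- The synthetic tangent functor `T = [𝔻¹(1), -]`. -/
abbrev synT : ThSmthSet ⥤ ThSmthSet := mapSpace D1

/-- The projection `TG ⟶ G`, restriction along the point of `𝔻¹(1)`. -/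
def synTProj (G : ThSmthSet) : synT.obj G ⟶ G :=
  ObjectProperty.homMk
    { app := fun X => G.obj.map (X.unop.point (TrivSqZeroExt.fstHom ℝ ℝ ℝ)).op
      naturality := fun X Y f => by
        exact (G.obj.map_comp _ _).symm.trans ((congrArg (fun h => G.obj.map (Quiver.Hom.op h))
          (ThCartSp.point_naturality f.unop (TrivSqZeroExt.fstHom ℝ ℝ ℝ))).trans
            (G.obj.map_comp _ _)) }

theorem synTProj_naturality {G H : ThSmthSet} (f : G ⟶ H) :
    synTProj G ≫ f = synT.map f ≫ synTProj H := by
  refine ObjectProperty.hom_ext _ ?_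
  ext X x
  exact (NatTrans.naturality_apply f.hom (X.unop.point (TrivSqZeroExt.fstHom ℝ ℝ ℝ)).op x)

/-- The zero section `G ⟶ TG`, restriction along `𝔻¹(1) ⟶ *`. -/
def synTZero (G : ThSmthSet) : G ⟶ synT.obj G :=
  ObjectProperty.homMk
    { app := fun X => G.obj.map (X.unop.fst D1).op
      naturality := fun X Y f => by
        exact (G.obj.map_comp _ _).symm.trans ((congrArg (fun h => G.obj.map (Quiver.Hom.op h))
          (ThCartSp.pair_fst (Y.unop.fst D1 ≫ f.unop) _).symm).trans (G.obj.map_comp _ _)) }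

/-- The algebra map `ℝ[ε₁, ε₂]/(ε₁, ε₂)² → ℝ[ε]/ε²` induced by a linear map. -/
def d2Map (l : ℝ × ℝ →ₗ[ℝ] ℝ) : D2 →ₐ[ℝ] D1 := TrivSqZeroExt.map l

/-- Restriction of `X × 𝔻²(1)`-plots to `X × 𝔻¹(1)`-plots along `ε ↦ (l(1,0) ε, l(0,1) ε)`. -/
def d2Res (G : ThSmthSet) {X : ThCartSp} (l : ℝ × ℝ →ₗ[ℝ] ℝ) (u : Plots G (X.ext D2)) :
    Plots (synT.obj G) X :=
  res G (ThCartSp.extMap (𝟙 X) (d2Map l)) u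

/-- `z` is a sum of the tangent plots `v` and `w`: there is a map `X × 𝔻²(1) ⟶ G` which restricts
to `v` and `w` on the two axes of `𝔻²(1)`, and to `z` on the diagonal. -/
def IsTangentSum {G : ThSmthSet} {X : ThCartSp} (v w z : Plots (synT.obj G) X) : Prop :=
  ∃ u : Plots G (X.ext D2), d2Res G (LinearMap.fst ℝ ℝ ℝ) u = v ∧
    d2Res G (LinearMap.snd ℝ ℝ ℝ) u = w ∧
    d2Res G (LinearMap.fst ℝ ℝ ℝ + LinearMap.snd ℝ ℝ ℝ) u = z

/-- The `X`-plots of `TG` over a given `X`-plot `g` of `G`. -/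
abbrev TFiber (G : ThSmthSet) {X : ThCartSp} (g : Plots G X) : Type :=
  {v : Plots (synT.obj G) X // ap (synTProj G) v = g}

/-- The given `𝒪(X)`-module structure on the fibre of `TG` over an `X`-plot is the canonical one:
any two tangents are the restrictions to the axes of a unique map `X × 𝔻²(1) ⟶ G`, whose
restriction to the diagonal is their sum, and scalars act by rescaling `𝔻¹(1)`. -/
structure IsSyntheticModule (G : ThSmthSet) {X : ThCartSp} (g : Plots G X)
    [AddCommGroup (TFiber G g)] [Module X.O (TFiber G g)] : Prop where
  existsUnique : ∀ v w : TFiber G g, ∃! u : Plots G (X.ext D2),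
    d2Res G (LinearMap.fst ℝ ℝ ℝ) u = v.1 ∧ d2Res G (LinearMap.snd ℝ ℝ ℝ) u = w.1
  add_eq : ∀ v w : TFiber G g, IsTangentSum v.1 w.1 (v + w).1
  smul_eq : ∀ (r : X.O) (v : TFiber G g), (r • v).1 = res G (X.scale r) v.1

/-- The map on fibres of synthetic tangent bundles induced by `f : G ⟶ H`. -/
def tFiberMap {G H : ThSmthSet} (f : G ⟶ H) {X : ThCartSp} (g : Plots G X) (v : TFiber G g) :
    TFiber H (ap f g) :=
  ⟨ap (synT.map f) v.1,
    (NatTrans.naturality_apply f.hom (X.point (TrivSqZeroExt.fstHom ℝ ℝ ℝ)).op v.1).symm.trans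
      (congrArg (ap f) v.2)⟩

/-! ### Smooth manifolds as thickened smooth sets -/

section Manifolds

variable {E H N E' H' N' : Type} [NormedAddCommGroup E] [NormedSpace ℝ E]
  [TopologicalSpace H] [TopologicalSpace N] [ChartedSpace H N]
  [NormedAddCommGroup E'] [NormedSpace ℝ E'] [TopologicalSpace H']
  [TopologicalSpace N'] [ChartedSpace H' N']

/-- The embedding of smooth manifolds into thickened smooth sets: the plots of `N` are the algebra
maps `C^∞(N) → 𝒪(X)`. -/
def yMan (I : ModelWithCorners ℝ E H) (N : Type) [TopologicalSpace N] [ChartedSpace H N] :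
    ThSmthSet :=
  algSpec C^∞⟮I, N; ℝ⟯

/-- The map of thickened smooth sets given by a smooth map. -/
def yMap {I : ModelWithCorners ℝ E H} {I' : ModelWithCorners ℝ E' H'} (f : C^∞⟮I, N; I', N'⟯) :
    yMan I N ⟶ yMan I' N' :=
  algSpecMap (smoothPullback f)

/-- The tangent map of a smooth map. -/
def tangentCM {I : ModelWithCorners ℝ E H} {I' : ModelWithCorners ℝ E' H'} [IsManifold I ∞ N]
    [IsManifold I' ∞ N'] (f : C^∞⟮I, N; I', N'⟯) :
    C^∞⟮I.tangent, TangentBundle I N; I'.tangent, TangentBundle I' N'⟯ :=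
  ⟨tangentMap I I' f, f.contMDiff.contMDiff_tangentMap (by simp)⟩

variable (I : ModelWithCorners ℝ E H) [IsManifold I ∞ N]

/-- The bundle projection `TN → N`. -/
def tangentProjCM (N : Type) [TopologicalSpace N] [ChartedSpace H N] [IsManifold I ∞ N] :
    C^∞⟮I.tangent, TangentBundle I N; I, N⟯ :=
  ⟨fun v => v.1, Bundle.contMDiff_proj _⟩

variable {I}

/-- The differential of a function, as a function on the tangent bundle. -/
def dFun (f : C^∞⟮I, N; ℝ⟯) : C^∞⟮I.tangent, TangentBundle I N; ℝ⟯ :=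
  ⟨fun v => mfderiv I 𝓘(ℝ, ℝ) f v.1 v.2,
    (contMDiff_snd_tangentBundle_modelSpace ℝ 𝓘(ℝ, ℝ)).comp
      (f.contMDiff.contMDiff_tangentMap (m := ∞) (by simp))⟩

/-- The algebra map `b ↦ p b + e d b` given by an algebra map `p`, a derivation `d` along it and
an element `e` of square zero. -/
def dualAlgHom {A B D : Type} [CommRing A] [Algebra ℝ A] [CommRing B] [Algebra ℝ B] [CommRing D]
    [Algebra ℝ D] (e : D) (he : e * e = 0) (p : B →ₐ[ℝ] A) (d : B → A) (hadd : ∀ f g, d (f + g) = d f + d g) (hmul : ∀ f g, d (f * g) = p f * d g + p g * d f)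
    (halg : ∀ r, d (algebraMap ℝ B r) = 0) : B →ₐ[ℝ] A ⊗[ℝ] D where
  toFun f := p f ⊗ₜ 1 + d f ⊗ₜ e
  map_one' := by
    have h := halg 1
    rw [map_one] at h
    rw [h, map_one, TensorProduct.zero_tmul, add_zero, Algebra.TensorProduct.one_def]
  map_mul' f g := by
    rw [hmul, map_mul, add_mul, mul_add, mul_add]
    simp only [Algebra.TensorProduct.tmul_mul_tmul, one_mul, mul_one, he, TensorProduct.tmul_zero,
      add_zero, TensorProduct.add_tmul, mul_comm (d f)]
    abel
  map_zero' := by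
    have h := halg 0
    rw [map_zero] at h
    rw [h, map_zero, TensorProduct.zero_tmul, TensorProduct.zero_tmul, add_zero]
  map_add' f g := by
    rw [hadd, map_add, TensorProduct.add_tmul, TensorProduct.add_tmul]
    abel
  commutes' r := by
    rw [halg, AlgHom.commutes, TensorProduct.zero_tmul, add_zero,
      Algebra.TensorProduct.algebraMap_apply]

theorem ThCartSp.assoc_tmul (D : Type) [CommRing D] [Algebra ℝ D]
    [IsWeilAlgebra D] (X : ThCartSp) (y : X.O) (d : D) :
    Algebra.TensorProduct.assoc ℝ ℝ ℝ (CartFun X.k) X.W D (y ⊗ₜ d) =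
      (X.fst D).comorphism y * X.snd d := by
  induction y using TensorProduct.induction_on with
  | zero => simp
  | add a b ha hb => rw [TensorProduct.add_tmul, map_add, ha, hb, map_add, add_mul]
  | tmul a w =>
    change a ⊗ₜ[ℝ] (w ⊗ₜ[ℝ] d) =
      (a ⊗ₜ[ℝ] (w ⊗ₜ[ℝ] (1 : D))) * ((1 : CartFun X.k) ⊗ₜ[ℝ] ((1 : X.W) ⊗ₜ[ℝ] d))
    simp

theorem ThCartSp.assoc_naturality (D : Type) [CommRing D] [Algebra ℝ D]
    [IsWeilAlgebra D] {A : Type} [CommRing A] [Algebra ℝ A] {X Y : ThCartSp}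
    (f : Y ⟶ X) (φ : A →ₐ[ℝ] X.O) (t : A ⊗[ℝ] D) :
    Algebra.TensorProduct.assoc ℝ ℝ ℝ (CartFun Y.k) Y.W D
      (Algebra.TensorProduct.map (f.comorphism.comp φ) (AlgHom.id ℝ D) t) =
    (ThCartSp.extMap f (AlgHom.id ℝ D)).comorphism
      (Algebra.TensorProduct.assoc ℝ ℝ ℝ (CartFun X.k) X.W D
        (Algebra.TensorProduct.map φ (AlgHom.id ℝ D) t)) := by
  induction t using TensorProduct.induction_on with
  | zero => simp only [map_zero]
  | add a b ha hb => simp only [map_add, ha, hb]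
  | tmul a d =>
    rw [Algebra.TensorProduct.map_tmul, Algebra.TensorProduct.map_tmul, ThCartSp.assoc_tmul,
      ThCartSp.assoc_tmul, map_mul]
    have h1 : (ThCartSp.extMap f (AlgHom.id ℝ D)).comorphism ((X.fst D).comorphism (φ a)) =
        (Y.fst D).comorphism (f.comorphism (φ a)) :=
      congrArg (fun h : Y.ext D ⟶ X => h.comorphism (φ a))
        (ThCartSp.pair_fst (Y.fst D ≫ f) (Y.snd.comp (AlgHom.id ℝ D)))
    have h2 : (ThCartSp.extMap f (AlgHom.id ℝ D)).comorphism (X.snd d) = Y.snd d :=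
      DFunLike.congr_fun (ThCartSp.extMap_snd f (AlgHom.id ℝ D)) d
    rw [h1, AlgHom.id_apply, h2]
    rfl

/-- The algebra map `f ↦ f ∘ π + ε df`. -/
def kappaAlg (I : ModelWithCorners ℝ E H) (N : Type) [TopologicalSpace N] [ChartedSpace H N]
    [IsManifold I ∞ N] : C^∞⟮I, N; ℝ⟯ →ₐ[ℝ] C^∞⟮I.tangent, TangentBundle I N; ℝ⟯ ⊗[ℝ] D1 :=
  dualAlgHom eps (TrivSqZeroExt.inr_mul_inr _ _ _) (smoothPullback (tangentProjCM I N)) dFun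
    (fun f g => by
      ext v
      exact congrArg (fun A : _ →L[ℝ] ℝ => A v.2)
        (HasMFDerivAt.add ((f.contMDiff.mdifferentiable (by simp) v.1).hasMFDerivAt)
          ((g.contMDiff.mdifferentiable (by simp) v.1).hasMFDerivAt)).mfderiv)
    (fun f g => by
      ext v
      exact congrArg (fun A : _ →L[ℝ] ℝ => A v.2)
        (HasMFDerivAt.mul ((f.contMDiff.mdifferentiable (by simp) v.1).hasMFDerivAt)
          ((g.contMDiff.mdifferentiable (by simp) v.1).hasMFDerivAt)).mfderiv)
    (fun r => by
      ext v
      exact congrArg (fun A : _ →L[ℝ] ℝ => A v.2) (mfderiv_const (c := r)))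

/-- The canonical map from the tangent bundle of a manifold to its synthetic tangent bundle:
on a tangent vector `v` it is `f ↦ f(π(v)) + ε df(v)`. -/
def kappa (I : ModelWithCorners ℝ E H) (N : Type) [TopologicalSpace N] [ChartedSpace H N]
    [IsManifold I ∞ N] : yMan I.tangent (TangentBundle I N) ⟶ synT.obj (yMan I N) :=
  ObjectProperty.homMk
    { app := fun X => ↾fun φ =>
        ((Algebra.TensorProduct.assoc ℝ ℝ ℝ (CartFun X.unop.k) X.unop.W D1).toAlgHom.comp
          (Algebra.TensorProduct.map φ (AlgHom.id ℝ D1))).comp (kappaAlg I N)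
      naturality := by
        intro X Y f
        ext φ
        change C^∞⟮I.tangent, TangentBundle I N; ℝ⟯ →ₐ[ℝ] X.unop.O at φ
        refine AlgHom.ext fun g => ?_
        exact ThCartSp.assoc_naturality D1 f.unop φ (kappaAlg I N g) }

theorem kappa_proj (I : ModelWithCorners ℝ E H) (N : Type) [TopologicalSpace N] [ChartedSpace H N]
    [IsManifold I ∞ N] : kappa I N ≫ synTProj (yMan I N) = yMap (tangentProjCM I N) := by
  refine ObjectProperty.hom_ext _ ?_
  ext X φ
  change C^∞⟮I.tangent, TangentBundle I N; ℝ⟯ →ₐ[ℝ] X.unop.O at φ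
  refine AlgHom.ext fun f => ?_
  set aug := TrivSqZeroExt.fstHom ℝ ℝ ℝ with haug
  have h1 : ∀ y : X.unop.O,
      (X.unop.point aug).comorphism ((X.unop.fst D1).comorphism y) = y := fun y =>
    congrArg (fun t : X.unop ⟶ X.unop => t.comorphism y)
      (ThCartSp.pair_fst (𝟙 X.unop) ((Algebra.ofId ℝ X.unop.O).comp aug))
  have h2 : ∀ d : D1, (X.unop.point aug).comorphism (X.unop.snd d) =
      algebraMap ℝ X.unop.O (aug d) := fun d =>
    DFunLike.congr_fun (ThCartSp.pair_snd (𝟙 X.unop) ((Algebra.ofId ℝ X.unop.O).comp aug)) d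
  have h3 : ∀ (y : X.unop.O) (d : D1), (X.unop.point aug).comorphism
      (Algebra.TensorProduct.assoc ℝ ℝ ℝ (CartFun X.unop.k) X.unop.W D1 (y ⊗ₜ d)) =
      y * algebraMap ℝ X.unop.O (aug d) := by
    intro y d
    rw [ThCartSp.assoc_tmul, map_mul, h1, h2]
  change (X.unop.point aug).comorphism
    (Algebra.TensorProduct.assoc ℝ ℝ ℝ (CartFun X.unop.k) X.unop.W D1
      (Algebra.TensorProduct.map φ (AlgHom.id ℝ D1)
        (smoothPullback (tangentProjCM I N) f ⊗ₜ 1 + dFun f ⊗ₜ eps))) =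
    φ (smoothPullback (tangentProjCM I N) f)
  rw [map_add, map_add, map_add, Algebra.TensorProduct.map_tmul, Algebra.TensorProduct.map_tmul,
    AlgHom.id_apply, AlgHom.id_apply, h3, h3, map_one, map_one,
    show aug eps = 0 from TrivSqZeroExt.fst_inr ℝ 1, map_zero, mul_zero, add_zero]
  exact mul_one _

end Manifolds

/-! ### Manifolds from families of charts on a set -/

/-- A family of charts on a set `X`, with open overlaps and smooth transition maps. -/
structure SmoothAtlasOn (B X : Type) [NormedAddCommGroup B] [NormedSpace ℝ B] where
  ι : Type
  chart : ι → PartialEquiv X B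
  cover : ∀ x, ∃ i, x ∈ (chart i).source
  isOpen_overlap : ∀ i j, IsOpen ((chart i).symm.trans (chart j)).source
  contDiffOn : ∀ i j, ContDiffOn ℝ ∞ ((chart i).symm.trans (chart j))
    ((chart i).symm.trans (chart j)).source

namespace SmoothAtlasOn

variable {B X : Type} [NormedAddCommGroup B] [NormedSpace ℝ B] (A : SmoothAtlasOn B X)

/-- The underlying charted space data. -/
def toCore : ChartedSpaceCore B X where
  atlas := Set.range A.chart
  chartAt x := A.chart (A.cover x).choose
  mem_chart_source x := (A.cover x).choose_spec
  chart_mem_atlas x := ⟨_, rfl⟩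
  open_source := by
    rintro _ _ ⟨i, rfl⟩ ⟨j, rfl⟩
    exact A.isOpen_overlap i j
  continuousOn_toFun := by
    rintro _ _ ⟨i, rfl⟩ ⟨j, rfl⟩
    exact (A.contDiffOn i j).continuousOn

/-- The topology generated by the charts. -/
@[reducible] def topologicalSpace : TopologicalSpace X := A.toCore.toTopologicalSpace

/-- The charted space structure given by the charts. -/
@[reducible] def chartedSpace : @ChartedSpace B _ X A.topologicalSpace := A.toCore.toChartedSpace

theorem isManifold :
    @IsManifold ℝ _ B _ _ B _ 𝓘(ℝ, B) ∞ X A.topologicalSpace A.chartedSpace := by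
  let := A.topologicalSpace
  let := A.chartedSpace
  refine isManifold_of_contDiffOn _ _ _ ?_
  intro e e' he he'
  obtain ⟨f, hf, he⟩ := Set.mem_iUnion₂.1 he
  obtain ⟨f', hf', he'⟩ := Set.mem_iUnion₂.1 he'
  obtain ⟨i, rfl⟩ := hf
  obtain ⟨j, rfl⟩ := hf'
  obtain rfl : e = A.toCore.openPartialHomeomorph (A.chart i) ⟨i, rfl⟩ := he
  obtain rfl : e' = A.toCore.openPartialHomeomorph (A.chart j) ⟨j, rfl⟩ := he'
  refine (A.contDiffOn i j).mono ?_
  intro x hx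
  exact hx.1

/-- The charts, as partial homeomorphisms. -/
def homeo (i : A.ι) : @OpenPartialHomeomorph X B A.topologicalSpace _ :=
  A.toCore.openPartialHomeomorph (A.chart i) ⟨i, rfl⟩

theorem homeo_mem (i : A.ι) :
    A.homeo i ∈ @IsManifold.maximalAtlas ℝ _ B _ _ B _ 𝓘(ℝ, B) ∞ X A.topologicalSpace
      A.chartedSpace := by
  let := A.topologicalSpace
  let := A.chartedSpace
  have := A.isManifold
  refine IsManifold.subset_maximalAtlas ?_
  exact Set.mem_iUnion₂.2 ⟨A.chart i, ⟨i, rfl⟩, rfl⟩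

end SmoothAtlasOn

/-- A map given in charts by smooth maps is smooth. -/
theorem contMDiff_of_charts {B B' X Y : Type} [NormedAddCommGroup B] [NormedSpace ℝ B]
    [NormedAddCommGroup B'] [NormedSpace ℝ B'] [TopologicalSpace X] [TopologicalSpace Y]
    [ChartedSpace B X] [IsManifold 𝓘(ℝ, B) ∞ X] {H' E' : Type} [NormedAddCommGroup E']
    [NormedSpace ℝ E'] [TopologicalSpace H'] {I' : ModelWithCorners ℝ E' H'}
    [ChartedSpace H' Y] (f : X → Y)
    (h : ∀ x, ∃ (e : OpenPartialHomeomorph X B) (e' : OpenPartialHomeomorph Y B'),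
      ContMDiffOn 𝓘(ℝ, B) 𝓘(ℝ, B) ∞ e e.source ∧
      ContMDiffOn 𝓘(ℝ, B') I' ∞ e'.symm e'.target ∧ x ∈ e.source ∧
      (∀ z ∈ e.source, f z ∈ e'.source) ∧
      ContDiffOn ℝ ∞ (fun z => e' (f (e.symm z))) e.target) :
    ContMDiff 𝓘(ℝ, B) I' ∞ f := by
  intro x
  obtain ⟨e, e', h1, h2, hx, hf, hs⟩ := h x
  have : ContMDiffOn 𝓘(ℝ, B) I' ∞ (fun z => e'.symm (e' (f (e.symm (e z))))) e.source := by
    refine h2.comp (hs.contMDiffOn.comp h1 fun z hz => e.map_source hz) ?_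
    intro z hz
    refine e'.map_source (hf _ (e.map_target (e.map_source hz)))
  refine (this.congr fun z hz => ?_).contMDiffAt (e.open_source.mem_nhds hx)
  rw [e.left_inv hz, e'.left_inv (hf z hz)]

/-! ### Jets of vector valued functions -/

section JetFiber

variable {P E V W : Type} [NormedAddCommGroup P] [NormedSpace ℝ P] [NormedAddCommGroup E]
  [NormedSpace ℝ E] [NormedAddCommGroup V] [NormedSpace ℝ V] [NormedAddCommGroup W]
  [NormedSpace ℝ W]

/-- The Taylor coefficients of order at most `n` of `u` at `x`. -/
def taylorJet (n : ℕ) (u : E → V) (x : E) : ∀ k : Fin (n + 1), E [×(k : ℕ)]→L[ℝ] V :=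
  fun k => iteratedFDeriv ℝ k u x

/-- `u` is smooth in a neighbourhood of `x`. -/
def SmoothNear (u : E → V) (x : E) : Prop := ∀ᶠ z in 𝓝 x, ContDiffAt ℝ ∞ u z

theorem SmoothNear.self {u : E → V} {x : E} (h : SmoothNear u x) : ContDiffAt ℝ ∞ u x :=
  h.self_of_nhds

theorem iteratedFDeriv_add_of_smooth {u v : E → V} {x : E} (hu : ContDiffAt ℝ ∞ u x)
    (hv : ContDiffAt ℝ ∞ v x) (k : ℕ) :
    iteratedFDeriv ℝ k (fun z => u z + v z) x = iteratedFDeriv ℝ k u x + iteratedFDeriv ℝ k v x := by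
  have hk : (k : ℕ∞ω) ≤ ∞ := by exact_mod_cast le_top
  exact iteratedFDeriv_add_apply (hu.of_le hk) (hv.of_le hk)

variable (E V) in
/-- The space of `n`-jets at `0` of smooth functions `E → V`. -/
def JetFiber (n : ℕ) : Submodule ℝ (∀ k : Fin (n + 1), E [×(k : ℕ)]→L[ℝ] V) where
  carrier := {A | ∃ u : E → V, SmoothNear u 0 ∧ A = taylorJet n u 0}
  zero_mem' := ⟨fun _ => 0, Filter.Eventually.of_forall fun _ => contDiffAt_const, by
    ext k : 1
    rw [taylorJet, iteratedFDeriv_fun_zero]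
    rfl⟩
  add_mem' := by
    rintro _ _ ⟨u, hu, rfl⟩ ⟨v, hv, rfl⟩
    refine ⟨fun z => u z + v z, (hu.and hv).mono fun z hz => hz.1.add hz.2, ?_⟩
    ext k : 1
    exact (iteratedFDeriv_add_of_smooth hu.self hv.self k).symm
  smul_mem' := by
    rintro r _ ⟨u, hu, rfl⟩
    refine ⟨fun z => r • u z, hu.mono fun z hz => contDiffAt_const.smul hz, ?_⟩
    ext k : 1
    have hk : ((k : ℕ) : ℕ∞ω) ≤ ∞ := by exact_mod_cast le_top
    exact (iteratedFDeriv_const_smul_apply (hu.self.of_le hk)).symm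

instance (n : ℕ) : NormedAddCommGroup (JetFiber E V n) := Submodule.normedAddCommGroup _

instance (n : ℕ) : NormedSpace ℝ (JetFiber E V n) := Submodule.normedSpace _

instance (n : ℕ) [FiniteDimensional ℝ E] [FiniteDimensional ℝ V] :
    FiniteDimensional ℝ (JetFiber E V n) := by
  have : ∀ k : ℕ, FiniteDimensional ℝ (E [×k]→L[ℝ] V) := fun k =>
    FiniteDimensional.of_injective
      (ContinuousMultilinearMap.toMultilinearMapLinear (R' := ℝ) (A := ℝ) (M₁ := fun _ : Fin k => E)
        (M₂ := V))
      ContinuousMultilinearMap.toMultilinearMap_injective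
  infer_instance

/-- Partial iterated derivatives of a smooth family are jointly smooth. -/
theorem contDiffOn_iteratedFDeriv_param {g : P × E → V} {U : Set (P × E)} (hU : IsOpen U)
    (hg : ContDiffOn ℝ ∞ g U) (k : ℕ) :
    ContDiffOn ℝ ∞ (fun q : P × E => iteratedFDeriv ℝ k (fun z => g (q.1, z)) q.2) U := by
  induction k with
  | zero =>
    have : (fun q : P × E => iteratedFDeriv ℝ 0 (fun z => g (q.1, z)) q.2) =
        fun q => (continuousMultilinearCurryFin0 ℝ E V).symm (g q) := by
      ext q
      simp
    rw [this]
    exact (continuousMultilinearCurryFin0 ℝ E V).symm.contDiff.comp_contDiffOn hg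
  | succ k ih =>
    set h := fun q : P × E => iteratedFDeriv ℝ k (fun z => g (q.1, z)) q.2 with hh
    have h1 : ContDiffOn ℝ ∞ (fderiv ℝ h) U := ih.fderiv_of_isOpen hU (by simp)
    have h2 : ContDiffOn ℝ ∞ (fun q => (fderiv ℝ h q).comp (ContinuousLinearMap.inr ℝ P E)) U :=
      h1.clm_comp contDiffOn_const
    have h3 := (continuousMultilinearCurryLeftEquiv ℝ
      (fun _ : Fin (k + 1) => E) V).symm.contDiff.comp_contDiffOn h2
    refine h3.congr fun q hq => ?_
    rw [iteratedFDeriv_succ_eq_comp_left]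
    simp only [Function.comp_apply]
    congr 1
    have h4 : HasFDerivAt h (fderiv ℝ h q) q :=
      ((ih.contDiffAt (hU.mem_nhds hq)).differentiableAt (by simp)).hasFDerivAt
    have h5 := (HasFDerivAt.comp (g := h) (f := fun z => (q.1, z)) q.2 h4
      (hasFDerivAt_prodMk_right q.1 q.2)).fderiv
    exact h5

theorem SmoothNear.iteratedFDeriv_param {g : P × E → V} {q : P × E} (hg : SmoothNear g q) (k : ℕ) :
    ContDiffAt ℝ ∞ (fun q : P × E => iteratedFDeriv ℝ k (fun z => g (q.1, z)) q.2) q := by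
  obtain ⟨U, hU, hUo, hq⟩ := eventually_nhds_iff.1 hg
  exact (contDiffOn_iteratedFDeriv_param hUo (fun q' hq' => (hU q' hq').contDiffWithinAt)
    k).contDiffAt (hUo.mem_nhds hq)

/-- Equal jets have equal compositions. -/
theorem taylorJet_comp_congr {n : ℕ} {g g' : V → W} {f f' : E → V} {x : E}
    (hg : ContDiffAt ℝ ∞ g (f x)) (hg' : ContDiffAt ℝ ∞ g' (f' x)) (hf : ContDiffAt ℝ ∞ f x)
    (hf' : ContDiffAt ℝ ∞ f' x) (h : taylorJet n f x = taylorJet n f' x)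
    (h' : taylorJet n g (f x) = taylorJet n g' (f' x)) :
    taylorJet n (fun z => g (f z)) x = taylorJet n (fun z => g' (f' z)) x := by
  ext k : 1
  have hk : ((k : ℕ) : ℕ∞ω) ≤ ∞ := by exact_mod_cast le_top
  refine (iteratedFDeriv_comp hg hf hk).trans (Eq.trans ?_ (iteratedFDeriv_comp hg' hf' hk).symm)
  unfold FormalMultilinearSeries.taylorComp
  refine Finset.sum_congr rfl fun c _ => ?_
  unfold FormalMultilinearSeries.compAlongOrderedFinpartition
  have e1 : ftaylorSeries ℝ g (f x) c.length = ftaylorSeries ℝ g' (f' x) c.length :=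
    congrFun h' ⟨c.length, (c.length_le.trans_lt k.2)⟩
  have e2 : (fun i => ftaylorSeries ℝ f x (c.partSize i)) =
      fun i => ftaylorSeries ℝ f' x (c.partSize i) := by
    funext i
    exact congrFun h ⟨c.partSize i, (c.partSize_le i).trans_lt k.2⟩
  rw [e1, e2]

end JetFiber

section Realize

variable {E V : Type} [NormedAddCommGroup E] [NormedSpace ℝ E] [NormedAddCommGroup V]
  [NormedSpace ℝ V] {n : ℕ}

/-- The value of a jet. -/
def jetVal (A : JetFiber E V n) : V := A.1 0 0

theorem taylorJet_mem (n : ℕ) {u : E → V} {x : E} (hu : SmoothNear u x) :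
    taylorJet n u x ∈ JetFiber E V n := by
  refine ⟨fun z => u (z + x), ?_, ?_⟩
  · have h : Filter.Tendsto (fun z : E => z + x) (𝓝 0) (𝓝 x) := by
      have : Continuous fun z : E => z + x := by fun_prop
      simpa using this.tendsto 0
    filter_upwards [h.eventually hu] with z hz
    exact ContDiffAt.comp (g := u) (f := fun z : E => z + x) z hz
      (contDiffAt_id.add contDiffAt_const)
  · ext k : 1
    simp only [taylorJet]
    rw [iteratedFDeriv_comp_add_right, zero_add]

theorem continuous_jetVal : Continuous (jetVal : JetFiber E V n → V) := by
  have h : Continuous fun A : JetFiber E V n => A.1 0 := (continuous_apply 0).comp continuous_subtype_val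
  exact (ContinuousMultilinearMap.apply ℝ (fun _ => E) V 0).continuous.comp h

variable [FiniteDimensional ℝ E] [FiniteDimensional ℝ V]

/-- A function with prescribed Taylor coefficients at `0`, depending linearly on these. -/
def realizeJet (A : JetFiber E V n) (z : E) : V :=
  ∑ i, (Module.finBasis ℝ (JetFiber E V n)).repr A i •
    (Module.finBasis ℝ (JetFiber E V n) i).2.choose z

theorem realizeJet_exists_nhds (E V : Type) [NormedAddCommGroup E] [NormedSpace ℝ E]
    [NormedAddCommGroup V] [NormedSpace ℝ V] [FiniteDimensional ℝ E] [FiniteDimensional ℝ V]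
    (n : ℕ) : ∃ U : Set E, IsOpen U ∧ (0 : E) ∈ U ∧
      ContDiffOn ℝ ∞ (fun q : JetFiber E V n × E => realizeJet q.1 q.2) (Set.univ ×ˢ U) := by
  have h : ∀ᶠ z in 𝓝 (0 : E), ∀ i, ContDiffAt ℝ ∞
      (Module.finBasis ℝ (JetFiber E V n) i).2.choose z :=
    Filter.eventually_all.2 fun i => (Module.finBasis ℝ (JetFiber E V n) i).2.choose_spec.1
  obtain ⟨U, hU, hU', h0⟩ := eventually_nhds_iff.1 h
  refine ⟨U, hU', h0, ?_⟩
  unfold realizeJet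
  refine ContDiffOn.sum fun i _ => ContDiffOn.smul ?_ ?_
  · have : ContDiff ℝ ∞ (LinearMap.toContinuousLinearMap
      ((Module.finBasis ℝ (JetFiber E V n)).coord i)) := ContinuousLinearMap.contDiff _
    exact (this.comp contDiff_fst).contDiffOn
  · intro q hq
    exact ((hU q.2 hq.2 i).comp q contDiffAt_snd).contDiffWithinAt

theorem realizeJet_smoothNear (A : JetFiber E V n) : SmoothNear (realizeJet A) 0 := by
  obtain ⟨U, hU, h0, h⟩ := realizeJet_exists_nhds E V n
  filter_upwards [hU.mem_nhds h0] with z hz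
  exact ContDiffAt.comp (g := fun q : JetFiber E V n × E => realizeJet q.1 q.2)
    (f := fun z : E => (A, z)) z
    (h.contDiffAt ((isOpen_univ.prod hU).mem_nhds ⟨trivial, hz⟩))
    (contDiffAt_const.prodMk contDiffAt_id)

theorem taylorJet_realizeJet (A : JetFiber E V n) : taylorJet n (realizeJet A) 0 = A.1 := by
  ext k : 1
  set b := Module.finBasis ℝ (JetFiber E V n) with hb
  have hk : ((k : ℕ) : ℕ∞ω) ≤ ∞ := by exact_mod_cast le_top
  have h1 : ∀ i, ContDiffAt ℝ (k : ℕ) (b i).2.choose 0 := fun i =>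
    (b i).2.choose_spec.1.self.of_le hk
  have h2 : ∀ i, iteratedFDeriv ℝ k (b i).2.choose 0 = (b i).1 k := fun i =>
    (congrFun (b i).2.choose_spec.2 k).symm
  have h3 := congrArg (fun B : JetFiber E V n => B.1 k) (b.sum_repr A)
  refine Eq.trans ?_ h3
  simp only [taylorJet]
  have h4 : (realizeJet A) = fun z => ∑ i, (b.repr A i • (b i).2.choose) z := rfl
  rw [h4, iteratedFDeriv_fun_sum_apply]
  · simp only [AddSubmonoidClass.coe_finsetSum, Finset.sum_apply]
    refine Finset.sum_congr rfl fun i _ => ?_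
    rw [iteratedFDeriv_const_smul_apply (h1 i), h2]
    rfl
  · intro i _
    exact contDiffAt_const.smul (h1 i)

/-- A function with prescribed Taylor coefficients at `x`. -/
def realizeJetAt (A : JetFiber E V n) (x : E) (z : E) : V := realizeJet A (z - x)

theorem taylorJet_realizeJetAt (A : JetFiber E V n) (x : E) :
    taylorJet n (realizeJetAt A x) x = A.1 := by
  rw [← taylorJet_realizeJet A]
  ext k : 1
  simp only [taylorJet]
  unfold realizeJetAt
  rw [iteratedFDeriv_comp_sub, sub_self]

theorem realizeJetAt_smoothNear (A : JetFiber E V n) (x : E) :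
    SmoothNear (realizeJetAt A x) x := by
  have h : Filter.Tendsto (fun z : E => z - x) (𝓝 x) (𝓝 0) := by
    have : Continuous fun z : E => z - x := by fun_prop
    simpa using this.tendsto x
  filter_upwards [h.eventually (realizeJet_smoothNear A)] with z hz
  exact ContDiffAt.comp (g := (realizeJet A)) (f := fun z : E => z - x) z hz
    (contDiffAt_id.sub contDiffAt_const)

theorem realizeJetAt_self (A : JetFiber E V n) (x : E) : realizeJetAt A x x = jetVal A := by
  have h := congrArg (fun B : ∀ k : Fin (n + 1), E [×(k : ℕ)]→L[ℝ] V => B 0 0)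
    (taylorJet_realizeJetAt A x)
  exact h

end Realize

/-! ### Fibered manifolds and jet bundles -/

section Fibered

variable (E EF V : Type) [NormedAddCommGroup E] [NormedSpace ℝ E] [NormedAddCommGroup EF]
  [NormedSpace ℝ EF] [NormedAddCommGroup V] [NormedSpace ℝ V]
  {M F : Type} [TopologicalSpace M] [ChartedSpace E M] [TopologicalSpace F] [ChartedSpace EF F]

/-- An adapted chart of `π : F → M`: charts of `F` and `M` in which `π` is the projection
`E × V → E`. -/
structure AdaptedChart (π : F → M) where
  base : OpenPartialHomeomorph M E
  tot : OpenPartialHomeomorph F (E × V)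
  base_smooth : ContMDiffOn 𝓘(ℝ, E) 𝓘(ℝ, E) ∞ base base.source
  base_symm_smooth : ContMDiffOn 𝓘(ℝ, E) 𝓘(ℝ, E) ∞ base.symm base.target
  tot_smooth : ContMDiffOn 𝓘(ℝ, EF) 𝓘(ℝ, E × V) ∞ tot tot.source
  tot_symm_smooth : ContMDiffOn 𝓘(ℝ, E × V) 𝓘(ℝ, EF) ∞ tot.symm tot.target
  maps : ∀ z ∈ tot.source, π z ∈ base.source
  fst_tot : ∀ z ∈ tot.source, (tot z).1 = base (π z)

/-- `π : F → M` has an adapted chart around every point of `F`. -/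
def IsFibered (π : F → M) : Prop :=
  ∀ y : F, ∃ c : AdaptedChart E EF V π, y ∈ c.tot.source

variable {E EF V} {π : F → M}

/-- `s` is a smooth section of `π` on a neighbourhood of `p`. -/
def IsLocSec (E EF : Type) [NormedAddCommGroup E] [NormedSpace ℝ E] [NormedAddCommGroup EF]
    [NormedSpace ℝ EF] {M F : Type} [TopologicalSpace M] [ChartedSpace E M] [TopologicalSpace F]
    [ChartedSpace EF F] (π : F → M) (p : M) (s : M → F) : Prop :=
  ∀ᶠ q in 𝓝 p, ContMDiffAt 𝓘(ℝ, E) 𝓘(ℝ, EF) ∞ s q ∧ π (s q) = q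

namespace AdaptedChart

variable (c d : AdaptedChart E EF V π)

/-- The local representation `E → V` of a section. -/
def rep (s : M → F) (x : E) : V := (c.tot (s (c.base.symm x))).2

/-- The section with local representation `u`. -/
def sec (u : E → V) (q : M) : F := c.tot.symm (c.base q, u (c.base q))

variable {c d}

theorem _root_.IsLocSec.eq {p : M} {s : M → F} (hs : IsLocSec E EF π p s) : π (s p) = p :=
  hs.self_of_nhds.2

theorem _root_.IsLocSec.cont {p : M} {s : M → F} (hs : IsLocSec E EF π p s) : ContinuousAt s p :=
  hs.self_of_nhds.1.continuousAt

theorem eventually_source {p : M} {s : M → F} (hs : IsLocSec E EF π p s)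
    (h : s p ∈ c.tot.source) : ∀ᶠ q in 𝓝 p, s q ∈ c.tot.source :=
  hs.cont (c.tot.open_source.mem_nhds h)

theorem mem_base {p : M} {s : M → F} (hs : π (s p) = p) (h : s p ∈ c.tot.source) :
    p ∈ c.base.source := by
  have := c.maps _ h
  rwa [hs] at this

theorem tot_eq {p : M} {s : M → F} (hs : π (s p) = p) (h : s p ∈ c.tot.source) :
    c.tot (s p) = (c.base p, c.rep s (c.base p)) := by
  refine Prod.ext ?_ ?_
  · rw [c.fst_tot _ h, hs]
  · rw [rep, c.base.left_inv (mem_base hs h)]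

theorem tendsto_base_symm {p : M} (hp : p ∈ c.base.source) :
    Filter.Tendsto c.base.symm (𝓝 (c.base p)) (𝓝 p) := by
  have := c.base.symm.continuousAt (c.base.map_source hp)
  rwa [ContinuousAt, c.base.left_inv hp] at this

theorem rep_smoothNear {p : M} {s : M → F} (hs : IsLocSec E EF π p s) (h : s p ∈ c.tot.source) :
    SmoothNear (c.rep s) (c.base p) := by
  have hp := mem_base hs.eq h
  filter_upwards [(tendsto_base_symm hp).eventually (hs.and (eventually_source hs h)),
    c.base.open_target.mem_nhds (c.base.map_source hp)] with x hx hx'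
  have h1 : ContMDiffAt 𝓘(ℝ, E) 𝓘(ℝ, E × V) ∞ (fun x => c.tot (s (c.base.symm x))) x :=
    (c.tot_smooth.contMDiffAt (c.tot.open_source.mem_nhds hx.2)).comp x
      (hx.1.1.comp x (c.base_symm_smooth.contMDiffAt (c.base.open_target.mem_nhds hx')))
  exact (contMDiffAt_iff_contDiffAt.1 h1).snd

theorem mem_target {x : E} {v : V} (h : (x, v) ∈ c.tot.target) : x ∈ c.base.target := by
  have h1 := c.tot.map_target h
  have h2 := c.fst_tot _ h1
  rw [c.tot.right_inv h] at h2
  have h3 : x = c.base (π (c.tot.symm (x, v))) := h2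
  rw [h3]
  exact c.base.map_source (c.maps _ h1)

theorem proj_symm {x : E} {v : V} (h : (x, v) ∈ c.tot.target) :
    π (c.tot.symm (x, v)) = c.base.symm x := by
  have h1 := c.tot.map_target h
  have h2 := c.fst_tot _ h1
  rw [c.tot.right_inv h] at h2
  have h3 : x = c.base (π (c.tot.symm (x, v))) := h2
  rw [h3, c.base.left_inv]
  · rw [← h3]
  · exact c.maps _ h1

theorem sec_apply {x : E} {u : E → V} (h : x ∈ c.base.target) :
    c.sec u (c.base.symm x) = c.tot.symm (x, u x) := by
  rw [sec, c.base.right_inv h]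

theorem sec_isLocSec {x : E} {u : E → V} (hu : SmoothNear u x) (h : (x, u x) ∈ c.tot.target) :
    IsLocSec E EF π (c.base.symm x) (c.sec u) := by
  have hx := mem_target h
  have h1 : Filter.Tendsto c.base (𝓝 (c.base.symm x)) (𝓝 x) := by
    have := c.base.continuousAt (c.base.map_target hx)
    rwa [ContinuousAt, c.base.right_inv hx] at this
  have h2 : ∀ᶠ z in 𝓝 x, (z, u z) ∈ c.tot.target :=
    (continuousAt_id.prodMk hu.self.continuousAt) (c.tot.open_target.mem_nhds h)
  filter_upwards [h1.eventually (hu.and h2),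
    c.base.open_source.mem_nhds (c.base.map_target hx)] with q hq hq'
  refine ⟨?_, ?_⟩
  · refine (c.tot_symm_smooth.contMDiffAt (c.tot.open_target.mem_nhds hq.2)).comp q ?_
    have h3 : ContMDiffAt 𝓘(ℝ, E) 𝓘(ℝ, E × V) ∞ (fun z => (z, u z)) (c.base q) :=
      (contDiffAt_id.prodMk hq.1).contMDiffAt
    exact h3.comp q (c.base_smooth.contMDiffAt (c.base.open_source.mem_nhds hq'))
  · rw [sec, proj_symm hq.2, c.base.left_inv hq']

theorem rep_sec {x : E} {u : E → V} (hu : SmoothNear u x) (h : (x, u x) ∈ c.tot.target) :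
    c.rep (c.sec u) =ᶠ[𝓝 x] u := by
  have h2 : ∀ᶠ z in 𝓝 x, (z, u z) ∈ c.tot.target :=
    (continuousAt_id.prodMk hu.self.continuousAt) (c.tot.open_target.mem_nhds h)
  filter_upwards [h2] with z hz
  rw [rep, sec_apply (mem_target hz), c.tot.right_inv hz]

/-- The change of local representations. -/
theorem rep_change {p : M} {s : M → F} (hs : IsLocSec E EF π p s) (hc : s p ∈ c.tot.source)
    (hd : s p ∈ d.tot.source) : d.rep s =ᶠ[𝓝 (d.base p)] fun z =>
      (fun w => (fun y => (d.tot (c.tot.symm y)).2) ((fun w => (w, c.rep s w)) w))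
        (c.base (d.base.symm z)) := by
  filter_upwards [(tendsto_base_symm (mem_base hs.eq hd)).eventually
    (hs.and (eventually_source hs hc))] with z hz
  rw [← tot_eq hz.1.2 hz.2, c.tot.left_inv hz.2]
  rfl

end AdaptedChart

theorem taylorJet_congr {n : ℕ} {u v : E → V} {x : E} (h : u =ᶠ[𝓝 x] v) :
    taylorJet n u x = taylorJet n v x := by
  ext k : 1
  exact (h.iteratedFDeriv ℝ k).self_of_nhds

theorem taylorJet_graph {n : ℕ} {u v : E → V} {x : E} (hu : ContDiffAt ℝ ∞ u x)
    (hv : ContDiffAt ℝ ∞ v x) (h : taylorJet n u x = taylorJet n v x) :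
    taylorJet n (fun z => (z, u z)) x = taylorJet n (fun z => (z, v z)) x := by
  ext k : 1
  have hk : ((k : ℕ) : ℕ∞ω) ≤ ∞ := by exact_mod_cast le_top
  have key : ∀ w : E → V, ContDiffAt ℝ ∞ w x → taylorJet n (fun z => (z, w z)) x k =
      iteratedFDeriv ℝ k (fun z : E => (z, (0 : V))) x +
        (ContinuousLinearMap.inr ℝ E V).compContinuousMultilinearMap (taylorJet n w x k) := by
    intro w hw
    have h1 : (fun z => (z, w z)) = fun z : E => (z, (0 : V)) + (ContinuousLinearMap.inr ℝ E V ∘ w) z := by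
      ext z <;> simp
    have h2 : ContDiffAt ℝ ∞ (ContinuousLinearMap.inr ℝ E V ∘ w) x :=
      (ContinuousLinearMap.inr ℝ E V).contDiff.contDiffAt.comp x hw
    have h3 : ContDiffAt ℝ ∞ (fun z : E => (z, (0 : V))) x := contDiffAt_id.prodMk contDiffAt_const
    rw [h1]
    refine (iteratedFDeriv_add_of_smooth h3 h2 k).trans ?_
    rw [(ContinuousLinearMap.inr ℝ E V).iteratedFDeriv_comp_left hw hk]
    rfl
  rw [key u hu, key v hv, h]

/-- Two local sections at `p` have the same `n`-jet if their values at `p` agree and the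
Taylor coefficients of order at most `n` of their local representations agree. -/
def jetSetoid (E EF V : Type) [NormedAddCommGroup E] [NormedSpace ℝ E] [NormedAddCommGroup EF]
    [NormedSpace ℝ EF] [NormedAddCommGroup V] [NormedSpace ℝ V] {M F : Type} [TopologicalSpace M]
    [ChartedSpace E M] [TopologicalSpace F] [ChartedSpace EF F] (π : F → M) (n : ℕ) (p : M) :
    Setoid {s : M → F // IsLocSec E EF π p s} where
  r s s' := s.1 p = s'.1 p ∧ ∀ c : AdaptedChart E EF V π, s.1 p ∈ c.tot.source →
    taylorJet n (c.rep s.1) (c.base p) = taylorJet n (c.rep s'.1) (c.base p)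
  iseqv :=
    { refl := fun _ => ⟨rfl, fun _ _ => rfl⟩
      symm := fun h => ⟨h.1.symm, fun c hc => (h.2 c (h.1 ▸ hc)).symm⟩
      trans := fun h h' => ⟨h.1.trans h'.1, fun c hc => (h.2 c hc).trans (h'.2 c (h.1 ▸ hc))⟩ }

/-- It suffices to compare Taylor coefficients in one adapted chart. -/
theorem jetSetoid_of_chart {n : ℕ} {p : M} {s s' : {s : M → F // IsLocSec E EF π p s}}
    (c : AdaptedChart E EF V π) (hs : s.1 p ∈ c.tot.source) (hs' : s'.1 p ∈ c.tot.source)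
    (h : taylorJet n (c.rep s.1) (c.base p) = taylorJet n (c.rep s'.1) (c.base p)) :
    (jetSetoid E EF V π n p).r s s' := by
  have h0 : c.rep s.1 (c.base p) = c.rep s'.1 (c.base p) :=
    congrArg (fun B : ∀ k : Fin (n + 1), E [×(k : ℕ)]→L[ℝ] V => B 0 0) h
  have e0 : s.1 p = s'.1 p := by
    refine c.tot.injOn hs hs' ?_
    rw [AdaptedChart.tot_eq s.2.eq hs, AdaptedChart.tot_eq s'.2.eq hs', h0]
  refine ⟨e0, fun d hd => ?_⟩
  have hd' : s'.1 p ∈ d.tot.source := e0 ▸ hd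
  rw [taylorJet_congr (AdaptedChart.rep_change s.2 hs hd),
    taylorJet_congr (AdaptedChart.rep_change s'.2 hs' hd')]
  have hp := AdaptedChart.mem_base s.2.eq hs
  have hpd := AdaptedChart.mem_base s.2.eq hd
  have hψ : ContDiffAt ℝ ∞ (fun z => c.base (d.base.symm z)) (d.base p) := by
    rw [← contMDiffAt_iff_contDiffAt]
    refine ContMDiffAt.comp (I' := 𝓘(ℝ, E)) (g := c.base) _ ?_ (d.base_symm_smooth.contMDiffAt
      (d.base.open_target.mem_nhds (d.base.map_source hpd)))
    rw [d.base.left_inv hpd]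
    exact c.base_smooth.contMDiffAt (c.base.open_source.mem_nhds hp)
  have hΦ : ∀ s : {t : M → F // IsLocSec E EF π p t}, s.1 p ∈ c.tot.source → s.1 p ∈ d.tot.source →
      ContDiffAt ℝ ∞ (fun y => (d.tot (c.tot.symm y)).2) (c.base p, c.rep s.1 (c.base p)) := by
    intro s hs hd
    have h1 : ContMDiffAt 𝓘(ℝ, E × V) 𝓘(ℝ, E × V) ∞ (fun y => d.tot (c.tot.symm y))
        (c.base p, c.rep s.1 (c.base p)) := by
      rw [← AdaptedChart.tot_eq s.2.eq hs]
      refine ContMDiffAt.comp (I' := 𝓘(ℝ, EF)) (g := d.tot) _ ?_ (c.tot_symm_smooth.contMDiffAt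
        (c.tot.open_target.mem_nhds (c.tot.map_source hs)))
      rw [c.tot.left_inv hs]
      exact d.tot_smooth.contMDiffAt (d.tot.open_source.mem_nhds hd)
    exact (contMDiffAt_iff_contDiffAt.1 h1).snd
  have hr := (AdaptedChart.rep_smoothNear s.2 hs).self
  have hr' := (AdaptedChart.rep_smoothNear s'.2 hs').self
  have hψp : c.base (d.base.symm (d.base p)) = c.base p := by rw [d.base.left_inv hpd]
  refine taylorJet_comp_congr
    (g := fun w => (fun y => (d.tot (c.tot.symm y)).2) ((fun w => (w, c.rep s.1 w)) w))
    (g' := fun w => (fun y => (d.tot (c.tot.symm y)).2) ((fun w => (w, c.rep s'.1 w)) w))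
    ?_ ?_ hψ hψ rfl ?_
  · rw [hψp]
    exact ContDiffAt.comp (f := fun w => (w, c.rep s.1 w)) _ (hΦ s hs hd) (contDiffAt_id.prodMk hr)
  · rw [hψp]
    exact ContDiffAt.comp (f := fun w => (w, c.rep s'.1 w)) _ (hΦ s' hs' hd')
      (contDiffAt_id.prodMk hr')
  · rw [hψp]
    refine taylorJet_comp_congr (g := fun y => (d.tot (c.tot.symm y)).2)
      (g' := fun y => (d.tot (c.tot.symm y)).2) (f := fun w => (w, c.rep s.1 w))
      (f' := fun w => (w, c.rep s'.1 w)) (hΦ s hs hd) (hΦ s' hs' hd') (contDiffAt_id.prodMk hr)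
      (contDiffAt_id.prodMk hr') (taylorJet_graph hr hr' h) ?_
    rw [h0]

end Fibered

section Jets

variable {E EF V : Type} [NormedAddCommGroup E] [NormedSpace ℝ E] [NormedAddCommGroup EF]
  [NormedSpace ℝ EF] [NormedAddCommGroup V] [NormedSpace ℝ V] [FiniteDimensional ℝ E]
  [FiniteDimensional ℝ V]
  {M F : Type} [TopologicalSpace M] [ChartedSpace E M] [TopologicalSpace F] [ChartedSpace EF F]
  {π : F → M}

/-- The `n`-th jet bundle of `π : F → M`: the set of `n`-jets of local sections at points of `M`. -/
@[nolint unusedArguments]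
def JetBundle (_h : IsFibered E EF V π) (n : ℕ) : Type :=
  Σ p : M, Quotient (jetSetoid E EF V π n p)

namespace JetBundle

variable {h : IsFibered E EF V π} {n : ℕ}

/-- The `n`-jet at `p` of a local section. -/
def jet (h : IsFibered E EF V π) (n : ℕ) (p : M) (s : M → F) (hs : IsLocSec E EF π p s) :
    JetBundle h n :=
  ⟨p, Quotient.mk (jetSetoid E EF V π n p) ⟨s, hs⟩⟩

theorem exists_rep (j : JetBundle h n) : ∃ p s hs, j = jet h n p s hs := by
  obtain ⟨p, q⟩ := j
  induction q using Quotient.inductionOn with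
  | h s => exact ⟨p, s.1, s.2, rfl⟩

/-- The base point of a jet. -/
def pt (j : JetBundle h n) : M := j.1

/-- The value of a jet. -/
def value (j : JetBundle h n) : F :=
  Quotient.lift (s := jetSetoid E EF V π n j.1) (fun s => s.1 j.1) (fun _ _ hr => hr.1) j.2

/-- The `n`-jet underlying an `n + 1`-jet. -/
def trunc (j : JetBundle h (n + 1)) : JetBundle h n :=
  ⟨j.1, Quotient.map' (s₁ := jetSetoid E EF V π (n + 1) j.1) (s₂ := jetSetoid E EF V π n j.1) id
    (fun _ _ hr => ⟨hr.1, fun c hc => funext fun k => congrFun (hr.2 c hc) k.castSucc⟩) j.2⟩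

open Classical in
/-- The Taylor coefficients of a jet in an adapted chart. -/
def coordFiber (c : AdaptedChart E EF V π) (j : JetBundle h n) : JetFiber E V n :=
  Quotient.lift (s := jetSetoid E EF V π n j.1)
    (fun s => if hs : s.1 j.1 ∈ c.tot.source then
      ⟨taylorJet n (c.rep s.1) (c.base j.1), taylorJet_mem n (AdaptedChart.rep_smoothNear s.2 hs)⟩
      else 0)
    (fun s s' hr => by
      by_cases hs : s.1 j.1 ∈ c.tot.source
      · have hs' : s'.1 j.1 ∈ c.tot.source := hr.1 ▸ hs
        simp only [dif_pos hs, dif_pos hs', Subtype.mk.injEq]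
        exact hr.2 c hs
      · have hs' : s'.1 j.1 ∉ c.tot.source := hr.1 ▸ hs
        simp only [dif_neg hs, dif_neg hs']) j.2

/-- The coordinates of a jet in an adapted chart. -/
def coord (c : AdaptedChart E EF V π) (j : JetBundle h n) : E × JetFiber E V n :=
  (c.base j.pt, coordFiber c j)

theorem coord_jet (c : AdaptedChart E EF V π) {p : M} {s : M → F} (hs : IsLocSec E EF π p s)
    (hc : s p ∈ c.tot.source) : coord c (jet h n p s hs) =
      (c.base p, ⟨taylorJet n (c.rep s) (c.base p),
        taylorJet_mem n (AdaptedChart.rep_smoothNear hs hc)⟩) :=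
  Prod.ext rfl (dif_pos hc)

theorem jetVal_coord (c : AdaptedChart E EF V π) {j : JetBundle h n}
    (hj : j.value ∈ c.tot.source) :
    ((coord c j).1, jetVal (coord c j).2) = c.tot j.value := by
  obtain ⟨p, s, hs, rfl⟩ := j.exists_rep
  have hc : s p ∈ c.tot.source := hj
  rw [coord_jet c hs hc]
  exact (AdaptedChart.tot_eq hs.eq hc).symm

theorem target_realize (c : AdaptedChart E EF V π) {x : E} {A : JetFiber E V n}
    (hA : (x, jetVal A) ∈ c.tot.target) : (x, realizeJetAt A x x) ∈ c.tot.target := by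
  rwa [realizeJetAt_self]

/-- The jet with given coordinates. -/
def ofCoord (h : IsFibered E EF V π) (c : AdaptedChart E EF V π) (x : E) (A : JetFiber E V n)
    (hA : (x, jetVal A) ∈ c.tot.target) : JetBundle h n :=
  jet h n (c.base.symm x) (c.sec (realizeJetAt A x))
    (AdaptedChart.sec_isLocSec (realizeJetAt_smoothNear A x) (target_realize c hA))

theorem value_ofCoord (c : AdaptedChart E EF V π) {x : E} {A : JetFiber E V n}
    (hA : (x, jetVal A) ∈ c.tot.target) :
    (ofCoord h c x A hA).value = c.tot.symm (x, jetVal A) := by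
  change c.sec (realizeJetAt A x) (c.base.symm x) = _
  rw [AdaptedChart.sec_apply (AdaptedChart.mem_target hA), realizeJetAt_self]

theorem coord_ofCoord (c : AdaptedChart E EF V π) {x : E} {A : JetFiber E V n}
    (hA : (x, jetVal A) ∈ c.tot.target) : coord c (ofCoord h c x A hA) = (x, A) := by
  have h1 : (ofCoord h c x A hA).value ∈ c.tot.source := by
    rw [value_ofCoord]
    exact c.tot.map_target hA
  have hx := c.base.right_inv (AdaptedChart.mem_target hA)
  rw [ofCoord, coord_jet c _ h1]
  refine Prod.ext hx (Subtype.ext ?_)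
  change taylorJet n (c.rep (c.sec (realizeJetAt A x))) (c.base (c.base.symm x)) = A.1
  rw [hx, taylorJet_congr (AdaptedChart.rep_sec (realizeJetAt_smoothNear A x)
    (target_realize c hA)), taylorJet_realizeJetAt]

theorem ext_coord (c : AdaptedChart E EF V π) {j j' : JetBundle h n}
    (hj : j.value ∈ c.tot.source) (hj' : j'.value ∈ c.tot.source) (he : coord c j = coord c j') :
    j = j' := by
  obtain ⟨p, s, hs, rfl⟩ := j.exists_rep
  obtain ⟨p', s', hs', rfl⟩ := j'.exists_rep
  have hc : s p ∈ c.tot.source := hj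
  have hc' : s' p' ∈ c.tot.source := hj'
  rw [coord_jet c hs hc, coord_jet c hs' hc'] at he
  obtain rfl : p = p' := c.base.injOn (AdaptedChart.mem_base hs.eq hc)
    (AdaptedChart.mem_base hs'.eq hc') (congrArg Prod.fst he)
  refine Sigma.ext rfl (heq_of_eq (Quotient.sound ?_))
  exact jetSetoid_of_chart c hc hc' (congrArg (fun t => t.2.1) he)

open Classical in
/-- The chart of the jet bundle given by an adapted chart; `j₀` is the value of the inverse outside
the range of the chart. -/
def chart (c : AdaptedChart E EF V π) (j₀ : JetBundle h n) :
    PartialEquiv (JetBundle h n) (E × JetFiber E V n) where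
  toFun := coord c
  invFun y := if hy : (y.1, jetVal y.2) ∈ c.tot.target then ofCoord h c y.1 y.2 hy else j₀
  source := {j | j.value ∈ c.tot.source}
  target := {y | (y.1, jetVal y.2) ∈ c.tot.target}
  map_source' j hj := by
    change ((coord c j).1, jetVal (coord c j).2) ∈ c.tot.target
    rw [jetVal_coord c hj]
    exact c.tot.map_source hj
  map_target' y hy := by
    change (y.1, jetVal y.2) ∈ c.tot.target at hy
    simp only [dif_pos hy, Set.mem_ofPred_eq, value_ofCoord]
    exact c.tot.map_target hy
  left_inv' j hj := by
    have hy : ((coord c j).1, jetVal (coord c j).2) ∈ c.tot.target := by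
      rw [jetVal_coord c hj]
      exact c.tot.map_source hj
    rw [dif_pos hy]
    refine ext_coord c ?_ hj (coord_ofCoord c hy)
    rw [value_ofCoord]
    exact c.tot.map_target hy
  right_inv' y hy := by
    change (y.1, jetVal y.2) ∈ c.tot.target at hy
    rw [dif_pos hy, coord_ofCoord]

theorem chart_symm (c : AdaptedChart E EF V π) (j₀ : JetBundle h n) {y : E × JetFiber E V n}
    (hy : (y.1, jetVal y.2) ∈ c.tot.target) : (chart c j₀).symm y = ofCoord h c y.1 y.2 hy :=
  dif_pos hy

theorem value_chart_symm (c : AdaptedChart E EF V π) (j₀ : JetBundle h n)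
    {y : E × JetFiber E V n} (hy : (y.1, jetVal y.2) ∈ c.tot.target) :
    ((chart c j₀).symm y).value = c.tot.symm (y.1, jetVal y.2) := by
  rw [chart_symm c j₀ hy, value_ofCoord]

theorem overlap_eq (c d : AdaptedChart E EF V π) (j₀ j₁ : JetBundle h n) :
    ((chart c j₀).symm.trans (chart d j₁)).source =
      (fun y : E × JetFiber E V n => (y.1, jetVal y.2)) ⁻¹' (c.tot.symm.trans d.tot).source := by
  ext y
  constructor
  · rintro ⟨hy, hy'⟩
    have hy : (y.1, jetVal y.2) ∈ c.tot.target := hy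
    have h1 : ((chart c j₀).symm y).value ∈ d.tot.source := hy'
    rw [value_chart_symm c j₀ hy] at h1
    exact ⟨hy, h1⟩
  · rintro ⟨hy, hy'⟩
    have hy : (y.1, jetVal y.2) ∈ c.tot.target := hy
    have h1 : c.tot.symm (y.1, jetVal y.2) ∈ d.tot.source := hy'
    rw [← value_chart_symm c j₀ hy] at h1
    exact ⟨hy, h1⟩

theorem isOpen_overlap (c d : AdaptedChart E EF V π) (j₀ j₁ : JetBundle h n) :
    IsOpen ((chart c j₀).symm.trans (chart d j₁)).source := by
  rw [overlap_eq]
  refine (c.tot.symm.trans d.tot).open_source.preimage ?_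
  exact continuous_fst.prodMk (continuous_jetVal.comp continuous_snd)

theorem contDiff_jetFiber {P : Type} [NormedAddCommGroup P] [NormedSpace ℝ P] {f : P → JetFiber E V n}
    {x : P} (hf : ∀ k, ContDiffAt ℝ ∞ (fun y => (f y).1 k) x) : ContDiffAt ℝ ∞ f x := by
  have hfd : FiniteDimensional ℝ (∀ k : Fin (n + 1), E [×(k : ℕ)]→L[ℝ] V) := by
    have : ∀ k : ℕ, FiniteDimensional ℝ (E [×k]→L[ℝ] V) := fun k =>
      FiniteDimensional.of_injective
        (ContinuousMultilinearMap.toMultilinearMapLinear (R' := ℝ) (A := ℝ)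
          (M₁ := fun _ : Fin k => E) (M₂ := V))
        ContinuousMultilinearMap.toMultilinearMap_injective
    infer_instance
  obtain ⟨L, hL⟩ := (JetFiber E V n).subtype.exists_leftInverse_of_injective
    (Submodule.ker_subtype _)
  have h1 : ContDiffAt ℝ ∞ (fun y => (f y).1) x := contDiffAt_pi.2 hf
  have h3 : ContDiff ℝ ∞ (LinearMap.toContinuousLinearMap L :
      (∀ k : Fin (n + 1), E [×(k : ℕ)]→L[ℝ] V) → JetFiber E V n) := ContinuousLinearMap.contDiff _
  have h2 := h3.contDiffAt.comp x h1
  refine h2.congr_of_eventuallyEq (Filter.Eventually.of_forall fun y => ?_)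
  exact (LinearMap.congr_fun hL (f y)).symm

theorem contDiffOn_transition (c d : AdaptedChart E EF V π) (j₀ j₁ : JetBundle h n) :
    ContDiffOn ℝ ∞ ((chart c j₀).symm.trans (chart d j₁))
      ((chart c j₀).symm.trans (chart d j₁)).source := by
  intro y₀ hy₀
  refine ContDiffAt.contDiffWithinAt ?_
  have hev := (isOpen_overlap c d j₀ j₁).mem_nhds hy₀
  rw [overlap_eq] at hev hy₀
  set ψ : E → E := fun z => c.base (d.base.symm z) with hψ
  set φ : E → E := fun x => d.base (c.base.symm x) with hφ
  have hmem : ∀ y : E × JetFiber E V n,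
      y ∈ (fun y : E × JetFiber E V n => (y.1, jetVal y.2)) ⁻¹' (c.tot.symm.trans d.tot).source →
      c.base.symm y.1 ∈ d.base.source ∧ y.1 ∈ c.base.target := by
    rintro y ⟨hy, hy'⟩
    have hy : (y.1, jetVal y.2) ∈ c.tot.target := hy
    have hy' : c.tot.symm (y.1, jetVal y.2) ∈ d.tot.source := hy'
    have h1 := d.maps _ hy'
    rw [AdaptedChart.proj_symm hy] at h1
    exact ⟨h1, AdaptedChart.mem_target hy⟩
  have hφs : ∀ x, c.base.symm x ∈ d.base.source → x ∈ c.base.target → ContDiffAt ℝ ∞ φ x := by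
    intro x hx hx'
    rw [← contMDiffAt_iff_contDiffAt]
    exact ContMDiffAt.comp (I' := 𝓘(ℝ, E)) (g := d.base) x
      (d.base_smooth.contMDiffAt (d.base.open_source.mem_nhds hx))
      (c.base_symm_smooth.contMDiffAt (c.base.open_target.mem_nhds hx'))
  have hψs : ∀ x, d.base.symm x ∈ c.base.source → x ∈ d.base.target → ContDiffAt ℝ ∞ ψ x := by
    intro x hx hx'
    rw [← contMDiffAt_iff_contDiffAt]
    exact ContMDiffAt.comp (I' := 𝓘(ℝ, E)) (g := c.base) x
      (c.base_smooth.contMDiffAt (c.base.open_source.mem_nhds hx))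
      (d.base_symm_smooth.contMDiffAt (d.base.open_target.mem_nhds hx'))
  obtain ⟨U, hU, h0, hUs⟩ := realizeJet_exists_nhds E V n
  set r : (E × JetFiber E V n) × E → E × V :=
    fun q => (ψ q.2, realizeJet q.1.2 (ψ q.2 - q.1.1)) with hr
  set g : (E × JetFiber E V n) × E → V := fun q => (d.tot (c.tot.symm (r q))).2 with hg
  obtain ⟨hd0, hc0⟩ := hmem y₀ hy₀
  set q₀ : (E × JetFiber E V n) × E := (y₀, φ y₀.1) with hq₀
  have e1 : d.base.symm (φ y₀.1) = c.base.symm y₀.1 := d.base.left_inv hd0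
  have e2 : ψ (φ y₀.1) = y₀.1 := by
    rw [hψ]
    simp only [e1]
    exact c.base.right_inv hc0
  have er : r q₀ = (y₀.1, jetVal y₀.2) := by
    rw [hr]
    simp only [hq₀, e2]
    exact congrArg _ (realizeJetAt_self y₀.2 y₀.1)
  have hrs : ∀ q : (E × JetFiber E V n) × E, ContDiffAt ℝ ∞ ψ q.2 → ψ q.2 - q.1.1 ∈ U →
      ContDiffAt ℝ ∞ r q := by
    intro q h1 h2
    have h3 : ContDiffAt ℝ ∞ (fun q : (E × JetFiber E V n) × E => ψ q.2) q :=
      ContDiffAt.comp (g := ψ) q h1 contDiffAt_snd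
    refine h3.prodMk ?_
    exact ContDiffAt.comp (g := fun q : JetFiber E V n × E => realizeJet q.1 q.2)
      (f := fun q : (E × JetFiber E V n) × E => (q.1.2, ψ q.2 - q.1.1)) q
      (hUs.contDiffAt ((isOpen_univ.prod hU).mem_nhds ⟨trivial, h2⟩))
      ((contDiffAt_snd.comp q contDiffAt_fst).prodMk (h3.sub (contDiffAt_fst.comp q contDiffAt_fst)))
  have hφd : φ y₀.1 ∈ d.base.target := d.base.map_source hd0
  have hψ0 : ContDiffAt ℝ ∞ ψ (φ y₀.1) := by
    refine hψs _ ?_ hφd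
    rw [e1]
    exact c.base.map_target hc0
  have hU0 : ψ q₀.2 - q₀.1.1 ∈ U := by
    simp only [hq₀, e2, sub_self]
    exact h0
  have hgs : SmoothNear g q₀ := by
    have hr0 := hrs q₀ hψ0 hU0
    have t1 : ∀ᶠ z in 𝓝 (φ y₀.1), d.base.symm z ∈ c.base.source ∧ z ∈ d.base.target := by
      have := (d.base.symm.continuousAt hφd).eventually (c.base.open_source.mem_nhds
        (by rw [e1]; exact c.base.map_target hc0))
      exact this.and (d.base.open_target.mem_nhds hφd)
    have t2 : Filter.Tendsto (fun q : (E × JetFiber E V n) × E => q.2) (𝓝 q₀) (𝓝 (φ y₀.1)) :=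
      continuous_snd.tendsto q₀
    have t3 : ContinuousAt (fun q : (E × JetFiber E V n) × E => ψ q.2 - q.1.1) q₀ :=
      (ContinuousAt.comp (g := ψ) (f := fun q : (E × JetFiber E V n) × E => q.2) (x := q₀)
        hψ0.continuousAt continuousAt_snd).sub
        (continuous_fst.comp continuous_fst).continuousAt
    have t4 : ∀ᶠ q in 𝓝 q₀, r q ∈ (c.tot.symm.trans d.tot).source := by
      refine hr0.continuousAt ((c.tot.symm.trans d.tot).open_source.mem_nhds ?_)
      rw [er]
      exact hy₀
    filter_upwards [t2.eventually t1, t3 (hU.mem_nhds hU0), t4] with q hq1 hq2 hq3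
    have h1 := hrs q (hψs _ hq1.1 hq1.2) hq2
    have h2 : ContMDiffAt 𝓘(ℝ, E × V) 𝓘(ℝ, E × V) ∞ (fun y => d.tot (c.tot.symm y)) (r q) :=
      ContMDiffAt.comp (I' := 𝓘(ℝ, EF)) (g := d.tot) _
        (d.tot_smooth.contMDiffAt (d.tot.open_source.mem_nhds hq3.2))
        (c.tot_symm_smooth.contMDiffAt (c.tot.open_target.mem_nhds hq3.1))
    exact ((contMDiffAt_iff_contDiffAt.1 h2).comp q h1).snd
  have hT : ∀ y ∈ (fun y : E × JetFiber E V n => (y.1, jetVal y.2)) ⁻¹'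
        (c.tot.symm.trans d.tot).source,
      ((chart c j₀).symm.trans (chart d j₁)) y = (φ y.1, (coord d ((chart c j₀).symm y)).2) ∧
      ∀ k : Fin (n + 1), ((coord d ((chart c j₀).symm y)).2).1 k =
        iteratedFDeriv ℝ k (fun z => g (y, z)) (φ y.1) := by
    intro y hy
    have hyc : (y.1, jetVal y.2) ∈ c.tot.target := hy.1
    have hyd : c.tot.symm (y.1, jetVal y.2) ∈ d.tot.source := hy.2
    have hyd' : (ofCoord h c y.1 y.2 hyc).value ∈ d.tot.source := by rwa [value_ofCoord]
    have hyc' : (ofCoord h c y.1 y.2 hyc).value ∈ c.tot.source := by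
      rw [value_ofCoord]
      exact c.tot.map_target hyc
    have hs := AdaptedChart.sec_isLocSec (realizeJetAt_smoothNear y.2 y.1) (target_realize c hyc)
    have e3 : coord d ((chart c j₀).symm y) = (φ y.1, ⟨taylorJet n
        (d.rep (c.sec (realizeJetAt y.2 y.1))) (φ y.1),
        taylorJet_mem n (AdaptedChart.rep_smoothNear hs hyd')⟩) := by
      rw [chart_symm c j₀ hyc]
      exact coord_jet d hs hyd'
    refine ⟨?_, fun k => ?_⟩
    · refine Prod.ext ?_ rfl
      change (coord d ((chart c j₀).symm y)).1 = φ y.1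
      rw [e3]
    · rw [e3]
      refine congrFun (taylorJet_congr (v := fun z => g (y, z)) ?_) k
      refine (AdaptedChart.rep_change hs hyc' hyd').trans ?_
      obtain ⟨hb, hb'⟩ := hmem y hy
      have h4 := AdaptedChart.rep_sec (realizeJetAt_smoothNear y.2 y.1) (target_realize c hyc)
      have h5 : ContDiffAt ℝ ∞ ψ (φ y.1) := by
        refine hψs _ ?_ (d.base.map_source hb)
        rw [hφ]
        simp only [d.base.left_inv hb]
        exact c.base.map_target hb'
      have h6 : ψ (φ y.1) = y.1 := by
        rw [hψ, hφ]
        simp only [d.base.left_inv hb]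
        exact c.base.right_inv hb'
      have h7 := h5.continuousAt
      rw [ContinuousAt, h6] at h7
      filter_upwards [h7.eventually h4] with z hz
      have hz : c.rep (c.sec (realizeJetAt y.2 y.1)) (ψ z) = realizeJetAt y.2 y.1 (ψ z) := hz
      change (d.tot (c.tot.symm (ψ z, c.rep (c.sec (realizeJetAt y.2 y.1)) (ψ z)))).2 = _
      rw [hz]
      rfl
  have hfin : ContDiffAt ℝ ∞
      (fun y => (φ y.1, (coord d ((chart c j₀).symm y)).2)) y₀ := by
    refine ((hφs _ hd0 hc0).comp y₀ contDiffAt_fst).prodMk (contDiff_jetFiber fun k => ?_)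
    have h1 := ContDiffAt.comp
      (g := fun q : (E × JetFiber E V n) × E => iteratedFDeriv ℝ k (fun z => g (q.1, z)) q.2)
      (f := fun y : E × JetFiber E V n => (y, φ y.1)) y₀ (hgs.iteratedFDeriv_param k)
      (contDiffAt_id.prodMk ((hφs _ hd0 hc0).comp y₀ contDiffAt_fst))
    refine h1.congr_of_eventuallyEq ?_
    filter_upwards [hev] with y hy
    exact (hT y hy).2 k
  refine hfin.congr_of_eventuallyEq ?_
  filter_upwards [hev] with y hy
  exact (hT y hy).1

/-- The charts of the jet bundle. -/
def smoothAtlas (h : IsFibered E EF V π) (n : ℕ) :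
    SmoothAtlasOn (E × JetFiber E V n) (JetBundle h n) where
  ι := AdaptedChart E EF V π × JetBundle h n
  chart i := chart i.1 i.2
  cover j := by
    obtain ⟨c, hc⟩ := h j.value
    exact ⟨(c, j), hc⟩
  isOpen_overlap i j := isOpen_overlap _ _ _ _
  contDiffOn i j := contDiffOn_transition _ _ _ _

instance : TopologicalSpace (JetBundle h n) := (smoothAtlas h n).topologicalSpace

instance : ChartedSpace (E × JetFiber E V n) (JetBundle h n) := (smoothAtlas h n).chartedSpace

instance : IsManifold 𝓘(ℝ, E × JetFiber E V n) ∞ (JetBundle h n) := (smoothAtlas h n).isManifold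

end JetBundle

end Jets

section JetMaps

variable {E EF V : Type} [NormedAddCommGroup E] [NormedSpace ℝ E] [NormedAddCommGroup EF]
  [NormedSpace ℝ EF] [NormedAddCommGroup V] [NormedSpace ℝ V] [FiniteDimensional ℝ E]
  [FiniteDimensional ℝ V]
  {M F : Type} [TopologicalSpace M] [ChartedSpace E M] [TopologicalSpace F] [ChartedSpace EF F]
  {π : F → M}

namespace JetBundle

variable {h : IsFibered E EF V π} {n : ℕ}

theorem exists_chart (j : JetBundle h n) : ∃ (c : AdaptedChart E EF V π)
    (e : OpenPartialHomeomorph (JetBundle h n) (E × JetFiber E V n)),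
    e.source = {j | j.value ∈ c.tot.source} ∧ e = coord (n := n) (h := h) c ∧ j ∈ e.source ∧
    ContMDiffOn 𝓘(ℝ, E × JetFiber E V n) 𝓘(ℝ, E × JetFiber E V n) ∞ e e.source ∧
    ContMDiffOn 𝓘(ℝ, E × JetFiber E V n) 𝓘(ℝ, E × JetFiber E V n) ∞ e.symm e.target := by
  obtain ⟨c, hc⟩ := h j.value
  exact ⟨c, (smoothAtlas h n).homeo (c, j), rfl, rfl, hc,
    contMDiffOn_of_mem_maximalAtlas ((smoothAtlas h n).homeo_mem (c, j)),
    contMDiffOn_symm_of_mem_maximalAtlas ((smoothAtlas h n).homeo_mem (c, j))⟩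

theorem exists_chart_at (c : AdaptedChart E EF V π) (j : JetBundle h n)
    (hc : j.value ∈ c.tot.source) :
    ∃ e : OpenPartialHomeomorph (JetBundle h n) (E × JetFiber E V n),
    e.source = {j | j.value ∈ c.tot.source} ∧ e = coord (n := n) (h := h) c ∧ j ∈ e.source ∧
    ContMDiffOn 𝓘(ℝ, E × JetFiber E V n) 𝓘(ℝ, E × JetFiber E V n) ∞ e e.source ∧
    ContMDiffOn 𝓘(ℝ, E × JetFiber E V n) 𝓘(ℝ, E × JetFiber E V n) ∞ e.symm e.target := by
  exact ⟨(smoothAtlas h n).homeo (c, j), rfl, rfl, hc,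
    contMDiffOn_of_mem_maximalAtlas ((smoothAtlas h n).homeo_mem (c, j)),
    contMDiffOn_symm_of_mem_maximalAtlas ((smoothAtlas h n).homeo_mem (c, j))⟩

/-- The truncation of jets of functions. -/
def truncFiber (A : JetFiber E V (n + 1)) : JetFiber E V n :=
  ⟨fun k => A.1 k.castSucc, by
    obtain ⟨u, hu, hA⟩ := A.2
    exact ⟨u, hu, funext fun k => congrFun hA k.castSucc⟩⟩

theorem contDiff_truncFiber : ContDiff ℝ ∞ (truncFiber : JetFiber E V (n + 1) → JetFiber E V n) := by
  rw [contDiff_iff_contDiffAt]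
  intro A
  refine contDiff_jetFiber fun k => ?_
  have h1 : ContDiff ℝ ∞ fun A : JetFiber E V (n + 1) => A.1 :=
    (JetFiber E V (n + 1)).subtypeₗᵢ.contDiff
  exact (contDiff_pi.1 h1 k.castSucc).contDiffAt

theorem coord_trunc (c : AdaptedChart E EF V π) (j : JetBundle h (n + 1))
    (hc : j.value ∈ c.tot.source) :
    coord c j.trunc = ((coord c j).1, truncFiber (coord c j).2) := by
  obtain ⟨p, s, hs, rfl⟩ := j.exists_rep
  have hc : s p ∈ c.tot.source := hc
  rw [coord_jet c hs hc]
  exact coord_jet (n := n) c hs hc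

theorem value_trunc (j : JetBundle h (n + 1)) : j.trunc.value = j.value := by
  obtain ⟨p, s, hs, rfl⟩ := j.exists_rep
  rfl

theorem contMDiff_trunc : ContMDiff 𝓘(ℝ, E × JetFiber E V (n + 1)) 𝓘(ℝ, E × JetFiber E V n) ∞
    (trunc : JetBundle h (n + 1) → JetBundle h n) := by
  refine contMDiff_of_charts (B' := E × JetFiber E V n) _ fun j => ?_
  obtain ⟨c, e, he, hec, hj, h1, -⟩ := j.exists_chart
  have hc : j.value ∈ c.tot.source := by rwa [he] at hj
  obtain ⟨e', he', hec', hj', -, h2⟩ := exists_chart_at c j.trunc (by rwa [value_trunc])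
  refine ⟨e, e', h1, h2, hj, fun z hz => ?_, ?_⟩
  · rw [he] at hz
    rw [he']
    change z.trunc.value ∈ c.tot.source
    rwa [value_trunc]
  · have h3 : ContDiff ℝ ∞ fun y : E × JetFiber E V (n + 1) => (y.1, truncFiber y.2) :=
      contDiff_fst.prodMk (contDiff_truncFiber.comp contDiff_snd)
    refine h3.contDiffOn.congr fun y hy => ?_
    have hy' := e.map_target hy
    rw [he] at hy'
    have hy2 := e.right_inv hy
    rw [hec] at hy2
    rw [hec', coord_trunc c _ hy', hy2]

theorem contMDiff_value : ContMDiff 𝓘(ℝ, E × JetFiber E V n) 𝓘(ℝ, EF) ∞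
    (value : JetBundle h n → F) := by
  refine contMDiff_of_charts (B' := E × V) _ fun j => ?_
  obtain ⟨c, e, he, hec, hj, h1, -⟩ := j.exists_chart
  refine ⟨e, c.tot, h1, c.tot_symm_smooth, hj, fun z hz => ?_, ?_⟩
  · rwa [he] at hz
  · have h4 : ContDiff ℝ ∞ (jetVal : JetFiber E V n → V) := by
      have h1 : ContDiff ℝ ∞ fun A : JetFiber E V n => A.1 := (JetFiber E V n).subtypeₗᵢ.contDiff
      exact (ContinuousMultilinearMap.apply ℝ (fun _ => E) V 0).contDiff.comp (contDiff_pi.1 h1 0)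
    have h3 : ContDiff ℝ ∞ fun y : E × JetFiber E V n => (y.1, jetVal y.2) :=
      contDiff_fst.prodMk (h4.comp contDiff_snd)
    refine h3.contDiffOn.congr fun y hy => ?_
    have hy' := e.map_target hy
    rw [he] at hy'
    have hy2 := e.right_inv hy
    rw [hec] at hy2
    rw [← jetVal_coord c hy', hy2]

theorem contMDiff_pt : ContMDiff 𝓘(ℝ, E × JetFiber E V n) 𝓘(ℝ, E) ∞
    (pt : JetBundle h n → M) := by
  refine contMDiff_of_charts (B' := E) _ fun j => ?_
  obtain ⟨c, e, he, hec, hj, h1, -⟩ := j.exists_chart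
  have key : ∀ z : JetBundle h n, z.value ∈ c.tot.source → z.pt ∈ c.base.source := by
    intro z hz
    obtain ⟨p, s, hs, rfl⟩ := z.exists_rep
    exact AdaptedChart.mem_base hs.eq hz
  refine ⟨e, c.base, h1, c.base_symm_smooth, hj, fun z hz => ?_, ?_⟩
  · rw [he] at hz
    exact key z hz
  · refine contDiffOn_fst.congr fun y hy => ?_
    have hy2 := e.right_inv hy
    rw [hec] at hy2
    exact congrArg Prod.fst hy2

/-- The projection from `n + 1`-jets to `n`-jets. -/
def truncCM (h : IsFibered E EF V π) (n : ℕ) : C^∞⟮𝓘(ℝ, E × JetFiber E V (n + 1)),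
    JetBundle h (n + 1); 𝓘(ℝ, E × JetFiber E V n), JetBundle h n⟯ :=
  ⟨trunc, contMDiff_trunc⟩

/-- The projection from jets to values. -/
def valueCM (h : IsFibered E EF V π) (n : ℕ) : C^∞⟮𝓘(ℝ, E × JetFiber E V n),
    JetBundle h n; 𝓘(ℝ, EF), F⟯ :=
  ⟨value, contMDiff_value⟩

/-- The projection from jets to the base. -/
def ptCM (h : IsFibered E EF V π) (n : ℕ) : C^∞⟮𝓘(ℝ, E × JetFiber E V n),
    JetBundle h n; 𝓘(ℝ, E), M⟯ :=
  ⟨pt, contMDiff_pt⟩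

open Classical in
/-- The `n`-jet at `p` of a map `s`, and `j₀` if `s` is not a smooth section near `p`. -/
def jetOr (j₀ : JetBundle h n) (s : M → F) (p : M) : JetBundle h n :=
  if hs : IsLocSec E EF π p s then jet h n p s hs else j₀

end JetBundle

/-- `π : F → M` is a smooth fibre bundle with typical fibre `N`. -/
def IsSmoothFiberBundle (E EF V : Type) [NormedAddCommGroup E] [NormedSpace ℝ E]
    [NormedAddCommGroup EF] [NormedSpace ℝ EF] [NormedAddCommGroup V] [NormedSpace ℝ V]
    {M F : Type} [TopologicalSpace M] [ChartedSpace E M] [TopologicalSpace F] [ChartedSpace EF F]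
    (N : Type) [TopologicalSpace N] [ChartedSpace V N] (π : F → M) : Prop :=
  ∀ p : M, ∃ e : Bundle.Trivialization N π, p ∈ e.baseSet ∧
    ContMDiffOn 𝓘(ℝ, EF) (𝓘(ℝ, E).prod 𝓘(ℝ, V)) ∞ e e.source ∧
    ContMDiffOn (𝓘(ℝ, E).prod 𝓘(ℝ, V)) 𝓘(ℝ, EF) ∞ e.toOpenPartialHomeomorph.symm e.target

theorem IsSmoothFiberBundle.isFibered [IsManifold 𝓘(ℝ, E) ∞ M] {N : Type} [TopologicalSpace N]
    [ChartedSpace V N] [IsManifold 𝓘(ℝ, V) ∞ N] (h : IsSmoothFiberBundle E EF V N π) :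
    IsFibered E EF V π := by
  intro y
  obtain ⟨e, he, h1, h2⟩ := h (π y)
  have hy : y ∈ e.source := e.mem_source.2 he
  let b := chartAt E (π y)
  let f := chartAt V (e y).2
  have hmaps : ∀ z ∈ (e.toOpenPartialHomeomorph.trans (b.prod f)).source,
      z ∈ e.source ∧ π z ∈ b.source ∧ (e z).2 ∈ f.source := by
    rintro z ⟨hz, hz'⟩
    have hz' : (e z).1 ∈ b.source ∧ (e z).2 ∈ f.source := hz'
    refine ⟨hz, ?_, hz'.2⟩
    rw [← e.coe_fst hz]
    exact hz'.1
  have hbf : ContMDiffOn (𝓘(ℝ, E).prod 𝓘(ℝ, V)) 𝓘(ℝ, E × V) ∞ (b.prod f) (b.prod f).source := by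
    rw [modelWithCornersSelf_prod, ← chartedSpaceSelf_prod]
    exact (contMDiffOn_chart (x := π y)).prodMap (contMDiffOn_chart (x := (e y).2))
  have hbf' : ContMDiffOn 𝓘(ℝ, E × V) (𝓘(ℝ, E).prod 𝓘(ℝ, V)) ∞ (b.prod f).symm
      (b.prod f).target := by
    rw [modelWithCornersSelf_prod, ← chartedSpaceSelf_prod]
    exact (contMDiffOn_chart_symm (x := π y)).prodMap (contMDiffOn_chart_symm (x := (e y).2))
  refine ⟨⟨b, e.toOpenPartialHomeomorph.trans (b.prod f), contMDiffOn_chart,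
    contMDiffOn_chart_symm, ?_, ?_, fun z hz => (hmaps z hz).2.1, fun z hz => ?_⟩, ?_⟩
  · exact hbf.comp (h1.mono fun z hz => hz.1) fun z hz => hz.2
  · exact h2.comp (hbf'.mono fun z hz => hz.1) fun z hz => hz.2
  · exact congrArg b (e.coe_fst (hmaps z hz).1)
  · refine ⟨hy, ?_⟩
    refine ⟨?_, mem_chart_source V (e y).2⟩
    change (e y).1 ∈ b.source
    rw [e.coe_fst hy]
    exact mem_chart_source E (π y)

end JetMaps

/-! ### The vertical bundle -/

section Vertical

variable {E EF V : Type} [NormedAddCommGroup E] [NormedSpace ℝ E] [NormedAddCommGroup EF]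
  [NormedSpace ℝ EF] [NormedAddCommGroup V] [NormedSpace ℝ V]
  {M F : Type} [TopologicalSpace M] [ChartedSpace E M] [TopologicalSpace F] [ChartedSpace EF F]
  [IsManifold 𝓘(ℝ, E) ∞ M] [IsManifold 𝓘(ℝ, EF) ∞ F] {π : F → M}

/-- The vertical bundle of `π : F → M`: tangent vectors of `F` annihilated by `dπ`. -/
@[nolint unusedArguments]
def VertBundle (_h : IsFibered E EF V π) : Type :=
  {w : TangentBundle 𝓘(ℝ, EF) F // mfderiv 𝓘(ℝ, EF) 𝓘(ℝ, E) π w.1 w.2 = 0}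

theorem AdaptedChart.mdifferentiable (c : AdaptedChart E EF V π) :
    c.tot.MDifferentiable 𝓘(ℝ, EF) 𝓘(ℝ, E × V) :=
  ⟨c.tot_smooth.mdifferentiableOn (by simp), c.tot_symm_smooth.mdifferentiableOn (by simp)⟩

theorem AdaptedChart.base_mdifferentiable (c : AdaptedChart E EF V π) :
    c.base.MDifferentiable 𝓘(ℝ, E) 𝓘(ℝ, E) :=
  ⟨c.base_smooth.mdifferentiableOn (by simp), c.base_symm_smooth.mdifferentiableOn (by simp)⟩

theorem AdaptedChart.proj_eventuallyEq (c : AdaptedChart E EF V π) {y : F}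
    (hy : y ∈ c.tot.source) : π =ᶠ[𝓝 y] fun z => c.base.symm (c.tot z).1 := by
  filter_upwards [c.tot.open_source.mem_nhds hy] with z hz
  rw [c.fst_tot z hz, c.base.left_inv (c.maps z hz)]

theorem AdaptedChart.hasMFDerivAt_proj (c : AdaptedChart E EF V π) {y : F}
    (hy : y ∈ c.tot.source) : MDifferentiableAt 𝓘(ℝ, EF) 𝓘(ℝ, E) π y := by
  have h1 : MDifferentiableAt 𝓘(ℝ, EF) 𝓘(ℝ, E × V) c.tot y := c.mdifferentiable.mdifferentiableAt hy
  have hb : (c.tot y).1 ∈ c.base.target := by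
    rw [c.fst_tot y hy]
    exact c.base.map_source (c.maps y hy)
  have h2 : MDifferentiableAt 𝓘(ℝ, E) 𝓘(ℝ, E) c.base.symm (c.tot y).1 :=
    c.base_mdifferentiable.mdifferentiableAt_symm hb
  have h3 : MDifferentiableAt 𝓘(ℝ, E × V) 𝓘(ℝ, E) (fun z : E × V => z.1) (c.tot y) :=
    differentiableAt_fst.mdifferentiableAt
  exact ((h2.comp (c.tot y) h3).comp y h1).congr_of_eventuallyEq (c.proj_eventuallyEq hy)

theorem AdaptedChart.mfderiv_fst (c : AdaptedChart E EF V π) {y : F}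
    (hy : y ∈ c.tot.source) (w : TangentSpace 𝓘(ℝ, EF) y) :
    Prod.fst (α := E) (β := V) (mfderiv 𝓘(ℝ, EF) 𝓘(ℝ, E × V) c.tot y w) =
      mfderiv 𝓘(ℝ, E) 𝓘(ℝ, E) c.base (π y) (mfderiv 𝓘(ℝ, EF) 𝓘(ℝ, E) π y w) := by
  have h1 : MDifferentiableAt 𝓘(ℝ, EF) 𝓘(ℝ, E × V) c.tot y := c.mdifferentiable.mdifferentiableAt hy
  have h3 : HasMFDerivAt 𝓘(ℝ, E × V) 𝓘(ℝ, E) (fun z : E × V => z.1) (c.tot y)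
      (ContinuousLinearMap.fst ℝ E V) := (hasFDerivAt_fst).hasMFDerivAt
  have h4 := h3.comp y h1.hasMFDerivAt
  have h5 : MDifferentiableAt 𝓘(ℝ, E) 𝓘(ℝ, E) c.base (π y) :=
    c.base_mdifferentiable.mdifferentiableAt (c.maps y hy)
  have h6 := h5.hasMFDerivAt.comp y (c.hasMFDerivAt_proj hy).hasMFDerivAt
  have h7 : (fun z => (c.tot z).1) =ᶠ[𝓝 y] fun z => c.base (π z) := by
    filter_upwards [c.tot.open_source.mem_nhds hy] with z hz
    exact c.fst_tot z hz
  have h8 := (h6.congr_of_eventuallyEq h7)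
  exact congrArg (fun A : EF →L[ℝ] E => A w) (hasMFDerivAt_unique h4 h8)

namespace VertBundle

variable {h : IsFibered E EF V π}

/-- The foot point of a vertical tangent vector. -/
def foot (w : VertBundle h) : F := w.1.1

/-- The projection `VF → M`. -/
def proj (h : IsFibered E EF V π) (w : VertBundle h) : M := π w.foot

/-- Coordinates of a vertical tangent vector in an adapted chart. -/
def coord (c : AdaptedChart E EF V π) (w : VertBundle h) : E × (V × V) :=
  ((c.tot w.foot).1, ((c.tot w.foot).2,
    Prod.snd (α := E) (β := V) (mfderiv 𝓘(ℝ, EF) 𝓘(ℝ, E × V) c.tot w.1.1 w.1.2)))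

/-- The vertical vector with given coordinates. -/
def ofCoord (h : IsFibered E EF V π) (c : AdaptedChart E EF V π) (y : E × (V × V))
    (hy : (y.1, y.2.1) ∈ c.tot.target) : VertBundle h :=
  ⟨⟨c.tot.symm (y.1, y.2.1),
    mfderiv 𝓘(ℝ, E × V) 𝓘(ℝ, EF) c.tot.symm (y.1, y.2.1) ((0, y.2.2) : E × V)⟩, by
    have hs := c.tot.map_target hy
    have h1 := c.mfderiv_fst hs
      (mfderiv 𝓘(ℝ, E × V) 𝓘(ℝ, EF) c.tot.symm (y.1, y.2.1) ((0, y.2.2) : E × V))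
    have h2 := congrArg (fun A : E × V →L[ℝ] E × V => (A ((0, y.2.2) : E × V)).1)
      (c.mdifferentiable.comp_symm_deriv hy)
    have h3 := h1.symm.trans h2
    refine (c.base_mdifferentiable.mfderiv_bijective (c.maps _ hs)).injective ?_
    exact h3.trans (map_zero _).symm⟩

theorem coord_ofCoord (c : AdaptedChart E EF V π) (y : E × (V × V))
    (hy : (y.1, y.2.1) ∈ c.tot.target) : coord c (ofCoord h c y hy) = y := by
  have h0 : c.tot (ofCoord h c y hy).foot = (y.1, y.2.1) := c.tot.right_inv hy
  have h2 := congrArg (fun A : E × V →L[ℝ] E × V => (A ((0, y.2.2) : E × V)).2)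
      (c.mdifferentiable.comp_symm_deriv hy)
  refine Prod.ext ?_ (Prod.ext ?_ h2)
  · exact congrArg (fun t : E × V => t.1) h0
  · exact congrArg (fun t : E × V => t.2) h0

theorem ext_coord (c : AdaptedChart E EF V π) {w w' : VertBundle h}
    (hw : w.foot ∈ c.tot.source) (hw' : w'.foot ∈ c.tot.source) (he : coord c w = coord c w') :
    w = w' := by
  obtain ⟨⟨y, w⟩, hv⟩ := w
  obtain ⟨⟨y', w'⟩, hv'⟩ := w'
  have h1 : c.tot y = c.tot y' := Prod.ext (congrArg (fun t : E × (V × V) => t.1) he)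
    (congrArg (fun t : E × (V × V) => t.2.1) he)
  obtain rfl : y = y' := c.tot.injOn hw hw' h1
  have key : ∀ u : TangentSpace 𝓘(ℝ, EF) y, mfderiv 𝓘(ℝ, EF) 𝓘(ℝ, E) π y u = 0 →
      Prod.fst (α := E) (β := V) (mfderiv 𝓘(ℝ, EF) 𝓘(ℝ, E × V) c.tot y u) = 0 := by
    intro u hu
    refine (c.mfderiv_fst hw u).trans ((congrArg (mfderiv 𝓘(ℝ, E) 𝓘(ℝ, E) c.base (π y)) hu).trans ?_)
    exact map_zero (mfderiv 𝓘(ℝ, E) 𝓘(ℝ, E) c.base (π y))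
  have h2 : w = w' := by
    refine (c.mdifferentiable.mfderiv_bijective hw).injective ?_
    refine Prod.ext ((key w hv).trans (key w' hv').symm) ?_
    exact congrArg (fun t : E × (V × V) => t.2.2) he
  subst h2
  rfl

open Classical in
/-- The chart of the vertical bundle given by an adapted chart; `w₀` is the value of the inverse
outside the range of the chart. -/
def chart (c : AdaptedChart E EF V π) (w₀ : VertBundle h) :
    PartialEquiv (VertBundle h) (E × (V × V)) where
  toFun := coord c
  invFun y := if hy : (y.1, y.2.1) ∈ c.tot.target then ofCoord h c y hy else w₀
  source := {w | w.foot ∈ c.tot.source}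
  target := {y | (y.1, y.2.1) ∈ c.tot.target}
  map_source' w hw := c.tot.map_source hw
  map_target' y hy := by
    change (y.1, y.2.1) ∈ c.tot.target at hy
    rw [dif_pos hy]
    exact c.tot.map_target hy
  left_inv' w hw := by
    have hy : ((coord c w).1, (coord c w).2.1) ∈ c.tot.target := c.tot.map_source hw
    rw [dif_pos hy]
    exact ext_coord c (c.tot.map_target hy) hw (coord_ofCoord c _ hy)
  right_inv' y hy := by
    change (y.1, y.2.1) ∈ c.tot.target at hy
    rw [dif_pos hy, coord_ofCoord]

theorem chart_symm (c : AdaptedChart E EF V π) (w₀ : VertBundle h) {y : E × (V × V)}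
    (hy : (y.1, y.2.1) ∈ c.tot.target) : (chart c w₀).symm y = ofCoord h c y hy :=
  dif_pos hy

theorem foot_chart_symm (c : AdaptedChart E EF V π) (w₀ : VertBundle h) {y : E × (V × V)}
    (hy : (y.1, y.2.1) ∈ c.tot.target) :
    ((chart c w₀).symm y).foot = c.tot.symm (y.1, y.2.1) := by
  rw [chart_symm c w₀ hy]
  rfl

theorem overlap_eq (c d : AdaptedChart E EF V π) (w₀ w₁ : VertBundle h) :
    ((chart c w₀).symm.trans (chart d w₁)).source =
      (fun y : E × (V × V) => (y.1, y.2.1)) ⁻¹' (c.tot.symm.trans d.tot).source := by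
  ext y
  constructor
  · rintro ⟨hy, hy'⟩
    have hy : (y.1, y.2.1) ∈ c.tot.target := hy
    have h1 : ((chart c w₀).symm y).foot ∈ d.tot.source := hy'
    rw [foot_chart_symm c w₀ hy] at h1
    exact ⟨hy, h1⟩
  · rintro ⟨hy, hy'⟩
    have hy : (y.1, y.2.1) ∈ c.tot.target := hy
    have h1 : c.tot.symm (y.1, y.2.1) ∈ d.tot.source := hy'
    rw [← foot_chart_symm c w₀ hy] at h1
    exact ⟨hy, h1⟩

theorem isOpen_overlap (c d : AdaptedChart E EF V π) (w₀ w₁ : VertBundle h) :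
    IsOpen ((chart c w₀).symm.trans (chart d w₁)).source := by
  rw [overlap_eq]
  refine (c.tot.symm.trans d.tot).open_source.preimage ?_
  fun_prop

theorem contDiffOn_transition (c d : AdaptedChart E EF V π) (w₀ w₁ : VertBundle h) :
    ContDiffOn ℝ ∞ ((chart c w₀).symm.trans (chart d w₁))
      ((chart c w₀).symm.trans (chart d w₁)).source := by
  set Φ : E × V → E × V := fun z => d.tot (c.tot.symm z) with hΦ
  have hΦs : ContDiffOn ℝ ∞ Φ (c.tot.symm.trans d.tot).source := by
    rw [← contMDiffOn_iff_contDiffOn]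
    exact d.tot_smooth.comp (c.tot_symm_smooth.mono fun z hz => hz.1) fun z hz => hz.2
  have hΦd : ContDiffOn ℝ ∞ (fderiv ℝ Φ) (c.tot.symm.trans d.tot).source :=
    hΦs.fderiv_of_isOpen (c.tot.symm.trans d.tot).open_source (by simp)
  have hp : ContDiff ℝ ∞ fun y : E × (V × V) => (y.1, y.2.1) := by fun_prop
  have h1 : ContDiffOn ℝ ∞ (fun y : E × (V × V) => Φ (y.1, y.2.1))
      ((fun y : E × (V × V) => (y.1, y.2.1)) ⁻¹' (c.tot.symm.trans d.tot).source) :=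
    hΦs.comp hp.contDiffOn fun y hy => hy
  have h2 : ContDiffOn ℝ ∞ (fun y : E × (V × V) => fderiv ℝ Φ (y.1, y.2.1) ((0, y.2.2) : E × V))
      ((fun y : E × (V × V) => (y.1, y.2.1)) ⁻¹' (c.tot.symm.trans d.tot).source) :=
    (hΦd.comp hp.contDiffOn fun y hy => hy).clm_apply (by fun_prop)
  rw [overlap_eq]
  have h3 : ContDiffOn ℝ ∞ (fun y : E × (V × V) => ((Φ (y.1, y.2.1)).1, ((Φ (y.1, y.2.1)).2,
      (fderiv ℝ Φ (y.1, y.2.1) ((0, y.2.2) : E × V)).2)))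
      ((fun y : E × (V × V) => (y.1, y.2.1)) ⁻¹' (c.tot.symm.trans d.tot).source) :=
    h1.fst.prodMk (h1.snd.prodMk h2.snd)
  refine h3.congr fun y hy => ?_
  have hyc : (y.1, y.2.1) ∈ c.tot.target := hy.1
  have hyd : c.tot.symm (y.1, y.2.1) ∈ d.tot.source := hy.2
  change coord d ((chart c w₀).symm y) = _
  rw [chart_symm c w₀ hyc]
  have h4 : mfderiv 𝓘(ℝ, E × V) 𝓘(ℝ, E × V) Φ (y.1, y.2.1) =
      (mfderiv 𝓘(ℝ, EF) 𝓘(ℝ, E × V) d.tot (c.tot.symm (y.1, y.2.1))).comp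
        (mfderiv 𝓘(ℝ, E × V) 𝓘(ℝ, EF) c.tot.symm (y.1, y.2.1)) :=
    mfderiv_comp (y.1, y.2.1) (d.mdifferentiable.mdifferentiableAt hyd)
      (c.mdifferentiable.mdifferentiableAt_symm hyc)
  rw [mfderiv_eq_fderiv] at h4
  refine Prod.ext rfl (Prod.ext rfl ?_)
  exact (congrArg (fun A : E × V →L[ℝ] E × V => (A ((0, y.2.2) : E × V)).2) h4).symm

/-- The charts of the vertical bundle. -/
def smoothAtlas (h : IsFibered E EF V π) : SmoothAtlasOn (E × (V × V)) (VertBundle h) where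
  ι := AdaptedChart E EF V π × VertBundle h
  chart i := chart i.1 i.2
  cover w := by
    obtain ⟨c, hc⟩ := h w.foot
    exact ⟨(c, w), hc⟩
  isOpen_overlap i j := isOpen_overlap _ _ _ _
  contDiffOn i j := contDiffOn_transition _ _ _ _

instance : TopologicalSpace (VertBundle h) := (smoothAtlas h).topologicalSpace

instance : ChartedSpace (E × (V × V)) (VertBundle h) := (smoothAtlas h).chartedSpace

instance : IsManifold 𝓘(ℝ, E × (V × V)) ∞ (VertBundle h) := (smoothAtlas h).isManifold

/-- An adapted chart of `F → M` induces one of `VF → M`. -/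
def adapted (c : AdaptedChart E EF V π) (w₀ : VertBundle h) :
    AdaptedChart E (E × (V × V)) (V × V) (proj h) where
  base := c.base
  tot := (smoothAtlas h).homeo (c, w₀)
  base_smooth := c.base_smooth
  base_symm_smooth := c.base_symm_smooth
  tot_smooth := contMDiffOn_of_mem_maximalAtlas ((smoothAtlas h).homeo_mem (c, w₀))
  tot_symm_smooth := contMDiffOn_symm_of_mem_maximalAtlas ((smoothAtlas h).homeo_mem (c, w₀))
  maps w hw := c.maps w.foot hw
  fst_tot w hw := c.fst_tot w.foot hw

theorem isFibered (h : IsFibered E EF V π) : IsFibered E (E × (V × V)) (V × V) (proj h) := by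
  intro w
  obtain ⟨c, hc⟩ := h w.foot
  exact ⟨adapted c w, hc⟩

theorem contMDiff_foot : ContMDiff 𝓘(ℝ, E × (V × V)) 𝓘(ℝ, EF) ∞ (foot : VertBundle h → F) := by
  refine contMDiff_of_charts (B' := E × V) _ fun w => ?_
  obtain ⟨c, hc⟩ := h w.foot
  refine ⟨(smoothAtlas h).homeo (c, w), c.tot, (adapted c w).tot_smooth, c.tot_symm_smooth, hc,
    fun z hz => hz, ?_⟩
  have hp : ContDiff ℝ ∞ fun y : E × (V × V) => (y.1, y.2.1) := by fun_prop
  refine hp.contDiffOn.congr fun y hy => ?_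
  have h1 : c.tot ((chart c w).symm y).foot = (y.1, y.2.1) := by
    rw [foot_chart_symm c w hy]
    exact c.tot.right_inv hy
  exact h1

/-- The projection `VF → F`. -/
def footCM (h : IsFibered E EF V π) : C^∞⟮𝓘(ℝ, E × (V × V)), VertBundle h; 𝓘(ℝ, EF), F⟯ :=
  ⟨foot, contMDiff_foot⟩

end VertBundle

end Vertical

/-! ### The infinite jet bundle -/

section JetInf

variable {E EF V : Type} [NormedAddCommGroup E] [NormedSpace ℝ E] [NormedAddCommGroup EF]
  [NormedSpace ℝ EF] [NormedAddCommGroup V] [NormedSpace ℝ V] [FiniteDimensional ℝ E]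
  [FiniteDimensional ℝ V]
  {M F : Type} [TopologicalSpace M] [ChartedSpace E M] [TopologicalSpace F] [ChartedSpace EF F]
  {π : F → M} (h : IsFibered E EF V π)

/-- The `n`-th jet bundle as a thickened smooth set. -/
abbrev yJet (n : ℕ) : ThSmthSet := yMan 𝓘(ℝ, E × JetFiber E V n) (JetBundle h n)

/-- The model with corners of `T(JⁿF)`. -/
abbrev jetI (E V : Type) [NormedAddCommGroup E] [NormedSpace ℝ E] [NormedAddCommGroup V]
    [NormedSpace ℝ V] (n : ℕ) :
    ModelWithCorners ℝ (E × JetFiber E V n) (E × JetFiber E V n) :=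
  𝓘(ℝ, E × JetFiber E V n)

/-- The tower `⋯ → J²F → J¹F → J⁰F`. -/
def jetTower : ℕᵒᵖ ⥤ ThSmthSet :=
  Functor.ofOpSequence (X := fun n => yJet h n) fun n => yMap (JetBundle.truncCM h n)

/-- The infinite jet bundle. -/
def jetInf : ThSmthSet := limit (jetTower h)

/-- The projection `J^∞F ⟶ JⁿF`. -/
def jetInfProj (n : ℕ) : jetInf h ⟶ yJet h n := limit.π (jetTower h) (op n)

/-- The projection `J^∞F ⟶ M`. -/
def jetInfPt : jetInf h ⟶ yMan 𝓘(ℝ, E) M := jetInfProj h 0 ≫ yMap (JetBundle.ptCM h 0)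

theorem jetInfProj_succ (n : ℕ) :
    jetInfProj h (n + 1) ≫ yMap (JetBundle.truncCM h n) = jetInfProj h n := by
  have h1 := limit.w (jetTower h) (homOfLE (Nat.le_add_right n 1)).op
  rw [jetTower, Functor.ofOpSequence_map_homOfLE_succ] at h1
  exact h1

theorem jetInfProj_pt (n : ℕ) : jetInfProj h n ≫ yMap (JetBundle.ptCM h n) = jetInfPt h := by
  induction n with
  | zero => rfl
  | succ n ih =>
    rw [← ih, ← jetInfProj_succ h n, Category.assoc]
    rfl

/-- The projection `J^∞F ⟶ F`. -/
def jetInfValue : jetInf h ⟶ yMan 𝓘(ℝ, EF) F := jetInfProj h 0 ≫ yMap (JetBundle.valueCM h 0)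

/-- The tower `⋯ → TJ²F → TJ¹F → TJ⁰F` of tangent bundles of manifolds. -/
def tanTower : ℕᵒᵖ ⥤ ThSmthSet :=
  Functor.ofOpSequence
    (X := fun n => yMan (jetI E V n).tangent (TangentBundle (jetI E V n) (JetBundle h n)))
    fun n => yMap (tangentCM (JetBundle.truncCM h n))

/-- The limit of the tangent bundles of the finite jet bundles. -/
def tanLim : ThSmthSet := limit (tanTower h)

/-- The projection from the limit to `TJⁿF`. -/
def tanLimProj (n : ℕ) :
    tanLim h ⟶ yMan (jetI E V n).tangent (TangentBundle (jetI E V n) (JetBundle h n)) :=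
  limit.π (tanTower h) (op n)

/-- The vertical subbundle `VJ^∞F` of `TJ^∞F`: the pullback of `TJ^∞F ⟶ TM` along the zero
section `M ⟶ TM`. -/
def vertInf : ThSmthSet := pullback (synTZero (yMan 𝓘(ℝ, E) M)) (synT.map (jetInfPt h))

/-- The inclusion `VJ^∞F ⟶ TJ^∞F`. -/
def vertInfIncl : vertInf h ⟶ synT.obj (jetInf h) := pullback.snd _ _

/-- The fibre product `J^∞F ×_M TM`. -/
def jetInfTM : ThSmthSet := pullback (jetInfPt h) (synTProj (yMan 𝓘(ℝ, E) M))

/-- The projection `J^∞F ×_M TM ⟶ J^∞F`. -/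
def jetInfTMFst : jetInfTM h ⟶ jetInf h := pullback.fst _ _

/-- The projection `J^∞F ×_M TM ⟶ TM`. -/
def jetInfTMSnd : jetInfTM h ⟶ synT.obj (yMan 𝓘(ℝ, E) M) := pullback.snd _ _

/-- The map `TJ^∞F ⟶ J^∞F ×_M TM` with components the bundle projection and the differential of
`J^∞F ⟶ M`. -/
def jetInfDiff : synT.obj (jetInf h) ⟶ jetInfTM h :=
  pullback.lift (synTProj (jetInf h)) (synT.map (jetInfPt h)) (synTProj_naturality _)

variable [IsManifold 𝓘(ℝ, E) ∞ M]

/-- The manifold `JⁿF ×_M TM`, the total space of the pullback of `TM → M` to `JⁿF`. -/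
abbrev JetTM (n : ℕ) : Type :=
  Bundle.TotalSpace E (JetBundle.ptCM h n *ᵖ (TangentSpace 𝓘(ℝ, E) : M → Type))

/-- The projection `JⁿF ×_M TM → JⁿF`. -/
def jetTMFst (n : ℕ) : C^∞⟮(jetI E V n).prod 𝓘(ℝ, E), JetTM h n; jetI E V n, JetBundle h n⟯ :=
  ⟨fun z => z.proj, Bundle.contMDiff_proj _⟩

/-- The projection `JⁿF ×_M TM → TM`. -/
def jetTMSnd (n : ℕ) :
    C^∞⟮(jetI E V n).prod 𝓘(ℝ, E), JetTM h n; 𝓘(ℝ, E).tangent, TangentBundle 𝓘(ℝ, E) M⟯ :=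
  ⟨fun z => ⟨z.proj.pt, z.snd⟩, by
    intro z
    rw [Bundle.contMDiffAt_totalSpace]
    refine ⟨((JetBundle.ptCM h n).contMDiff.comp (Bundle.contMDiff_proj _)) z, ?_⟩
    have h1 : ContMDiffAt ((jetI E V n).prod 𝓘(ℝ, E)) ((jetI E V n).prod 𝓘(ℝ, E)) ∞
      (fun z : JetTM h n => z) z := contMDiffAt_id
    exact (Bundle.contMDiffAt_totalSpace.1 h1).2⟩

/-- The canonical map from the manifold `JⁿF ×_M TM` to the fibre product of `JⁿF` and the
synthetic tangent bundle of `M`. -/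
def jetTMCompare (n : ℕ) : yMan ((jetI E V n).prod 𝓘(ℝ, E)) (JetTM h n) ⟶
    pullback (yMap (JetBundle.ptCM h n)) (synTProj (yMan 𝓘(ℝ, E) M)) :=
  pullback.lift (yMap (jetTMFst h n)) (yMap (jetTMSnd h n) ≫ kappa 𝓘(ℝ, E) M) (by
    rw [Category.assoc, kappa_proj]
    rfl)

/-- The map `π^∞_n × id : J^∞F ×_M TM ⟶ JⁿF ×_M TM`. -/
def jetInfTMProj (n : ℕ) : jetInfTM h ⟶
    pullback (yMap (JetBundle.ptCM h n)) (synTProj (yMan 𝓘(ℝ, E) M)) :=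
  pullback.lift (jetInfTMFst h ≫ jetInfProj h n) (jetInfTMSnd h) (by
    rw [Category.assoc, jetInfProj_pt]
    exact pullback.condition)

end JetInf

section Splitting

variable {E EF V : Type} [NormedAddCommGroup E] [NormedSpace ℝ E] [NormedAddCommGroup EF]
  [NormedSpace ℝ EF] [NormedAddCommGroup V] [NormedSpace ℝ V] [FiniteDimensional ℝ E]
  [FiniteDimensional ℝ V]
  {M F : Type} [TopologicalSpace M] [ChartedSpace E M] [TopologicalSpace F] [ChartedSpace EF F]
  [IsManifold 𝓘(ℝ, E) ∞ M] [IsManifold 𝓘(ℝ, EF) ∞ F] {π : F → M} (h : IsFibered E EF V π)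

/-- The velocity at time `0` of a curve. -/
def velocity {B H N : Type} [NormedAddCommGroup B] [NormedSpace ℝ B] [TopologicalSpace H]
    (I : ModelWithCorners ℝ B H) [TopologicalSpace N] [ChartedSpace H N] [IsManifold I ∞ N]
    (γ : ℝ → N) : TangentBundle I N :=
  tangentMap 𝓘(ℝ, ℝ) I γ ⟨0, (1 : ℝ)⟩

/-- `s t` is a smooth one-parameter family of local sections near `p`, and `σ` is its velocity at
`t = 0`, a vertical vector field along `s 0`. -/
structure IsVelocityOfFamily (p : M) (s : ℝ → M → F) (σ : M → VertBundle h) : Prop where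
  smooth : ∀ᶠ z : ℝ × M in 𝓝 (0, p),
    ContMDiffAt (𝓘(ℝ, ℝ).prod 𝓘(ℝ, E)) 𝓘(ℝ, EF) ∞ (fun z : ℝ × M => s z.1 z.2) z
  isSection : ∀ᶠ z : ℝ × M in 𝓝 (0, p), π (s z.1 z.2) = z.2
  velocity_eq : ∀ᶠ q in 𝓝 p, (σ q).1 = velocity 𝓘(ℝ, EF) fun t => s t q

/-- The map `Jⁿ(VF) → T(JⁿF)` sends the `n`-jet of the velocity of a family `s t` of sections to
the velocity of the family of the `n`-jets of the `s t`. -/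
def IsJetVelocityMap (n : ℕ)
    (θ : C^∞⟮jetI E (V × V) n, JetBundle (VertBundle.isFibered h) n;
      (jetI E V n).tangent, TangentBundle (jetI E V n) (JetBundle h n)⟯) : Prop :=
  ∀ (p : M) (s : ℝ → M → F) (σ : M → VertBundle h) (hs : IsLocSec E EF π p (s 0))
    (hσ : IsLocSec E (E × (V × V)) (VertBundle.proj h) p σ), IsVelocityOfFamily h p s σ →
    θ (JetBundle.jet (VertBundle.isFibered h) n p σ hσ) =
      velocity (jetI E V n) fun t => JetBundle.jetOr (JetBundle.jet h n p (s 0) hs) (s t) p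

/-- The map `Jⁿ⁺¹F ×_M TM → T(JⁿF)` is `(j^{n+1}_p s, X) ↦ d(jⁿ s)_p X`. -/
def IsHolonomicPushforward (n : ℕ)
    (Hn : C^∞⟮(jetI E V (n + 1)).prod 𝓘(ℝ, E), JetTM h (n + 1);
      (jetI E V n).tangent, TangentBundle (jetI E V n) (JetBundle h n)⟯) : Prop :=
  ∀ (p : M) (s : M → F) (hs : IsLocSec E EF π p s) (X : TangentSpace 𝓘(ℝ, E) p),
    Hn ⟨JetBundle.jet h (n + 1) p s hs, X⟩ =
      tangentMap 𝓘(ℝ, E) (jetI E V n) (JetBundle.jetOr (JetBundle.jet h n p s hs) s) ⟨p, X⟩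

/-- `H : J^∞F ×_M TM ⟶ TJ^∞F` splits the sequence `0 ⟶ VJ^∞F ⟶ TJ^∞F ⟶ J^∞F ×_M TM ⟶ 0`
of modules of plots over every plot `s` of `J^∞F`. -/
def IsFiberwiseSplitting (H : jetInfTM h ⟶ synT.obj (jetInf h)) : Prop :=
  ∀ (X : ThCartSp) (s : Plots (jetInf h) X),
    ∃ (_ : AddCommGroup (TFiber (jetInf h) s)) (_ : Module X.O (TFiber (jetInf h) s))
      (_ : AddCommGroup (TFiber (yMan 𝓘(ℝ, E) M) (ap (jetInfPt h) s)))
      (_ : Module X.O (TFiber (yMan 𝓘(ℝ, E) M) (ap (jetInfPt h) s))),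
      IsSyntheticModule (jetInf h) s ∧
      IsSyntheticModule (yMan 𝓘(ℝ, E) M) (ap (jetInfPt h) s) ∧
      ∃ (q : TFiber (jetInf h) s →ₗ[X.O] TFiber (yMan 𝓘(ℝ, E) M) (ap (jetInfPt h) s))
        (η : TFiber (yMan 𝓘(ℝ, E) M) (ap (jetInfPt h) s) →ₗ[X.O] TFiber (jetInf h) s),
        (∀ v, q v = tFiberMap (jetInfPt h) s v) ∧
        (∀ w, ∃ z : Plots (jetInfTM h) X, ap (jetInfTMFst h) z = s ∧
          ap (jetInfTMSnd h) z = w.1 ∧ ap H z = (η w).1) ∧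
        (∀ v, v ∈ LinearMap.ker q ↔ ∃ z : Plots (vertInf h) X, ap (vertInfIncl h) z = v.1) ∧
        (∀ v, v ∈ LinearMap.range η ↔ ∃ z : Plots (jetInfTM h) X, ap H z = v.1) ∧
        q ∘ₗ η = LinearMap.id ∧ IsCompl (LinearMap.ker q) (LinearMap.range η)

/-- The horizontal subbundle: the plot-wise image of `H : J^∞F ×_M TM ⟶ TJ^∞F`. -/
def horInf (H : jetInfTM h ⟶ synT.obj (jetInf h))
    (hH : IsThickenedSmoothSet (Subfunctor.range H.hom).toFunctor) : ThSmthSet :=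
  ⟨(Subfunctor.range H.hom).toFunctor, hH⟩

/-- The inclusion of the horizontal subbundle. -/
def horInfIncl (H : jetInfTM h ⟶ synT.obj (jetInf h))
    (hH : IsThickenedSmoothSet (Subfunctor.range H.hom).toFunctor) :
    horInf h H hH ⟶ synT.obj (jetInf h) :=
  ObjectProperty.homMk (Subfunctor.range H.hom).ι

/-- The sum `VJ^∞F ⊕ HJ^∞F` of vector bundles over `J^∞F`. -/
abbrev vertSumHor (H : jetInfTM h ⟶ synT.obj (jetInf h))
    (hH : IsThickenedSmoothSet (Subfunctor.range H.hom).toFunctor) : ThSmthSet :=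
  pullback (vertInfIncl h ≫ synTProj (jetInf h)) (horInfIncl h H hH ≫ synTProj (jetInf h))

end Splitting

end

/-!
# The tangent bundle of the infinite jet bundle and its splitting

Everything rests on a concrete description of the plots of a manifold `N`, the algebra maps
`C^∞(N) → 𝒪(X)`. Such a map has an underlying map `bodyMap : ℝ^k → N`, because every character of
`C^∞(N)` is the evaluation at a point (`exists_point`), and its value at a point of the probe
depends only on germs (`apply_eq_of_eventuallyEq`). If `N` is a vector space, a plot is the same as
an arbitrary choice of values on linear functions: the values determine the plot by Hadamard's lemma
and the nilpotence of the nilradical (`algHom_ext_of_linFun`), and every choice is realized by a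
finite Taylor series around its real part (`exists_algHom_linFun`). A retract chart
(`RetractChart`), a pair of globally defined smooth maps `N → B → N` which compose to the identity
near a point, carries this over to manifolds. The outcome is that the plots of `N` are determined
by their values on any test family, that is, a family of functions which separates points and
generates local coordinates, and that they can be glued from local plots with prescribed values on
it (`IsTestFamily.plot_ext`, `IsTestFamily.exists_plot`).

*Tangent bundles.* A tangent plot of `N` is an algebra map `φ₀ + ε φ₁`. The pullbacks `f ∘ π` and the
differentials `df` form a test family on `TN`, and `φ₀ f`, `φ₁ f` are the values on them of a plot of
`TN`; hence `kappa` is an isomorphism (`isIso_kappa`). As `T` is evaluation of plots on `X × 𝔻¹(1)`,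
it commutes with limits, so `T(J^∞F)` is the limit of the `T(JⁿF)` (`exists_iso_tanLim`).

*The vertical bundle.* By the symmetry of derivatives (`fderiv_iteratedFDeriv_param`), the velocity of
the `n`-jets of a family of sections is given in coordinates by the `n`-jet of the velocity of the
family. This defines a smooth map `jetVelocityCM : Jⁿ(VF) → T(JⁿF)`, in coordinates the linear
inclusion of the tangent vectors whose base component vanishes. Therefore the plots of `Jⁿ(VF)` are
exactly the tangent plots of `JⁿF` over zero tangent plots of `M` (`exists_plot_comp_jetVelocity`);
in the limit these are the plots of the vertical bundle of `J^∞F` (`exists_iso_vertInf`).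

*The horizontal lift.* In coordinates, the pushforward of a tangent vector along `jⁿs` depends only on
the `n + 1`-jet of `s` (`tangentMap_jet`), which yields smooth maps `jetPushCM` compatible with the
truncations of jets. The functions pulled back from the two factors are a test family on the
manifold `JⁿF ×_M TM`, so that it is also the fibre product of thickened smooth sets
(`IsTangentPullback.isIso_lift`), and the pushforwards define the map `H` into the limit
(`exists_horizontalLift`). Uniqueness holds because maps into `T(J^∞F)` are determined by their
composites with the `T(π^∞_n)`.

*The splitting.* The tangent plots over a plot `g` are the derivations along `g`, or compatible families
of those for a limit of manifolds (`PlotTower.tangentEquiv`). Derivations form a module, and the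
synthetic operations are those of this module (`PlotTower.isSyntheticModule`), so differentials of
maps are linear. Linearity of `H` on plots is not formal, since plots have nilpotent directions: a
function on `J ×_M TM` which is linear along the fibres over `J` is locally a combination of
differentials of coordinates of `M` with coefficients in `C^∞(J)`
(`IsTangentPullback.exists_expansion`), and such an expansion may be evaluated on plots
(`IsTangentPullback.apply_combination`). Given linearity, the section `H` splits the sequence of
modules over each plot (`IsLinearLift.exists_splitting`), and the fibrewise addition of vertical and
horizontal tangent plots is bijective (`AreFiberwiseComplements.exists_iso`).
-/

noncomputable section

/-! ### Weil algebras and nilpotent elements -/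

namespace IsWeilAlgebra

variable {W : Type} [CommRing W] [Algebra ℝ W] [IsWeilAlgebra W]

/-- The real part of an element of a Weil algebra is unique. -/
theorem eq_of_isNilpotent_sub {w : W} {r s : ℝ} (hr : IsNilpotent (w - algebraMap ℝ W r))
    (hs : IsNilpotent (w - algebraMap ℝ W s)) : r = s := by
  have h1 := (Commute.all _ _).isNilpotent_sub hr hs
  have h2 : w - algebraMap ℝ W r - (w - algebraMap ℝ W s) = algebraMap ℝ W (s - r) := by
    rw [map_sub]; ring
  rw [h2, IsNilpotent.map_iff (algebraMap ℝ W).injective, isNilpotent_iff_eq_zero] at h1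
  linarith

variable (W) in
/-- The augmentation of a Weil algebra, i.e. the quotient map to its residue field `ℝ`. -/
def aug : W →ₐ[ℝ] ℝ where
  toFun w := (exists_isNilpotent_sub w).choose
  map_one' := eq_of_isNilpotent_sub (exists_isNilpotent_sub (1 : W)).choose_spec (by simp)
  map_mul' v w := by
    refine eq_of_isNilpotent_sub (exists_isNilpotent_sub (v * w)).choose_spec ?_
    have hv := (exists_isNilpotent_sub v).choose_spec
    have hw := (exists_isNilpotent_sub w).choose_spec
    set r := (exists_isNilpotent_sub v).choose
    set s := (exists_isNilpotent_sub w).choose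
    have h : v * w - algebraMap ℝ W (r * s) =
        w * (v - algebraMap ℝ W r) + algebraMap ℝ W r * (w - algebraMap ℝ W s) := by
      rw [map_mul]; ring
    rw [h]
    exact (Commute.all _ _).isNilpotent_add ((Commute.all _ _).isNilpotent_mul_left hv)
      ((Commute.all _ _).isNilpotent_mul_left hw)
  map_zero' := eq_of_isNilpotent_sub (exists_isNilpotent_sub (0 : W)).choose_spec (by simp)
  map_add' v w := by
    refine eq_of_isNilpotent_sub (exists_isNilpotent_sub (v + w)).choose_spec ?_
    have hv := (exists_isNilpotent_sub v).choose_spec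
    have hw := (exists_isNilpotent_sub w).choose_spec
    rw [map_add, add_sub_add_comm]
    exact (Commute.all _ _).isNilpotent_add hv hw
  commutes' r := eq_of_isNilpotent_sub (exists_isNilpotent_sub (algebraMap ℝ W r)).choose_spec
    (by simp)

theorem isNilpotent_sub_aug (w : W) : IsNilpotent (w - algebraMap ℝ W (aug W w)) :=
  (exists_isNilpotent_sub w).choose_spec

theorem isUnit_of_aug_ne_zero {w : W} (h : aug W w ≠ 0) : IsUnit w := by
  have h1 := IsNilpotent.isUnit_add_right_of_commute (isNilpotent_sub_aug w)
    ((IsUnit.mk0 _ h).map (algebraMap ℝ W)) (Commute.all _ _)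
  rwa [sub_add_cancel] at h1

variable (W) in
theorem isNilpotent_nilradical : IsNilpotent (nilradical W) := by
  have : IsNoetherianRing W := IsNoetherianRing.of_finite ℝ W
  exact IsNoetherianRing.isNilpotent_nilradical W

end IsWeilAlgebra

/-! ### Deforming an algebra map along a derivation -/

section Shift

variable {A R : Type} [CommRing A] [Algebra ℝ A] [CommRing R] [Algebra ℝ R]

/-- The Taylor series `∑ a (dᵏ f) / k! Xᵏ`. -/
def taylorSeries (a : A →ₐ[ℝ] R) (d : Derivation ℝ A A) (f : A) : PowerSeries R :=
  PowerSeries.mk fun k => (k.factorial : ℝ)⁻¹ • a (d^[k] f)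

variable (a : A →ₐ[ℝ] R) (d : Derivation ℝ A A)

theorem coeff_taylorSeries_succ (f : A) (k : ℕ) :
    PowerSeries.coeff (k + 1) (taylorSeries a d f) * ((k : R) + 1) =
      PowerSeries.coeff k (taylorSeries a d (d f)) := by
  rw [taylorSeries, taylorSeries, PowerSeries.coeff_mk, PowerSeries.coeff_mk,
    Function.iterate_succ_apply]
  have h1 : ((k : R) + 1) = algebraMap ℝ R ((k : ℝ) + 1) := by simp
  have h2 : ((k : ℝ) + 1) ≠ 0 := by positivity
  rw [h1, mul_comm, ← Algebra.smul_def, smul_smul, Nat.factorial_succ]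
  congr 1
  push_cast
  field_simp

theorem taylorSeries_add (f g : A) :
    taylorSeries a d (f + g) = taylorSeries a d f + taylorSeries a d g := by
  ext k
  simp only [taylorSeries, map_add, PowerSeries.coeff_mk, iterate_map_add, smul_add]

/-- Leibniz's rule for the iterates of a derivation. -/
theorem taylorSeries_mul (f g : A) :
    taylorSeries a d (f * g) = taylorSeries a d f * taylorSeries a d g := by
  have key : ∀ (k : ℕ) (f g : A), PowerSeries.coeff k (taylorSeries a d (f * g)) =
      PowerSeries.coeff k (taylorSeries a d f * taylorSeries a d g) := by
    intro k
    induction k with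
    | zero => intro f g; simp [taylorSeries, PowerSeries.coeff_mul]
    | succ k ih =>
      -- The two sides have the same derivative by induction, and `k + 1` is invertible in `R`.
      intro f g
      have hder : ∀ f : A, PowerSeries.derivative R (taylorSeries a d f) =
          taylorSeries a d (d f) := by
        intro f
        ext k
        rw [PowerSeries.coeff_derivative, coeff_taylorSeries_succ]
      have hu : IsUnit ((k : R) + 1) := by
        have h1 : ((k : R) + 1) = algebraMap ℝ R ((k : ℝ) + 1) := by simp
        rw [h1]
        exact (IsUnit.mk0 _ (by positivity)).map _
      refine hu.mul_right_cancel ?_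
      rw [coeff_taylorSeries_succ, ← PowerSeries.coeff_derivative, Derivation.leibniz,
        Derivation.leibniz, hder, hder, taylorSeries_add, map_add, map_add]
      simp only [smul_eq_mul]
      rw [ih, ih]
  ext k
  exact key k f g

theorem eval_eq_of_coeff_eq {P Q : Polynomial R} {r : ℕ} {n : R} (hn : n ^ r = 0)
    (h : ∀ k < r, P.coeff k = Q.coeff k) : P.eval n = Q.eval n := by
  have h1 : Polynomial.X ^ r ∣ P - Q :=
    Polynomial.X_pow_dvd_iff.2 fun k hk => by rw [Polynomial.coeff_sub, h k hk, sub_self]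
  obtain ⟨S, hS⟩ := h1
  have h2 := congrArg (Polynomial.eval n) hS
  rw [Polynomial.eval_sub, Polynomial.eval_mul, Polynomial.eval_pow, Polynomial.eval_X, hn,
    zero_mul] at h2
  exact sub_eq_zero.1 h2

/-- The algebra map `f ↦ ∑ a (dᵏ f) nᵏ / k!` for a nilpotent element `n`. The order of truncation
is at least `2`, so that the linear term is always present. -/
def shiftHom {n : R} (hn : IsNilpotent n) : A →ₐ[ℝ] R where
  toFun f := (PowerSeries.trunc (hn.choose + 2) (taylorSeries a d f)).eval n
  map_one' := by
    have h1 : taylorSeries a d 1 = 1 := by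
      ext k
      cases k with
      | zero => simp [taylorSeries]
      | succ k => simp [taylorSeries, Function.iterate_succ_apply, iterate_map_zero,
          PowerSeries.coeff_one]
    rw [h1, PowerSeries.trunc_one, Polynomial.eval_one]
  map_mul' f g := by
    rw [← Polynomial.eval_mul]
    refine eval_eq_of_coeff_eq (r := hn.choose + 2) ?_ fun k hk => ?_
    · rw [pow_add, hn.choose_spec, zero_mul]
    · rw [PowerSeries.coeff_trunc, if_pos hk, taylorSeries_mul,
        PowerSeries.coeff_mul_eq_coeff_trunc_mul_trunc _ _ hk, ← Polynomial.coe_mul,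
        Polynomial.coeff_coe]
  map_zero' := by
    have h1 : taylorSeries a d 0 = 0 := by
      ext k
      simp [taylorSeries, iterate_map_zero]
    rw [h1]
    simp
  map_add' f g := by
    rw [taylorSeries_add, map_add, Polynomial.eval_add]
  commutes' r := by
    have h1 : taylorSeries a d (algebraMap ℝ A r) = PowerSeries.C (algebraMap ℝ R r) := by
      ext k
      cases k with
      | zero => simp [taylorSeries]
      | succ k => simp [taylorSeries, Function.iterate_succ_apply, iterate_map_zero]
    rw [h1, PowerSeries.trunc_C, Polynomial.eval_C]

/-- On functions with constant derivative, in particular on linear coordinates, the deformation has no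
terms of order higher than one. -/
theorem shiftHom_of_const {n : R} (hn : IsNilpotent n) {f : A} {r : ℝ}
    (hf : d f = algebraMap ℝ A r) : shiftHom a d hn f = a f + r • n := by
  have h1 := eval_eq_of_coeff_eq (r := hn.choose + 2) (n := n)
    (P := PowerSeries.trunc (hn.choose + 2) (taylorSeries a d f))
    (Q := Polynomial.C (a f) + Polynomial.C (algebraMap ℝ R r) * Polynomial.X)
    (by rw [pow_add, hn.choose_spec, zero_mul]) fun k hk => by
      rw [PowerSeries.coeff_trunc, if_pos hk]
      match k with
      | 0 => simp [taylorSeries]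
      | 1 => simp [taylorSeries, hf]
      | k + 2 => simp [taylorSeries, Function.iterate_succ_apply, hf, iterate_map_zero]
  refine h1.trans ?_
  simp [Algebra.smul_def]

end Shift

/-! ### Hadamard's lemma -/

section Hadamard

/-- A parametric integral of a smooth function over a compact interval is smooth. -/
theorem contDiff_nat_intervalIntegral {B : Type} [NormedAddCommGroup B] [NormedSpace ℝ B]
    [FiniteDimensional ℝ B] (n : ℕ) : ∀ {G : Type} [NormedAddCommGroup G] [NormedSpace ℝ G]
    [CompleteSpace G] {f : B → ℝ → G}, ContDiff ℝ ∞ (Function.uncurry f) →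
    ContDiff ℝ n fun y => ∫ t in (0 : ℝ)..1, f y t := by
  induction n with
  | zero =>
    intro G _ _ _ f hf
    rw [Nat.cast_zero, contDiff_zero]
    exact intervalIntegral.continuous_parametric_intervalIntegral_of_continuous' hf.continuous _ _
  | succ n ih =>
    intro G _ _ _ f hf
    have hprop : ProperSpace B := FiniteDimensional.proper ℝ B
    set f' : B → ℝ → B →L[ℝ] G := fun y t =>
      (fderiv ℝ (Function.uncurry f) (y, t)).comp (ContinuousLinearMap.inl ℝ B ℝ) with hf'
    have hs : ContDiff ℝ ∞ (Function.uncurry f') :=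
      (hf.fderiv_right (m := ∞) (by simp)).clm_comp contDiff_const
    have hd : ∀ y t, HasFDerivAt (fun z => f z t) (f' y t) y := by
      intro y t
      have h1 : HasFDerivAt (Function.uncurry f) (fderiv ℝ (Function.uncurry f) (y, t)) (y, t) :=
        (hf.differentiable (by simp) _).hasFDerivAt
      exact HasFDerivAt.comp (f := fun z : B => (z, t)) y h1 (hasFDerivAt_prodMk_left y t)
    have hD : ∀ y, HasFDerivAt (fun y => ∫ t in (0 : ℝ)..1, f y t)
        (∫ t in (0 : ℝ)..1, f' y t) y := by
      intro y
      have hK : IsCompact (Metric.closedBall y 1 ×ˢ Set.Icc (0 : ℝ) 1) :=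
        (isCompact_closedBall y 1).prod isCompact_Icc
      obtain ⟨C, hC⟩ := hK.exists_bound_of_continuousOn hs.continuous.continuousOn
      have hc : ∀ y, Continuous (f y) := fun y =>
        hf.continuous.comp (continuous_const.prodMk continuous_id)
      have hc' : ∀ y, Continuous (f' y) := fun y =>
        hs.continuous.comp (continuous_const.prodMk continuous_id)
      refine intervalIntegral.hasFDerivAt_integral_of_dominated_of_fderiv_le (bound := fun _ => C)
        (F := f) (F' := f') (Metric.closedBall_mem_nhds y one_pos)
        (Filter.Eventually.of_forall fun z => (hc z).aestronglyMeasurable)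
        ((hc y).intervalIntegrable _ _) ((hc' y).aestronglyMeasurable) ?_ (by simp)
        (Filter.Eventually.of_forall fun t _ z _ => hd z t)
      refine Filter.Eventually.of_forall fun t ht z hz => hC (z, t) ⟨hz, ?_⟩
      rw [Set.uIoc_of_le zero_le_one] at ht
      exact ⟨ht.1.le, ht.2⟩
    push_cast
    rw [contDiff_succ_iff_fderiv]
    refine ⟨fun y => (hD y).differentiableAt, fun h => absurd h (by simp), ?_⟩
    have h2 : fderiv ℝ (fun y => ∫ t in (0 : ℝ)..1, f y t) = fun y => ∫ t in (0 : ℝ)..1, f' y t :=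
      funext fun y => (hD y).fderiv
    rw [h2]
    exact ih hs

/-- Hadamard's lemma, with a smooth remainder: `g y` is the mean of the derivative of `f` over the
segment from `a` to `y`. -/
theorem exists_hadamard {B : Type} [NormedAddCommGroup B] [NormedSpace ℝ B]
    [FiniteDimensional ℝ B] {f : B → ℝ} (hf : ContDiff ℝ ∞ f) (a : B) :
    ∃ g : B → B →L[ℝ] ℝ, ContDiff ℝ ∞ g ∧ ∀ y, f y = f a + g y (y - a) := by
  have hs : ContDiff ℝ ∞ (Function.uncurry fun (y : B) (t : ℝ) => fderiv ℝ f (a + t • (y - a))) :=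
    (hf.fderiv_right (m := ∞) (by simp)).comp (by fun_prop)
  refine ⟨fun y => ∫ t in (0 : ℝ)..1, fderiv ℝ f (a + t • (y - a)),
    contDiff_infty.2 fun n => contDiff_nat_intervalIntegral n hs, fun y => ?_⟩
  have hc : Continuous fun t : ℝ => fderiv ℝ f (a + t • (y - a)) :=
    hs.continuous.comp (continuous_const.prodMk continuous_id)
  have h1 : ∀ t : ℝ, HasDerivAt (fun t : ℝ => f (a + t • (y - a)))
      (fderiv ℝ f (a + t • (y - a)) (y - a)) t := by
    intro t
    have h2 : HasDerivAt (fun t : ℝ => a + t • (y - a)) (y - a) t := by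
      simpa using ((hasDerivAt_id t).smul_const (y - a)).const_add a
    exact ((hf.differentiable (by simp) _).hasFDerivAt).comp_hasDerivAt t h2
  have h3 := intervalIntegral.integral_eq_sub_of_hasDerivAt (a := 0) (b := 1)
    (fun t _ => h1 t) ((hc.clm_apply continuous_const).intervalIntegrable 0 1)
  rw [ContinuousLinearMap.intervalIntegral_apply (hc.intervalIntegrable 0 1), h3]
  simp

end Hadamard

/-! ### Algebra maps out of the smooth functions on a vector space -/

/-- The body of a function on a thickened Cartesian space: its restriction to `ℝ^k`. -/
def ThCartSp.body (X : ThCartSp) : X.O →ₐ[ℝ] CartFun X.k :=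
  (Algebra.TensorProduct.rid ℝ ℝ (CartFun X.k)).toAlgHom.comp
    (Algebra.TensorProduct.map (AlgHom.id ℝ _) (IsWeilAlgebra.aug X.W))

theorem ThCartSp.body_tmul (X : ThCartSp) (f : CartFun X.k) (w : X.W) :
    X.body (f ⊗ₜ w) = IsWeilAlgebra.aug X.W w • f := by
  simp [ThCartSp.body]

theorem ThCartSp.isNilpotent_sub_body (X : ThCartSp) (x : X.O) :
    IsNilpotent (x - X.body x ⊗ₜ[ℝ] (1 : X.W)) := by
  induction x using TensorProduct.induction_on with
  | zero => simp
  | add x y hx hy =>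
    rw [map_add, TensorProduct.add_tmul, add_sub_add_comm]
    exact (Commute.all _ _).isNilpotent_add hx hy
  | tmul f w =>
    have h1 : f ⊗ₜ[ℝ] w - X.body (f ⊗ₜ w) ⊗ₜ[ℝ] (1 : X.W) =
        f ⊗ₜ[ℝ] (w - algebraMap ℝ X.W (IsWeilAlgebra.aug X.W w)) := by
      rw [ThCartSp.body_tmul, TensorProduct.tmul_sub, TensorProduct.smul_tmul,
        Algebra.algebraMap_eq_smul_one]
    rw [h1]
    obtain ⟨n, hn⟩ := IsWeilAlgebra.isNilpotent_sub_aug w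
    exact ⟨n, by rw [Algebra.TensorProduct.tmul_pow, hn, TensorProduct.tmul_zero]⟩

theorem aug_evalPoint (X : ThCartSp) (p : Cart X.k) (x : X.O) :
    IsWeilAlgebra.aug X.W (evalPoint X p x) = X.body x p := by
  induction x using TensorProduct.induction_on with
  | zero => simp
  | add x y hx hy => simp [hx, hy]
  | tmul f w =>
    rw [evalPoint_tmul, ThCartSp.body_tmul, map_smul]
    simp [mul_comm]

theorem contMDiffMap_sum_apply {E H N : Type} [NormedAddCommGroup E] [NormedSpace ℝ E]
    [TopologicalSpace H] {I : ModelWithCorners ℝ E H} [TopologicalSpace N] [ChartedSpace H N]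
    {ι : Type} (t : Finset ι) (f : ι → C^∞⟮I, N; ℝ⟯) (y : N) :
    (∑ i ∈ t, f i) y = ∑ i ∈ t, f i y :=
  map_sum ({ toFun := fun g => g y, map_zero' := rfl, map_add' := fun _ _ => rfl } :
    C^∞⟮I, N; ℝ⟯ →+ ℝ) f t

section VectorSpace

variable {B : Type} [NormedAddCommGroup B] [NormedSpace ℝ B]

/-- A continuous linear functional as a smooth function. -/
def linFun : (B →L[ℝ] ℝ) →ₗ[ℝ] C^∞⟮𝓘(ℝ, B), B; ℝ⟯ where
  toFun ℓ := ⟨ℓ, ℓ.contDiff.contMDiff⟩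
  map_add' _ _ := rfl
  map_smul' _ _ := rfl

/-- The directional derivative of smooth functions on a vector space. -/
def dirDeriv (v : B) : Derivation ℝ C^∞⟮𝓘(ℝ, B), B; ℝ⟯ C^∞⟮𝓘(ℝ, B), B; ℝ⟯ :=
  Derivation.mk'
    { toFun := fun f => ⟨fun y => fderiv ℝ f y v,
        ((f.contMDiff.contDiff.fderiv_right (m := ∞) (by simp)).clm_apply
          contDiff_const).contMDiff⟩
      map_add' := fun f g => by
        ext y
        have hf := (f.contMDiff.contDiff.differentiable (by simp)) y
        have hg := (g.contMDiff.contDiff.differentiable (by simp)) y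
        exact congrArg (fun A : B →L[ℝ] ℝ => A v) (fderiv_add hf hg)
      map_smul' := fun r f => by
        ext y
        have hf := (f.contMDiff.contDiff.differentiable (by simp)) y
        exact congrArg (fun A : B →L[ℝ] ℝ => A v) (fderiv_const_smul hf r) }
    (fun f g => by
      ext y
      have hf := (f.contMDiff.contDiff.differentiable (by simp)) y
      have hg := (g.contMDiff.contDiff.differentiable (by simp)) y
      exact congrArg (fun A : B →L[ℝ] ℝ => A v) (fderiv_mul hf hg))

theorem dirDeriv_linFun (v : B) (ℓ : B →L[ℝ] ℝ) :
    dirDeriv v (linFun ℓ) = algebraMap ℝ _ (ℓ v) := by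
  ext y
  exact congrArg (fun A : B →L[ℝ] ℝ => A v) ℓ.fderiv

variable [FiniteDimensional ℝ B]

variable (B) in
/-- The coordinates of a finite-dimensional space with respect to a fixed basis. -/
def coordCLM (i : Fin (Module.finrank ℝ B)) : B →L[ℝ] ℝ :=
  LinearMap.toContinuousLinearMap ((Module.finBasis ℝ B).coord i)

theorem sum_coordCLM (y : B) : ∑ i, coordCLM B i y • Module.finBasis ℝ B i = y :=
  (Module.finBasis ℝ B).sum_repr y

theorem eq_sum_coordCLM (ℓ : B →L[ℝ] ℝ) : ℓ = ∑ i, ℓ (Module.finBasis ℝ B i) • coordCLM B i := by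
  ext y
  conv_lhs => rw [← sum_coordCLM y]
  simp [mul_comm]

/-- Algebra maps from the smooth functions on a vector space to a Weil algebra are determined by
their values on linear functions: by Hadamard's lemma the difference of two such maps takes values
in every power of the nilradical. -/
theorem algHom_ext_of_linFun {W : Type} [CommRing W] [Algebra ℝ W] [IsWeilAlgebra W]
    {φ ψ : C^∞⟮𝓘(ℝ, B), B; ℝ⟯ →ₐ[ℝ] W} (h : ∀ ℓ, φ (linFun ℓ) = ψ (linFun ℓ)) : φ = ψ := by
  set r : Fin (Module.finrank ℝ B) → ℝ :=
    fun i => IsWeilAlgebra.aug W (φ (linFun (coordCLM B i))) with hr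
  set a : B := ∑ i, r i • Module.finBasis ℝ B i with ha
  have hai : ∀ i, coordCLM B i a = r i := by
    intro i
    change (Module.finBasis ℝ B).repr a i = r i
    rw [ha, (Module.finBasis ℝ B).repr_sum_self]
  have key : ∀ (k : ℕ) (f : C^∞⟮𝓘(ℝ, B), B; ℝ⟯), φ f - ψ f ∈ nilradical W ^ k := by
    intro k
    induction k with
    | zero => intro f; simp
    | succ k ih =>
      intro f
      -- In the expansion `f = f a + ∑ i, (xᵢ - rᵢ) gᵢ` the maps `φ` and `ψ` agree on `xᵢ - rᵢ`, whose value is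
      -- nilpotent by the choice of `rᵢ`; so `φ f - ψ f` lies one power deeper than the `φ gᵢ - ψ gᵢ`.
      obtain ⟨g, hg, hfg⟩ := exists_hadamard f.contMDiff.contDiff a
      let G : Fin (Module.finrank ℝ B) → C^∞⟮𝓘(ℝ, B), B; ℝ⟯ := fun i =>
        ⟨fun y => g y (Module.finBasis ℝ B i), (hg.clm_apply contDiff_const).contMDiff⟩
      have e : f = algebraMap ℝ _ (f a) +
          ∑ i, (linFun (coordCLM B i) - algebraMap ℝ _ (r i)) * G i := by
        ext y
        have h1 := hfg y
        have h2 : g y (y - a) = ∑ i, (coordCLM B i y - r i) * g y (Module.finBasis ℝ B i) := by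
          conv_lhs => rw [← sum_coordCLM (y - a)]
          simp [hai]
        rw [h2] at h1
        have h3 : (∑ i, (linFun (coordCLM B i) - algebraMap ℝ _ (r i)) * G i :
            C^∞⟮𝓘(ℝ, B), B; ℝ⟯) y = ∑ i, (coordCLM B i y - r i) * g y (Module.finBasis ℝ B i) := by
          rw [contMDiffMap_sum_apply]
          rfl
        exact h1.trans (congrArg (f a + ·) h3.symm)
      have hφ := congrArg φ e
      have hψ := congrArg ψ e
      rw [hφ, hψ]
      simp only [map_add, map_sum, map_mul, map_sub, AlgHom.commutes, ← h]
      rw [add_sub_add_left_eq_sub, ← Finset.sum_sub_distrib]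
      refine Ideal.sum_mem _ fun i _ => ?_
      rw [← mul_sub, pow_succ']
      exact Ideal.mul_mem_mul (IsWeilAlgebra.isNilpotent_sub_aug _) (ih _)
  obtain ⟨k, hk⟩ := IsWeilAlgebra.isNilpotent_nilradical W
  ext f
  have := key k f
  rw [hk] at this
  exact sub_eq_zero.1 this

/-- Plots of a vector space are determined by their values on linear functions. -/
theorem plot_ext_of_linFun {X : ThCartSp} {φ ψ : C^∞⟮𝓘(ℝ, B), B; ℝ⟯ →ₐ[ℝ] X.O}
    (h : ∀ ℓ, φ (linFun ℓ) = ψ (linFun ℓ)) : φ = ψ := by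
  ext f
  refine evalPoint_ext X fun p => ?_
  exact DFunLike.congr_fun (algHom_ext_of_linFun (φ := (evalPoint X p).comp φ)
    (ψ := (evalPoint X p).comp ψ) fun ℓ => congrArg (evalPoint X p) (h ℓ)) f

/-- A vector space represents the functor of tuples of functions: every choice of values on the
linear functions extends to the algebra of smooth functions. Starting from the composition with the
body of the tuple, the nilpotent parts are added one coordinate at a time. -/
theorem exists_algHom_linFun (X : ThCartSp) (u : (B →L[ℝ] ℝ) →ₗ[ℝ] X.O) :
    ∃ φ : C^∞⟮𝓘(ℝ, B), B; ℝ⟯ →ₐ[ℝ] X.O, ∀ ℓ, φ (linFun ℓ) = u ℓ := by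
  let a : C^∞⟮𝓘(ℝ, Cart X.k), Cart X.k; 𝓘(ℝ, B), B⟯ :=
    ⟨fun p => ∑ i, X.body (u (coordCLM B i)) p • Module.finBasis ℝ B i, by
      refine ContDiff.contMDiff (ContDiff.sum fun i _ => ?_)
      exact (X.body (u (coordCLM B i))).contMDiff.contDiff.smul contDiff_const⟩
  let φ₀ : C^∞⟮𝓘(ℝ, B), B; ℝ⟯ →ₐ[ℝ] X.O :=
    (Algebra.TensorProduct.includeLeft : CartFun X.k →ₐ[ℝ] X.O).comp (smoothPullback a)
  have h0 : ∀ i, φ₀ (linFun (coordCLM B i)) = X.body (u (coordCLM B i)) ⊗ₜ 1 := by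
    intro i
    change (smoothPullback a (linFun (coordCLM B i))) ⊗ₜ[ℝ] (1 : X.W) = _
    congr 1
    ext p
    change (Module.finBasis ℝ B).repr (∑ i, X.body (u (coordCLM B i)) p • Module.finBasis ℝ B i) i
      = _
    rw [(Module.finBasis ℝ B).repr_sum_self]
  have hn : ∀ i, IsNilpotent (u (coordCLM B i) - X.body (u (coordCLM B i)) ⊗ₜ[ℝ] (1 : X.W)) :=
    fun i => X.isNilpotent_sub_body _
  have key : ∀ s : Finset (Fin (Module.finrank ℝ B)), ∃ φ : C^∞⟮𝓘(ℝ, B), B; ℝ⟯ →ₐ[ℝ] X.O,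
      ∀ i, φ (linFun (coordCLM B i)) = if i ∈ s then u (coordCLM B i) else
        X.body (u (coordCLM B i)) ⊗ₜ 1 := by
    intro s
    induction s using Finset.induction_on with
    | empty => exact ⟨φ₀, fun i => by simpa using h0 i⟩
    | insert j s hj ih =>
      obtain ⟨φ, hφ⟩ := ih
      -- The derivative along the `j`-th basis vector is `1` on the `j`-th coordinate and `0` on the
      -- others, so that only the value on the `j`-th coordinate is changed.
      refine ⟨shiftHom φ (dirDeriv (Module.finBasis ℝ B j)) (hn j), fun i => ?_⟩
      rw [shiftHom_of_const _ _ _ (dirDeriv_linFun _ _), hφ]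
      have h1 : coordCLM B i (Module.finBasis ℝ B j) = if j = i then 1 else 0 := by
        change (Module.finBasis ℝ B).repr (Module.finBasis ℝ B j) i = _
        rw [Module.Basis.repr_self, Finsupp.single_apply]
      rw [h1]
      by_cases hij : j = i
      · subst hij
        simp [hj]
      · simp [hij, Ne.symm hij]
  obtain ⟨φ, hφ⟩ := key Finset.univ
  refine ⟨φ, fun ℓ => ?_⟩
  rw [eq_sum_coordCLM ℓ]
  simp only [map_sum, map_smul, hφ, Finset.mem_univ, if_true]

end VectorSpace

/-! ### Plots of manifolds: body and locality -/

section Body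

variable {E H N : Type} [NormedAddCommGroup E] [NormedSpace ℝ E] [FiniteDimensional ℝ E]
  [TopologicalSpace H] {I : ModelWithCorners ℝ E H} [TopologicalSpace N] [ChartedSpace H N]
  [IsManifold I ∞ N] [T2Space N]

variable (I) in
theorem exists_bump (x : N) {U : Set N} (hU : U ∈ 𝓝 x) :
    ∃ χ : C^∞⟮I, N; ℝ⟯, (∀ᶠ y in 𝓝 x, χ y = 1) ∧ ∀ y, y ∉ U → χ y = 0 := by
  obtain ⟨f, -, hf⟩ := (SmoothBumpFunction.nhds_basis_support (I := I) hU).mem_iff.1 hU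
  refine ⟨⟨f, f.contMDiff⟩, f.eventuallyEq_one, fun y hy => ?_⟩
  by_contra h
  exact hy (hf h)

theorem eq_of_forall_apply_eq {x y : N} (h : ∀ f : C^∞⟮I, N; ℝ⟯, f x = f y) : x = y := by
  by_contra hxy
  obtain ⟨χ, h1, h0⟩ := exists_bump I x (isOpen_ne.mem_nhds hxy : {z | z ≠ y} ∈ 𝓝 x)
  have h2 := h χ
  rw [h1.self_of_nhds, h0 y (by simp)] at h2
  exact one_ne_zero h2

variable [SecondCountableTopology N]

/-- A smooth function with compact sublevel sets. -/
theorem exists_proper_function :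
    ∃ ρ : C^∞⟮I, N; ℝ⟯, ∀ r : ℝ, ∃ K : Set N, IsCompact K ∧ ∀ x, ρ x ≤ r → x ∈ K := by
  have hH : LocallyCompactSpace N := by
    have := I.locallyCompactSpace
    exact ChartedSpace.locallyCompactSpace H N
  let K : CompactExhaustion N := default
  obtain ⟨ρ, hρ⟩ := exists_contMDiffMap_forall_mem_convex_of_local_const (n := ⊤) I
    (t := fun x : N => Set.Ici (K.find x : ℝ)) (fun x => convex_Ici _) (fun x => by
      refine ⟨(K.find x + 1 : ℕ), ?_⟩
      filter_upwards [mem_interior_iff_mem_nhds.1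
        (K.subset_interior_succ (K.find x) (K.mem_find x))] with y hy
      exact Nat.cast_le (α := ℝ).2 (K.mem_iff_find_le.1 hy))
  refine ⟨ρ, fun r => ?_⟩
  obtain ⟨n, hn⟩ := exists_nat_ge r
  refine ⟨K n, K.isCompact n, fun x hx => K.mem_iff_find_le.2 ?_⟩
  have h1 : (K.find x : ℝ) ≤ n := (hρ x).trans (hx.trans hn)
  exact_mod_cast h1

/-- Every character of `C^∞(N)` is the evaluation at a point. -/
theorem exists_point (χ : C^∞⟮I, N; ℝ⟯ →ₐ[ℝ] ℝ) : ∃ x : N, ∀ f, χ f = f x := by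
  by_contra! hcon
  choose f hf using hcon
  obtain ⟨ρ, hρ⟩ := exists_proper_function (I := I) (N := N)
  obtain ⟨K, hK, hKρ⟩ := hρ (χ ρ)
  obtain ⟨t, -, ht⟩ := hK.elim_nhds_subcover (fun x => {y | f x y ≠ χ (f x)}) (fun x _ => by
    have : IsOpen {y | f x y ≠ χ (f x)} :=
      isOpen_ne_fun (f x).contMDiff.continuous continuous_const
    exact this.mem_nhds (hf x).symm)
  -- The function `g` has no zero: the first summand is positive outside `K`, and one of the others is
  -- positive at each point of `K`. So `g` is invertible, although `χ g = 0`.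
  let g : C^∞⟮I, N; ℝ⟯ := (ρ - algebraMap ℝ _ (χ ρ)) ^ 2 +
    ∑ x ∈ t, (f x - algebraMap ℝ _ (χ (f x))) ^ 2
  have hg0 : χ g = 0 := by simp [g]
  have hgy : ∀ y, g y = (ρ y - χ ρ) ^ 2 + ∑ x ∈ t, (f x y - χ (f x)) ^ 2 := by
    intro y
    change ((ρ - algebraMap ℝ _ (χ ρ)) ^ 2 : C^∞⟮I, N; ℝ⟯) y +
      (∑ x ∈ t, (f x - algebraMap ℝ _ (χ (f x))) ^ 2 : C^∞⟮I, N; ℝ⟯) y = _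
    rw [contMDiffMap_sum_apply]
    rfl
  have hpos : ∀ y, g y ≠ 0 := by
    intro y hy
    rw [hgy] at hy
    have h1 : 0 ≤ ∑ x ∈ t, (f x y - χ (f x)) ^ 2 := Finset.sum_nonneg fun x _ => sq_nonneg _
    have h2 : (ρ y - χ ρ) ^ 2 = 0 := by nlinarith [sq_nonneg (ρ y - χ ρ)]
    have h3 : ∑ x ∈ t, (f x y - χ (f x)) ^ 2 = 0 := by linarith
    have hyK := ht (hKρ y (by nlinarith [pow_eq_zero_iff (two_ne_zero) |>.1 h2]))
    obtain ⟨x, hx, hxy⟩ := Set.mem_iUnion₂.1 hyK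
    have h4 := (Finset.sum_eq_zero_iff_of_nonneg fun x _ => sq_nonneg _).1 h3 x hx
    exact hxy (sub_eq_zero.1 (pow_eq_zero_iff two_ne_zero |>.1 h4))
  let ginv : C^∞⟮I, N; ℝ⟯ := ⟨fun y => (g y)⁻¹, fun y =>
    (g.contMDiff y).inv₀ (hpos y)⟩
  have h1 : g * ginv = 1 := by
    ext y
    exact mul_inv_cancel₀ (hpos y)
  have h2 := congrArg χ h1
  rw [map_mul, hg0, zero_mul, map_one] at h2
  exact zero_ne_one h2

section Weil

variable {W : Type} [CommRing W] [Algebra ℝ W] [IsWeilAlgebra W]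

/-- The point of `N` underlying an algebra map from `C^∞(N)` to a Weil algebra. -/
def bodyPt (φ : C^∞⟮I, N; ℝ⟯ →ₐ[ℝ] W) : N :=
  (exists_point ((IsWeilAlgebra.aug W).comp φ)).choose

theorem aug_apply (φ : C^∞⟮I, N; ℝ⟯ →ₐ[ℝ] W) (f : C^∞⟮I, N; ℝ⟯) :
    IsWeilAlgebra.aug W (φ f) = f (bodyPt φ) :=
  (exists_point ((IsWeilAlgebra.aug W).comp φ)).choose_spec f

/-- The value of an algebra map to a Weil algebra depends on the germ at the underlying point. -/
theorem apply_eq_of_eventuallyEq (φ : C^∞⟮I, N; ℝ⟯ →ₐ[ℝ] W) {f g : C^∞⟮I, N; ℝ⟯}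
    (h : ∀ᶠ y in 𝓝 (bodyPt φ), f y = g y) : φ f = φ g := by
  obtain ⟨χ, h1, h0⟩ := exists_bump I (bodyPt φ) h
  have h2 : χ * (f - g) = 0 := by
    ext y
    by_cases hy : f y = g y
    · change χ y * (f y - g y) = 0
      rw [hy, sub_self, mul_zero]
    · change χ y * (f y - g y) = 0
      rw [h0 y hy, zero_mul]
  have h3 : IsUnit (φ χ) := IsWeilAlgebra.isUnit_of_aug_ne_zero (by
    rw [aug_apply, h1.self_of_nhds]
    exact one_ne_zero)
  have h4 := congrArg φ h2
  rw [map_mul, map_zero, h3.mul_right_eq_zero, map_sub] at h4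
  exact sub_eq_zero.1 h4

end Weil

/-- The map `ℝ^k → N` underlying a plot of `N`. -/
def bodyMap {X : ThCartSp} (φ : C^∞⟮I, N; ℝ⟯ →ₐ[ℝ] X.O) (p : Cart X.k) : N :=
  bodyPt ((evalPoint X p).comp φ)

theorem body_apply {X : ThCartSp} (φ : C^∞⟮I, N; ℝ⟯ →ₐ[ℝ] X.O) (f : C^∞⟮I, N; ℝ⟯)
    (p : Cart X.k) : X.body (φ f) p = f (bodyMap φ p) := by
  rw [← aug_evalPoint]
  exact aug_apply ((evalPoint X p).comp φ) f

theorem continuous_bodyMap {X : ThCartSp} (φ : C^∞⟮I, N; ℝ⟯ →ₐ[ℝ] X.O) :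
    Continuous (bodyMap φ) := by
  rw [continuous_iff_continuousAt]
  intro p
  refine Filter.tendsto_def.2 fun U hU => ?_
  obtain ⟨χ, h1, h0⟩ := exists_bump I (bodyMap φ p) hU
  have hc : ContinuousAt (X.body (φ χ)) p := (X.body (φ χ)).contMDiff.continuous.continuousAt
  have h2 : ∀ᶠ q in 𝓝 p, X.body (φ χ) q ≠ 0 := hc.eventually_ne (by
    rw [body_apply, h1.self_of_nhds]
    exact one_ne_zero)
  filter_upwards [h2] with q hq
  by_contra hqU
  exact hq (by rw [body_apply, h0 _ hqU])

/-- At a point `p` of the probe, the value of a function along a plot depends only on its germ at the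
point underlying the plot at `p`. -/
theorem evalPoint_eq_of_eventuallyEq {X : ThCartSp} (φ : C^∞⟮I, N; ℝ⟯ →ₐ[ℝ] X.O) {p : Cart X.k}
    {f g : C^∞⟮I, N; ℝ⟯} (h : ∀ᶠ y in 𝓝 (bodyMap φ p), f y = g y) :
    evalPoint X p (φ f) = evalPoint X p (φ g) :=
  apply_eq_of_eventuallyEq ((evalPoint X p).comp φ) h

end Body

/-! ### Retract charts -/

section Retract

variable {E H : Type} [NormedAddCommGroup E] [NormedSpace ℝ E]
  [TopologicalSpace H] {I : ModelWithCorners ℝ E H} {N B : Type} [TopologicalSpace N] [ChartedSpace H N]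
  [NormedAddCommGroup B] [NormedSpace ℝ B]

variable (I N B) in
/-- A retract chart at a point `x` of a manifold `N`: globally defined smooth maps `c : N → B` and
`s : B → N` with `s ∘ c = id` near `x`. Unlike a chart it pulls back all smooth functions on `N` to
smooth functions on the whole of `B`, and its coordinates are smooth functions on `N`. -/
structure RetractChart (x : N) where
  c : C^∞⟮I, N; 𝓘(ℝ, B), B⟯
  s : C^∞⟮𝓘(ℝ, B), B; I, N⟯
  retract : ∀ᶠ y in 𝓝 x, s (c y) = y

/-- Every chart with values in a vector space can be modified away from a given point to yield a
retract chart. -/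
theorem exists_retractChart_of_chart [FiniteDimensional ℝ E] [FiniteDimensional ℝ B]
    [IsManifold I ∞ N] [T2Space N]
    [I.Boundaryless] (e : PartialEquiv N B) {x : N} (hx : e.source ∈ 𝓝 x)
    (ht : e.target ∈ 𝓝 (e x)) (he : ContMDiffOn I 𝓘(ℝ, B) ∞ e e.source)
    (hes : ContMDiffOn 𝓘(ℝ, B) I ∞ e.symm e.target) {U : Set N} (hU : U ∈ 𝓝 x) :
    ∃ r : RetractChart I N B x, (∀ b, r.s b ∈ U) ∧ (∀ᶠ y in 𝓝 x, r.c y = e y) ∧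
      ∀ᶠ b in 𝓝 (e x), r.s b = e.symm b := by
  set a := e x with ha
  have hxs : x ∈ e.source := mem_of_mem_nhds hx
  have h2 : e.symm ⁻¹' U ∈ 𝓝 a := by
    refine (hes.contMDiffAt ht).continuousAt.preimage_mem_nhds ?_
    rwa [ha, e.left_inv hxs]
  obtain ⟨ε, hε, hball⟩ := Metric.mem_nhds_iff.1 (Filter.inter_mem ht h2)
  -- The map `b ↦ a + f b • (b - a)` sends all of `B` into the ball and is the identity near `a`.
  let f : ContDiffBump a := ⟨ε / 2, ε, by positivity, by linarith⟩
  have hin : ∀ b, a + f b • (b - a) ∈ Metric.ball a ε := by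
    intro b
    rw [Metric.mem_ball, dist_eq_norm, add_sub_cancel_left, norm_smul, Real.norm_eq_abs,
      abs_of_nonneg f.nonneg]
    by_cases hb : dist b a < ε
    · rw [dist_eq_norm] at hb
      exact (mul_le_of_le_one_left (norm_nonneg _) f.le_one).trans_lt hb
    · rw [f.zero_of_le_dist (not_lt.1 hb), zero_mul]
      exact hε
  -- The product `χ • e` extends by zero to a smooth map on `N`.
  obtain ⟨χ, -, hχ⟩ := (SmoothBumpFunction.nhds_basis_tsupport (I := I) x).mem_iff.1
    (interior_mem_nhds.2 hx)
  have hs : ∀ᶠ b in 𝓝 a, e.symm (a + f b • (b - a)) = e.symm b := by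
    filter_upwards [f.eventuallyEq_one] with b hb
    have hb : f b = 1 := hb
    rw [hb, one_smul, add_sub_cancel]
  have hc : ∀ᶠ y in 𝓝 x, χ y • e y = e y := by
    filter_upwards [χ.eventuallyEq_one] with y hy
    have hy : χ y = 1 := hy
    rw [hy, one_smul]
  refine ⟨⟨⟨fun y => χ y • e y, ?_⟩, ⟨fun b => e.symm (a + f b • (b - a)), ?_⟩, ?_⟩,
    fun b => (hball (hin b)).2, hc, hs⟩
  · refine contMDiff_of_tsupport fun y hy => ?_
    have hy : y ∈ interior e.source := hχ (closure_mono (Function.support_smul_subset_left _ _) hy)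
    exact χ.contMDiff.contMDiffAt.smul (he.contMDiffAt (mem_interior_iff_mem_nhds.1 hy))
  · have h3 : ContMDiff 𝓘(ℝ, B) 𝓘(ℝ, B) ∞ fun b => a + f b • (b - a) :=
      ContDiff.contMDiff (contDiff_const.add (f.contDiff.smul (contDiff_id.sub contDiff_const)))
    exact hes.comp_contMDiff h3 fun b => (hball (hin b)).1
  · filter_upwards [hc, hx, (he.contMDiffAt hx).continuousAt.eventually hs] with y hy1 hy2 hy3
    change e.symm (a + f (χ y • e y) • (χ y • e y - a)) = y
    rw [hy1, hy3, e.left_inv hy2]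

theorem exists_retractChart [FiniteDimensional ℝ E] [IsManifold I ∞ N] [T2Space N]
    [I.Boundaryless] (x : N) {U : Set N} (hU : U ∈ 𝓝 x) :
    ∃ r : RetractChart I N E x, ∀ b, r.s b ∈ U := by
  obtain ⟨r, hr, -⟩ := exists_retractChart_of_chart (extChartAt I x) (extChartAt_source_mem_nhds x)
    (extChartAt_target_mem_nhds x) (by rw [extChartAt_source]; exact contMDiffOn_extChartAt)
    (contMDiffOn_extChartAt_symm x) hU
  exact ⟨r, hr⟩

/-- A linear coordinate of a vector-valued smooth map. -/
abbrev coordFun (c : C^∞⟮I, N; 𝓘(ℝ, B), B⟯) (ℓ : B →L[ℝ] ℝ) : C^∞⟮I, N; ℝ⟯ :=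
  smoothPullback c (linFun ℓ)

theorem RetractChart.eventually_comp {x : N} (r : RetractChart I N B x) (f : C^∞⟮I, N; ℝ⟯) :
    ∀ᶠ y in 𝓝 x, f y = smoothPullback r.c (smoothPullback r.s f) y := by
  filter_upwards [r.retract] with y hy
  exact congrArg f hy.symm

end Retract

/-! ### Plots determined and glued by test functions -/

section Tests

variable {E H : Type} [NormedAddCommGroup E] [NormedSpace ℝ E] [FiniteDimensional ℝ E]
  [TopologicalSpace H] {I : ModelWithCorners ℝ E H} {N B : Type} [TopologicalSpace N] [ChartedSpace H N]
  [IsManifold I ∞ N] [T2Space N] [SecondCountableTopology N]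
  [NormedAddCommGroup B] [NormedSpace ℝ B] [FiniteDimensional ℝ B]

/-- Along a plot, functions may be replaced by their pullbacks to a retract chart. -/
theorem RetractChart.eventually_evalPoint {X : ThCartSp} (φ : C^∞⟮I, N; ℝ⟯ →ₐ[ℝ] X.O)
    {p₀ : Cart X.k} (r : RetractChart I N B (bodyMap φ p₀)) : ∀ᶠ p in 𝓝 p₀, ∀ f,
      evalPoint X p (φ f) = evalPoint X p (φ (smoothPullback r.c (smoothPullback r.s f))) := by
  filter_upwards [(continuous_bodyMap φ).continuousAt.eventually r.retract.eventually_nhds]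
    with p hp f
  refine evalPoint_eq_of_eventuallyEq φ ?_
  filter_upwards [hp] with y hy
  exact congrArg f hy.symm

variable (B) in
/-- A family of smooth functions which separates points and generates the coordinates of retract
charts at all points. -/
structure IsTestFamily {J : Type} (τ : J → C^∞⟮I, N; ℝ⟯) : Prop where
  separates : ∀ x y : N, (∀ j, τ j x = τ j y) → x = y
  exists_chart : ∀ x : N, ∃ r : RetractChart I N B x, ∀ ℓ,
    coordFun r.c ℓ ∈ Algebra.adjoin ℝ (Set.range τ)

variable {J : Type} {τ : J → C^∞⟮I, N; ℝ⟯}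

/-- Algebra maps to a Weil algebra which agree on a test family are equal: their underlying points
agree since the family separates points, and near this point every function is a function of
coordinates which are polynomials in the test functions. -/
theorem IsTestFamily.algHom_ext (hS : IsTestFamily B τ) {W : Type} [CommRing W] [Algebra ℝ W] [IsWeilAlgebra W]
    {φ ψ : C^∞⟮I, N; ℝ⟯ →ₐ[ℝ] W} (h : ∀ j, φ (τ j) = ψ (τ j)) : φ = ψ := by
  have hb : bodyPt φ = bodyPt ψ := by
    refine hS.separates _ _ fun j => ?_
    rw [← aug_apply, ← aug_apply, h j]
  obtain ⟨r, hr⟩ := hS.exists_chart (bodyPt φ)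
  have h1 : φ.comp (smoothPullback r.c) = ψ.comp (smoothPullback r.c) :=
    algHom_ext_of_linFun fun ℓ => by
      have h2 : Set.EqOn φ ψ (Set.range τ) := by
        rintro _ ⟨j, rfl⟩
        exact h j
      exact AlgHom.eqOn_adjoin_iff.2 h2 (hr ℓ)
  ext f
  rw [apply_eq_of_eventuallyEq φ (r.eventually_comp f),
    apply_eq_of_eventuallyEq ψ (by rw [← hb]; exact r.eventually_comp f)]
  exact DFunLike.congr_fun h1 _

theorem IsTestFamily.plot_ext (hS : IsTestFamily B τ) {X : ThCartSp} {φ ψ : C^∞⟮I, N; ℝ⟯ →ₐ[ℝ] X.O}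
    (h : ∀ j, φ (τ j) = ψ (τ j)) : φ = ψ := by
  ext f
  refine evalPoint_ext X fun p => ?_
  exact DFunLike.congr_fun (hS.algHom_ext (φ := (evalPoint X p).comp φ)
    (ψ := (evalPoint X p).comp ψ) fun j => congrArg (evalPoint X p) (h j)) f

/-- A plot with prescribed values on test functions exists if it exists locally. -/
theorem IsTestFamily.exists_plot (hS : IsTestFamily B τ) {X : ThCartSp} (t : J → X.O)
    (h : ∀ p₀ : Cart X.k, ∃ ψ : C^∞⟮I, N; ℝ⟯ →ₐ[ℝ] X.O, ∀ᶠ p in 𝓝 p₀, ∀ j,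
      evalPoint X p (ψ (τ j)) = evalPoint X p (t j)) :
    ∃ ψ : C^∞⟮I, N; ℝ⟯ →ₐ[ℝ] X.O, ∀ j, ψ (τ j) = t j := by
  choose ψ hψ using h
  -- The local plots agree on overlaps, since they agree there on the test functions.
  have hloc : ∀ p₀, ∀ᶠ p in 𝓝 p₀, ∀ f, evalPoint X p (ψ p₀ f) = evalPoint X p (ψ p f) := by
    intro p₀
    filter_upwards [hψ p₀] with p hp f
    exact DFunLike.congr_fun (hS.algHom_ext (φ := (evalPoint X p).comp (ψ p₀))
      (ψ := (evalPoint X p).comp (ψ p)) fun j =>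
        (hp j).trans ((hψ p).self_of_nhds j).symm) f
  -- Their values are smooth, as smoothness is local, and hence are values of a function on `X`.
  have hex : ∀ f, ∃ a : X.O, ∀ p, evalPoint X p a = evalPoint X p (ψ p f) := by
    intro f
    refine exists_evalPoint X _ fun ℓ => ?_
    rw [contDiff_iff_contDiffAt]
    intro p₀
    refine (evalPoint_contDiff X (ψ p₀ f) ℓ).contDiffAt.congr_of_eventuallyEq ?_
    filter_upwards [hloc p₀] with p hp
    rw [hp f]
  choose T hT using hex
  refine ⟨{ toFun := T
            map_one' := evalPoint_ext X fun p => by simp [hT]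
            map_mul' := fun f g => evalPoint_ext X fun p => by simp [hT]
            map_zero' := evalPoint_ext X fun p => by simp [hT]
            map_add' := fun f g => evalPoint_ext X fun p => by simp [hT]
            commutes' := fun s => evalPoint_ext X fun p => by
              rw [hT, AlgHom.commutes, AlgHom.commutes] }, fun j => evalPoint_ext X fun p => ?_⟩
  exact (hT (τ j) p).trans ((hψ p).self_of_nhds j)

end Tests

/-! ### The tangent bundle: retract charts -/

section TangentRetract

variable {E H : Type} [NormedAddCommGroup E] [NormedSpace ℝ E]
  [TopologicalSpace H] {I : ModelWithCorners ℝ E H} {N B : Type} [TopologicalSpace N] [ChartedSpace H N]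
  [IsManifold I ∞ N] [NormedAddCommGroup B] [NormedSpace ℝ B]

/-- The differential of a vector-valued smooth map, as a map on the tangent bundle. -/
def dMap (c : C^∞⟮I, N; 𝓘(ℝ, B), B⟯) : C^∞⟮I.tangent, TangentBundle I N; 𝓘(ℝ, B), B⟯ :=
  ⟨fun v => mfderiv I 𝓘(ℝ, B) c v.1 v.2,
    (contMDiff_snd_tangentBundle_modelSpace B 𝓘(ℝ, B)).comp
      (c.contMDiff.contMDiff_tangentMap (m := ∞) (by simp))⟩

/-- The map `TN → TB = B × B` induced by `c : N → B`. -/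
def tanCoord (c : C^∞⟮I, N; 𝓘(ℝ, B), B⟯) :
    C^∞⟮I.tangent, TangentBundle I N; 𝓘(ℝ, B × B), B × B⟯ :=
  ⟨fun v => (c v.1, dMap c v), (c.contMDiff.comp (Bundle.contMDiff_proj _)).prodMk_space
    (dMap c).contMDiff⟩

theorem contMDiff_mk_tangentBundle_modelSpace :
    ContMDiff 𝓘(ℝ, B × B) 𝓘(ℝ, B).tangent ∞
      (fun z : B × B => (⟨z.1, z.2⟩ : TangentBundle 𝓘(ℝ, B) B)) := by
  intro z
  rw [Bundle.contMDiffAt_totalSpace]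
  refine ⟨contDiff_fst.contMDiff z, ?_⟩
  simpa using contDiff_snd.contMDiff z

/-- The map `B × B = TB → TN` induced by `s : B → N`. -/
def tanParam (s : C^∞⟮𝓘(ℝ, B), B; I, N⟯) :
    C^∞⟮𝓘(ℝ, B × B), B × B; I.tangent, TangentBundle I N⟯ :=
  ⟨fun z => ⟨s z.1, mfderiv 𝓘(ℝ, B) I s z.1 z.2⟩,
    (s.contMDiff.contMDiff_tangentMap (m := ∞) (by simp)).comp
      contMDiff_mk_tangentBundle_modelSpace⟩

/-- The tangent maps of a retract chart compose to the identity, also over points near `x`. -/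
theorem RetractChart.eventually_tangent {x : N} (r : RetractChart I N B x) :
    ∀ᶠ y in 𝓝 x, ∀ v : TangentSpace I y,
      tanParam r.s (tanCoord r.c ⟨y, v⟩) = (⟨y, v⟩ : TangentBundle I N) := by
  filter_upwards [r.retract.eventually_nhds] with y hy v
  have hc : MDifferentiableAt I 𝓘(ℝ, B) r.c y := r.c.mdifferentiableAt
  have hs : MDifferentiableAt 𝓘(ℝ, B) I r.s (r.c y) := r.s.mdifferentiableAt
  have h1 : tangentMap I I (fun y => r.s (r.c y)) ⟨y, v⟩ = ⟨y, v⟩ := by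
    have h3 : (fun y => r.s (r.c y)) =ᶠ[𝓝 y] id := hy
    have h2 : mfderiv I I (fun y => r.s (r.c y)) y = mfderiv I I id y :=
      h3.mfderiv_eq
    have h4 : tangentMap I I (fun y => r.s (r.c y)) ⟨y, v⟩ = tangentMap I I id ⟨y, v⟩ := by
      rw [tangentMap, tangentMap, h2]
      exact congrArg (fun z : N => (⟨z, (mfderiv I I id y v : E)⟩ : TangentBundle I N)) hy.self_of_nhds
    rw [h4, tangentMap_id]
    rfl
  refine Eq.trans ?_ h1
  exact (tangentMap_comp_at (⟨y, v⟩ : TangentBundle I N) hs hc).symm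

/-- The tangent of a retract chart. -/
def RetractChart.tangent {z : TangentBundle I N} (r : RetractChart I N B z.1) :
    RetractChart I.tangent (TangentBundle I N) (B × B) z where
  c := tanCoord r.c
  s := tanParam r.s
  retract := by
    have h1 : ContinuousAt (fun v : TangentBundle I N => v.1) z :=
      (tangentProjCM I N).contMDiff.continuous.continuousAt
    filter_upwards [h1.eventually r.eventually_tangent] with v hv
    exact hv v.2

end TangentRetract

/-! ### Topology of total spaces -/

section Topology

variable {Z N Y : Type} [TopologicalSpace Z] [TopologicalSpace N] [TopologicalSpace Y]

/-- The total space of a map to a Hausdorff space is Hausdorff if the preimages of small open sets lie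
in the domains of charts: points over the same point lie in a common chart. -/
theorem t2Space_of_local_charts [T2Space N] [T2Space Y] {f : Z → N} (hf : Continuous f)
    (h : ∀ z, ∃ (e : OpenPartialHomeomorph Z Y) (U : Set N), IsOpen U ∧ f z ∈ U ∧
      f ⁻¹' U ⊆ e.source) : T2Space Z := by
  refine ⟨fun z z' hz => ?_⟩
  by_cases hfz : f z = f z'
  · obtain ⟨e, U, hU, hzU, he⟩ := h z
    have h1 : z ∈ e.source := he hzU
    have h2 : z' ∈ e.source := he (by rw [Set.mem_preimage, ← hfz]; exact hzU)
    obtain ⟨A, A', hA, hA', hzA, hzA', hd⟩ := t2_separation (fun h => hz (e.injOn h1 h2 h))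
    refine ⟨e.source ∩ e ⁻¹' A, e.source ∩ e ⁻¹' A', e.isOpen_inter_preimage hA,
      e.isOpen_inter_preimage hA', ⟨h1, hzA⟩, ⟨h2, hzA'⟩, ?_⟩
    exact (hd.preimage e).mono Set.inter_subset_right Set.inter_subset_right
  · exact separated_by_continuous hf hfz

theorem secondCountableTopology_of_local_charts [SecondCountableTopology N]
    [SecondCountableTopology Y] {f : Z → N} (hf : Continuous f)
    (h : ∀ z, ∃ (e : OpenPartialHomeomorph Z Y) (U : Set N), IsOpen U ∧ f z ∈ U ∧
      f ⁻¹' U ⊆ e.source) : SecondCountableTopology Z := by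
  choose e U hU hzU he using h
  obtain ⟨T, hT, hTU⟩ := TopologicalSpace.isOpen_iUnion_countable U hU
  have : Countable T := hT.to_subtype
  have h1 : ∀ z : T, SecondCountableTopology (f ⁻¹' U z) := fun z => by
    have := (e z).secondCountableTopology_source
    exact (Topology.IsEmbedding.inclusion (he z)).secondCountableTopology
  refine TopologicalSpace.secondCountableTopology_of_countable_cover
    (U := fun z : T => f ⁻¹' U z) (fun z => (hU z).preimage hf) ?_
  ext z
  have h2 : f z ∈ ⋃ z, U z := Set.mem_iUnion.2 ⟨z, hzU z⟩
  rw [← hTU] at h2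
  obtain ⟨z', hz', h3⟩ := Set.mem_iUnion₂.1 h2
  exact ⟨fun _ => trivial, fun _ => Set.mem_iUnion.2 ⟨⟨z', hz'⟩, h3⟩⟩

theorem totalSpace_local_charts {F : Type} [TopologicalSpace F] (E : N → Type)
    [TopologicalSpace (Bundle.TotalSpace F E)] [∀ x, TopologicalSpace (E x)] [FiberBundle F E]
    (z : Bundle.TotalSpace F E) :
    ∃ (e : OpenPartialHomeomorph (Bundle.TotalSpace F E) (N × F)) (U : Set N), IsOpen U ∧
      z.proj ∈ U ∧ Bundle.TotalSpace.proj ⁻¹' U ⊆ e.source :=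
  ⟨(trivializationAt F E z.proj).toOpenPartialHomeomorph, (trivializationAt F E z.proj).baseSet,
    (trivializationAt F E z.proj).open_baseSet, FiberBundle.mem_baseSet_trivializationAt' z.proj,
    (trivializationAt F E z.proj).source_eq.ge⟩

variable {E H : Type} [NormedAddCommGroup E] [NormedSpace ℝ E] [FiniteDimensional ℝ E]

theorem t2Space_totalSpace [T2Space N] (V : N → Type)
    [TopologicalSpace (Bundle.TotalSpace E V)] [∀ x, TopologicalSpace (V x)] [FiberBundle E V] :
    T2Space (Bundle.TotalSpace E V) :=
  t2Space_of_local_charts (FiberBundle.continuous_proj E V) (totalSpace_local_charts V)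

theorem secondCountableTopology_totalSpace [SecondCountableTopology N] (V : N → Type)
    [TopologicalSpace (Bundle.TotalSpace E V)] [∀ x, TopologicalSpace (V x)] [FiberBundle E V] :
    SecondCountableTopology (Bundle.TotalSpace E V) := by
  have : ProperSpace E := FiniteDimensional.proper ℝ E
  exact secondCountableTopology_of_local_charts (FiberBundle.continuous_proj E V)
    (totalSpace_local_charts V)

instance [TopologicalSpace H] {I : ModelWithCorners ℝ E H} [ChartedSpace H N] [IsManifold I 1 N]
    [T2Space N] : T2Space (TangentBundle I N) := t2Space_totalSpace _

instance [TopologicalSpace H] {I : ModelWithCorners ℝ E H} [ChartedSpace H N] [IsManifold I 1 N]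
    [SecondCountableTopology N] : SecondCountableTopology (TangentBundle I N) :=
  secondCountableTopology_totalSpace _

end Topology

/-! ### Isomorphisms of thickened smooth sets -/

/-- A map which is bijective on plots over every probe is an isomorphism. -/
theorem isIso_of_bijective {G H : ThSmthSet} (f : G ⟶ H)
    (h : ∀ X, Function.Bijective fun x : Plots G X => ap f x) : IsIso f := by
  have h1 : ∀ X, IsIso (f.hom.app X) := fun X => (isIso_iff_bijective _).2 (h X.unop)
  have h2 : IsIso (IsThickenedSmoothSet.ι.map f) := (NatTrans.isIso_iff_isIso_app f.hom).2 h1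
  exact isIso_of_reflects_iso f IsThickenedSmoothSet.ι

/-! ### Coefficients of functions on infinitesimal thickenings -/

namespace ThCartSp

section Coef

variable {D : Type} [CommRing D] [Algebra ℝ D] [IsWeilAlgebra D]

/-- The coefficient of a function on `X × 𝔻` along a linear functional on `𝒪(𝔻)`. -/
def coef (X : ThCartSp) (ℓ : D →ₗ[ℝ] ℝ) : (X.ext D).O →ₗ[ℝ] X.O :=
  LinearMap.lTensor (CartFun X.k)
    ((TensorProduct.rid ℝ X.W).toLinearMap ∘ₗ LinearMap.lTensor X.W ℓ)

theorem coef_fst_mul_snd (X : ThCartSp) (ℓ : D →ₗ[ℝ] ℝ) (a : X.O) (d : D) :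
    X.coef ℓ ((X.fst D).comorphism a * X.snd d) = ℓ d • a := by
  rw [← ThCartSp.assoc_tmul]
  induction a using TensorProduct.induction_on with
  | zero => simp
  | add a b ha hb => rw [TensorProduct.add_tmul, map_add, map_add, ha, hb, smul_add]
  | tmul f w => simp [coef]

theorem coef_fst (X : ThCartSp) (ℓ : D →ₗ[ℝ] ℝ) (a : X.O) :
    X.coef ℓ ((X.fst D).comorphism a) = ℓ 1 • a := by
  rw [← coef_fst_mul_snd, map_one, mul_one]

/-- The functions on `X × 𝔻` are sums of products of functions on the two factors. -/
theorem fst_mul_snd_induction (X : ThCartSp) {P : (X.ext D).O → Prop} (h0 : P 0)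
    (hadd : ∀ x y, P x → P y → P (x + y))
    (h : ∀ a d, P ((X.fst D).comorphism a * X.snd d)) (x : (X.ext D).O) : P x := by
  obtain ⟨y, rfl⟩ :=
    (Algebra.TensorProduct.assoc ℝ ℝ ℝ (CartFun X.k) X.W D).surjective x
  induction y using TensorProduct.induction_on with
  | zero => rwa [map_zero]
  | add a b ha hb => rw [map_add]; exact hadd _ _ ha hb
  | tmul a d => rw [ThCartSp.assoc_tmul]; exact h a d

/-- The expansion of a function on `X × 𝔻` in a basis of `𝒪(𝔻)`. -/
theorem eq_sum_coef (X : ThCartSp) {ι : Type} [Fintype ι] (ℓ : ι → D →ₗ[ℝ] ℝ) (b : ι → D)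
    (h : ∀ d, ∑ i, ℓ i d • b i = d) (x : (X.ext D).O) :
    x = ∑ i, (X.fst D).comorphism (X.coef (ℓ i) x) * X.snd (b i) := by
  induction x using fst_mul_snd_induction with
  | h0 => simp
  | hadd x y hx hy =>
    simp only [map_add, add_mul, Finset.sum_add_distrib]
    rw [← hx, ← hy]
  | h a d =>
    simp only [coef_fst_mul_snd, map_smul, smul_mul_assoc]
    conv_lhs => rw [← h d]
    simp only [map_sum, map_smul, Finset.mul_sum, mul_smul_comm]

theorem evalPoint_coef (X : ThCartSp) (ℓ : D →ₗ[ℝ] ℝ) (p : Cart X.k) (x : (X.ext D).O) :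
    evalPoint X p (X.coef ℓ x) =
      TensorProduct.rid ℝ X.W (LinearMap.lTensor X.W ℓ (evalPoint (X.ext D) p x)) := by
  induction x using TensorProduct.induction_on with
  | zero => simp
  | add x y hx hy => simp only [map_add, hx, hy]
  | tmul f z =>
    rw [evalPoint_tmul (X.ext D) p f z]
    simp [coef]

end Coef

/-- The coefficient of `1` of a function on `X × 𝔻¹(1)`. -/
abbrev coef₀ (X : ThCartSp) : (X.ext D1).O →ₗ[ℝ] X.O :=
  X.coef (TrivSqZeroExt.fstHom ℝ ℝ ℝ).toLinearMap

/-- The coefficient of `ε` of a function on `X × 𝔻¹(1)`. -/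
abbrev coef₁ (X : ThCartSp) : (X.ext D1).O →ₗ[ℝ] X.O := X.coef (TrivSqZeroExt.sndHom ℝ ℝ)

theorem eq_coef₀_add_coef₁ (X : ThCartSp) (x : (X.ext D1).O) :
    x = (X.fst D1).comorphism (X.coef₀ x) + (X.fst D1).comorphism (X.coef₁ x) * X.snd eps := by
  have h := X.eq_sum_coef (D := D1)
    ![(TrivSqZeroExt.fstHom ℝ ℝ ℝ).toLinearMap, TrivSqZeroExt.sndHom ℝ ℝ] ![1, eps]
    (fun d => by
      rw [Fin.sum_univ_two]
      ext <;> simp) x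
  rw [Fin.sum_univ_two] at h
  simpa using h

theorem ext_coef {X : ThCartSp} {x y : (X.ext D1).O} (h0 : X.coef₀ x = X.coef₀ y)
    (h1 : X.coef₁ x = X.coef₁ y) : x = y := by
  rw [X.eq_coef₀_add_coef₁ x, X.eq_coef₀_add_coef₁ y, h0, h1]

theorem coef₀_add (X : ThCartSp) (a b : X.O) :
    X.coef₀ ((X.fst D1).comorphism a + (X.fst D1).comorphism b * X.snd eps) = a := by
  rw [map_add, coef_fst, coef_fst_mul_snd]
  simp

theorem coef₁_add (X : ThCartSp) (a b : X.O) :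
    X.coef₁ ((X.fst D1).comorphism a + (X.fst D1).comorphism b * X.snd eps) = b := by
  rw [map_add, coef_fst, coef_fst_mul_snd]
  simp

end ThCartSp

/-! ### The synthetic tangent bundle of a manifold -/

section Kappa

variable {E H : Type} [NormedAddCommGroup E] [NormedSpace ℝ E]
  [TopologicalSpace H] {I : ModelWithCorners ℝ E H} {N : Type} [TopologicalSpace N]
  [ChartedSpace H N] [IsManifold I ∞ N]

theorem kappa_apply {X : ThCartSp} (φ : C^∞⟮I.tangent, TangentBundle I N; ℝ⟯ →ₐ[ℝ] X.O)
    (f : C^∞⟮I, N; ℝ⟯) :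
    (show C^∞⟮I, N; ℝ⟯ →ₐ[ℝ] (X.ext D1).O from
      ap (G := yMan I.tangent (TangentBundle I N)) (X := X) (kappa I N) φ) f =
    (X.fst D1).comorphism (φ (smoothPullback (tangentProjCM I N) f)) +
      (X.fst D1).comorphism (φ (dFun f)) * X.snd eps := by
  change Algebra.TensorProduct.assoc ℝ ℝ ℝ (CartFun X.k) X.W D1
      (Algebra.TensorProduct.map φ (AlgHom.id ℝ D1)
        (smoothPullback (tangentProjCM I N) f ⊗ₜ 1 + dFun f ⊗ₜ eps)) = _
  rw [map_add, map_add, Algebra.TensorProduct.map_tmul, Algebra.TensorProduct.map_tmul,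
    AlgHom.id_apply, AlgHom.id_apply, ThCartSp.assoc_tmul, ThCartSp.assoc_tmul, map_one, mul_one]

theorem coef₀_kappa {X : ThCartSp} (φ : C^∞⟮I.tangent, TangentBundle I N; ℝ⟯ →ₐ[ℝ] X.O)
    (f : C^∞⟮I, N; ℝ⟯) :
    X.coef₀ ((show C^∞⟮I, N; ℝ⟯ →ₐ[ℝ] (X.ext D1).O from
      ap (G := yMan I.tangent (TangentBundle I N)) (X := X) (kappa I N) φ) f) =
    φ (smoothPullback (tangentProjCM I N) f) := by
  rw [kappa_apply, ThCartSp.coef₀_add]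

theorem coef₁_kappa {X : ThCartSp} (φ : C^∞⟮I.tangent, TangentBundle I N; ℝ⟯ →ₐ[ℝ] X.O)
    (f : C^∞⟮I, N; ℝ⟯) :
    X.coef₁ ((show C^∞⟮I, N; ℝ⟯ →ₐ[ℝ] (X.ext D1).O from
      ap (G := yMan I.tangent (TangentBundle I N)) (X := X) (kappa I N) φ) f) = φ (dFun f) := by
  rw [kappa_apply, ThCartSp.coef₁_add]

/-- The pullbacks and the differentials of the functions on `N`, as functions on `TN`. -/
def tangentTest : C^∞⟮I, N; ℝ⟯ ⊕ C^∞⟮I, N; ℝ⟯ → C^∞⟮I.tangent, TangentBundle I N; ℝ⟯ :=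
  Sum.elim (smoothPullback (tangentProjCM I N)) dFun

theorem dFun_coordFun {B : Type} [NormedAddCommGroup B] [NormedSpace ℝ B]
    (c : C^∞⟮I, N; 𝓘(ℝ, B), B⟯) (ℓ : B →L[ℝ] ℝ) (v : TangentBundle I N) :
    dFun (coordFun c ℓ) v = ℓ (dMap c v) := by
  have h1 : HasMFDerivAt 𝓘(ℝ, B) 𝓘(ℝ, ℝ) ℓ (c v.1) ℓ := ℓ.hasFDerivAt.hasMFDerivAt
  have h2 := h1.comp v.1 c.mdifferentiableAt.hasMFDerivAt
  exact congrArg (fun A : E →L[ℝ] ℝ => A v.2) h2.mfderiv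

theorem coordFun_tanCoord {B : Type} [NormedAddCommGroup B] [NormedSpace ℝ B]
    (c : C^∞⟮I, N; 𝓘(ℝ, B), B⟯) (ℓ : B × B →L[ℝ] ℝ) :
    coordFun (tanCoord c) ℓ = smoothPullback (tangentProjCM I N)
      (coordFun c (ℓ.comp (ContinuousLinearMap.inl ℝ B B))) +
      dFun (coordFun c (ℓ.comp (ContinuousLinearMap.inr ℝ B B))) := by
  ext v
  have h1 : (smoothPullback (tangentProjCM I N)
      (coordFun c (ℓ.comp (ContinuousLinearMap.inl ℝ B B))) +
      dFun (coordFun c (ℓ.comp (ContinuousLinearMap.inr ℝ B B)))) v =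
      ℓ (c v.1, 0) + ℓ (0, dMap c v) := by
    rw [← ContinuousLinearMap.inr_apply (R := ℝ), ← ContinuousLinearMap.comp_apply ℓ,
      ← dFun_coordFun]
    rfl
  rw [h1, ← map_add, Prod.mk_add_mk, add_zero, zero_add]
  rfl

/-- Tangent vectors are determined by the values of functions and of their differentials. -/
theorem tangent_ext_of_dFun [FiniteDimensional ℝ E] [T2Space N] [I.Boundaryless]
    {v w : TangentBundle I N} (h0 : ∀ f : C^∞⟮I, N; ℝ⟯, f v.1 = f w.1)
    (h1 : ∀ f : C^∞⟮I, N; ℝ⟯, dFun f v = dFun f w) : v = w := by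
  obtain ⟨x, v⟩ := v
  obtain ⟨y, w⟩ := w
  obtain rfl : x = y := eq_of_forall_apply_eq (I := I) h0
  obtain ⟨r, -⟩ := exists_retractChart (I := I) x Filter.univ_mem
  have h2 : dMap r.c ⟨x, v⟩ = dMap r.c ⟨x, w⟩ := by
    refine (Module.finBasis ℝ E).ext_elem fun i => ?_
    have h3 := h1 (coordFun r.c (coordCLM E i))
    rwa [dFun_coordFun, dFun_coordFun] at h3
  have h3 := r.eventually_tangent.self_of_nhds
  rw [← h3 v, ← h3 w]
  exact congrArg (tanParam r.s) (Prod.ext rfl h2)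

variable [FiniteDimensional ℝ E] [T2Space N] [SecondCountableTopology N] [I.Boundaryless]

theorem isTestFamily_tangentTest :
    IsTestFamily (E × E) (tangentTest : _ → C^∞⟮I.tangent, TangentBundle I N; ℝ⟯) where
  separates v w h := tangent_ext_of_dFun (fun f => h (Sum.inl f)) fun f => h (Sum.inr f)
  exists_chart v := by
    obtain ⟨r, -⟩ := exists_retractChart (I := I) v.1 Filter.univ_mem
    refine ⟨r.tangent, fun ℓ => ?_⟩
    change coordFun (tanCoord r.c) ℓ ∈ Algebra.adjoin ℝ (Set.range tangentTest)
    rw [coordFun_tanCoord]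
    exact Subalgebra.add_mem _ (Algebra.subset_adjoin ⟨Sum.inl _, rfl⟩)
      (Algebra.subset_adjoin ⟨Sum.inr _, rfl⟩)

/-- The differential of the pullback of a function along `s : B → N`. -/
theorem dFun_smoothPullback {B : Type} [NormedAddCommGroup B] [NormedSpace ℝ B]
    (s : C^∞⟮𝓘(ℝ, B), B; I, N⟯) (f : C^∞⟮I, N; ℝ⟯) (z : B × B) :
    dFun (smoothPullback s f) (⟨z.1, z.2⟩ : TangentBundle 𝓘(ℝ, B) B) =
      dFun f (tanParam s z) := by
  have h1 : MDifferentiableAt I 𝓘(ℝ, ℝ) f (s z.1) := f.contMDiff.mdifferentiable (by simp) _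
  have h2 := h1.hasMFDerivAt.comp z.1 s.mdifferentiableAt.hasMFDerivAt
  exact congrArg (fun A : B →L[ℝ] ℝ => A z.2) h2.mfderiv

/-- A tangent plot of a manifold `N` locally comes from a plot of `TN`: in a retract chart it is
given by the coordinates of its foot point and the coefficients of `ε`. -/
theorem exists_local_tangent_plot {X : ThCartSp} (Φ : C^∞⟮I, N; ℝ⟯ →ₐ[ℝ] (X.ext D1).O)
    (p₀ : Cart X.k) : ∃ ψ : C^∞⟮I.tangent, TangentBundle I N; ℝ⟯ →ₐ[ℝ] X.O, ∀ᶠ p in 𝓝 p₀,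
      ∀ f, evalPoint X p (ψ (smoothPullback (tangentProjCM I N) f)) =
          evalPoint X p (X.coef₀ (Φ f)) ∧
        evalPoint X p (ψ (dFun f)) = evalPoint X p (X.coef₁ (Φ f)) := by
  obtain ⟨r, -⟩ := exists_retractChart (I := I) (bodyMap Φ p₀) Filter.univ_mem
  -- The coefficients of the coordinates: a tangent plot of `E` is prescribed by these, and it is the
  -- image under `kappa` of the plot of `TE = E × E` which they define.
  let c₀ : (E →L[ℝ] ℝ) →ₗ[ℝ] X.O :=
    X.coef₀ ∘ₗ Φ.toLinearMap ∘ₗ (smoothPullback r.c).toLinearMap ∘ₗ linFun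
  let c₁ : (E →L[ℝ] ℝ) →ₗ[ℝ] X.O :=
    X.coef₁ ∘ₗ Φ.toLinearMap ∘ₗ (smoothPullback r.c).toLinearMap ∘ₗ linFun
  let i₁ : (E × E →L[ℝ] ℝ) →ₗ[ℝ] (E →L[ℝ] ℝ) :=
    { toFun := fun ℓ => ℓ.comp (ContinuousLinearMap.inl ℝ E E)
      map_add' := fun _ _ => rfl
      map_smul' := fun _ _ => rfl }
  let i₂ : (E × E →L[ℝ] ℝ) →ₗ[ℝ] (E →L[ℝ] ℝ) :=
    { toFun := fun ℓ => ℓ.comp (ContinuousLinearMap.inr ℝ E E)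
      map_add' := fun _ _ => rfl
      map_smul' := fun _ _ => rfl }
  obtain ⟨w, hw⟩ := exists_algHom_linFun X (c₀ ∘ₗ i₁ + c₁ ∘ₗ i₂)
  have hw : ∀ ℓ, w (linFun ℓ) = X.coef₀ (Φ (coordFun r.c (ℓ.comp (ContinuousLinearMap.inl ℝ E E))))
    + X.coef₁ (Φ (coordFun r.c (ℓ.comp (ContinuousLinearMap.inr ℝ E E)))) := hw
  let idE : C^∞⟮𝓘(ℝ, E), E; 𝓘(ℝ, E), E⟯ := ContMDiffMap.id
  let wT : C^∞⟮𝓘(ℝ, E).tangent, TangentBundle 𝓘(ℝ, E) E; ℝ⟯ →ₐ[ℝ] X.O :=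
    w.comp (smoothPullback (tanParam idE))
  let ΦB : C^∞⟮𝓘(ℝ, E), E; ℝ⟯ →ₐ[ℝ] (X.ext D1).O :=
    ap (G := yMan 𝓘(ℝ, E).tangent (TangentBundle 𝓘(ℝ, E) E)) (X := X) (kappa 𝓘(ℝ, E) E) wT
  have hid : ∀ z : E × E, tanParam idE z = (⟨z.1, z.2⟩ : TangentBundle 𝓘(ℝ, E) E) := by
    intro z
    change (⟨z.1, mfderiv 𝓘(ℝ, E) 𝓘(ℝ, E) id z.1 z.2⟩ : TangentBundle 𝓘(ℝ, E) E) = _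
    rw [mfderiv_id]
    rfl
  have h0 : coordFun r.c (0 : E →L[ℝ] ℝ) = 0 := rfl
  -- Both sides agree on the linear functions, hence everywhere.
  have e : Φ.comp (smoothPullback r.c) = ΦB := by
    refine plot_ext_of_linFun fun ℓ => ThCartSp.ext_coef ?_ ?_
    · refine Eq.trans ?_ (coef₀_kappa (I := 𝓘(ℝ, E)) wT (linFun ℓ)).symm
      have h1 : smoothPullback (tanParam idE) (smoothPullback (tangentProjCM 𝓘(ℝ, E) E) (linFun ℓ))
        = linFun (ℓ.comp (ContinuousLinearMap.fst ℝ E E)) := rfl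
      change _ = w (smoothPullback (tanParam idE)
        (smoothPullback (tangentProjCM 𝓘(ℝ, E) E) (linFun ℓ)))
      rw [h1, hw]
      have h2 : (ℓ.comp (ContinuousLinearMap.fst ℝ E E)).comp (ContinuousLinearMap.inl ℝ E E) = ℓ :=
        rfl
      have h3 : (ℓ.comp (ContinuousLinearMap.fst ℝ E E)).comp (ContinuousLinearMap.inr ℝ E E) = 0 := by
        ext; simp
      rw [h2, h3, h0, map_zero, map_zero, add_zero]
      rfl
    · refine Eq.trans ?_ (coef₁_kappa (I := 𝓘(ℝ, E)) wT (linFun ℓ)).symm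
      have h1 : smoothPullback (tanParam idE) (dFun (linFun ℓ))
        = linFun (ℓ.comp (ContinuousLinearMap.snd ℝ E E)) := by
        ext z
        refine (congrArg (dFun (linFun ℓ)) (hid z)).trans ?_
        change mfderiv 𝓘(ℝ, E) 𝓘(ℝ, ℝ) ℓ z.1 z.2 = ℓ z.2
        rw [mfderiv_eq_fderiv, ℓ.fderiv]
        rfl
      change _ = w (smoothPullback (tanParam idE) (dFun (linFun ℓ)))
      rw [h1, hw]
      have h2 : (ℓ.comp (ContinuousLinearMap.snd ℝ E E)).comp (ContinuousLinearMap.inr ℝ E E) = ℓ :=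
        rfl
      have h3 : (ℓ.comp (ContinuousLinearMap.snd ℝ E E)).comp (ContinuousLinearMap.inl ℝ E E) = 0 := by
        ext; simp
      rw [h2, h3, h0, map_zero, map_zero, zero_add]
      rfl
  refine ⟨w.comp (smoothPullback (tanParam r.s)), ?_⟩
  filter_upwards [r.eventually_evalPoint Φ] with p hp f
  have h1 : evalPoint (X.ext D1) p (Φ f) = evalPoint (X.ext D1) p (ΦB (smoothPullback r.s f)) :=
    (hp f).trans (congrArg (evalPoint (X.ext D1) p) (DFunLike.congr_fun e (smoothPullback r.s f)))
  rw [X.evalPoint_coef, X.evalPoint_coef, h1, ← X.evalPoint_coef, ← X.evalPoint_coef]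
  constructor
  · refine congrArg (evalPoint X p) (Eq.trans ?_
      (coef₀_kappa (I := 𝓘(ℝ, E)) wT (smoothPullback r.s f)).symm)
    rfl
  · refine congrArg (evalPoint X p) (Eq.trans ?_
      (coef₁_kappa (I := 𝓘(ℝ, E)) wT (smoothPullback r.s f)).symm)
    refine congrArg w ?_
    ext z
    refine ((dFun_smoothPullback r.s f z).symm.trans ?_)
    exact congrArg (dFun (smoothPullback r.s f)) (hid z).symm

/-- The synthetic tangent bundle of a manifold is its tangent bundle. The coefficients of `1` and of `ε`
of a tangent plot are the values of a plot of `TN` on the pulled back functions and on the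
differentials of functions, and these form a test family on `TN`. -/
instance isIso_kappa : IsIso (kappa I N) := by
  refine isIso_of_bijective _ fun X => ⟨fun φ ψ h => ?_, fun Φ => ?_⟩
  · change C^∞⟮I.tangent, TangentBundle I N; ℝ⟯ →ₐ[ℝ] X.O at φ ψ
    refine isTestFamily_tangentTest.plot_ext (φ := φ) (ψ := ψ) fun j => ?_
    have h1 : ∀ f, _ := DFunLike.congr_fun (show (show C^∞⟮I, N; ℝ⟯ →ₐ[ℝ] (X.ext D1).O from
      ap (G := yMan I.tangent (TangentBundle I N)) (X := X) (kappa I N) φ) = _ from h)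
    cases j with
    | inl f =>
      exact (coef₀_kappa φ f).symm.trans ((congrArg X.coef₀ (h1 f)).trans (coef₀_kappa ψ f))
    | inr f =>
      exact (coef₁_kappa φ f).symm.trans ((congrArg X.coef₁ (h1 f)).trans (coef₁_kappa ψ f))
  · change C^∞⟮I, N; ℝ⟯ →ₐ[ℝ] (X.ext D1).O at Φ
    obtain ⟨ψ, hψ⟩ := isTestFamily_tangentTest (I := I) (N := N).exists_plot
      (Sum.elim (fun f => X.coef₀ (Φ f)) fun f => X.coef₁ (Φ f)) fun p₀ => by
        obtain ⟨ψ, hψ⟩ := exists_local_tangent_plot Φ p₀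
        refine ⟨ψ, hψ.mono fun p hp j => ?_⟩
        cases j with
        | inl f => exact (hp f).1
        | inr f => exact (hp f).2
    refine ⟨ψ, AlgHom.ext fun f => ThCartSp.ext_coef ?_ ?_⟩
    · exact (coef₀_kappa ψ f).trans (hψ (Sum.inl f))
    · exact (coef₁_kappa ψ f).trans (hψ (Sum.inr f))

end Kappa

/-! ### Plots of limits -/

section Limits

variable {X : ThCartSp}

theorem ap_comp {G H K : ThSmthSet} (f : G ⟶ H) (g : H ⟶ K) (x : Plots G X) :
    ap (f ≫ g) x = ap g (ap f x) := rfl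

theorem ap_inv_ap {G H : ThSmthSet} (f : G ⟶ H) [IsIso f] (x : Plots G X) :
    ap (inv f) (ap f x) = x := by
  rw [← ap_comp, IsIso.hom_inv_id]
  rfl

theorem ap_ap_inv {G H : ThSmthSet} (f : G ⟶ H) [IsIso f] (x : Plots H X) :
    ap f (ap (inv f) x) = x := by
  rw [← ap_comp, IsIso.inv_hom_id]
  rfl

theorem bijective_ap {G H : ThSmthSet} (f : G ⟶ H) [IsIso f] :
    Function.Bijective fun x : Plots G X => ap f x :=
  Function.bijective_iff_has_inverse.2 ⟨fun y => ap (inv f) y, ap_inv_ap f, ap_ap_inv f⟩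

/-- The action of a map on plots is natural in the probe. -/
theorem ap_res {G H : ThSmthSet} (f : G ⟶ H) {Y : ThCartSp} (g : Y ⟶ X) (x : Plots G X) :
    ap f (res G g x) = res H g (ap f x) :=
  NatTrans.naturality_apply f.hom g.op x

theorem thSmthSet_hom_ext {G H : ThSmthSet} {f g : G ⟶ H}
    (h : ∀ (X : ThCartSp) (x : Plots G X), ap f x = ap g x) : f = g := by
  refine ObjectProperty.hom_ext _ ?_
  ext X x
  exact h X.unop x

variable {J : Type} [SmallCategory J] (K : J ⥤ ThSmthSet)

theorem existsUnique_plot_limit (x : ∀ j, Plots (K.obj j) X)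
    (hx : ∀ {i j} (f : i ⟶ j), ap (K.map f) (x i) = x j) :
    ∃! a : Plots (limit K) X, ∀ j, ap (limit.π K j) a = x j := by
  have h1 := isLimitOfPreserves
    (IsThickenedSmoothSet.ι ⋙ (evaluation ThCartSpᵒᵖ Type).obj (op X)) (limit.isLimit K)
  exact (Types.isLimit_iff _).1 ⟨h1⟩ x fun f => hx f

theorem plot_limit_ext {a b : Plots (limit K) X}
    (h : ∀ j, ap (limit.π K j) a = ap (limit.π K j) b) : a = b :=
  (existsUnique_plot_limit K (fun j => ap (limit.π K j) b) fun f => by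
    rw [← ap_comp, limit.w]).unique h fun _ => rfl

theorem plot_pullback_ext {G H L : ThSmthSet} {f : G ⟶ L} {g : H ⟶ L}
    {a b : Plots (pullback f g) X} (h1 : ap (pullback.fst f g) a = ap (pullback.fst f g) b)
    (h2 : ap (pullback.snd f g) a = ap (pullback.snd f g) b) : a = b := by
  refine plot_limit_ext _ fun j => ?_
  match j with
  | none =>
    have h3 : limit.π (cospan f g) WalkingCospan.one = pullback.fst f g ≫ f :=
      (limit.w (cospan f g) WalkingCospan.Hom.inl).symm
    change ap (limit.π (cospan f g) WalkingCospan.one) a = ap (limit.π (cospan f g) WalkingCospan.one) b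
    rw [h3]
    exact congrArg (ap f) h1
  | some WalkingPair.left => exact h1
  | some WalkingPair.right => exact h2

theorem exists_plot_pullback {G H L : ThSmthSet} (f : G ⟶ L) (g : H ⟶ L)
    (a : Plots G X) (b : Plots H X) (h : ap f a = ap g b) :
    ∃ z : Plots (pullback f g) X, ap (pullback.fst f g) z = a ∧ ap (pullback.snd f g) z = b := by
  obtain ⟨z, hz, -⟩ := existsUnique_plot_limit (X := X) (cospan f g)
    (fun j => match j with
      | none => ap f a
      | some WalkingPair.left => a
      | some WalkingPair.right => b)
    (fun {i j} k => match i, j, k with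
      | i, _, WidePullbackShape.Hom.id _ =>
        congrArg (fun t : (cospan f g).obj i ⟶ (cospan f g).obj i => ap t _)
          ((cospan f g).map_id i)
      | _, _, WidePullbackShape.Hom.term WalkingPair.left => rfl
      | _, _, WidePullbackShape.Hom.term WalkingPair.right => h.symm)
  exact ⟨z, hz WalkingCospan.left, hz WalkingCospan.right⟩

/-- The fibre condition for the plots of a fibre product. -/
theorem ap_pullback_condition {G H L : ThSmthSet} (f : G ⟶ L) (g : H ⟶ L)
    (z : Plots (pullback f g) X) : ap f (ap (pullback.fst f g) z) = ap g (ap (pullback.snd f g) z) := by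
  rw [← ap_comp, ← ap_comp, pullback.condition]

end Limits

section Sequences

variable {A : ℕ → ThSmthSet} (f : ∀ n, A (n + 1) ⟶ A n)

theorem map_eq_of_succ {X : ThCartSp} (x : ∀ n, Plots (A n) X)
    (hx : ∀ n, ap (f n) (x (n + 1)) = x n) {i j : ℕᵒᵖ} (k : i ⟶ j) :
    ap ((Functor.ofOpSequence f).map k) (x i.unop) = x j.unop := by
  obtain ⟨d, hd⟩ := Nat.exists_eq_add_of_le (leOfHom k.unop)
  obtain ⟨i⟩ := i
  obtain ⟨j⟩ := j
  change i = j + d at hd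
  subst hd
  obtain rfl : k = (homOfLE (Nat.le_add_right j d)).op := Subsingleton.elim _ _
  change ap ((Functor.ofOpSequence f).map (homOfLE (Nat.le_add_right j d)).op) (x (j + d)) = x j
  induction d with
  | zero =>
    have h1 := (Functor.ofOpSequence f).map_id (op j)
    exact congrArg (fun t : A j ⟶ A j => ap t (x j)) h1
  | succ d ih =>
    have h1 : (homOfLE (Nat.le_add_right j (d + 1))).op =
      (homOfLE (Nat.le_add_right (j + d) 1)).op ≫ (homOfLE (Nat.le_add_right j d)).op :=
        Subsingleton.elim _ _
    rw [h1, Functor.map_comp, Functor.ofOpSequence_map_homOfLE_succ]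
    exact (congrArg _ (hx (j + d))).trans ih

/-- Compatible sequences of plots are plots of the sequential limit. -/
theorem exists_plot_limit_ofOpSequence {X : ThCartSp} (x : ∀ n, Plots (A n) X)
    (hx : ∀ n, ap (f n) (x (n + 1)) = x n) : ∃ a : Plots (limit (Functor.ofOpSequence f)) X,
      ∀ n, ap (limit.π (Functor.ofOpSequence f) (op n)) a = x n := by
  obtain ⟨a, ha, -⟩ := existsUnique_plot_limit (Functor.ofOpSequence f) (fun j => x j.unop)
    (map_eq_of_succ f x hx)
  exact ⟨a, fun n => ha (op n)⟩

theorem exists_lift_ofOpSequence {G : ThSmthSet} (c : ∀ n, G ⟶ A n)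
    (hc : ∀ n, c (n + 1) ≫ f n = c n) : ∃ l : G ⟶ limit (Functor.ofOpSequence f),
      ∀ n, l ≫ limit.π (Functor.ofOpSequence f) (op n) = c n :=
  ⟨limit.lift (Functor.ofOpSequence f)
    { pt := G
      π := { app := fun j => c j.unop
             naturality := fun i j k => by
              refine thSmthSet_hom_ext fun X x => ?_
              exact (map_eq_of_succ f (fun n => ap (c n) x)
                (fun n => congrArg (fun t : G ⟶ A n => ap t x) (hc n)) k).symm } },
    fun n => limit.lift_π _ _⟩

end Sequences

section TangentNaturality

variable {E H N E' H' N' : Type} [NormedAddCommGroup E] [NormedSpace ℝ E]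
  [TopologicalSpace H] {I : ModelWithCorners ℝ E H} [TopologicalSpace N]
  [ChartedSpace H N] [IsManifold I ∞ N] [NormedAddCommGroup E'] [NormedSpace ℝ E']
  [TopologicalSpace H'] {I' : ModelWithCorners ℝ E' H'} [TopologicalSpace N']
  [ChartedSpace H' N'] [IsManifold I' ∞ N']

theorem smoothPullback_tangentCM_dFun (f : C^∞⟮I, N; I', N'⟯) (g : C^∞⟮I', N'; ℝ⟯) :
    smoothPullback (tangentCM f) (dFun g) = dFun (smoothPullback f g) := by
  ext v
  have h1 : MDifferentiableAt I' 𝓘(ℝ, ℝ) g (f v.1) := g.contMDiff.mdifferentiable (by simp) _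
  have h2 := h1.hasMFDerivAt.comp v.1 f.mdifferentiableAt.hasMFDerivAt
  exact congrArg (fun A : E →L[ℝ] ℝ => A v.2) h2.mfderiv.symm

theorem kappa_naturality (f : C^∞⟮I, N; I', N'⟯) :
    kappa I N ≫ synT.map (yMap f) = yMap (tangentCM f) ≫ kappa I' N' := by
  refine thSmthSet_hom_ext fun X φ => ?_
  change C^∞⟮I.tangent, TangentBundle I N; ℝ⟯ →ₐ[ℝ] X.O at φ
  refine AlgHom.ext fun g => ThCartSp.ext_coef ?_ ?_
  · refine (coef₀_kappa φ (smoothPullback f g)).trans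
      (coef₀_kappa (φ.comp (smoothPullback (tangentCM f))) g).symm
  · refine (coef₁_kappa φ (smoothPullback f g)).trans
      (Eq.trans ?_ (coef₁_kappa (φ.comp (smoothPullback (tangentCM f))) g).symm)
    exact congrArg φ (smoothPullback_tangentCM_dFun f g).symm

end TangentNaturality

/-! ### The topology of jet bundles -/

section JetTopology

variable {E EF V : Type} [NormedAddCommGroup E] [NormedSpace ℝ E] [NormedAddCommGroup EF]
  [NormedSpace ℝ EF] [NormedAddCommGroup V] [NormedSpace ℝ V] [FiniteDimensional ℝ E]
  [FiniteDimensional ℝ V]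
  {M F : Type} [TopologicalSpace M] [ChartedSpace E M] [TopologicalSpace F] [ChartedSpace EF F]
  {π : F → M} {h : IsFibered E EF V π} {n : ℕ}

theorem JetBundle.local_charts (j : JetBundle h n) :
    ∃ (e : OpenPartialHomeomorph (JetBundle h n) (E × JetFiber E V n)) (U : Set F), IsOpen U ∧
      j.value ∈ U ∧ JetBundle.value ⁻¹' U ⊆ e.source := by
  obtain ⟨c, e, he, -, hj, -⟩ := j.exists_chart
  rw [he] at hj
  exact ⟨e, c.tot.source, c.tot.open_source, hj, he.ge⟩

instance [T2Space F] : T2Space (JetBundle h n) :=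
  t2Space_of_local_charts (JetBundle.contMDiff_value (h := h)).continuous JetBundle.local_charts

instance [SecondCountableTopology F] : SecondCountableTopology (JetBundle h n) := by
  have : ProperSpace (E × JetFiber E V n) := FiniteDimensional.proper ℝ _
  exact secondCountableTopology_of_local_charts (JetBundle.contMDiff_value (h := h)).continuous
    JetBundle.local_charts

variable [IsManifold 𝓘(ℝ, E) ∞ M] [IsManifold 𝓘(ℝ, EF) ∞ F]

theorem VertBundle.local_charts (w : VertBundle h) :
    ∃ (e : OpenPartialHomeomorph (VertBundle h) (E × (V × V))) (U : Set F), IsOpen U ∧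
      w.foot ∈ U ∧ VertBundle.foot ⁻¹' U ⊆ e.source := by
  obtain ⟨c, hc⟩ := h w.foot
  exact ⟨(VertBundle.adapted c w).tot, c.tot.source, c.tot.open_source, hc, subset_rfl⟩

instance [T2Space F] : T2Space (VertBundle h) :=
  t2Space_of_local_charts VertBundle.contMDiff_foot.continuous VertBundle.local_charts

instance [SecondCountableTopology F] : SecondCountableTopology (VertBundle h) := by
  have : ProperSpace (E × (V × V)) := FiniteDimensional.proper ℝ _
  exact secondCountableTopology_of_local_charts VertBundle.contMDiff_foot.continuous
    VertBundle.local_charts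

instance [T2Space F] : T2Space (JetTM h n) := t2Space_totalSpace _

instance [SecondCountableTopology F] : SecondCountableTopology (JetTM h n) :=
  secondCountableTopology_totalSpace _

instance : IsManifold ((jetI E V n).prod 𝓘(ℝ, E)) ∞ (JetTM h n) := inferInstance

end JetTopology

/-! ### The tangent bundle of the infinite jet bundle -/

section TanLim

variable {E EF V : Type} [NormedAddCommGroup E] [NormedSpace ℝ E] [NormedAddCommGroup EF]
  [NormedSpace ℝ EF] [NormedAddCommGroup V] [NormedSpace ℝ V] [FiniteDimensional ℝ E]
  [FiniteDimensional ℝ V]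
  {M F : Type} [TopologicalSpace M] [ChartedSpace E M] [TopologicalSpace F] [ChartedSpace EF F]
  {π : F → M} (h : IsFibered E EF V π) {X : ThCartSp}

variable {h} in
theorem jetInf_plot_ext {a b : Plots (jetInf h) X}
    (hab : ∀ n, ap (jetInfProj h n) a = ap (jetInfProj h n) b) : a = b :=
  plot_limit_ext _ fun j => hab j.unop

theorem exists_jetInf_plot (x : ∀ n, Plots (yJet h n) X)
    (hx : ∀ n, ap (yMap (JetBundle.truncCM h n)) (x (n + 1)) = x n) :
    ∃ a : Plots (jetInf h) X, ∀ n, ap (jetInfProj h n) a = x n :=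
  exists_plot_limit_ofOpSequence (A := fun n => yJet h n) _ x hx

theorem tanLimProj_succ (n : ℕ) :
    tanLimProj h (n + 1) ≫ yMap (tangentCM (JetBundle.truncCM h n)) = tanLimProj h n := by
  have h1 := limit.w (tanTower h) (homOfLE (Nat.le_add_right n 1)).op
  rw [tanTower, Functor.ofOpSequence_map_homOfLE_succ] at h1
  exact h1

theorem ap_jetInfProj_succ (n : ℕ) (a : Plots (jetInf h) X) :
    ap (yMap (JetBundle.truncCM h n)) (ap (jetInfProj h (n + 1)) a) = ap (jetInfProj h n) a := by
  rw [← ap_comp, jetInfProj_succ]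

variable [T2Space F] [SecondCountableTopology F]

theorem inv_kappa_naturality (n : ℕ) :
    inv (kappa (jetI E V (n + 1)) (JetBundle h (n + 1))) ≫
        yMap (tangentCM (JetBundle.truncCM h n)) =
      synT.map (yMap (JetBundle.truncCM h n)) ≫ inv (kappa (jetI E V n) (JetBundle h n)) := by
  rw [IsIso.inv_comp_eq, ← Category.assoc, IsIso.eq_comp_inv, kappa_naturality]

/-- The tangent bundle of the infinite jet bundle is the limit of the tangent bundles of the finite
jet bundles. -/
theorem exists_iso_tanLim : ∃ Λ : synT.obj (jetInf h) ≅ tanLim h, ∀ n,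
    Λ.hom ≫ tanLimProj h n ≫ kappa (jetI E V n) (JetBundle h n) = synT.map (jetInfProj h n) := by
  obtain ⟨l, hl⟩ := exists_lift_ofOpSequence
    (A := fun n => yMan (jetI E V n).tangent (TangentBundle (jetI E V n) (JetBundle h n)))
    (fun n => yMap (tangentCM (JetBundle.truncCM h n)))
    (fun n => synT.map (jetInfProj h n) ≫ inv (kappa (jetI E V n) (JetBundle h n))) fun n => by
      rw [Category.assoc, inv_kappa_naturality, ← Category.assoc, ← Functor.map_comp,
        jetInfProj_succ]
  change synT.obj (jetInf h) ⟶ tanLim h at l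
  have hl : ∀ n, l ≫ tanLimProj h n ≫ kappa (jetI E V n) (JetBundle h n) =
      synT.map (jetInfProj h n) := fun n => by
    rw [← Category.assoc, ← IsIso.eq_comp_inv]
    exact hl n
  have h1 : IsIso l := by
    refine isIso_of_bijective l fun X => ⟨fun a b hab => ?_, fun z => ?_⟩
    · refine jetInf_plot_ext (h := h) (X := X.ext D1) fun n => ?_
      change ap (synT.map (jetInfProj h n)) a = ap (synT.map (jetInfProj h n)) b
      rw [← hl]
      exact congrArg (fun t => ap (tanLimProj h n ≫ kappa (jetI E V n) (JetBundle h n)) t) hab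
    · obtain ⟨a, ha⟩ := exists_jetInf_plot h (X := X.ext D1)
        (fun n => ap (tanLimProj h n ≫ kappa (jetI E V n) (JetBundle h n)) z) fun n => by
          change ap (synT.map (yMap (JetBundle.truncCM h n))) _ = _
          rw [← ap_comp, Category.assoc, kappa_naturality, ← Category.assoc, tanLimProj_succ]
      refine ⟨a, plot_limit_ext _ fun j => ?_⟩
      refine (bijective_ap (kappa (jetI E V j.unop) (JetBundle h j.unop))).injective ?_
      change ap (l ≫ tanLimProj h j.unop ≫ kappa (jetI E V j.unop) (JetBundle h j.unop)) a = _
      rw [hl]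
      exact ha j.unop
  exact ⟨asIso l, hl⟩

/-- Maps into the tangent bundle of the infinite jet bundle are given by compatible families of
maps into the tangent bundles of the finite jet bundles. -/
theorem exists_lift_synT_jetInf {G : ThSmthSet}
    (c : ∀ n, G ⟶ yMan (jetI E V n).tangent (TangentBundle (jetI E V n) (JetBundle h n)))
    (hc : ∀ n, c (n + 1) ≫ yMap (tangentCM (JetBundle.truncCM h n)) = c n) :
    ∃ l : G ⟶ synT.obj (jetInf h), ∀ n, l ≫ synT.map (jetInfProj h n) =
      c n ≫ kappa (jetI E V n) (JetBundle h n) := by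
  obtain ⟨Λ, hΛ⟩ := exists_iso_tanLim h
  obtain ⟨l, hl⟩ := exists_lift_ofOpSequence
    (A := fun n => yMan (jetI E V n).tangent (TangentBundle (jetI E V n) (JetBundle h n)))
    (fun n => yMap (tangentCM (JetBundle.truncCM h n))) c hc
  change G ⟶ tanLim h at l
  refine ⟨l ≫ Λ.inv, fun n => ?_⟩
  rw [← hΛ n, Category.assoc, Iso.inv_hom_id_assoc, ← Category.assoc]
  exact congrArg (fun t => t ≫ kappa (jetI E V n) (JetBundle h n)) (hl n)

theorem synT_jetInf_hom_ext {G : ThSmthSet} {f g : G ⟶ synT.obj (jetInf h)}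
    (hfg : ∀ n, f ≫ synT.map (jetInfProj h n) = g ≫ synT.map (jetInfProj h n)) : f = g :=
  thSmthSet_hom_ext fun X x => jetInf_plot_ext (h := h) (X := X.ext D1) fun n =>
    congrArg (fun t : G ⟶ synT.obj (yJet h n) => ap t x) (hfg n)

end TanLim

/-! ### Calculus of jets of vector-valued functions -/

section Param

variable {P E V W : Type} [NormedAddCommGroup P] [NormedSpace ℝ P] [NormedAddCommGroup E]
  [NormedSpace ℝ E] [NormedAddCommGroup V] [NormedSpace ℝ V] [NormedAddCommGroup W]
  [NormedSpace ℝ W]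

/-- The next iterated derivative in the variable is the partial derivative in the variable of the
previous one. -/
theorem iteratedFDeriv_succ_param {g : P × E → V} {U : Set (P × E)} (hU : IsOpen U)
    (hg : ContDiffOn ℝ ∞ g U) (k : ℕ) {q : P × E} (hq : q ∈ U) :
    iteratedFDeriv ℝ (k + 1) (fun z => g (q.1, z)) q.2 =
      (continuousMultilinearCurryLeftEquiv ℝ (fun _ : Fin (k + 1) => E) V).symm
        ((fderiv ℝ (fun q : P × E => iteratedFDeriv ℝ k (fun z => g (q.1, z)) q.2) q).comp
          (ContinuousLinearMap.inr ℝ P E)) := by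
  have h4 := (((contDiffOn_iteratedFDeriv_param hU hg k).contDiffAt
    (hU.mem_nhds hq)).differentiableAt (by simp)).hasFDerivAt
  have h5 := (HasFDerivAt.comp (f := fun z => (q.1, z)) q.2 h4
      (hasFDerivAt_prodMk_right q.1 q.2)).fderiv
  rw [iteratedFDeriv_succ_eq_comp_left]
  exact congrArg _ h5

/-- Partial derivatives in the parameter commute with iterated derivatives in the variable. -/
theorem fderiv_iteratedFDeriv_param {g : P × E → V} {U : Set (P × E)} (hU : IsOpen U)
    (hg : ContDiffOn ℝ ∞ g U) (a : P) (k : ℕ) {q : P × E} (hq : q ∈ U) :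
    fderiv ℝ (fun q : P × E => iteratedFDeriv ℝ k (fun z => g (q.1, z)) q.2) q (a, 0) =
      iteratedFDeriv ℝ k (fun z => fderiv ℝ g (q.1, z) (a, 0)) q.2 := by
  induction k generalizing q with
  | zero =>
    have h1 : (fun q : P × E => iteratedFDeriv ℝ 0 (fun z => g (q.1, z)) q.2) =
        (continuousMultilinearCurryFin0 ℝ E V).symm ∘ g := by
      ext q
      simp
    rw [h1, LinearIsometryEquiv.comp_fderiv]
    ext v
    simp
  | succ k ih =>
    set G := fun q : P × E => iteratedFDeriv ℝ k (fun z => g (q.1, z)) q.2 with hG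
    set g' := fun q : P × E => fderiv ℝ g q (a, 0) with hg'
    have hg's : ContDiffOn ℝ ∞ g' U := (hg.fderiv_of_isOpen hU (by simp)).clm_apply contDiffOn_const
    have hGs : ContDiffOn ℝ ∞ G U := contDiffOn_iteratedFDeriv_param hU hg k
    have hdG : DifferentiableAt ℝ (fderiv ℝ G) q :=
      ((hGs.fderiv_of_isOpen hU (m := ∞) (by simp)).contDiffAt (hU.mem_nhds hq)).differentiableAt
        (by simp)
    have h1 : (fun q : P × E => iteratedFDeriv ℝ (k + 1) (fun z => g (q.1, z)) q.2) =ᶠ[𝓝 q]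
        (continuousMultilinearCurryLeftEquiv ℝ (fun _ : Fin (k + 1) => E) V).symm ∘
          fun q => (fderiv ℝ G q).comp (ContinuousLinearMap.inr ℝ P E) := by
      filter_upwards [hU.mem_nhds hq] with z hz
      exact iteratedFDeriv_succ_param hU hg k hz
    have h2 := hdG.hasFDerivAt.clm_comp (hasFDerivAt_const (ContinuousLinearMap.inr ℝ P E) q)
    have h6 := ((continuousMultilinearCurryLeftEquiv ℝ (fun _ : Fin (k + 1) => E)
      V).symm.toContinuousLinearEquiv.hasFDerivAt.comp q h2).congr_of_eventuallyEq h1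
    rw [h6.fderiv]
    refine Eq.trans ?_ (iteratedFDeriv_succ_param hU hg's k hq).symm
    refine congrArg (continuousMultilinearCurryLeftEquiv ℝ (fun _ : Fin (k + 1) => E) V).symm ?_
    have h3 : (fun q => fderiv ℝ G q (a, 0)) =ᶠ[𝓝 q]
        fun q : P × E => iteratedFDeriv ℝ k (fun z => g' (q.1, z)) q.2 := by
      filter_upwards [hU.mem_nhds hq] with z hz
      exact ih hz
    rw [← h3.fderiv_eq]
    ext1 v
    have h4 : fderiv ℝ (fun q => fderiv ℝ G q (a, 0)) q (0, v) =
        fderiv ℝ (fderiv ℝ G) q (0, v) (a, 0) := by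
      rw [fderiv_clm_apply hdG (differentiableAt_const _)]
      simp
    have h7 : ∀ k : ℕ, (k : ℕ∞ω) ≤ ∞ := fun k => by exact_mod_cast le_top
    -- The derivatives in the parameter and in the variable commute by the symmetry of the second
    -- derivative.
    have h5 := (hGs.contDiffAt (hU.mem_nhds hq)).isSymmSndFDerivAt
      (by rw [minSmoothness_of_isRCLikeNormedField]; exact h7 2)
      (a, 0) (0, v)
    refine Eq.trans ?_ (h5.trans h4.symm)
    simp

theorem hasFDerivAt_iteratedFDeriv {u : E → V} {x : E} (hu : ContDiffAt ℝ ∞ u x) (k : ℕ) :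
    HasFDerivAt (iteratedFDeriv ℝ k u) (iteratedFDeriv ℝ (k + 1) u x).curryLeft x := by
  have h1 : DifferentiableAt ℝ (iteratedFDeriv ℝ k u) x :=
    hu.differentiableAt_iteratedFDeriv (by exact_mod_cast WithTop.coe_lt_top _)
  have h2 := h1.hasFDerivAt
  have h3 : (iteratedFDeriv ℝ (k + 1) u x).curryLeft = fderiv ℝ (iteratedFDeriv ℝ k u) x :=
    (continuousMultilinearCurryLeftEquiv ℝ (fun _ : Fin (k + 1) => E) V).apply_symm_apply _
  rwa [h3]

end Param

section JetFiberMaps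

variable {E V W : Type} [NormedAddCommGroup E] [NormedSpace ℝ E] [NormedAddCommGroup V]
  [NormedSpace ℝ V] [NormedAddCommGroup W] [NormedSpace ℝ W] [FiniteDimensional ℝ E]
  [FiniteDimensional ℝ V] [FiniteDimensional ℝ W] {n : ℕ}

instance (k : ℕ) : FiniteDimensional ℝ (E [×k]→L[ℝ] V) :=
  FiniteDimensional.of_injective
    (ContinuousMultilinearMap.toMultilinearMapLinear (R' := ℝ) (A := ℝ) (M₁ := fun _ : Fin k => E)
      (M₂ := V))
    ContinuousMultilinearMap.toMultilinearMap_injective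

theorem exists_jetProj (E V : Type) [NormedAddCommGroup E] [NormedSpace ℝ E]
    [NormedAddCommGroup V] [NormedSpace ℝ V] [FiniteDimensional ℝ E] [FiniteDimensional ℝ V]
    (n : ℕ) : ∃ L : (∀ k : Fin (n + 1), E [×(k : ℕ)]→L[ℝ] V) →L[ℝ] JetFiber E V n,
      ∀ A : JetFiber E V n, L A.1 = A := by
  obtain ⟨L, hL⟩ := (JetFiber E V n).subtype.exists_leftInverse_of_injective
    (Submodule.ker_subtype _)
  exact ⟨LinearMap.toContinuousLinearMap L, fun A => LinearMap.congr_fun hL A⟩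

/-- A linear projection from all families of Taylor coefficients to those of functions. -/
def jetProj (E V : Type) [NormedAddCommGroup E] [NormedSpace ℝ E]
    [NormedAddCommGroup V] [NormedSpace ℝ V] [FiniteDimensional ℝ E] [FiniteDimensional ℝ V]
    (n : ℕ) : (∀ k : Fin (n + 1), E [×(k : ℕ)]→L[ℝ] V) →L[ℝ] JetFiber E V n :=
  (exists_jetProj E V n).choose

theorem jetProj_coe (A : JetFiber E V n) : jetProj E V n A.1 = A :=
  (exists_jetProj E V n).choose_spec A

theorem taylorJet_clm_comp (L : V →L[ℝ] W) {u : E → V} {x : E} (hu : ContDiffAt ℝ ∞ u x)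
    (k : Fin (n + 1)) :
    taylorJet n (fun z => L (u z)) x k = L.compContinuousMultilinearMap (taylorJet n u x k) :=
  L.iteratedFDeriv_comp_left (f := u) hu (by exact_mod_cast le_top)

/-- Postcomposition of jets with a linear map. -/
def JetFiber.map (n : ℕ) (L : V →L[ℝ] W) : JetFiber E V n →L[ℝ] JetFiber E W n :=
  LinearMap.toContinuousLinearMap
    { toFun := fun A => ⟨fun k => L.compContinuousMultilinearMap (A.1 k), by
        obtain ⟨u, hu, hA⟩ := A.2
        refine ⟨fun z => L (u z), hu.mono fun z hz => L.contDiff.contDiffAt.comp z hz, ?_⟩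
        ext k : 1
        rw [taylorJet_clm_comp L hu.self, hA]⟩
      map_add' := fun A B => by
        ext k v
        exact map_add L _ _
      map_smul' := fun r A => by
        ext k v
        exact map_smul L _ _ }

variable (E V n) in
/-- The first component `A` of a jet `(A, A')` of a pair of functions. -/
abbrev fstJet : JetFiber E (V × V) n →L[ℝ] JetFiber E V n :=
  JetFiber.map n (ContinuousLinearMap.fst ℝ V V)

variable (E V n) in
/-- The second component `A'` of a jet `(A, A')` of a pair of functions. -/
abbrev sndJet : JetFiber E (V × V) n →L[ℝ] JetFiber E V n :=
  JetFiber.map n (ContinuousLinearMap.snd ℝ V V)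

/-- The jet of a pair of functions with given jets. -/
def pairJet : JetFiber E V n × JetFiber E V n →L[ℝ] JetFiber E (V × V) n :=
  (JetFiber.map n (ContinuousLinearMap.inl ℝ V V)).coprod
    (JetFiber.map n (ContinuousLinearMap.inr ℝ V V))

theorem fstJet_pairJet (A B : JetFiber E V n) : fstJet E V n (pairJet (A, B)) = A := by
  ext k v
  change (A.1 k v) + (0 : V) = A.1 k v
  rw [add_zero]

theorem sndJet_pairJet (A B : JetFiber E V n) : sndJet E V n (pairJet (A, B)) = B := by
  ext k v
  change (0 : V) + B.1 k v = B.1 k v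
  rw [zero_add]

theorem pairJet_fst_snd (A : JetFiber E (V × V) n) :
    pairJet (fstJet E V n A, sndJet E V n A) = A := by
  refine Subtype.ext (funext fun k => ContinuousMultilinearMap.ext fun v => Prod.ext ?_ ?_)
  · change (A.1 k v).1 + (0 : V) = (A.1 k v).1
    rw [add_zero]
  · change (0 : V) + (A.1 k v).2 = (A.1 k v).2
    rw [zero_add]

variable (E V n) in
/-- The derivative of the `n`-jet prolongation of a function with given `n + 1`-jet. -/
def diffJet : JetFiber E V (n + 1) →L[ℝ] E →L[ℝ] JetFiber E V n :=
  LinearMap.toContinuousLinearMap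
    { toFun := fun A => (jetProj E V n).comp
        (ContinuousLinearMap.pi fun k : Fin (n + 1) => (A.1 k.succ).curryLeft)
      map_add' := fun A B => by
        ext1 v
        exact map_add (jetProj E V n) (fun k : Fin (n + 1) => (A.1 k.succ).curryLeft v)
          (fun k : Fin (n + 1) => (B.1 k.succ).curryLeft v)
      map_smul' := fun r A => by
        ext1 v
        exact map_smul (jetProj E V n) r (fun k : Fin (n + 1) => (A.1 k.succ).curryLeft v) }

end JetFiberMaps

/-! ### Velocities and differentials in charts -/

section Velocity

variable {E₀ H₀ N₀ E H N B : Type} [NormedAddCommGroup E₀] [NormedSpace ℝ E₀]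
  [TopologicalSpace H₀] {I₀ : ModelWithCorners ℝ E₀ H₀} [TopologicalSpace N₀]
  [ChartedSpace H₀ N₀] [IsManifold I₀ ∞ N₀] [NormedAddCommGroup E] [NormedSpace ℝ E]
  [TopologicalSpace H] {I : ModelWithCorners ℝ E H} [TopologicalSpace N]
  [ChartedSpace H N] [IsManifold I ∞ N] [NormedAddCommGroup B] [NormedSpace ℝ B]

theorem tangentMap_congr {g g' : N₀ → N} {p : N₀} (hg : g =ᶠ[𝓝 p] g') (X : TangentSpace I₀ p) :
    tangentMap I₀ I g ⟨p, X⟩ = tangentMap I₀ I g' ⟨p, X⟩ := by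
  rw [tangentMap, tangentMap, hg.mfderiv_eq]
  exact congrArg (fun z : N => (⟨z, (mfderiv I₀ I g' p X : E)⟩ : TangentBundle I N))
    hg.self_of_nhds

/-- The differential of a map given in coordinates `s : B → N`. -/
theorem tangentMap_eq_tanParam {s : C^∞⟮𝓘(ℝ, B), B; I, N⟯} {g : N₀ → N} {β : N₀ → B} {p : N₀}
    {β' : TangentSpace I₀ p →L[ℝ] B} (hg : g =ᶠ[𝓝 p] fun q => s (β q))
    (hβ : HasMFDerivAt I₀ 𝓘(ℝ, B) β p β') (X : TangentSpace I₀ p) :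
    MDifferentiableAt I₀ I g p ∧ tangentMap I₀ I g ⟨p, X⟩ = tanParam s (β p, β' X) := by
  have h1 : HasMFDerivAt 𝓘(ℝ, B) I s (β p) (mfderiv 𝓘(ℝ, B) I s (β p)) :=
    s.mdifferentiableAt.hasMFDerivAt
  have h2 := h1.comp p hβ
  refine ⟨h2.mdifferentiableAt.congr_of_eventuallyEq hg, ?_⟩
  rw [tangentMap_congr hg]
  exact congrArg (fun A : TangentSpace I₀ p →L[ℝ] E =>
    (⟨s (β p), (A X : E)⟩ : TangentBundle I N)) h2.mfderiv

theorem velocity_vector {γ : ℝ → B} {v : B} (hγ : HasDerivAt γ v 0) :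
    velocity 𝓘(ℝ, B) γ = (⟨γ 0, v⟩ : TangentBundle 𝓘(ℝ, B) B) := by
  change (⟨γ 0, mfderiv 𝓘(ℝ, ℝ) 𝓘(ℝ, B) γ 0 (1 : ℝ)⟩ : TangentBundle 𝓘(ℝ, B) B) = _
  rw [mfderiv_eq_fderiv]
  exact congrArg (fun v : B => (⟨γ 0, v⟩ : TangentBundle 𝓘(ℝ, B) B)) hγ.deriv

theorem velocity_comp {f : N₀ → N} {γ : ℝ → N₀} (hf : MDifferentiableAt I₀ I f (γ 0))
    (hγ : MDifferentiableAt 𝓘(ℝ, ℝ) I₀ γ 0) :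
    velocity I (fun t => f (γ t)) = tangentMap I₀ I f (velocity I₀ γ) :=
  tangentMap_comp_at (⟨0, (1 : ℝ)⟩ : TangentBundle 𝓘(ℝ, ℝ) ℝ) hf hγ

end Velocity

/-! ### Retract charts of jet bundles -/

section JetRetract

variable {E EF V : Type} [NormedAddCommGroup E] [NormedSpace ℝ E] [NormedAddCommGroup EF]
  [NormedSpace ℝ EF] [NormedAddCommGroup V] [NormedSpace ℝ V] [FiniteDimensional ℝ E]
  [FiniteDimensional ℝ V]
  {M F : Type} [TopologicalSpace M] [ChartedSpace E M] [TopologicalSpace F] [ChartedSpace EF F]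
  {π : F → M} {h : IsFibered E EF V π} {n : ℕ}

open JetBundle

/-- A retract chart of the jet bundle which agrees with the coordinates given by an adapted chart
near a jet `j`. -/
structure JetRetract (d : AdaptedChart E EF V π) (j : JetBundle h n) extends
    RetractChart (jetI E V n) (JetBundle h n) (E × JetFiber E V n) j where
  c_eq : ∀ᶠ j' in 𝓝 j, c j' = coord d j'
  s_eq : ∀ᶠ y in 𝓝 (coord d j), (s y).value ∈ d.tot.source ∧ coord d (s y) = y

theorem JetBundle.isOpen_value_preimage {U : Set F} (hU : IsOpen U) :
    IsOpen {j : JetBundle h n | j.value ∈ U} :=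
  hU.preimage (contMDiff_value (h := h)).continuous

theorem exists_jetRetract [T2Space F] (d : AdaptedChart E EF V π) (j : JetBundle h n)
    (hj : j.value ∈ d.tot.source) : Nonempty (JetRetract d j) := by
  obtain ⟨e, he, hed, hje, h1, h2⟩ := exists_chart_at d j hj
  obtain ⟨r, -, hc, hs⟩ := exists_retractChart_of_chart (I := jetI E V n) e.toPartialEquiv
    (e.open_source.mem_nhds hje) (e.open_target.mem_nhds (e.map_source hje)) h1 h2
    Filter.univ_mem
  have hs : ∀ᶠ y in 𝓝 (e j), r.s y = e.symm y := hs
  rw [hed] at hs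
  refine ⟨⟨r, hc.mono fun j' hj' => hj'.trans (congrFun hed j'), ?_⟩⟩
  have h3 : e.target ∈ 𝓝 (coord d j) := by
    rw [← hed]
    exact e.open_target.mem_nhds (e.map_source hje)
  filter_upwards [hs, h3] with y hy hy'
  rw [hy]
  refine ⟨?_, ?_⟩
  · have h4 := e.map_target hy'
    rwa [he] at h4
  · rw [← hed]
    exact e.right_inv hy'

namespace JetRetract

variable {d : AdaptedChart E EF V π} {j : JetBundle h n} (r : JetRetract d j)

/-- At the coordinates `y`, the retract chart parametrizes the jet with these coordinates. -/
def Good (y : E × JetFiber E V n) : Prop :=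
  ∀ j' : JetBundle h n, j'.value ∈ d.tot.source → coord d j' = y → r.s y = j'

theorem eventually_good : ∀ᶠ y in 𝓝 (coord d j), r.Good y := by
  filter_upwards [r.s_eq] with y hy j' hj' hy'
  exact ext_coord d hy.1 hj' (hy.2.trans hy'.symm)

end JetRetract

theorem JetBundle.jetOr_eq {j₀ : JetBundle h n} {s : M → F} {p : M} (hs : IsLocSec E EF π p s) :
    jetOr j₀ s p = jet h n p s hs := dif_pos hs

theorem AdaptedChart.coord_jet_eq (d : AdaptedChart E EF V π) {p : M} {s : M → F}
    (hs : IsLocSec E EF π p s) (hd : s p ∈ d.tot.source) :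
    coord d (jet h n p s hs) =
      (d.base p, jetProj E V n (taylorJet n (d.rep s) (d.base p))) := by
  rw [coord_jet d hs hd]
  exact congrArg (Prod.mk (d.base p)) (jetProj_coe (⟨taylorJet n (d.rep s) (d.base p), _⟩ :
    JetFiber E V n)).symm

/-- The coordinates of the tangent vector `d(jⁿs)(X)`, in terms of those of `jⁿ⁺¹s` and of `X`. -/
def pushforwardCoord (n : ℕ) (z : (E × JetFiber E V (n + 1)) × E) :
    (E × JetFiber E V n) × (E × JetFiber E V n) :=
  ((z.1.1, truncFiber z.1.2), (z.2, diffJet E V n z.1.2 z.2))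

theorem contDiff_pushforwardCoord : ContDiff ℝ ∞ (pushforwardCoord (E := E) (V := V) n) := by
  refine ((contDiff_fst.comp contDiff_fst).prodMk (contDiff_truncFiber.comp
    (contDiff_snd.comp contDiff_fst))).prodMk (contDiff_snd.prodMk ?_)
  exact ((diffJet E V n).contDiff.comp
    (contDiff_snd.comp contDiff_fst)).clm_apply contDiff_snd

variable [IsManifold 𝓘(ℝ, E) ∞ M] [IsManifold 𝓘(ℝ, EF) ∞ F]

/-- The differential of the `n`-jet prolongation of a section at `p`, in coordinates. It depends on the
section only through its `n + 1`-jet at `p`. -/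
theorem tangentMap_jet {p : M} {s : M → F} (hs : IsLocSec E EF π p s)
    (d : AdaptedChart E EF V π) (hd : s p ∈ d.tot.source) (X : TangentSpace 𝓘(ℝ, E) p)
    {j₁ : JetBundle h n} (r : JetRetract d j₁)
    (hr : ∀ᶠ y in 𝓝 (coord d (jet h n p s hs)), r.Good y) :
    MDifferentiableAt 𝓘(ℝ, E) (jetI E V n) (jetOr (jet h n p s hs) s) p ∧
      tangentMap 𝓘(ℝ, E) (jetI E V n) (jetOr (jet h n p s hs) s) ⟨p, X⟩ =
        tanParam r.s (pushforwardCoord n (coord d (jet h (n + 1) p s hs),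
          mfderiv 𝓘(ℝ, E) 𝓘(ℝ, E) d.base p X)) := by
  set u := d.rep s with hu
  have hp := AdaptedChart.mem_base hs.eq hd
  have hus : SmoothNear u (d.base p) := AdaptedChart.rep_smoothNear hs hd
  set b : E → JetFiber E V n := fun x => jetProj E V n (taylorJet n u x) with hb
  have hbd : HasFDerivAt b ((jetProj E V n).comp (ContinuousLinearMap.pi
      fun k : Fin (n + 1) => (iteratedFDeriv ℝ (k + 1) u (d.base p)).curryLeft)) (d.base p) :=
    (jetProj E V n).hasFDerivAt.comp (d.base p)
      (hasFDerivAt_pi.2 fun k : Fin (n + 1) => hasFDerivAt_iteratedFDeriv hus.self k)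
  have h1 : HasMFDerivAt 𝓘(ℝ, E) 𝓘(ℝ, E) d.base p (mfderiv 𝓘(ℝ, E) 𝓘(ℝ, E) d.base p) :=
    (d.base_mdifferentiable.mdifferentiableAt hp).hasMFDerivAt
  have h2 := (((hasFDerivAt_id (𝕜 := ℝ) (d.base p)).prodMk hbd).hasMFDerivAt).comp p h1
  have hcont : ContinuousAt (fun q => (d.base q, b (d.base q))) p := h2.continuousAt
  have hg : jetOr (jet h n p s hs) s =ᶠ[𝓝 p] fun q => r.s (d.base q, b (d.base q)) := by
    have h3 := d.coord_jet_eq (h := h) (n := n) hs hd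
    rw [h3] at hr
    filter_upwards [(eventually_eventually_nhds.2 hs : ∀ᶠ q in 𝓝 p, IsLocSec E EF π q s),
      AdaptedChart.eventually_source hs hd, hcont.eventually hr] with q hq hqd hqr
    rw [jetOr_eq hq]
    exact (hqr (jet h n q s hq) hqd (d.coord_jet_eq hq hqd)).symm
  obtain ⟨h4, h5⟩ := tangentMap_eq_tanParam hg h2 X
  refine ⟨h4, h5.trans (congrArg (tanParam r.s) ?_)⟩
  have h6 := coord_jet (h := h) (n := n + 1) d hs hd
  have h7 : coord d (jet h n p s hs) = (d.base p, b (d.base p)) := d.coord_jet_eq hs hd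
  have h8 : coord d (jet h n p s hs) = ((coord d (jet h (n + 1) p s hs)).1,
      truncFiber (coord d (jet h (n + 1) p s hs)).2) := coord_trunc d (jet h (n + 1) p s hs) hd
  have h9 : (coord d (jet h (n + 1) p s hs)).2.1 = taylorJet (n + 1) u (d.base p) := by
    rw [h6]
  refine Prod.ext (h7.symm.trans h8) (Prod.ext rfl ?_)
  change jetProj E V n (fun k : Fin (n + 1) => (iteratedFDeriv ℝ (k + 1) u (d.base p)).curryLeft
    (mfderiv 𝓘(ℝ, E) 𝓘(ℝ, E) d.base p X)) = jetProj E V n (fun k : Fin (n + 1) =>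
      ((coord d (jet h (n + 1) p s hs)).2.1 k.succ).curryLeft
        (mfderiv 𝓘(ℝ, E) 𝓘(ℝ, E) d.base p X))
  rw [h9]
  rfl

end JetRetract

/-! ### Velocities of families of sections -/

section JetVelocity

variable {E EF V : Type} [NormedAddCommGroup E] [NormedSpace ℝ E] [NormedAddCommGroup EF]
  [NormedSpace ℝ EF] [NormedAddCommGroup V] [NormedSpace ℝ V]
  {M F : Type} [TopologicalSpace M] [ChartedSpace E M] [TopologicalSpace F] [ChartedSpace EF F]
  [IsManifold 𝓘(ℝ, E) ∞ M] [IsManifold 𝓘(ℝ, EF) ∞ F]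
  {π : F → M} {h : IsFibered E EF V π} {n : ℕ}
  {p : M} {s : ℝ → M → F} {σ : M → VertBundle h}

open JetBundle

theorem IsVelocityOfFamily.eventually_isLocSec (H : IsVelocityOfFamily h p s σ) :
    ∀ᶠ t in 𝓝 (0 : ℝ), IsLocSec E EF π p (s t) := by
  have h1 := H.smooth.and H.isSection
  rw [nhds_prod_eq] at h1
  filter_upwards [h1.curry] with t ht
  filter_upwards [ht] with q hq
  exact ⟨ContMDiffAt.comp (I' := 𝓘(ℝ, ℝ).prod 𝓘(ℝ, E)) (f := fun q : M => (t, q)) q hq.1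
    (contMDiffAt_const.prodMk contMDiffAt_id), hq.2⟩

theorem IsVelocityOfFamily.foot_eq (H : IsVelocityOfFamily h p s σ) : (σ p).foot = s 0 p :=
  congrArg (fun v : TangentBundle 𝓘(ℝ, EF) F => v.1) H.velocity_eq.self_of_nhds

theorem IsVelocityOfFamily.tendsto (d : AdaptedChart E EF V π) (hp : p ∈ d.base.source) :
    Filter.Tendsto (fun z : ℝ × E => (z.1, d.base.symm z.2)) (𝓝 (0, d.base p)) (𝓝 (0, p)) := by
  rw [nhds_prod_eq, nhds_prod_eq]
  exact Filter.tendsto_fst.prodMk ((AdaptedChart.tendsto_base_symm hp).comp Filter.tendsto_snd)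

theorem IsVelocityOfFamily.eventually_source (H : IsVelocityOfFamily h p s σ)
    (d : AdaptedChart E EF V π) (hd : s 0 p ∈ d.tot.source) :
    ∀ᶠ z : ℝ × M in 𝓝 (0, p), s z.1 z.2 ∈ d.tot.source :=
  H.smooth.self_of_nhds.continuousAt (d.tot.open_source.mem_nhds hd)

theorem IsVelocityOfFamily.mem_base (H : IsVelocityOfFamily h p s σ)
    (d : AdaptedChart E EF V π) (hd : s 0 p ∈ d.tot.source) : p ∈ d.base.source :=
  AdaptedChart.mem_base H.isSection.self_of_nhds hd

/-- The local representation of a smooth family of sections is jointly smooth. -/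
theorem IsVelocityOfFamily.smoothNear_rep (H : IsVelocityOfFamily h p s σ)
    (d : AdaptedChart E EF V π) (hd : s 0 p ∈ d.tot.source) :
    SmoothNear (fun z : ℝ × E => d.rep (s z.1) z.2) (0, d.base p) := by
  have hp := H.mem_base d hd
  have h2 : ∀ᶠ z : ℝ × E in 𝓝 (0, d.base p), z.2 ∈ d.base.target :=
    continuous_snd.continuousAt (d.base.open_target.mem_nhds (d.base.map_source hp))
  filter_upwards [(IsVelocityOfFamily.tendsto d hp).eventually
    (H.smooth.and (H.eventually_source d hd)), h2] with z hz hz2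
  have h1 : ContMDiffAt 𝓘(ℝ, ℝ × E) (𝓘(ℝ, ℝ).prod 𝓘(ℝ, E)) ∞
      (fun z : ℝ × E => (z.1, d.base.symm z.2)) z :=
    ContMDiffAt.prodMk (contDiffAt_fst.contMDiffAt)
      ((d.base_symm_smooth.contMDiffAt (d.base.open_target.mem_nhds hz2)).comp z
        contDiffAt_snd.contMDiffAt)
  have h3 := (d.tot_smooth.contMDiffAt (d.tot.open_source.mem_nhds hz.2)).comp z (hz.1.comp z h1)
  exact (contMDiffAt_iff_contDiffAt.1 h3).snd

/-- The local representation of the velocity of a family of sections. -/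
theorem IsVelocityOfFamily.rep_eventuallyEq (H : IsVelocityOfFamily h p s σ)
    (d : AdaptedChart E EF V π) (hd : s 0 p ∈ d.tot.source) (w₀ : VertBundle h) :
    (VertBundle.adapted d w₀).rep σ =ᶠ[𝓝 (d.base p)] fun x =>
      (d.rep (s 0) x, fderiv ℝ (fun z : ℝ × E => d.rep (s z.1) z.2) (0, x) (1, 0)) := by
  have hp := H.mem_base d hd
  have t0 : Filter.Tendsto (fun x : E => ((0 : ℝ), x)) (𝓝 (d.base p)) (𝓝 (0, d.base p)) :=
    (Continuous.prodMk continuous_const continuous_id).tendsto _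
  have t1 := (IsVelocityOfFamily.tendsto d hp).comp t0
  filter_upwards [t1.eventually (H.smooth.and (H.eventually_source d hd)),
    t0.eventually (H.smoothNear_rep d hd),
    (AdaptedChart.tendsto_base_symm hp).eventually H.velocity_eq] with x hx hx2 hx3
  set q := d.base.symm x with hq
  have hx1 : ContMDiffAt (𝓘(ℝ, ℝ).prod 𝓘(ℝ, E)) 𝓘(ℝ, EF) ∞ (fun z : ℝ × M => s z.1 z.2) (0, q) :=
    hx.1
  have hx1' : s 0 q ∈ d.tot.source := hx.2
  have hγ : MDifferentiableAt 𝓘(ℝ, ℝ) 𝓘(ℝ, EF) (fun t => s t q) 0 :=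
    (ContMDiffAt.comp (I' := 𝓘(ℝ, ℝ).prod 𝓘(ℝ, E)) (f := fun t : ℝ => (t, q)) (0 : ℝ) hx1
      (contMDiffAt_id.prodMk contMDiffAt_const)).mdifferentiableAt (by simp)
  have h1 : HasMFDerivAt 𝓘(ℝ, EF) 𝓘(ℝ, E × V) d.tot (s 0 q) _ :=
    (d.mdifferentiable.mdifferentiableAt hx1').hasMFDerivAt
  have h2 : HasMFDerivAt 𝓘(ℝ, E × V) 𝓘(ℝ, V) (fun z : E × V => z.2) (d.tot (s 0 q))
      (ContinuousLinearMap.snd ℝ E V) := (hasFDerivAt_snd).hasMFDerivAt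
  have h3 := h2.comp (0 : ℝ) (h1.comp (0 : ℝ) hγ.hasMFDerivAt)
  have h4 : HasFDerivAt (fun t : ℝ => d.rep (s t) x)
      ((fderiv ℝ (fun z : ℝ × E => d.rep (s z.1) z.2) (0, x)).comp
        (ContinuousLinearMap.inl ℝ ℝ E)) 0 :=
    HasFDerivAt.comp (f := fun t : ℝ => (t, x)) (0 : ℝ)
      (hx2.differentiableAt (by simp)).hasFDerivAt (hasFDerivAt_prodMk_left 0 x)
  have h5 := congrArg (fun A : ℝ →L[ℝ] V => A 1) (hasMFDerivAt_unique h3 h4.hasMFDerivAt)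
  have h6 : (VertBundle.adapted d w₀).rep σ x = ((d.tot (σ q).1.1).2,
      Prod.snd (α := E) (β := V) (mfderiv 𝓘(ℝ, EF) 𝓘(ℝ, E × V) d.tot (σ q).1.1 (σ q).1.2)) := rfl
  rw [h6, hx3]
  exact Prod.ext rfl h5

variable [FiniteDimensional ℝ E] [FiniteDimensional ℝ V]

variable (E V n) in
/-- The coordinates of the tangent vector of `JⁿF` given by a jet of the vertical bundle, in terms
of the coordinates of the latter. -/
def vertCoord : E × JetFiber E (V × V) n →L[ℝ] (E × JetFiber E V n) × (E × JetFiber E V n) :=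
  ((ContinuousLinearMap.fst ℝ _ _).prod ((fstJet E V n).comp (ContinuousLinearMap.snd ℝ _ _))).prod
    ((0 : _ →L[ℝ] E).prod ((sndJet E V n).comp (ContinuousLinearMap.snd ℝ _ _)))

/-- The coordinates given by the `n`-jet of the velocity of a family of sections are the Taylor
coefficients of the section and of the derivative in the parameter of the family. -/
theorem IsVelocityOfFamily.vertCoord_eq (H : IsVelocityOfFamily h p s σ)
    (hσ : IsLocSec E (E × (V × V)) (VertBundle.proj h) p σ)
    (d : AdaptedChart E EF V π) (hd : s 0 p ∈ d.tot.source) (w₀ : VertBundle h) :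
    vertCoord E V n (coord (VertBundle.adapted d w₀) (jet (VertBundle.isFibered h) n p σ hσ)) =
      ((d.base p, jetProj E V n (taylorJet n (d.rep (s 0)) (d.base p))),
        (0, jetProj E V n (taylorJet n (fun x => fderiv ℝ (fun z : ℝ × E => d.rep (s z.1) z.2)
          (0, x) (1, 0)) (d.base p)))) := by
  have hd' : σ p ∈ (VertBundle.adapted d w₀).tot.source := by
    change (σ p).foot ∈ d.tot.source
    rwa [H.foot_eq]
  have hsm := AdaptedChart.rep_smoothNear hσ hd'
  have key : ∀ L : V × V →L[ℝ] V, JetFiber.map n L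
      (coord (VertBundle.adapted d w₀) (jet (VertBundle.isFibered h) n p σ hσ)).2 =
      jetProj E V n (taylorJet n (fun x => L (d.rep (s 0) x,
        fderiv ℝ (fun z : ℝ × E => d.rep (s z.1) z.2) (0, x) (1, 0))) (d.base p)) := by
    intro L
    rw [← jetProj_coe (JetFiber.map n L _), coord_jet _ hσ hd']
    refine congrArg (jetProj E V n) ?_
    have h1 : (fun x => L (d.rep (s 0) x,
        fderiv ℝ (fun z : ℝ × E => d.rep (s z.1) z.2) (0, x) (1, 0))) =ᶠ[𝓝 (d.base p)]
        fun x => L ((VertBundle.adapted d w₀).rep σ x) :=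
      (H.rep_eventuallyEq d hd w₀).symm.fun_comp L
    rw [taylorJet_congr h1]
    funext k
    exact (taylorJet_clm_comp L hsm.self k).symm
  exact Prod.ext (Prod.ext rfl (key _)) (Prod.ext rfl (key _))

/-- The velocity of the family of `n`-jets of a family of sections, in coordinates. -/
theorem IsVelocityOfFamily.velocity_jet (H : IsVelocityOfFamily h p s σ)
    (hs : IsLocSec E EF π p (s 0)) (hσ : IsLocSec E (E × (V × V)) (VertBundle.proj h) p σ)
    (d : AdaptedChart E EF V π) (hd : s 0 p ∈ d.tot.source) (w₀ : VertBundle h)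
    {j₁ : JetBundle h n} (r : JetRetract d j₁)
    (hr : ∀ᶠ y in 𝓝 (coord d (jet h n p (s 0) hs)), r.Good y) :
    MDifferentiableAt 𝓘(ℝ, ℝ) (jetI E V n) (fun t => jetOr (jet h n p (s 0) hs) (s t) p) 0 ∧
      velocity (jetI E V n) (fun t => jetOr (jet h n p (s 0) hs) (s t) p) =
        tanParam r.s (vertCoord E V n (coord (VertBundle.adapted d w₀)
          (jet (VertBundle.isFibered h) n p σ hσ))) := by
  have hp := H.mem_base d hd
  set x₀ := d.base p with hx₀
  set U : ℝ × E → V := fun z => d.rep (s z.1) z.2 with hU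
  obtain ⟨O, hO, hOo, hO0⟩ := eventually_nhds_iff.1 (H.smoothNear_rep d hd)
  have hUO : ContDiffOn ℝ ∞ U O := fun z hz => (hO z hz).contDiffWithinAt
  set G : ∀ k : Fin (n + 1), ℝ × E → E [×(k : ℕ)]→L[ℝ] V :=
    fun k z => iteratedFDeriv ℝ k (fun x => U (z.1, x)) z.2 with hG
  have hGd : ∀ k, HasFDerivAt (fun t : ℝ => G k (t, x₀))
      ((fderiv ℝ (G k) (0, x₀)).comp (ContinuousLinearMap.inl ℝ ℝ E)) 0 := fun k =>
    HasFDerivAt.comp (f := fun t : ℝ => (t, x₀)) (0 : ℝ)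
      (((contDiffOn_iteratedFDeriv_param hOo hUO k).contDiffAt
        (hOo.mem_nhds hO0)).differentiableAt (by simp)).hasFDerivAt (hasFDerivAt_prodMk_left 0 x₀)
  set b : ℝ → JetFiber E V n := fun t => jetProj E V n (fun k => G k (t, x₀)) with hb
  have hbd := (jetProj E V n).hasFDerivAt.comp (0 : ℝ) (hasFDerivAt_pi.2 hGd)
  have h2 := ((hasFDerivAt_const (𝕜 := ℝ) x₀ (0 : ℝ)).prodMk hbd).hasMFDerivAt
  have hcont : ContinuousAt (fun t => (x₀, b t)) 0 := h2.continuousAt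
  have h0 : coord d (jet h n p (s 0) hs) = (x₀, b 0) := d.coord_jet_eq hs hd
  have hg : (fun t => jetOr (jet h n p (s 0) hs) (s t) p) =ᶠ[𝓝 0] fun t => r.s (x₀, b t) := by
    rw [h0] at hr
    have t1 : Filter.Tendsto (fun t : ℝ => (t, p)) (𝓝 0) (𝓝 (0, p)) :=
      (Continuous.prodMk continuous_id continuous_const).tendsto _
    filter_upwards [H.eventually_isLocSec, t1.eventually (H.eventually_source d hd),
      hcont.eventually hr] with t ht htd htr
    rw [jetOr_eq ht]
    exact (htr (jet h n p (s t) ht) htd (d.coord_jet_eq ht htd)).symm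
  obtain ⟨h4, h5⟩ := tangentMap_eq_tanParam hg h2 (1 : ℝ)
  refine ⟨h4, h5.trans (congrArg (tanParam r.s) ?_)⟩
  rw [H.vertCoord_eq hσ d hd w₀]
  refine Prod.ext rfl (Prod.ext rfl ?_)
  refine congrArg (jetProj E V n) (funext fun k => ?_)
  -- The derivative in the parameter of the Taylor coefficients is the family of Taylor coefficients of
  -- the derivative in the parameter.
  exact fderiv_iteratedFDeriv_param hOo hUO (1 : ℝ) k hO0

/-- Every jet of the vertical bundle is the jet of the velocity of a family of sections: in an
adapted chart the family may be taken to be affine in the parameter. -/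
theorem exists_isVelocityOfFamily (j : JetBundle (VertBundle.isFibered h) n) :
    ∃ (p : M) (s : ℝ → M → F) (σ : M → VertBundle h)
      (_ : IsLocSec E EF π p (s 0)) (hσ : IsLocSec E (E × (V × V)) (VertBundle.proj h) p σ),
      IsVelocityOfFamily h p s σ ∧ j = jet (VertBundle.isFibered h) n p σ hσ := by
  obtain ⟨p, σ, hσ, rfl⟩ := j.exists_rep
  obtain ⟨d, hd⟩ := h (σ p).foot
  set dV := VertBundle.adapted d (σ p) with hdV
  have hdV' : σ p ∈ dV.tot.source := hd
  have hp : p ∈ d.base.source := AdaptedChart.mem_base (c := dV) hσ.eq hdV'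
  have hsm := AdaptedChart.rep_smoothNear hσ hdV'
  set u : E → V := fun x => (dV.rep σ x).1 with hu
  set u' : E → V := fun x => (dV.rep σ x).2 with hu'
  -- In the adapted chart, the family is `u + t • u'` with `(u, u')` the local representation of `σ`.
  set γ : ℝ × M → E × V := fun z => (d.base z.2, u (d.base z.2) + z.1 • u' (d.base z.2)) with hγ
  have hcoord : ∀ q, σ q ∈ dV.tot.source → VertBundle.proj h (σ q) = q →
      VertBundle.coord d (σ q) = (d.base q, (u (d.base q), u' (d.base q))) := fun q h1 h2 =>
    AdaptedChart.tot_eq (c := dV) h2 h1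
  have hγs : ∀ᶠ z : ℝ × M in 𝓝 (0, p), ContMDiffAt (𝓘(ℝ, ℝ).prod 𝓘(ℝ, E)) 𝓘(ℝ, E × V) ∞ γ z := by
    have t1 : Filter.Tendsto (fun z : ℝ × M => z.2) (𝓝 (0, p)) (𝓝 p) := continuous_snd.tendsto _
    filter_upwards [t1.eventually ((d.base.continuousAt hp).eventually hsm),
      t1.eventually (d.base.open_source.mem_nhds hp)] with z hz hz2
    have h1 : ContMDiffAt (𝓘(ℝ, ℝ).prod 𝓘(ℝ, E)) 𝓘(ℝ, ℝ × E) ∞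
        (fun z : ℝ × M => (z.1, d.base z.2)) z :=
      contMDiffAt_fst.prodMk_space
        ((d.base_smooth.contMDiffAt (d.base.open_source.mem_nhds hz2)).comp z contMDiffAt_snd)
    have h2 : ContDiffAt ℝ ∞ (fun y : ℝ × E => (y.2, u y.2 + y.1 • u' y.2)) (z.1, d.base z.2) := by
      have h3 : ContDiffAt ℝ ∞ (fun y : ℝ × E => dV.rep σ y.2) (z.1, d.base z.2) :=
        ContDiffAt.comp (g := dV.rep σ) (z.1, d.base z.2) hz contDiffAt_snd
      exact contDiffAt_snd.prodMk (h3.fst.add (contDiffAt_fst.smul h3.snd))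
    exact h2.contMDiffAt.comp z h1
  have hγ0 : ∀ q, γ (0, q) = (d.base q, u (d.base q)) := fun q =>
    Prod.ext rfl (by simp [hγ])
  have hγp : γ (0, p) ∈ d.tot.target := by
    rw [hγ0]
    have h1 := d.tot.map_source hd
    have h2 := hcoord p hdV' hσ.eq
    have h3 : d.tot (σ p).foot = (d.base p, u (d.base p)) :=
      Prod.ext (congrArg (fun t : E × (V × V) => t.1) h2)
        (congrArg (fun t : E × (V × V) => t.2.1) h2)
    rwa [h3] at h1
  have hγt : ∀ᶠ z : ℝ × M in 𝓝 (0, p), γ z ∈ d.tot.target :=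
    hγs.self_of_nhds.continuousAt (d.tot.open_target.mem_nhds hγp)
  have H : IsVelocityOfFamily h p (fun t q => d.tot.symm (γ (t, q))) σ := by
    refine ⟨?_, ?_, ?_⟩
    · filter_upwards [hγs, hγt] with z hz hz2
      exact (d.tot_symm_smooth.contMDiffAt (d.tot.open_target.mem_nhds hz2)).comp z hz
    · have t1 : Filter.Tendsto (fun z : ℝ × M => z.2) (𝓝 (0, p)) (𝓝 p) := continuous_snd.tendsto _
      filter_upwards [hγt, t1.eventually (d.base.open_source.mem_nhds hp)] with z hz hz2
      exact (AdaptedChart.proj_symm hz).trans (d.base.left_inv hz2)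
    · have t1 : Filter.Tendsto (fun q : M => ((0 : ℝ), q)) (𝓝 p) (𝓝 (0, p)) :=
        (Continuous.prodMk continuous_const continuous_id).tendsto _
      filter_upwards [AdaptedChart.eventually_source hσ hdV', hσ,
        t1.eventually (hγt.and hγs)] with q hq1 hq2 hq3
      have hc := hcoord q hq1 hq2.2
      have ht : (d.base q, u (d.base q)) ∈ d.tot.target := by
        rw [← hγ0]
        exact hq3.1
      have e1 : σ q = VertBundle.ofCoord h d (d.base q, (u (d.base q), u' (d.base q))) ht :=
        VertBundle.ext_coord d hq1 (d.tot.map_target ht)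
          (hc.trans (VertBundle.coord_ofCoord d _ ht).symm)
      have hd1 : HasDerivAt (fun t => γ (t, q)) ((0, u' (d.base q)) : E × V) (0 : ℝ) := by
        have h2 : HasDerivAt (fun t : ℝ => u (d.base q) + t • u' (d.base q)) (u' (d.base q)) 0 := by
          simpa using ((hasDerivAt_id (0 : ℝ)).smul_const (u' (d.base q))).const_add (u (d.base q))
        exact (hasDerivAt_const (0 : ℝ) (d.base q)).prodMk h2
      have h3 : MDifferentiableAt 𝓘(ℝ, E × V) 𝓘(ℝ, EF) d.tot.symm (γ (0, q)) :=
        d.mdifferentiable.mdifferentiableAt_symm hq3.1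
      have e2 := velocity_comp (γ := fun t => γ (t, q)) h3
        hd1.differentiableAt.mdifferentiableAt
      rw [e1, e2, velocity_vector hd1]
      change _ = tangentMap 𝓘(ℝ, E × V) 𝓘(ℝ, EF) d.tot.symm
        (⟨γ (0, q), ((0, u' (d.base q)) : E × V)⟩ : TangentBundle 𝓘(ℝ, E × V) (E × V))
      rw [hγ0]
      rfl
  exact ⟨p, _, σ, H.eventually_isLocSec.self_of_nhds, hσ, H, rfl⟩

end JetVelocity

/-! ### Jets of the vertical bundle as vertical tangent vectors -/

section VerticalJets

variable {E EF V : Type} [NormedAddCommGroup E] [NormedSpace ℝ E] [NormedAddCommGroup EF]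
  [NormedSpace ℝ EF] [NormedAddCommGroup V] [NormedSpace ℝ V] [FiniteDimensional ℝ E]
  [FiniteDimensional ℝ V]
  {M F : Type} [TopologicalSpace M] [ChartedSpace E M] [TopologicalSpace F] [ChartedSpace EF F]
  [IsManifold 𝓘(ℝ, E) ∞ M] [IsManifold 𝓘(ℝ, EF) ∞ F] {π : F → M}

open JetBundle

theorem exists_jetVelocity (h : IsFibered E EF V π) (n : ℕ)
    (j : JetBundle (VertBundle.isFibered h) n) :
    ∃ z : TangentBundle (jetI E V n) (JetBundle h n), ∃ (p : M) (s : ℝ → M → F)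
      (σ : M → VertBundle h) (hs : IsLocSec E EF π p (s 0))
      (hσ : IsLocSec E (E × (V × V)) (VertBundle.proj h) p σ), IsVelocityOfFamily h p s σ ∧
      j = jet (VertBundle.isFibered h) n p σ hσ ∧
      z = velocity (jetI E V n) fun t => jetOr (jet h n p (s 0) hs) (s t) p := by
  obtain ⟨p, s, σ, hs, hσ, H, hj⟩ := exists_isVelocityOfFamily j
  exact ⟨_, p, s, σ, hs, hσ, H, hj, rfl⟩

/-- The map `Jⁿ(VF) → T(JⁿF)`: the velocity of the `n`-jets of a family of sections whose velocity
has a given `n`-jet. -/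
def jetVelocity (h : IsFibered E EF V π) (n : ℕ) (j : JetBundle (VertBundle.isFibered h) n) :
    TangentBundle (jetI E V n) (JetBundle h n) :=
  (exists_jetVelocity h n j).choose

variable {h : IsFibered E EF V π} {n : ℕ} (j : JetBundle (VertBundle.isFibered h) n)

theorem jetVelocity_spec : ∃ (p : M) (s : ℝ → M → F)
      (σ : M → VertBundle h) (hs : IsLocSec E EF π p (s 0))
      (hσ : IsLocSec E (E × (V × V)) (VertBundle.proj h) p σ), IsVelocityOfFamily h p s σ ∧
      j = jet (VertBundle.isFibered h) n p σ hσ ∧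
      jetVelocity h n j = velocity (jetI E V n) fun t => jetOr (jet h n p (s 0) hs) (s t) p :=
  (exists_jetVelocity h n j).choose_spec

theorem jetVelocity_foot (d : AdaptedChart E EF V π) (hd : j.value.foot ∈ d.tot.source)
    (w₀ : VertBundle h) : (jetVelocity h n j).1.value = j.value.foot ∧
      coord d (jetVelocity h n j).1 =
        (vertCoord E V n (coord (VertBundle.adapted d w₀) j)).1 := by
  obtain ⟨p, s, σ, hs, hσ, H, hj, hz⟩ := jetVelocity_spec j
  have h1 : (jetVelocity h n j).1 = jet h n p (s 0) hs := by
    rw [hz]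
    exact jetOr_eq hs
  have h2 : j.value = σ p := by
    rw [hj]
    rfl
  rw [h2, H.foot_eq] at hd
  rw [h1, h2, H.foot_eq, hj, H.vertCoord_eq hσ d hd w₀]
  exact ⟨rfl, d.coord_jet_eq hs hd⟩

/-- In coordinates, the map `Jⁿ(VF) → T(JⁿF)` is linear. -/
theorem jetVelocity_coord (d : AdaptedChart E EF V π) (hd : j.value.foot ∈ d.tot.source)
    (w₀ : VertBundle h) {j₁ : JetBundle h n} (r : JetRetract d j₁)
    (hr : ∀ᶠ y in 𝓝 (vertCoord E V n (coord (VertBundle.adapted d w₀) j)).1, r.Good y) :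
    jetVelocity h n j = tanParam r.s (vertCoord E V n (coord (VertBundle.adapted d w₀) j)) := by
  rw [← (jetVelocity_foot j d hd w₀).2] at hr
  obtain ⟨p, s, σ, hs, hσ, H, hj, hz⟩ := jetVelocity_spec j
  have h1 : (jetVelocity h n j).1 = jet h n p (s 0) hs := by
    rw [hz]
    exact jetOr_eq hs
  have h2 : j.value = σ p := by
    rw [hj]
    rfl
  rw [h2, H.foot_eq] at hd
  rw [h1] at hr
  rw [hz, (H.velocity_jet hs hσ d hd w₀ r hr).2, ← hj]

variable [T2Space F]

/-- The value of `jetVelocity` does not depend on the chosen family: in coordinates, the velocity of the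
family of jets is a function of the jet of the velocity. -/
theorem IsVelocityOfFamily.jetVelocity_eq {p : M} {s : ℝ → M → F} {σ : M → VertBundle h}
    (H : IsVelocityOfFamily h p s σ) (hs : IsLocSec E EF π p (s 0))
    (hσ : IsLocSec E (E × (V × V)) (VertBundle.proj h) p σ) :
    MDifferentiableAt 𝓘(ℝ, ℝ) (jetI E V n) (fun t => jetOr (jet h n p (s 0) hs) (s t) p) 0 ∧
    jetVelocity h n (jet (VertBundle.isFibered h) n p σ hσ) =
      velocity (jetI E V n) fun t => jetOr (jet h n p (s 0) hs) (s t) p := by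
  obtain ⟨d, hd⟩ := h (s 0 p)
  obtain ⟨r⟩ := exists_jetRetract d (jet h n p (s 0) hs) hd
  obtain ⟨h1, h2⟩ := H.velocity_jet hs hσ d hd (σ p) r r.eventually_good.eventually_nhds.self_of_nhds
  refine ⟨h1, h2 ▸ ?_⟩
  have hd' : (σ p).foot ∈ d.tot.source := by rwa [H.foot_eq]
  refine jetVelocity_coord (jet (VertBundle.isFibered h) n p σ hσ) d hd' (σ p) r ?_
  rw [H.vertCoord_eq hσ d hd (σ p), ← d.coord_jet_eq hs hd]
  exact r.eventually_good

theorem eventually_jetVelocity (d : AdaptedChart E EF V π) (hd : j.value.foot ∈ d.tot.source)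
    (w₀ : VertBundle h) {j₁ : JetBundle h n} (r : JetRetract d j₁)
    (rV : JetRetract (VertBundle.adapted d w₀) j)
    (hr : ∀ᶠ y in 𝓝 (vertCoord E V n (coord (VertBundle.adapted d w₀) j)).1, r.Good y) :
    ∀ᶠ j' in 𝓝 j, jetVelocity h n j' = tanParam r.s (vertCoord E V n (rV.c j')) := by
  have h1 : ContinuousAt (fun j' => (vertCoord E V n (rV.c j')).1) j :=
    (continuous_fst.comp ((vertCoord E V n).continuous.comp
      rV.c.contMDiff.continuous)).continuousAt
  rw [← rV.c_eq.self_of_nhds] at hr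
  filter_upwards [rV.c_eq, h1.eventually hr.eventually_nhds, (isOpen_value_preimage
    (VertBundle.adapted d w₀).tot.open_source).mem_nhds hd] with j' hj' hr' hd'
  rw [hj'] at hr' ⊢
  exact jetVelocity_coord j' d hd' w₀ r hr'

theorem contMDiff_jetVelocity : ContMDiff (jetI E (V × V) n) (jetI E V n).tangent ∞
    (jetVelocity h n) := by
  intro j
  obtain ⟨d, hd⟩ := h j.value.foot
  obtain ⟨h1, h2⟩ := jetVelocity_foot j d hd j.value
  obtain ⟨r⟩ := exists_jetRetract d (jetVelocity h n j).1 (h1 ▸ hd)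
  obtain ⟨rV⟩ := exists_jetRetract (VertBundle.adapted d j.value) j hd
  have h3 := eventually_jetVelocity j d hd j.value r rV (h2 ▸ r.eventually_good)
  refine ContMDiffAt.congr_of_eventuallyEq ?_ h3
  exact ((tanParam r.s).contMDiff.comp
    ((vertCoord E V n).contDiff.contMDiff.comp rV.c.contMDiff)) j

variable (h n) in
/-- The map `Jⁿ(VF) → T(JⁿF)` as a smooth map. -/
def jetVelocityCM : C^∞⟮jetI E (V × V) n, JetBundle (VertBundle.isFibered h) n;
    (jetI E V n).tangent, TangentBundle (jetI E V n) (JetBundle h n)⟯ :=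
  ⟨jetVelocity h n, contMDiff_jetVelocity⟩

theorem isJetVelocityMap_jetVelocityCM : IsJetVelocityMap h n (jetVelocityCM h n) :=
  fun _ _ _ hs hσ H => (H.jetVelocity_eq hs hσ).2

theorem tangentCM_trunc_jetVelocity : (tangentCM (truncCM h n)).comp (jetVelocityCM h (n + 1)) =
    (jetVelocityCM h n).comp (truncCM (VertBundle.isFibered h) n) := by
  ext1 j
  obtain ⟨p, s, σ, hs, hσ, H, hj, hz⟩ := jetVelocity_spec j
  obtain ⟨h1, -⟩ := H.jetVelocity_eq (n := n + 1) hs hσ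
  obtain ⟨-, h2⟩ := H.jetVelocity_eq (n := n) hs hσ
  have h3 : j.trunc = jet (VertBundle.isFibered h) n p σ hσ := by
    rw [hj]
    rfl
  change tangentMap (jetI E V (n + 1)) (jetI E V n) trunc (jetVelocity h (n + 1) j) =
    jetVelocity h n j.trunc
  rw [h3, h2, hz, ← velocity_comp (f := trunc) ((truncCM h n).mdifferentiableAt) h1]
  congr 1
  funext t
  unfold jetOr
  split_ifs <;> rfl

/-- The image of `Jⁿ(VF)` consists of tangent vectors which are vertical over `M`. -/
theorem jetVelocity_pt : tangentMap (jetI E V n) 𝓘(ℝ, E) pt (jetVelocity h n j) =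
    (⟨j.pt, (0 : E)⟩ : TangentBundle 𝓘(ℝ, E) M) := by
  obtain ⟨p, s, σ, hs, hσ, H, hj, hz⟩ := jetVelocity_spec j
  obtain ⟨h1, -⟩ := H.jetVelocity_eq (n := n) hs hσ
  rw [hz, ← velocity_comp (f := pt) ((ptCM h n).mdifferentiableAt) h1, hj]
  have h4 : (fun t => (jetOr (jet h n p (s 0) hs) (s t) p).pt) = fun _ => p := by
    funext t
    unfold jetOr
    split_ifs <;> rfl
  rw [h4]
  change (⟨p, mfderiv 𝓘(ℝ, ℝ) 𝓘(ℝ, E) (fun _ => p) (0 : ℝ) (1 : ℝ)⟩ : TangentBundle 𝓘(ℝ, E) M) = _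
  rw [mfderiv_const]
  rfl

end VerticalJets

section RetractTangent

variable {E H N B : Type} [NormedAddCommGroup E] [NormedSpace ℝ E]
  [TopologicalSpace H] {I : ModelWithCorners ℝ E H} [TopologicalSpace N]
  [ChartedSpace H N] [IsManifold I ∞ N] [NormedAddCommGroup B] [NormedSpace ℝ B]

theorem tanCoord_tanParam {c : C^∞⟮I, N; 𝓘(ℝ, B), B⟯} {s : C^∞⟮𝓘(ℝ, B), B; I, N⟯} {z : B × B}
    (h : ∀ᶠ y in 𝓝 z.1, c (s y) = y) : tanCoord c (tanParam s z) = z := by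
  have h1 := (c.mdifferentiableAt (x := s z.1)).hasMFDerivAt.comp z.1
    (s.mdifferentiableAt (x := z.1)).hasMFDerivAt
  have h2 : HasMFDerivAt 𝓘(ℝ, B) 𝓘(ℝ, B) (fun y => c (s y)) z.1 (ContinuousLinearMap.id ℝ B) :=
    (hasMFDerivAt_id z.1).congr_of_eventuallyEq h
  exact Prod.ext h.self_of_nhds
    (congrArg (fun A : B →L[ℝ] B => A z.2) (hasMFDerivAt_unique h1 h2))

theorem dFun_congr {f g : C^∞⟮I, N; ℝ⟯} {v : TangentBundle I N} (h : ∀ᶠ y in 𝓝 v.1, f y = g y) :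
    dFun f v = dFun g v :=
  congrArg (fun A : E →L[ℝ] ℝ => A v.2)
    (show mfderiv I 𝓘(ℝ, ℝ) f v.1 = mfderiv I 𝓘(ℝ, ℝ) g v.1 from
      Filter.EventuallyEq.mfderiv_eq h)

end RetractTangent

/-! ### The image of `Jⁿ(VF)` in `T(JⁿF)` -/

section Image

variable {E₁ H₁ Z E₂ H₂ N B : Type} [NormedAddCommGroup E₁] [NormedSpace ℝ E₁]
  [FiniteDimensional ℝ E₁] [TopologicalSpace H₁] {I₁ : ModelWithCorners ℝ E₁ H₁}
  [TopologicalSpace Z] [ChartedSpace H₁ Z] [IsManifold I₁ ∞ Z] [T2Space Z]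
  [SecondCountableTopology Z] [NormedAddCommGroup E₂] [NormedSpace ℝ E₂]
  [TopologicalSpace H₂] {I₂ : ModelWithCorners ℝ E₂ H₂} [TopologicalSpace N]
  [ChartedSpace H₂ N] [NormedAddCommGroup B] [NormedSpace ℝ B] [FiniteDimensional ℝ B]

/-- A plot of `N` factors through `f : Z → N` if locally it is fixed by `f ∘ ρ` for some
`ρ : N → Z`. -/
theorem exists_comp_smoothPullback_eq {f : C^∞⟮I₁, Z; I₂, N⟯}
    (hf : IsTestFamily (I := I₁) B (smoothPullback f : C^∞⟮I₂, N; ℝ⟯ → C^∞⟮I₁, Z; ℝ⟯))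
    {X : ThCartSp} (ψ : C^∞⟮I₂, N; ℝ⟯ →ₐ[ℝ] X.O)
    (h : ∀ p₀ : Cart X.k, ∃ ρ : C^∞⟮I₂, N; I₁, Z⟯, ∀ᶠ p in 𝓝 p₀, ∀ g,
      evalPoint X p (ψ (smoothPullback ρ (smoothPullback f g))) = evalPoint X p (ψ g)) :
    ∃ φ : C^∞⟮I₁, Z; ℝ⟯ →ₐ[ℝ] X.O, φ.comp (smoothPullback f) = ψ := by
  obtain ⟨φ, hφ⟩ := hf.exists_plot ψ fun p₀ => by
    obtain ⟨ρ, hρ⟩ := h p₀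
    exact ⟨ψ.comp (smoothPullback ρ), hρ⟩
  exact ⟨φ, AlgHom.ext hφ⟩

end Image

section TangentImage

variable {E₁ H₁ Z E₂ H₂ N B B' : Type} [NormedAddCommGroup E₁] [NormedSpace ℝ E₁]
  [TopologicalSpace H₁] {I₁ : ModelWithCorners ℝ E₁ H₁}
  [FiniteDimensional ℝ E₁] [TopologicalSpace Z] [ChartedSpace H₁ Z] [IsManifold I₁ ∞ Z] [T2Space Z]
  [SecondCountableTopology Z] [NormedAddCommGroup E₂] [NormedSpace ℝ E₂] [FiniteDimensional ℝ E₂] [TopologicalSpace H₂] {I₂ : ModelWithCorners ℝ E₂ H₂}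
  [I₂.Boundaryless] [TopologicalSpace N] [ChartedSpace H₂ N] [IsManifold I₂ ∞ N] [T2Space N]
  [SecondCountableTopology N] [NormedAddCommGroup B] [NormedSpace ℝ B] [FiniteDimensional ℝ B]
  [NormedAddCommGroup B'] [NormedSpace ℝ B']

/-- A continuous linear map as a smooth map. -/
def clmCM (L : B →L[ℝ] B') : C^∞⟮𝓘(ℝ, B), B; 𝓘(ℝ, B'), B'⟯ := ⟨L, L.contDiff.contMDiff⟩

/-- A map to a Weil algebra is unchanged by a linear projection `P` if it kills the linear
coordinates of the complement. -/
theorem comp_smoothPullback_clmCM_eq {W : Type} [CommRing W] [Algebra ℝ W]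
    [IsWeilAlgebra W] (Ψ : C^∞⟮𝓘(ℝ, B), B; ℝ⟯ →ₐ[ℝ] W) {P : B →L[ℝ] B} {i : B' →L[ℝ] B}
    {q : B →L[ℝ] B'} (hP : ∀ z, P z + i (q z) = z)
    (hΨ : ∀ m : B' →L[ℝ] ℝ, Ψ (linFun (m.comp q)) = 0) :
    Ψ.comp (smoothPullback (clmCM P)) = Ψ := by
  refine algHom_ext_of_linFun fun ℓ => ?_
  have h1 : linFun ℓ = smoothPullback (clmCM P) (linFun ℓ) + linFun ((ℓ.comp i).comp q) := by
    ext z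
    change ℓ z = ℓ (P z) + ℓ (i (q z))
    rw [← map_add, hP]
  conv_rhs => rw [h1]
  rw [map_add, hΨ, add_zero]
  rfl

/-- A plot of `TN` factors through `f : Z → TN` if, in coordinates of `TN`, some `f ∘ ρ` is a
projection killing some components of the velocity, and these components vanish along the plot. -/
theorem exists_comp_smoothPullback_eq_of_vertical {B₁ : Type} [NormedAddCommGroup B₁]
    [NormedSpace ℝ B₁] [FiniteDimensional ℝ B₁] {f : C^∞⟮I₁, Z; I₂.tangent, TangentBundle I₂ N⟯}
    (hf : IsTestFamily (I := I₁) B₁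
      (smoothPullback f : C^∞⟮I₂.tangent, TangentBundle I₂ N; ℝ⟯ → C^∞⟮I₁, Z; ℝ⟯)) {X : ThCartSp}
    (ψ : C^∞⟮I₂.tangent, TangentBundle I₂ N; ℝ⟯ →ₐ[ℝ] X.O)
    {P : B × B →L[ℝ] B × B} {i : B' →L[ℝ] B × B}
    {q : B →L[ℝ] B'} (hP : ∀ z, P z + i (q.comp (ContinuousLinearMap.snd ℝ B B) z) = z)
    (H : ∀ z₀ : TangentBundle I₂ N, ∃ (r : RetractChart I₂ N B z₀.1)
      (ρ : C^∞⟮I₂.tangent, TangentBundle I₂ N; I₁, Z⟯)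
      (G : (B' →L[ℝ] ℝ) → C^∞⟮I₂.tangent, TangentBundle I₂ N; ℝ⟯), (∀ m, ψ (G m) = 0) ∧
      (∀ᶠ z in 𝓝 z₀, f (ρ z) = tanParam r.s (P (tanCoord r.c z))) ∧
      ∀ᶠ z in 𝓝 z₀, ∀ m : B' →L[ℝ] ℝ, dFun (coordFun r.c (m.comp q)) z = G m z) :
    ∃ φ : C^∞⟮I₁, Z; ℝ⟯ →ₐ[ℝ] X.O, φ.comp (smoothPullback f) = ψ := by
  refine exists_comp_smoothPullback_eq hf ψ fun p₀ => ?_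
  obtain ⟨r, ρ, G, hG, hρ, hq⟩ := H (bodyMap ψ p₀)
  refine ⟨ρ, ?_⟩
  have hcont : ContinuousAt (bodyMap ψ) p₀ := (continuous_bodyMap ψ).continuousAt
  filter_upwards [hcont.eventually hρ.eventually_nhds, hcont.eventually hq.eventually_nhds,
    r.tangent.eventually_evalPoint ψ] with p hp hpb hpt g
  have e : ((evalPoint X p).comp (ψ.comp (smoothPullback (tanCoord r.c)))).comp
      (smoothPullback (clmCM P)) =
      (evalPoint X p).comp (ψ.comp (smoothPullback (tanCoord r.c))) := by
    refine comp_smoothPullback_clmCM_eq _ hP fun m => ?_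
    change evalPoint X p (ψ (coordFun (tanCoord r.c) _)) = 0
    rw [coordFun_tanCoord]
    have h1 : ((m.comp (q.comp (ContinuousLinearMap.snd ℝ B B))).comp
        (ContinuousLinearMap.inl ℝ B B)) = 0 :=
      ContinuousLinearMap.ext fun _ => (congrArg m (map_zero q)).trans (map_zero m)
    have h2 : coordFun r.c (0 : B →L[ℝ] ℝ) = 0 := rfl
    have h3 : (m.comp (q.comp (ContinuousLinearMap.snd ℝ B B))).comp
      (ContinuousLinearMap.inr ℝ B B) = m.comp q := rfl
    rw [h1, h2, h3, map_zero, zero_add,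
      evalPoint_eq_of_eventuallyEq ψ (hpb.mono fun z hz => hz m), hG, map_zero]
  refine (evalPoint_eq_of_eventuallyEq ψ (g := smoothPullback (tanCoord r.c)
    (smoothPullback (clmCM P) (smoothPullback (tanParam r.s) g))) ?_).trans ?_
  · exact hp.mono fun z hz => congrArg g hz
  · exact (DFunLike.congr_fun e (smoothPullback (tanParam r.s) g)).trans (hpt g).symm

end TangentImage

section VerticalImage

variable {E EF V : Type} [NormedAddCommGroup E] [NormedSpace ℝ E] [NormedAddCommGroup EF]
  [NormedSpace ℝ EF] [NormedAddCommGroup V] [NormedSpace ℝ V] [FiniteDimensional ℝ E]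
  [FiniteDimensional ℝ V]
  {M F : Type} [TopologicalSpace M] [ChartedSpace E M] [TopologicalSpace F] [ChartedSpace EF F]

open JetBundle

variable (E V) in
/-- The linear map `((x, A), (ẋ, Ȧ)) ↦ (x, (A, Ȧ))` from the coordinates of `T(JⁿF)` to those of
`Jⁿ(VF)`. -/
def unvertCoord (n : ℕ) :
    (E × JetFiber E V n) × (E × JetFiber E V n) →L[ℝ] E × JetFiber E (V × V) n :=
  ((ContinuousLinearMap.fst ℝ _ _).comp (ContinuousLinearMap.fst ℝ _ _)).prod
    (pairJet.comp (((ContinuousLinearMap.snd ℝ _ _).comp (ContinuousLinearMap.fst ℝ _ _)).prod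
      ((ContinuousLinearMap.snd ℝ _ _).comp (ContinuousLinearMap.snd ℝ _ _))))

variable {n : ℕ}

theorem unvertCoord_vertCoord (y : E × JetFiber E (V × V) n) :
    unvertCoord E V n (vertCoord E V n y) = y :=
  Prod.ext rfl (pairJet_fst_snd y.2)

theorem vertCoord_unvertCoord (z : (E × JetFiber E V n) × (E × JetFiber E V n)) :
    vertCoord E V n (unvertCoord E V n z) = (z.1, (0, z.2.2)) :=
  Prod.ext (Prod.ext rfl (fstJet_pairJet _ _)) (Prod.ext rfl (sndJet_pairJet _ _))

theorem vertCoord_unvertCoord_add (z : (E × JetFiber E V n) × (E × JetFiber E V n)) :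
    (vertCoord E V n).comp (unvertCoord E V n) z +
      (ContinuousLinearMap.inr ℝ (E × JetFiber E V n) (E × JetFiber E V n)).comp
        (ContinuousLinearMap.inl ℝ E (JetFiber E V n))
        ((ContinuousLinearMap.fst ℝ E (JetFiber E V n)).comp
          (ContinuousLinearMap.snd ℝ (E × JetFiber E V n) (E × JetFiber E V n)) z) = z := by
  refine (congrArg (· + _) (vertCoord_unvertCoord z)).trans ?_
  exact Prod.ext (add_zero _) (Prod.ext (zero_add _) (add_zero _))

variable {π : F → M} {h : IsFibered E EF V π}

theorem JetRetract.eventually_c_s {d : AdaptedChart E EF V π} {j : JetBundle h n}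
    (r : JetRetract d j) (hj : j.value ∈ d.tot.source) :
    ∀ᶠ y in 𝓝 (coord d j), r.c (r.s y) = y := by
  have h1 : r.s (coord d j) = j := r.eventually_good.self_of_nhds j hj rfl
  have h2 : ContinuousAt r.s (coord d j) := r.s.contMDiff.continuous.continuousAt
  have h3 : ∀ᶠ j' in 𝓝 (r.s (coord d j)), r.c j' = coord d j' := h1.symm ▸ r.c_eq
  filter_upwards [h2.eventually h3, r.s_eq] with y hy hy'
  rw [hy, hy'.2]

variable [IsManifold 𝓘(ℝ, E) ∞ M] [IsManifold 𝓘(ℝ, EF) ∞ F] [T2Space F]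

/-- In coordinates, `Jⁿ(VF) → T(JⁿF)` is an injective linear map. -/
theorem jetVelocity_injective (h : IsFibered E EF V π) (n : ℕ) :
    Function.Injective (jetVelocity h n) := by
  intro j j' hjj
  obtain ⟨d, hd⟩ := h j.value.foot
  obtain ⟨h1, h2⟩ := jetVelocity_foot j d hd j.value
  have hd' : j'.value.foot ∈ d.tot.source := by
    obtain ⟨d', hd'⟩ := h j'.value.foot
    rwa [← (jetVelocity_foot j' d' hd' j.value).1, ← hjj, h1]
  obtain ⟨-, h2'⟩ := jetVelocity_foot j' d hd' j.value
  have hv : (jetVelocity h n j).1.value ∈ d.tot.source := h1 ▸ hd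
  obtain ⟨r⟩ := exists_jetRetract d (jetVelocity h n j).1 hv
  have hgood := r.eventually_good
  have hcs := r.eventually_c_s hv
  have e := jetVelocity_coord j d hd j.value r (h2 ▸ hgood)
  have h3 : coord d (jetVelocity h n j).1 =
    (vertCoord E V n (coord (VertBundle.adapted d j.value) j')).1 := by rw [← h2', hjj]
  have e' := jetVelocity_coord j' d hd' j.value r (h3 ▸ hgood)
  have h5 := congrArg (tanCoord r.c) (e.symm.trans (hjj.trans e'))
  rw [tanCoord_tanParam (h2 ▸ hcs), tanCoord_tanParam (h3 ▸ hcs)] at h5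
  have h6 := congrArg (unvertCoord E V n) h5
  rw [unvertCoord_vertCoord, unvertCoord_vertCoord] at h6
  exact ext_coord (VertBundle.adapted d j.value) hd hd' h6

/-- Near every point, coordinates on `Jⁿ(VF)` can be read off from the coordinates on `T(JⁿF)`. -/
theorem exists_retractChart_jetVelocity (j : JetBundle (VertBundle.isFibered h) n) :
    ∃ (r : RetractChart (jetI E (V × V) n) (JetBundle (VertBundle.isFibered h) n)
        (E × JetFiber E (V × V) n) j)
      (c : C^∞⟮(jetI E V n).tangent, TangentBundle (jetI E V n) (JetBundle h n);
        𝓘(ℝ, E × JetFiber E (V × V) n), E × JetFiber E (V × V) n⟯),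
      r.c = c.comp (jetVelocityCM h n) := by
  obtain ⟨d, hd⟩ := h j.value.foot
  obtain ⟨h1, h2⟩ := jetVelocity_foot j d hd j.value
  have hv : (jetVelocity h n j).1.value ∈ d.tot.source := h1 ▸ hd
  obtain ⟨r⟩ := exists_jetRetract d (jetVelocity h n j).1 hv
  obtain ⟨rV⟩ := exists_jetRetract (VertBundle.adapted d j.value) j hd
  have hcs := (r.eventually_c_s hv).eventually_nhds
  rw [h2, ← rV.c_eq.self_of_nhds] at hcs
  have hcont : ContinuousAt (fun j' => (vertCoord E V n (rV.c j')).1) j :=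
    (continuous_fst.comp ((vertCoord E V n).continuous.comp
      rV.c.contMDiff.continuous)).continuousAt
  let c := (clmCM (unvertCoord E V n)).comp (tanCoord r.c)
  refine ⟨{ c := c.comp (jetVelocityCM h n), s := rV.s, retract := ?_ }, c, rfl⟩
  filter_upwards [eventually_jetVelocity j d hd j.value r rV (h2 ▸ r.eventually_good),
    rV.retract, hcont.eventually hcs] with j' hj' hr hc
  change rV.s (unvertCoord E V n (tanCoord r.c (jetVelocity h n j'))) = j'
  rw [hj', tanCoord_tanParam hc, unvertCoord_vertCoord, hr]

/-- In coordinates, the projection killing the velocity of the base point factors through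
`Jⁿ(VF)`. -/
theorem exists_vertical_retraction (d : AdaptedChart E EF V π)
    {z₀ : TangentBundle (jetI E V n) (JetBundle h n)} (hd : z₀.1.value ∈ d.tot.source)
    (r : JetRetract d z₀.1) :
    ∃ ρ : C^∞⟮(jetI E V n).tangent, TangentBundle (jetI E V n) (JetBundle h n);
      jetI E (V × V) n, JetBundle (VertBundle.isFibered h) n⟯,
      ∀ᶠ z in 𝓝 z₀, jetVelocityCM h n (ρ z) =
        tanParam r.s ((vertCoord E V n).comp (unvertCoord E V n) (tanCoord r.c z)) := by
  set ζ := tanCoord r.c z₀ with hζ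
  have hζ1 : ζ.1 = coord d z₀.1 := r.c_eq.self_of_nhds
  have htgt : (ζ.1.1, jetVal ζ.1.2) ∈ d.tot.target := by
    rw [hζ1, jetVal_coord d hd]
    exact d.tot.map_source hd
  let w₀ : VertBundle h := VertBundle.ofCoord h d (ζ.1.1, (jetVal ζ.1.2, 0)) htgt
  let dV := VertBundle.adapted d w₀
  have hK : ((unvertCoord E V n ζ).1, jetVal (unvertCoord E V n ζ).2) ∈ dV.tot.target := by
    have h1 : jetVal (fstJet E V n (pairJet (ζ.1.2, ζ.2.2))) = jetVal ζ.1.2 := by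
      rw [fstJet_pairJet]
    rw [← h1] at htgt
    exact htgt
  let j₀ : JetBundle (VertBundle.isFibered h) n := ofCoord (VertBundle.isFibered h) dV _ _ hK
  have hj₀ : coord dV j₀ = unvertCoord E V n ζ := coord_ofCoord dV hK
  have hj₀v : j₀.value ∈ dV.tot.source := by
    have h1 : j₀.value = _ := value_ofCoord dV hK
    rw [h1]
    exact dV.tot.map_target hK
  obtain ⟨rV⟩ := exists_jetRetract dV j₀ hj₀v
  refine ⟨(rV.s.comp (clmCM (unvertCoord E V n))).comp (tanCoord r.c), ?_⟩
  have htan : ContinuousAt (tanCoord r.c) z₀ := (tanCoord r.c).contMDiff.continuous.continuousAt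
  have h1 : ContinuousAt (fun z => unvertCoord E V n (tanCoord r.c z)) z₀ :=
    (unvertCoord E V n).continuous.continuousAt.comp htan
  have h2 := rV.s_eq
  rw [hj₀] at h2
  have h3 := r.eventually_good.eventually_nhds
  rw [← hζ1] at h3
  filter_upwards [h1.eventually h2, (continuous_fst.continuousAt.comp htan).eventually h3]
    with z hz hz'
  have h4 := jetVelocity_coord (rV.s (unvertCoord E V n (tanCoord r.c z))) d hz.1 w₀ r (by
    change ∀ᶠ y in 𝓝 (vertCoord E V n (coord dV (rV.s (unvertCoord E V n (tanCoord r.c z))))).1, _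
    rw [hz.2, vertCoord_unvertCoord]
    exact hz')
  exact h4.trans (congrArg (fun t => tanParam r.s (vertCoord E V n t)) hz.2)

variable [T2Space M]

/-- Near a given point, the velocity of the base point is the differential of functions on the
base. -/
theorem exists_base_coordinates (d : AdaptedChart E EF V π)
    {z₀ : TangentBundle (jetI E V n) (JetBundle h n)} (hd : z₀.1.value ∈ d.tot.source)
    (r : JetRetract d z₀.1) : ∃ b : C^∞⟮𝓘(ℝ, E), M; 𝓘(ℝ, E), E⟯, ∀ᶠ z in 𝓝 z₀, ∀ m : E →L[ℝ] ℝ,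
      dFun (coordFun r.c (m.comp (ContinuousLinearMap.fst ℝ E (JetFiber E V n)))) z =
        dFun (smoothPullback (ptCM h n) (coordFun b m)) z := by
  obtain ⟨rM, -, hrM, -⟩ := exists_retractChart_of_chart (I := 𝓘(ℝ, E)) d.base.toPartialEquiv
    (d.base.open_source.mem_nhds (d.maps _ hd))
    (d.base.open_target.mem_nhds (d.base.map_source (d.maps _ hd)))
    d.base_smooth d.base_symm_smooth Filter.univ_mem
  have hpt : z₀.1.pt = π z₀.1.value := by
    obtain ⟨p, s, hs, hj⟩ := z₀.1.exists_rep
    rw [hj]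
    exact hs.eq.symm
  have hrM : ∀ᶠ y in 𝓝 z₀.1.pt, rM.c y = d.base y := by
    rw [hpt]
    exact hrM
  refine ⟨rM.c, ?_⟩
  have h1 : ContinuousAt (fun v : TangentBundle (jetI E V n) (JetBundle h n) => v.1) z₀ :=
    (tangentProjCM (jetI E V n) (JetBundle h n)).contMDiff.continuous.continuousAt
  have h2 : ContinuousAt (ptCM h n) z₀.1 := (ptCM h n).contMDiff.continuous.continuousAt
  filter_upwards [h1.eventually (r.c_eq.and (h2.eventually hrM)).eventually_nhds] with z hz m
  refine dFun_congr (hz.mono fun j hj => ?_)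
  exact congrArg m ((congrArg Prod.fst hj.1).trans hj.2.symm)

set_option maxHeartbeats 1000000 in
/-- In coordinates near `z₀`, the velocity of the base point is killed by a map which factors through
`Jⁿ(VF)`, and is the differential of functions on the base. -/
theorem exists_vertical_coordinates (z₀ : TangentBundle (jetI E V n) (JetBundle h n)) :
    ∃ (r : RetractChart (jetI E V n) (JetBundle h n) (E × JetFiber E V n) z₀.1)
      (ρ : C^∞⟮(jetI E V n).tangent, TangentBundle (jetI E V n) (JetBundle h n);
        jetI E (V × V) n, JetBundle (VertBundle.isFibered h) n⟯)
      (b : C^∞⟮𝓘(ℝ, E), M; 𝓘(ℝ, E), E⟯),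
      (∀ᶠ z in 𝓝 z₀, jetVelocityCM h n (ρ z) =
        tanParam r.s ((vertCoord E V n).comp (unvertCoord E V n) (tanCoord r.c z))) ∧
      ∀ᶠ z in 𝓝 z₀, ∀ m : E →L[ℝ] ℝ,
        dFun (coordFun r.c (m.comp (ContinuousLinearMap.fst ℝ E (JetFiber E V n)))) z =
          dFun (smoothPullback (ptCM h n) (coordFun b m)) z := by
  obtain ⟨d, hd⟩ := h z₀.1.value
  obtain ⟨r⟩ := exists_jetRetract d z₀.1 hd
  obtain ⟨ρ, hρ⟩ := exists_vertical_retraction d hd r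
  obtain ⟨b, hb⟩ := exists_base_coordinates d hd r
  exact ⟨r.toRetractChart, ρ, b, hρ, hb⟩

variable [SecondCountableTopology F]

/-- The functions pulled back from `T(JⁿF)` determine the plots of `Jⁿ(VF)`. -/
theorem isTestFamily_jetVelocityCM (h : IsFibered E EF V π) (n : ℕ) :
    IsTestFamily (I := jetI E (V × V) n) (E × JetFiber E (V × V) n)
      (smoothPullback (jetVelocityCM h n) : C^∞⟮(jetI E V n).tangent,
        TangentBundle (jetI E V n) (JetBundle h n); ℝ⟯ → _) where
  separates j j' hj := jetVelocity_injective h n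
    (eq_of_forall_apply_eq (I := (jetI E V n).tangent) hj)
  exists_chart j := by
    obtain ⟨r, c, hr⟩ := exists_retractChart_jetVelocity j
    refine ⟨r, fun ℓ => Algebra.subset_adjoin ⟨coordFun c ℓ, ?_⟩⟩
    rw [hr]
    rfl

/-- The plots of `Jⁿ(VF)` are the plots of `T(JⁿF)` on which the differentials of the functions on
the base vanish. -/
theorem exists_plot_comp_jetVelocity {X : ThCartSp}
    (ψ : C^∞⟮(jetI E V n).tangent, TangentBundle (jetI E V n) (JetBundle h n); ℝ⟯ →ₐ[ℝ] X.O)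
    (hψ : ∀ f : C^∞⟮𝓘(ℝ, E), M; ℝ⟯, ψ (dFun (smoothPullback (ptCM h n) f)) = 0) :
    ∃ φ : C^∞⟮jetI E (V × V) n, JetBundle (VertBundle.isFibered h) n; ℝ⟯ →ₐ[ℝ] X.O,
      φ.comp (smoothPullback (jetVelocityCM h n)) = ψ := by
  refine exists_comp_smoothPullback_eq_of_vertical (I₁ := jetI E (V × V) n) (I₂ := jetI E V n)
    (B := E × JetFiber E V n) (B' := E) (f := jetVelocityCM h n)
    (P := (vertCoord E V n).comp (unvertCoord E V n))
    (i := (ContinuousLinearMap.inr ℝ (E × JetFiber E V n) (E × JetFiber E V n)).comp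
        (ContinuousLinearMap.inl ℝ E (JetFiber E V n)))
    (q := ContinuousLinearMap.fst ℝ E (JetFiber E V n)) (isTestFamily_jetVelocityCM h n) ψ
    vertCoord_unvertCoord_add fun z₀ => ?_
  obtain ⟨r, ρ, b, hρ, hb⟩ := exists_vertical_coordinates z₀
  exact ⟨r, ρ, _, fun m => hψ (coordFun b m), hρ, hb⟩

end VerticalImage

/-! ### The vertical bundle of the infinite jet bundle -/

section ZeroSection

variable {E H E' H' N' E'' H'' N'' : Type} [NormedAddCommGroup E] [NormedSpace ℝ E]
  [TopologicalSpace H] {I : ModelWithCorners ℝ E H} {N : Type} [TopologicalSpace N]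
  [ChartedSpace H N]
  [NormedAddCommGroup E'] [NormedSpace ℝ E']
  [TopologicalSpace H'] {I' : ModelWithCorners ℝ E' H'} [TopologicalSpace N'] [ChartedSpace H' N']
  [NormedAddCommGroup E''] [NormedSpace ℝ E'']
  [TopologicalSpace H''] {I'' : ModelWithCorners ℝ E'' H''} [TopologicalSpace N'']
  [ChartedSpace H'' N'']

theorem yMap_comp (g : C^∞⟮I', N'; I'', N''⟯) (f : C^∞⟮I, N; I', N'⟯) :
    yMap (g.comp f) = yMap f ≫ yMap g := rfl

variable [IsManifold I ∞ N]

variable (I N) in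
/-- The zero section of the tangent bundle of a manifold. -/
def zeroSectionCM : C^∞⟮I, N; I.tangent, TangentBundle I N⟯ :=
  ⟨Bundle.zeroSection E (TangentSpace I : N → Type), Bundle.contMDiff_zeroSection ℝ _⟩

/-- The zero section of the tangent bundle corresponds to the synthetic one. -/
theorem zeroSectionCM_kappa : yMap (zeroSectionCM I N) ≫ kappa I N = synTZero (yMan I N) := by
  refine thSmthSet_hom_ext fun X φ => ?_
  change C^∞⟮I, N; ℝ⟯ →ₐ[ℝ] X.O at φ
  refine AlgHom.ext fun f => ?_
  have h1 : smoothPullback (zeroSectionCM I N) (dFun f) = 0 := by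
    ext x
    exact map_zero (mfderiv I 𝓘(ℝ, ℝ) f x)
  have h2 : smoothPullback (zeroSectionCM I N) (smoothPullback (tangentProjCM I N) f) = f := rfl
  refine (kappa_apply (φ.comp (smoothPullback (zeroSectionCM I N))) f).trans ?_
  rw [AlgHom.comp_apply, AlgHom.comp_apply, h1, h2, map_zero, map_zero, zero_mul, add_zero]
  rfl

end ZeroSection

section SyntheticZero

variable {G : ThSmthSet} {X : ThCartSp}

theorem synTZero_proj (G : ThSmthSet) : synTZero G ≫ synTProj G = 𝟙 G := by
  refine thSmthSet_hom_ext fun X x => ?_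
  change res G (X.point _) (res G (X.fst D1) x) = x
  have h1 : X.point (TrivSqZeroExt.fstHom ℝ ℝ ℝ) ≫ X.fst D1 = 𝟙 X := ThCartSp.pair_fst _ _
  have h2 : G.obj.map (X.fst D1).op ≫ G.obj.map (X.point (TrivSqZeroExt.fstHom ℝ ℝ ℝ)).op =
      𝟙 (G.obj.obj (op X)) := by
    rw [← G.obj.map_comp, ← op_comp, h1, op_id, G.obj.map_id]
  exact congrArg (fun t : G.obj.obj (op X) ⟶ G.obj.obj (op X) => t x) h2

instance (G : ThSmthSet) : Mono (synTZero G) :=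
  have : Mono (synTZero G ≫ synTProj G) := by rw [synTZero_proj]; infer_instance
  mono_of_mono _ (synTProj G)

end SyntheticZero

section VertInf

variable {E EF V : Type} [NormedAddCommGroup E] [NormedSpace ℝ E] [NormedAddCommGroup EF]
  [NormedSpace ℝ EF] [NormedAddCommGroup V] [NormedSpace ℝ V] [FiniteDimensional ℝ E]
  [FiniteDimensional ℝ V]
  {M F : Type} [TopologicalSpace M] [ChartedSpace E M] [TopologicalSpace F] [ChartedSpace EF F]
  {π : F → M} (h : IsFibered E EF V π)

open JetBundle

instance mono_vertInfIncl : Mono (vertInfIncl h) := by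
  have : Mono (synTZero (yMan 𝓘(ℝ, E) M)) := inferInstance
  exact pullback.snd_of_mono

variable [IsManifold 𝓘(ℝ, E) ∞ M] [IsManifold 𝓘(ℝ, EF) ∞ F] [T2Space F] [T2Space M]
  [SecondCountableTopology F]

/-- The tangent bundle of the `n`-th jet bundle as a thickened smooth set. -/
abbrev yTanJet (n : ℕ) : ThSmthSet :=
  yMan (jetI E V n).tangent (TangentBundle (jetI E V n) (JetBundle h n))

/-- The identification of the tangent bundle of the `n`-th jet bundle with the synthetic one. -/
abbrev kappaJet (n : ℕ) : yTanJet h n ⟶ synT.obj (yJet h n) :=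
  kappa (jetI E V n) (JetBundle h n)

/-- The differential of the projection of jet bundles. -/
abbrev yTanTrunc (n : ℕ) : yTanJet h (n + 1) ⟶ yTanJet h n := yMap (tangentCM (truncCM h n))

/-- The map `Jⁿ(VF) → T(JⁿF)` as a map of thickened smooth sets. -/
abbrev yJetVelocity (n : ℕ) : yJet (VertBundle.isFibered h) n ⟶ yTanJet h n :=
  yMap (jetVelocityCM h n)

variable {h} in
theorem jetVelocity_plot_ext {n : ℕ} {X : ThCartSp} {a b : Plots (yJet (VertBundle.isFibered h) n) X}
    (hab : ap (yJetVelocity h n) a = ap (yJetVelocity h n) b) : a = b :=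
  (isTestFamily_jetVelocityCM h n).plot_ext (X := X) (φ := a) (ψ := b) fun g =>
    DFunLike.congr_fun (show AlgHom.comp a (smoothPullback (jetVelocityCM h n)) = _ from hab) g

variable {h} in
/-- A tangent plot of `JⁿF` over a zero tangent plot of `M` comes from a plot of `Jⁿ(VF)`. -/
theorem exists_plot_jetVelocity_kappa {n : ℕ} {X : ThCartSp} (v : Plots (synT.obj (yJet h n)) X)
    (a : Plots (yMan 𝓘(ℝ, E) M) X)
    (hv : ap (synT.map (yMap (ptCM h n))) v = ap (synTZero (yMan 𝓘(ℝ, E) M)) a) :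
    ∃ b : Plots (yJet (VertBundle.isFibered h) n) X,
      ap (yJetVelocity h n ≫ kappaJet h n) b = v := by
  obtain ⟨ψ, rfl⟩ := (bijective_ap (kappaJet h n)).surjective v
  obtain ⟨b, hb⟩ := exists_plot_comp_jetVelocity (h := h) (X := X) ψ fun f => by
    have h1 := DFunLike.congr_fun (show (show C^∞⟮𝓘(ℝ, E), M; ℝ⟯ →ₐ[ℝ] (X.ext D1).O from
      ap (synT.map (yMap (ptCM h n))) (ap (kappaJet h n) ψ)) = _ from hv) f
    refine (coef₁_kappa (X := X) ψ (smoothPullback (ptCM h n) f)).symm.trans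
      ((congrArg X.coef₁ h1).trans ?_)
    change X.coef₁ ((X.fst D1).comorphism ((show C^∞⟮𝓘(ℝ, E), M; ℝ⟯ →ₐ[ℝ] X.O from a) f)) = 0
    rw [ThCartSp.coef_fst]
    simp
  exact ⟨b, congrArg (fun t : Plots (yMan (jetI E V n).tangent
    (TangentBundle (jetI E V n) (JetBundle h n))) X => ap (kappaJet h n) t) hb⟩

theorem yMap_trunc_jetVelocity (n : ℕ) :
    yJetVelocity h (n + 1) ≫ yTanTrunc h n =
      yMap (truncCM (VertBundle.isFibered h) n) ≫ yJetVelocity h n := by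
  exact congrArg yMap (tangentCM_trunc_jetVelocity (h := h) (n := n))

theorem yMap_jetVelocity_pt (n : ℕ) :
    yJetVelocity h n ≫ yMap (tangentCM (ptCM h n)) =
      yMap (ptCM (VertBundle.isFibered h) n) ≫ yMap (zeroSectionCM 𝓘(ℝ, E) M) := by
  rw [← yMap_comp, ← yMap_comp]
  congr 1
  ext1 j
  exact jetVelocity_pt j

theorem jetVelocity_value {n : ℕ} (j : JetBundle (VertBundle.isFibered h) n) :
    (jetVelocity h n j).1.value = j.value.foot := by
  obtain ⟨d, hd⟩ := h j.value.foot
  exact (jetVelocity_foot j d hd j.value).1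

/-- The maps `Jⁿ(VF) → T(JⁿF)` assemble to a map from the infinite jet bundle of the vertical bundle to
the vertical bundle of the infinite jet bundle. -/
theorem exists_hom_vertInf : ∃ i : jetInf (VertBundle.isFibered h) ⟶ vertInf h, ∀ n,
    i ≫ vertInfIncl h ≫ synT.map (jetInfProj h n) =
      jetInfProj (VertBundle.isFibered h) n ≫ yJetVelocity h n ≫
        kappaJet h n := by
  obtain ⟨l, hl⟩ := exists_lift_synT_jetInf h
    (fun n => jetInfProj (VertBundle.isFibered h) n ≫ yJetVelocity h n) fun n => by
      rw [Category.assoc, yMap_trunc_jetVelocity, ← Category.assoc, jetInfProj_succ]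
  simp only [Category.assoc] at hl
  have hpt : jetInfPt (VertBundle.isFibered h) ≫ synTZero (yMan 𝓘(ℝ, E) M) =
      l ≫ synT.map (jetInfPt h) := by
    rw [jetInfPt, jetInfPt, Functor.map_comp, ← Category.assoc l, hl 0, Category.assoc,
      Category.assoc, Category.assoc, kappa_naturality, ← Category.assoc (yJetVelocity h 0),
      yMap_jetVelocity_pt, Category.assoc, zeroSectionCM_kappa]
  exact ⟨pullback.lift _ l hpt, fun n =>
    (congrArg (fun t => t ≫ synT.map (jetInfProj h n)) (pullback.lift_snd _ l hpt)).trans (hl n)⟩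

variable {h} in
theorem vertInf_plot_ext {X : ThCartSp} {a b : Plots (vertInf h) X}
    (hab : ap (vertInfIncl h) a = ap (vertInfIncl h) b) : a = b := by
  refine plot_pullback_ext ?_ hab
  have h3 := (ap_pullback_condition _ _ a).trans
    ((congrArg (fun t => ap (synT.map (jetInfPt h)) t) hab).trans
      (ap_pullback_condition _ _ b).symm)
  have h4 := congrArg (fun t => ap (synTProj (yMan 𝓘(ℝ, E) M)) t) h3
  simp only [← ap_comp, synTZero_proj] at h4
  exact h4

variable {h} in
/-- Every tangent plot of the infinite jet bundle over a zero tangent plot of the base comes from a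
plot of the infinite jet bundle of the vertical bundle. -/
theorem exists_plot_jetVelocity_family {X : ThCartSp} (v : Plots (synT.obj (jetInf h)) X)
    (x : Plots (yMan 𝓘(ℝ, E) M) X)
    (hv : ap (synT.map (jetInfPt h)) v = ap (synTZero (yMan 𝓘(ℝ, E) M)) x) :
    ∃ a : Plots (jetInf (VertBundle.isFibered h)) X, ∀ n,
      ap (jetInfProj (VertBundle.isFibered h) n ≫ yJetVelocity h n ≫
        kappaJet h n) a = ap (synT.map (jetInfProj h n)) v := by
  have hb : ∀ n, ∃ b : Plots (yJet (VertBundle.isFibered h) n) X,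
      ap (yJetVelocity h n ≫ kappaJet h n) b =
        ap (synT.map (jetInfProj h n)) v := fun n => by
    refine exists_plot_jetVelocity_kappa _ x ?_
    rw [← hv, ← jetInfProj_pt h n, Functor.map_comp]
    rfl
  choose b hb using hb
  obtain ⟨a, ha⟩ := exists_jetInf_plot (VertBundle.isFibered h) b fun n => by
    refine jetVelocity_plot_ext
      ((bijective_ap (kappaJet h n)).injective ?_)
    change ap (yMap (truncCM _ n) ≫ yJetVelocity h n ≫ kappaJet h n) (b (n + 1)) =
      ap (yJetVelocity h n ≫ kappaJet h n) (b n)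
    rw [← Category.assoc, ← yMap_trunc_jetVelocity, Category.assoc, ← kappa_naturality,
      ← Category.assoc, ap_comp, hb, hb, ← jetInfProj_succ h n, Functor.map_comp]
    rfl
  exact ⟨a, fun n => by rw [ap_comp, ha, hb]⟩

variable {h} in
/-- The map is bijective on plots: injective because the plots of `Jⁿ(VF)` are determined by their images
in `T(JⁿF)`, surjective because every tangent plot over a zero plot of `M` has such an image at each
finite order. -/
theorem isIso_of_jetVelocity {i : jetInf (VertBundle.isFibered h) ⟶ vertInf h}
    (hi : ∀ n, i ≫ vertInfIncl h ≫ synT.map (jetInfProj h n) =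
      jetInfProj (VertBundle.isFibered h) n ≫ yJetVelocity h n ≫
        kappaJet h n) : IsIso i := by
  refine isIso_of_bijective i fun X => ⟨fun a b hab => ?_, fun z => ?_⟩
  · refine jetInf_plot_ext fun n => jetVelocity_plot_ext
      ((bijective_ap (kappaJet h n)).injective ?_)
    change ap (jetInfProj _ n ≫ yJetVelocity h n ≫ kappaJet h n) a =
      ap (jetInfProj _ n ≫ yJetVelocity h n ≫ kappaJet h n) b
    rw [← hi]
    exact congrArg (fun t => ap (vertInfIncl h ≫ synT.map (jetInfProj h n)) t) hab
  · obtain ⟨a, ha⟩ := exists_plot_jetVelocity_family (ap (vertInfIncl h) z)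
      (ap (pullback.fst _ _) z) (ap_pullback_condition _ _ z).symm
    refine ⟨a, vertInf_plot_ext (jetInf_plot_ext (h := h) (X := X.ext D1) fun n => ?_)⟩
    refine Eq.trans ?_ (ha n)
    rw [← hi]
    rfl

variable {h} in
theorem foot_of_jetVelocity {i : jetInf (VertBundle.isFibered h) ⟶ vertInf h}
    (hi : ∀ n, i ≫ vertInfIncl h ≫ synT.map (jetInfProj h n) =
      jetInfProj (VertBundle.isFibered h) n ≫ yJetVelocity h n ≫
        kappaJet h n) :
    i ≫ vertInfIncl h ≫ synTProj (jetInf h) ≫ jetInfProj h 0 =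
      jetInfProj (VertBundle.isFibered h) 0 ≫
        yMap ((tangentProjCM (jetI E V 0) (JetBundle h 0)).comp (jetVelocityCM h 0)) := by
  rw [synTProj_naturality, ← Category.assoc (vertInfIncl h), ← Category.assoc i, hi,
    Category.assoc, Category.assoc, kappa_proj, yMap_comp]

/-- The isomorphism between the vertical bundle of the infinite jet bundle and the infinite jet bundle
of the vertical bundle. -/
theorem exists_iso_vertInf : ∃ Θ : vertInf h ≅ jetInf (VertBundle.isFibered h),
    (∀ n, Θ.inv ≫ vertInfIncl h ≫ synT.map (jetInfProj h n) =
      jetInfProj (VertBundle.isFibered h) n ≫ yMap (jetVelocityCM h n) ≫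
        kappa (jetI E V n) (JetBundle h n)) ∧
    Θ.inv ≫ vertInfIncl h ≫ synTProj (jetInf h) ≫ jetInfValue h =
      jetInfValue (VertBundle.isFibered h) ≫ yMap (VertBundle.footCM h) ∧
    Θ.inv ≫ vertInfIncl h ≫ synTProj (jetInf h) ≫ jetInfPt h =
      jetInfPt (VertBundle.isFibered h) := by
  obtain ⟨i, hi⟩ := exists_hom_vertInf h
  have := isIso_of_jetVelocity hi
  have hfoot := foot_of_jetVelocity hi
  have h1 : (valueCM h 0).comp ((tangentProjCM (jetI E V 0) (JetBundle h 0)).comp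
      (jetVelocityCM h 0)) = (VertBundle.footCM h).comp (valueCM (VertBundle.isFibered h) 0) := by
    ext1 j
    exact jetVelocity_value h j
  have h2 : (ptCM h 0).comp ((tangentProjCM (jetI E V 0) (JetBundle h 0)).comp
      (jetVelocityCM h 0)) = ptCM (VertBundle.isFibered h) 0 := by
    ext1 j
    exact congrArg (fun v : TangentBundle 𝓘(ℝ, E) M => v.1) (jetVelocity_pt j)
  refine ⟨(asIso i).symm, hi, ?_, ?_⟩
  · refine (congrArg (fun t => t ≫ yMap (valueCM h 0)) hfoot).trans ?_
    rw [Category.assoc, ← yMap_comp, h1]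
    rfl
  · refine (congrArg (fun t => t ≫ yMap (ptCM h 0)) hfoot).trans ?_
    rw [Category.assoc, ← yMap_comp, h2]
    rfl

end VertInf

/-! ### Fibre products with tangent bundles -/

section TangentPullback

variable {E₁ H₁ E H E₂ H₂ : Type} [NormedAddCommGroup E₁] [NormedSpace ℝ E₁]
  [FiniteDimensional ℝ E₁] [TopologicalSpace H₁] {I₁ : ModelWithCorners ℝ E₁ H₁}
  [NormedAddCommGroup E] [NormedSpace ℝ E] [FiniteDimensional ℝ E] [TopologicalSpace H]
  {I : ModelWithCorners ℝ E H} [NormedAddCommGroup E₂] [NormedSpace ℝ E₂]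
  [FiniteDimensional ℝ E₂] [TopologicalSpace H₂] {I₂ : ModelWithCorners ℝ E₂ H₂}
  {J M Z : Type} [TopologicalSpace J] [ChartedSpace H₁ J] [IsManifold I₁ ∞ J] [T2Space J]
  [TopologicalSpace M] [ChartedSpace H M] [IsManifold I ∞ M] [T2Space M]
  [TopologicalSpace Z] [ChartedSpace H₂ Z] [IsManifold I₂ ∞ Z] [T2Space Z]
  [SecondCountableTopology J] [SecondCountableTopology M] [SecondCountableTopology Z]
  [I.Boundaryless] [I₁.Boundaryless]

/-- `Z`, with maps to `J` and to `TM`, is the fibre product of `P : J → M` with `TM → M`. -/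
structure IsTangentPullback (P : C^∞⟮I₁, J; I, M⟯) (F₁ : C^∞⟮I₂, Z; I₁, J⟯)
    (F₂ : C^∞⟮I₂, Z; I.tangent, TangentBundle I M⟯) : Prop where
  ext : ∀ z z', F₁ z = F₁ z' → F₂ z = F₂ z' → z = z'
  foot : ∀ z, (F₂ z).1 = P (F₁ z)
  exists_lift : ∀ {B : Type} [NormedAddCommGroup B] [NormedSpace ℝ B]
    (a : C^∞⟮𝓘(ℝ, B), B; I₁, J⟯) (b : C^∞⟮𝓘(ℝ, B), B; I.tangent, TangentBundle I M⟯),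
    (∀ x, (b x).1 = P (a x)) →
      ∃ s : C^∞⟮𝓘(ℝ, B), B; I₂, Z⟯, ∀ x, F₁ (s x) = a x ∧ F₂ (s x) = b x

namespace IsTangentPullback

variable {P : C^∞⟮I₁, J; I, M⟯} {F₁ : C^∞⟮I₂, Z; I₁, J⟯}
  {F₂ : C^∞⟮I₂, Z; I.tangent, TangentBundle I M⟯}

/-- Retract charts of `J` and of `M` parametrize the fibre product. -/
theorem exists_param (hZ : IsTangentPullback P F₁ F₂) {j₀ : J} {x₀ : M} (h : x₀ = P j₀) :
    ∃ (r : RetractChart I₁ J E₁ j₀) (r' : RetractChart I M E x₀)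
      (s : C^∞⟮𝓘(ℝ, E₁ × E), E₁ × E; I₂, Z⟯),
      ∀ x, F₁ (s x) = r.s x.1 ∧ F₂ (s x) = tanParam r'.s (r'.c (P (r.s x.1)), x.2) := by
  subst h
  obtain ⟨r', -⟩ := exists_retractChart (I := I) (P j₀) Filter.univ_mem
  obtain ⟨r, hr⟩ := exists_retractChart (I := I₁) j₀
    (P.contMDiff.continuous.continuousAt.eventually r'.retract)
  let a : C^∞⟮𝓘(ℝ, E₁ × E), E₁ × E; I₁, J⟯ :=
    ⟨fun x => r.s x.1, r.s.contMDiff.comp contDiff_fst.contMDiff⟩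
  let b : C^∞⟮𝓘(ℝ, E₁ × E), E₁ × E; I.tangent, TangentBundle I M⟯ :=
    ⟨fun x => tanParam r'.s (r'.c (P (a x)), x.2), (tanParam r'.s).contMDiff.comp
      ((r'.c.contMDiff.comp (P.contMDiff.comp a.contMDiff)).prodMk_space contDiff_snd.contMDiff)⟩
  obtain ⟨s, hs⟩ := hZ.exists_lift a b fun x => hr x.1
  exact ⟨r, r', s, hs⟩

variable (F₁ F₂) in
/-- The functions on the fibre product pulled back from the two factors. -/
def test : C^∞⟮I₁, J; ℝ⟯ ⊕ C^∞⟮I.tangent, TangentBundle I M; ℝ⟯ → C^∞⟮I₂, Z; ℝ⟯ :=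
  Sum.elim (smoothPullback F₁) (smoothPullback F₂)

/-- The functions pulled back from the two factors determine and glue plots of the fibre product. -/
theorem isTestFamily (hZ : IsTangentPullback P F₁ F₂) :
    IsTestFamily (I := I₂) (E₁ × E) (test F₁ F₂) where
  separates z z' h := hZ.ext z z'
    (eq_of_forall_apply_eq (I := I₁) fun f => h (Sum.inl f))
    (eq_of_forall_apply_eq (I := I.tangent) fun f => h (Sum.inr f))
  exists_chart z := by
    obtain ⟨r, r', s, hs⟩ := hZ.exists_param (hZ.foot z)
    let c : C^∞⟮I₂, Z; 𝓘(ℝ, E₁ × E), E₁ × E⟯ :=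
      ⟨fun z => (r.c (F₁ z), dMap r'.c (F₂ z)), (r.c.contMDiff.comp F₁.contMDiff).prodMk_space
        ((dMap r'.c).contMDiff.comp F₂.contMDiff)⟩
    refine ⟨⟨c, s, ?_⟩, fun ℓ => ?_⟩
    · filter_upwards [F₁.contMDiff.continuous.continuousAt.eventually r.retract,
        F₂.contMDiff.continuous.continuousAt.eventually r'.tangent.retract] with y hy hy'
      refine hZ.ext _ _ ((hs (c y)).1.trans hy) ((hs (c y)).2.trans (Eq.trans ?_ hy'))
      refine congrArg (tanParam r'.s) (Prod.ext ?_ rfl)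
      change r'.c (P (r.s (r.c (F₁ y)))) = r'.c (F₂ y).1
      rw [hy]
      exact congrArg r'.c (hZ.foot y).symm
    · have h1 : coordFun c ℓ =
          smoothPullback F₁ (coordFun r.c (ℓ.comp (ContinuousLinearMap.inl ℝ E₁ E))) +
          smoothPullback F₂ (coordFun (dMap r'.c) (ℓ.comp (ContinuousLinearMap.inr ℝ E₁ E))) := by
        ext y
        change ℓ (r.c (F₁ y), dMap r'.c (F₂ y)) = ℓ (r.c (F₁ y), 0) + ℓ (0, dMap r'.c (F₂ y))
        rw [← map_add, Prod.mk_add_mk, add_zero, zero_add]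
      rw [h1]
      exact Subalgebra.add_mem _ (Algebra.subset_adjoin ⟨Sum.inl _, rfl⟩)
        (Algebra.subset_adjoin ⟨Sum.inr _, rfl⟩)

variable {X : ThCartSp}

/-- A pair of plots of `J` and of `TM` over the same plot of `M` locally comes from a plot of the fibre
product, given in the coordinates of `J` and of the fibres of `TM`. -/
theorem exists_local_plot (hZ : IsTangentPullback P F₁ F₂) (a : C^∞⟮I₁, J; ℝ⟯ →ₐ[ℝ] X.O)
    (w : C^∞⟮I.tangent, TangentBundle I M; ℝ⟯ →ₐ[ℝ] X.O)
    (h : ∀ f, a (smoothPullback P f) = w (smoothPullback (tangentProjCM I M) f))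
    (p₀ : Cart X.k) : ∃ ψ : C^∞⟮I₂, Z; ℝ⟯ →ₐ[ℝ] X.O, ∀ᶠ p in 𝓝 p₀,
      (∀ g, evalPoint X p (ψ (smoothPullback F₁ g)) = evalPoint X p (a g)) ∧
      ∀ g, evalPoint X p (ψ (smoothPullback F₂ g)) = evalPoint X p (w g) := by
  have hfoot : (bodyMap w p₀).1 = P (bodyMap a p₀) := by
    refine eq_of_forall_apply_eq (I := I) fun f => ?_
    have h1 := body_apply a (smoothPullback P f) p₀
    have h2 := body_apply w (smoothPullback (tangentProjCM I M) f) p₀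
    rw [h] at h1
    exact h2.symm.trans h1
  obtain ⟨r, r', s, hs⟩ := hZ.exists_param hfoot
  let u₁ : (E₁ × E →L[ℝ] ℝ) →ₗ[ℝ] X.O := a.toLinearMap ∘ₗ (smoothPullback r.c).toLinearMap ∘ₗ
    linFun ∘ₗ
      { toFun := fun ℓ => ℓ.comp (ContinuousLinearMap.inl ℝ E₁ E)
        map_add' := fun _ _ => rfl
        map_smul' := fun _ _ => rfl }
  let u₂ : (E₁ × E →L[ℝ] ℝ) →ₗ[ℝ] X.O :=
    w.toLinearMap ∘ₗ (smoothPullback (dMap r'.c)).toLinearMap ∘ₗ linFun ∘ₗ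
      { toFun := fun ℓ => ℓ.comp (ContinuousLinearMap.inr ℝ E₁ E)
        map_add' := fun _ _ => rfl
        map_smul' := fun _ _ => rfl }
  -- The plot of `E₁ × E` given by the coordinates of the plot `a` and by the velocity coordinates of `w`.
  obtain ⟨Ψ, hΨ⟩ := exists_algHom_linFun X (u₁ + u₂)
  have hΨ : ∀ ℓ, Ψ (linFun ℓ) = a (coordFun r.c (ℓ.comp (ContinuousLinearMap.inl ℝ E₁ E))) +
    w (coordFun (dMap r'.c) (ℓ.comp (ContinuousLinearMap.inr ℝ E₁ E))) := hΨ
  let fst : C^∞⟮𝓘(ℝ, E₁ × E), E₁ × E; 𝓘(ℝ, E₁), E₁⟯ := clmCM (ContinuousLinearMap.fst ℝ E₁ E)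
  have e₁ : Ψ.comp (smoothPullback fst) = a.comp (smoothPullback r.c) := by
    refine plot_ext_of_linFun fun ℓ => ?_
    have h1 : smoothPullback fst (linFun ℓ) = linFun (ℓ.comp (ContinuousLinearMap.fst ℝ E₁ E)) := rfl
    have h2 : (ℓ.comp (ContinuousLinearMap.fst ℝ E₁ E)).comp (ContinuousLinearMap.inl ℝ E₁ E) = ℓ :=
      rfl
    have h3 : (ℓ.comp (ContinuousLinearMap.fst ℝ E₁ E)).comp (ContinuousLinearMap.inr ℝ E₁ E) = 0 :=
      ContinuousLinearMap.ext fun _ => map_zero ℓ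
    have h4 : coordFun (dMap r'.c) (0 : E →L[ℝ] ℝ) = 0 := rfl
    rw [AlgHom.comp_apply, h1, hΨ, h2, h3, h4, map_zero, add_zero]
    rfl
  let Q : C^∞⟮𝓘(ℝ, E₁ × E), E₁ × E; 𝓘(ℝ, E × E), E × E⟯ :=
    ⟨fun x => (r'.c (P (r.s x.1)), x.2), (r'.c.contMDiff.comp (P.contMDiff.comp
      (r.s.contMDiff.comp contDiff_fst.contMDiff))).prodMk_space contDiff_snd.contMDiff⟩
  refine ⟨Ψ.comp (smoothPullback s), ?_⟩
  filter_upwards [r.eventually_evalPoint a, r'.tangent.eventually_evalPoint w] with p hp hp'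
  have key : ∀ g : C^∞⟮I₁, J; ℝ⟯, evalPoint X p (Ψ (smoothPullback fst (smoothPullback r.s g))) =
      evalPoint X p (a g) := fun g => by
    refine Eq.trans ?_ (hp g).symm
    exact congrArg (evalPoint X p) (DFunLike.congr_fun e₁ (smoothPullback r.s g))
  refine ⟨fun g => ?_, fun g => ?_⟩
  · have h1 : smoothPullback s (smoothPullback F₁ g) =
        smoothPullback fst (smoothPullback r.s g) := by
      ext x
      exact congrArg g (hs x).1
    rw [AlgHom.comp_apply, h1, key]
  · have h1 : smoothPullback s (smoothPullback F₂ g) =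
        smoothPullback Q (smoothPullback (tanParam r'.s) g) := by
      ext x
      exact congrArg g (hs x).2
    -- The foot coordinates of `w` are those of the image of `a` in `M`, so that `w` is given in coordinates
    -- by `Q` along `Ψ`.
    have e₂ : ((evalPoint X p).comp Ψ).comp (smoothPullback Q) =
        ((evalPoint X p).comp w).comp (smoothPullback (tanCoord r'.c)) := by
      refine algHom_ext_of_linFun fun ℓ => ?_
      have h2 : smoothPullback Q (linFun ℓ) = smoothPullback fst (smoothPullback r.s (smoothPullback P
          (coordFun r'.c (ℓ.comp (ContinuousLinearMap.inl ℝ E E))))) +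
          linFun ((ℓ.comp (ContinuousLinearMap.inr ℝ E E)).comp (ContinuousLinearMap.snd ℝ E₁ E)) := by
        ext x
        change ℓ (r'.c (P (r.s x.1)), x.2) = ℓ (r'.c (P (r.s x.1)), 0) + ℓ (0, x.2)
        rw [← map_add, Prod.mk_add_mk, add_zero, zero_add]
      have h3 : ((ℓ.comp (ContinuousLinearMap.inr ℝ E E)).comp (ContinuousLinearMap.snd ℝ E₁ E)).comp
          (ContinuousLinearMap.inl ℝ E₁ E) = 0 := ContinuousLinearMap.ext fun _ => map_zero ℓ
      have h4 : ((ℓ.comp (ContinuousLinearMap.inr ℝ E E)).comp (ContinuousLinearMap.snd ℝ E₁ E)).comp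
          (ContinuousLinearMap.inr ℝ E₁ E) = ℓ.comp (ContinuousLinearMap.inr ℝ E E) := rfl
      have h5 : coordFun r.c (0 : E₁ →L[ℝ] ℝ) = 0 := rfl
      have h6 : coordFun (dMap r'.c) (ℓ.comp (ContinuousLinearMap.inr ℝ E E)) =
          dFun (coordFun r'.c (ℓ.comp (ContinuousLinearMap.inr ℝ E E))) := by
        ext v
        exact (dFun_coordFun r'.c (ℓ.comp (ContinuousLinearMap.inr ℝ E E)) v).symm
      change evalPoint X p (Ψ (smoothPullback Q (linFun ℓ))) =
        evalPoint X p (w (coordFun (tanCoord r'.c) ℓ))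
      rw [h2, map_add, map_add, key, hΨ, h3, h4, h5, map_zero, zero_add, h, h6, coordFun_tanCoord,
        map_add, map_add]
    rw [AlgHom.comp_apply, h1]
    refine Eq.trans ?_ (hp' g).symm
    exact DFunLike.congr_fun e₂ (smoothPullback (tanParam r'.s) g)

/-- The plots of the fibre product `J ×_M TM` are the pairs of plots of `J` and of `TM` over the same
plot of `M`. -/
theorem exists_plot (hZ : IsTangentPullback P F₁ F₂) (a : C^∞⟮I₁, J; ℝ⟯ →ₐ[ℝ] X.O)
    (w : C^∞⟮I.tangent, TangentBundle I M; ℝ⟯ →ₐ[ℝ] X.O)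
    (h : ∀ f, a (smoothPullback P f) = w (smoothPullback (tangentProjCM I M) f)) :
    ∃ ψ : C^∞⟮I₂, Z; ℝ⟯ →ₐ[ℝ] X.O, ψ.comp (smoothPullback F₁) = a ∧
      ψ.comp (smoothPullback F₂) = w := by
  obtain ⟨ψ, hψ⟩ := hZ.isTestFamily.exists_plot (Sum.elim a w) fun p₀ => by
    obtain ⟨ψ, hψ⟩ := hZ.exists_local_plot a w h p₀
    refine ⟨ψ, hψ.mono fun p hp j => ?_⟩
    cases j with
    | inl g => exact hp.1 g
    | inr g => exact hp.2 g
  exact ⟨ψ, AlgHom.ext fun g => hψ (Sum.inl g), AlgHom.ext fun g => hψ (Sum.inr g)⟩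

/-- The canonical map from the manifold `J ×_M TM` to the fibre product of thickened smooth sets is an
isomorphism. -/
theorem isIso_lift (hZ : IsTangentPullback P F₁ F₂) {i : yMan I₂ Z ⟶ pullback (yMap P) (synTProj (yMan I M))}
    (h₁ : i ≫ pullback.fst _ _ = yMap F₁) (h₂ : i ≫ pullback.snd _ _ = yMap F₂ ≫ kappa I M) :
    IsIso i := by
  refine isIso_of_bijective i fun X => ⟨fun φ ψ hφψ => ?_, fun z => ?_⟩
  · have e₁ : ap (yMap F₁) φ = ap (yMap F₁) ψ := by
      rw [← h₁]
      exact congrArg (fun t => ap (pullback.fst (yMap P) (synTProj (yMan I M))) t) hφψ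
    have e₂ : ap (yMap F₂) φ = ap (yMap F₂) ψ := by
      refine (bijective_ap (kappa I M)).injective ?_
      change ap (yMap F₂ ≫ kappa I M) φ = ap (yMap F₂ ≫ kappa I M) ψ
      rw [← h₂]
      exact congrArg (fun t => ap (pullback.snd (yMap P) (synTProj (yMan I M))) t) hφψ
    refine hZ.isTestFamily.plot_ext (X := X) (φ := φ) (ψ := ψ) fun j => ?_
    cases j with
    | inl g => exact DFunLike.congr_fun (show AlgHom.comp φ (smoothPullback F₁) = _ from e₁) g
    | inr g => exact DFunLike.congr_fun (show AlgHom.comp φ (smoothPullback F₂) = _ from e₂) g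
  · obtain ⟨w, hw⟩ := (bijective_ap (kappa I M)).surjective
      (ap (pullback.snd (yMap P) (synTProj (yMan I M))) z)
    have hw : ap (kappa I M) w = ap (pullback.snd (yMap P) (synTProj (yMan I M))) z := hw
    have hc := ap_pullback_condition (yMap P) (synTProj (yMan I M)) z
    rw [← hw, ← ap_comp (kappa I M), kappa_proj] at hc
    obtain ⟨ψ, h3, h4⟩ := hZ.exists_plot (X := X)
      (ap (pullback.fst (yMap P) (synTProj (yMan I M))) z) w fun f =>
        DFunLike.congr_fun (show AlgHom.comp _ (smoothPullback P) = _ from hc) f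
    refine ⟨ψ, plot_pullback_ext ?_ ?_⟩
    · change ap (i ≫ pullback.fst (yMap P) (synTProj (yMan I M))) ψ = _
      rw [h₁]
      exact h3
    · change ap (i ≫ pullback.snd (yMap P) (synTProj (yMan I M))) ψ = _
      rw [h₂, ← hw]
      exact congrArg (fun t : Plots (yMan I.tangent (TangentBundle I M)) X => ap (kappa I M) t) h4

end IsTangentPullback

end TangentPullback

/-! ### Pushforwards along jet prolongations -/

section

variable {E₀ H₀ N₀ E₁ H₁ N₁ E₂ H₂ N₂ : Type} [NormedAddCommGroup E₀] [NormedSpace ℝ E₀]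
  [TopologicalSpace H₀] {I₀ : ModelWithCorners ℝ E₀ H₀} [TopologicalSpace N₀]
  [ChartedSpace H₀ N₀] [IsManifold I₀ ∞ N₀] [NormedAddCommGroup E₁] [NormedSpace ℝ E₁]
  [TopologicalSpace H₁] {I₁ : ModelWithCorners ℝ E₁ H₁} [TopologicalSpace N₁]
  [ChartedSpace H₁ N₁] [IsManifold I₁ ∞ N₁] [NormedAddCommGroup E₂] [NormedSpace ℝ E₂]
  [TopologicalSpace H₂] {I₂ : ModelWithCorners ℝ E₂ H₂} [TopologicalSpace N₂]
  [ChartedSpace H₂ N₂] [IsManifold I₂ ∞ N₂]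

/-- The chain rule, for a map `g` which is `P ∘ f` near `p`. -/
theorem tangentMap_tangentMap_eq (P : C^∞⟮I₁, N₁; I₂, N₂⟯) {f : N₀ → N₁} {g : N₀ → N₂} {p : N₀}
    (hf : MDifferentiableAt I₀ I₁ f p) (hg : ∀ᶠ q in 𝓝 p, P (f q) = g q)
    (X : TangentSpace I₀ p) :
    tangentMap I₁ I₂ P (tangentMap I₀ I₁ f ⟨p, X⟩) = tangentMap I₀ I₂ g ⟨p, X⟩ :=
  (tangentMap_comp_at (⟨p, X⟩ : TangentBundle I₀ N₀) P.mdifferentiableAt hf).symm.trans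
    (tangentMap_congr hg X)

end

section JetTM

variable {E EF V : Type} [NormedAddCommGroup E] [NormedSpace ℝ E] [NormedAddCommGroup EF]
  [NormedSpace ℝ EF] [NormedAddCommGroup V] [NormedSpace ℝ V] [FiniteDimensional ℝ E]
  [FiniteDimensional ℝ V]
  {M F : Type} [TopologicalSpace M] [ChartedSpace E M] [TopologicalSpace F] [ChartedSpace EF F]
  [IsManifold 𝓘(ℝ, E) ∞ M] {π : F → M} {h : IsFibered E EF V π} {n : ℕ}

open JetBundle

/-- Smoothness of a map to `JⁿF ×_M TM` is the smoothness of its two components. -/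
theorem contMDiffAt_jetTM {B H Z : Type} [NormedAddCommGroup B] [NormedSpace ℝ B]
    [TopologicalSpace H] {I : ModelWithCorners ℝ B H} [TopologicalSpace Z] [ChartedSpace H Z]
    {f : Z → JetTM h n} {x : Z}
    (h₁ : ContMDiffAt I (jetI E V n) ∞ (fun z => (f z).proj) x)
    (h₂ : ContMDiffAt I 𝓘(ℝ, E).tangent ∞ (fun z => jetTMSnd h n (f z)) x) :
    ContMDiffAt I ((jetI E V n).prod 𝓘(ℝ, E)) ∞ f x :=
  Bundle.contMDiffAt_totalSpace.2 ⟨h₁, (Bundle.contMDiffAt_totalSpace.1 h₂).2⟩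

theorem jetTM_ext {z z' : JetTM h n} (h₁ : z.proj = z'.proj)
    (h₂ : jetTMSnd h n z = jetTMSnd h n z') : z = z' := by
  obtain ⟨j, X⟩ := z
  obtain ⟨j', X'⟩ := z'
  obtain rfl : j = j' := h₁
  have h3 : (⟨j.pt, X⟩ : TangentBundle 𝓘(ℝ, E) M) = ⟨j.pt, X'⟩ := h₂
  have h4 : X = X' := eq_of_heq (Bundle.TotalSpace.mk.inj h3).2
  rw [h4]

variable (h n) in
theorem isTangentPullback_jetTM : IsTangentPullback (ptCM h n) (jetTMFst h n) (jetTMSnd h n) where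
  ext _ _ h₁ h₂ := jetTM_ext h₁ h₂
  foot _ := rfl
  exists_lift {B} _ _ a b hab := by
    let s : B → JetTM h n := fun x => ⟨a x, ((b x).2 : E)⟩
    have hs : ∀ x, jetTMSnd h n (s x) = b x := fun x => by
      have h1 : (b x).1 = (a x).pt := hab x
      change (⟨(a x).pt, ((b x).2 : E)⟩ : TangentBundle 𝓘(ℝ, E) M) = b x
      rw [← h1]
    refine ⟨⟨s, fun x => contMDiffAt_jetTM (a.contMDiff x) ?_⟩, fun x => ⟨rfl, hs x⟩⟩
    rw [show (fun x => jetTMSnd h n (s x)) = b from funext hs]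
    exact b.contMDiff x

variable (h n) in
/-- The map `Jⁿ⁺¹F ×_M TM → JⁿF ×_M TM`. -/
def truncTM : C^∞⟮(jetI E V (n + 1)).prod 𝓘(ℝ, E), JetTM h (n + 1);
    (jetI E V n).prod 𝓘(ℝ, E), JetTM h n⟯ :=
  ⟨fun z => ⟨z.proj.trunc, z.snd⟩, fun z => contMDiffAt_jetTM
    (((truncCM h n).contMDiff.comp (jetTMFst h (n + 1)).contMDiff) z)
    ((jetTMSnd h (n + 1)).contMDiff z)⟩

variable [IsManifold 𝓘(ℝ, EF) ∞ F]

theorem exists_jetPush (z : JetTM h (n + 1)) :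
    ∃ v : TangentBundle (jetI E V n) (JetBundle h n), ∃ (p : M) (s : M → F)
      (hs : IsLocSec E EF π p s) (X : TangentSpace 𝓘(ℝ, E) p),
      z = ⟨jet h (n + 1) p s hs, X⟩ ∧
      v = tangentMap 𝓘(ℝ, E) (jetI E V n) (jetOr (jet h n p s hs) s) ⟨p, X⟩ := by
  obtain ⟨j, X⟩ := z
  obtain ⟨p, s, hs, rfl⟩ := j.exists_rep
  exact ⟨_, p, s, hs, X, rfl, rfl⟩

variable (h n) in
/-- The map `Jⁿ⁺¹F ×_M TM → T(JⁿF)`: the pushforward of a tangent vector along the `n`-jet prolongation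
of a section with a given `n+1`-jet. -/
def jetPush (z : JetTM h (n + 1)) : TangentBundle (jetI E V n) (JetBundle h n) :=
  (exists_jetPush z).choose

theorem jetPush_spec (z : JetTM h (n + 1)) : ∃ (p : M) (s : M → F)
      (hs : IsLocSec E EF π p s) (X : TangentSpace 𝓘(ℝ, E) p),
      z = ⟨jet h (n + 1) p s hs, X⟩ ∧
      jetPush h n z = tangentMap 𝓘(ℝ, E) (jetI E V n) (jetOr (jet h n p s hs) s) ⟨p, X⟩ :=
  (exists_jetPush z).choose_spec

theorem jetPush_proj (z : JetTM h (n + 1)) : (jetPush h n z).1 = z.proj.trunc := by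
  obtain ⟨p, s, hs, X, rfl, hv⟩ := jetPush_spec z
  rw [hv]
  exact jetOr_eq hs

theorem jetPush_coord (z : JetTM h (n + 1)) (d : AdaptedChart E EF V π)
    (hd : z.proj.value ∈ d.tot.source) {j₁ : JetBundle h n} (r : JetRetract d j₁)
    (hr : ∀ᶠ y in 𝓝 (coord d z.proj.trunc), r.Good y) :
    jetPush h n z = tanParam r.s (pushforwardCoord n (coord d z.proj,
      mfderiv 𝓘(ℝ, E) 𝓘(ℝ, E) d.base z.proj.pt z.snd)) := by
  obtain ⟨p, s, hs, X, rfl, hv⟩ := jetPush_spec z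
  rw [hv]
  exact (tangentMap_jet hs d hd X r hr).2

variable [T2Space F]

/-- The value of `jetPush` does not depend on the chosen section: by the coordinate expression of the
pushforward, only the `n + 1`-jet matters. -/
theorem jetPush_jet {p : M} {s : M → F} (hs : IsLocSec E EF π p s) (X : TangentSpace 𝓘(ℝ, E) p) :
    MDifferentiableAt 𝓘(ℝ, E) (jetI E V n) (jetOr (jet h n p s hs) s) p ∧
    jetPush h n ⟨jet h (n + 1) p s hs, X⟩ =
      tangentMap 𝓘(ℝ, E) (jetI E V n) (jetOr (jet h n p s hs) s) ⟨p, X⟩ := by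
  obtain ⟨d, hd⟩ := h (s p)
  obtain ⟨r⟩ := exists_jetRetract d (jet h n p s hs) hd
  have hr := r.eventually_good.eventually_nhds.self_of_nhds
  obtain ⟨h1, h2⟩ := tangentMap_jet hs d hd X r hr
  exact ⟨h1, (jetPush_coord ⟨jet h (n + 1) p s hs, X⟩ d hd r hr).trans h2.symm⟩

theorem eventually_good_trunc {d : AdaptedChart E EF V π} {j₀ : JetBundle h (n + 1)}
    (r : JetRetract d j₀.trunc) :
    ∀ᶠ j in 𝓝 j₀, ∀ᶠ y in 𝓝 (coord d (j.trunc : JetBundle h n)), r.Good y := by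
  have h1 : ContinuousAt (truncCM h n) j₀ := (truncCM h n).contMDiff.continuous.continuousAt
  have h2 : ContinuousAt r.c j₀.trunc := r.c.contMDiff.continuous.continuousAt
  have h3 : ∀ᶠ y in 𝓝 (r.c j₀.trunc), ∀ᶠ y' in 𝓝 y, r.Good y' := by
    rw [r.c_eq.self_of_nhds]
    exact r.eventually_good.eventually_nhds
  filter_upwards [h1.eventually (r.c_eq.and (h2.eventually h3))] with j hj
  have h4 := hj.2
  rwa [hj.1] at h4

theorem pt_eq_proj_value (j : JetBundle h n) : j.pt = π j.value := by
  obtain ⟨p, s, hs, hj⟩ := j.exists_rep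
  rw [hj]
  exact hs.eq.symm

variable [T2Space M]

theorem exists_base_coordinate (d : AdaptedChart E EF V π) {j₀ : JetBundle h n}
    (hd : j₀.value ∈ d.tot.source) : ∃ b : C^∞⟮𝓘(ℝ, E), M; 𝓘(ℝ, E), E⟯,
      ∀ᶠ j in 𝓝 j₀, mfderiv 𝓘(ℝ, E) 𝓘(ℝ, E) b j.pt = mfderiv 𝓘(ℝ, E) 𝓘(ℝ, E) d.base j.pt := by
  obtain ⟨rM, -, hrM, -⟩ := exists_retractChart_of_chart (I := 𝓘(ℝ, E)) d.base.toPartialEquiv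
    (d.base.open_source.mem_nhds (d.maps _ hd))
    (d.base.open_target.mem_nhds (d.base.map_source (d.maps _ hd)))
    d.base_smooth d.base_symm_smooth Filter.univ_mem
  have hrM : ∀ᶠ y in 𝓝 j₀.pt, rM.c y = d.base y := by
    rw [pt_eq_proj_value]
    exact hrM
  have h2 : ContinuousAt (ptCM h n) j₀ := (ptCM h n).contMDiff.continuous.continuousAt
  exact ⟨rM.c, (h2.eventually hrM.eventually_nhds).mono fun j hj =>
    Filter.EventuallyEq.mfderiv_eq hj⟩

set_option maxHeartbeats 400000 in
/-- Locally, the pushforward is given by a fixed smooth function of the coordinates of the jet and of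
the tangent vector. -/
theorem exists_jetPush_eq (z₀ : JetTM h (n + 1)) :
    ∃ (s : C^∞⟮𝓘(ℝ, E × JetFiber E V n), E × JetFiber E V n; jetI E V n, JetBundle h n⟯)
      (c : C^∞⟮jetI E V (n + 1), JetBundle h (n + 1);
        𝓘(ℝ, E × JetFiber E V (n + 1)), E × JetFiber E V (n + 1)⟯)
      (b : C^∞⟮𝓘(ℝ, E), M; 𝓘(ℝ, E), E⟯), ∀ᶠ z in 𝓝 z₀, jetPush h n z =
        tanParam s (pushforwardCoord n (c (jetTMFst h (n + 1) z),
          dMap b (jetTMSnd h (n + 1) z))) := by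
  obtain ⟨d, hd⟩ := h z₀.proj.value
  have hd' : z₀.proj.trunc.value ∈ d.tot.source := by
    rw [value_trunc]
    exact hd
  obtain ⟨r⟩ := exists_jetRetract d z₀.proj.trunc hd'
  obtain ⟨r'⟩ := exists_jetRetract d z₀.proj hd
  obtain ⟨b, hb⟩ := exists_base_coordinate d hd
  refine ⟨r.s, r'.c, b, ?_⟩
  have h1 : ContinuousAt (fun z : JetTM h (n + 1) => z.proj) z₀ :=
    (jetTMFst h (n + 1)).contMDiff.continuous.continuousAt
  filter_upwards [h1.eventually ((eventually_good_trunc r).and (r'.c_eq.and (hb.and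
    ((isOpen_value_preimage d.tot.open_source).mem_nhds hd))))] with z hz
  refine (jetPush_coord z d hz.2.2.2 r hz.1).trans
    (congrArg (fun y => tanParam r.s (pushforwardCoord n y)) (Prod.ext hz.2.1.symm ?_))
  exact congrArg (fun A : E →L[ℝ] E => A z.snd) hz.2.2.1.symm

variable (h n) in
/-- The map `Jⁿ⁺¹F ×_M TM → T(JⁿF)` as a smooth map. -/
def jetPushCM : C^∞⟮(jetI E V (n + 1)).prod 𝓘(ℝ, E), JetTM h (n + 1);
    (jetI E V n).tangent, TangentBundle (jetI E V n) (JetBundle h n)⟯ :=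
  ⟨jetPush h n, fun z₀ => by
    obtain ⟨s, c, b, hz⟩ := exists_jetPush_eq z₀
    refine ContMDiffAt.congr_of_eventuallyEq ?_ hz
    exact ((tanParam s).contMDiff.comp (contDiff_pushforwardCoord.contMDiff.comp
      ((c.contMDiff.comp (jetTMFst h (n + 1)).contMDiff).prodMk_space
        ((dMap b).contMDiff.comp (jetTMSnd h (n + 1)).contMDiff)))) z₀⟩

variable (h n) in
theorem isHolonomicPushforward_jetPushCM : IsHolonomicPushforward h n (jetPushCM h n) :=
  fun _ _ hs X => (jetPush_jet hs X).2

variable (h n) in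
theorem tangentProj_comp_jetPushCM : (tangentProjCM (jetI E V n) (JetBundle h n)).comp (jetPushCM h n) =
    (truncCM h n).comp (jetTMFst h (n + 1)) := by
  ext1 z
  exact jetPush_proj z

variable (h n) in
theorem tangentCM_pt_comp_jetPushCM :
    (tangentCM (ptCM h n)).comp (jetPushCM h n) = jetTMSnd h (n + 1) := by
  ext1 z
  obtain ⟨p, s, hs, X, rfl, hv⟩ := jetPush_spec z
  obtain ⟨h1, -⟩ := jetPush_jet (h := h) (n := n) hs X
  change tangentMap (jetI E V n) 𝓘(ℝ, E) pt (jetPush h n ⟨jet h (n + 1) p s hs, X⟩) =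
    (⟨p, X⟩ : TangentBundle 𝓘(ℝ, E) M)
  rw [hv]
  refine (tangentMap_tangentMap_eq (ptCM h n) h1 (g := id) ?_ X).trans (congrFun tangentMap_id _)
  filter_upwards [(eventually_eventually_nhds.2 hs : ∀ᶠ q in 𝓝 p, IsLocSec E EF π q s)] with q hq
  rw [jetOr_eq hq]
  rfl

theorem tangentMap_trunc_jetPush {p : M} {s : M → F} (hs : IsLocSec E EF π p s)
    (X : TangentSpace 𝓘(ℝ, E) p) :
    tangentMap (jetI E V (n + 1)) (jetI E V n) (truncCM h n)
      (jetPush h (n + 1) ⟨jet h (n + 1 + 1) p s hs, X⟩) =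
        jetPush h n ⟨jet h (n + 1) p s hs, X⟩ := by
  obtain ⟨h1, h2⟩ := jetPush_jet (h := h) (n := n + 1) hs X
  refine (congrArg (tangentMap (jetI E V (n + 1)) (jetI E V n) (truncCM h n)) h2).trans
    (Eq.trans ?_ (jetPush_jet (h := h) (n := n) hs X).2.symm)
  refine tangentMap_tangentMap_eq (truncCM h n) h1 ?_ X
  filter_upwards [(eventually_eventually_nhds.2 hs : ∀ᶠ q in 𝓝 p, IsLocSec E EF π q s)] with q hq
  rw [jetOr_eq hq, jetOr_eq hq]
  rfl

variable (h n) in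
theorem tangentCM_trunc_comp_jetPushCM :
    (tangentCM (truncCM h n)).comp (jetPushCM h (n + 1)) =
      (jetPushCM h n).comp (truncTM h (n + 1)) := by
  ext1 z
  obtain ⟨j, X⟩ := z
  obtain ⟨p, s, hs, rfl⟩ := j.exists_rep
  exact tangentMap_trunc_jetPush hs X

end JetTM

/-! ### Modules of tangent plots -/

namespace ThCartSp

section ExtMap

variable {D D' : Type} [CommRing D] [Algebra ℝ D] [IsWeilAlgebra D]
  [CommRing D'] [Algebra ℝ D'] [IsWeilAlgebra D']

theorem extMap_fst_mul_snd (X : ThCartSp) (φ : D' →ₐ[ℝ] D) (a : X.O) (d : D') :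
    (extMap (𝟙 X) φ).comorphism ((X.fst D').comorphism a * X.snd d) =
      (X.fst D).comorphism a * X.snd (φ d) := by
  have h1 : extMap (𝟙 X) φ ≫ X.fst D' = X.fst D := by
    rw [extMap, pair_fst, Category.comp_id]
  have h2 := DFunLike.congr_fun (extMap_snd (𝟙 X) φ) d
  refine (map_mul _ _ _).trans (congrArg₂ _ ?_ h2)
  exact congrArg (fun f : X.ext D ⟶ X => f.comorphism a) h1

theorem coef_extMap (X : ThCartSp) (ℓ : D →ₗ[ℝ] ℝ) (φ : D' →ₐ[ℝ] D) (x : (X.ext D').O) :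
    X.coef ℓ ((extMap (𝟙 X) φ).comorphism x) = X.coef (ℓ ∘ₗ φ.toLinearMap) x := by
  induction x using fst_mul_snd_induction with
  | h0 => rw [map_zero, map_zero, map_zero]
  | hadd x y hx hy => rw [map_add, map_add, map_add, hx, hy]
  | h a d =>
    rw [extMap_fst_mul_snd, coef_fst_mul_snd, coef_fst_mul_snd]
    rfl

end ExtMap

/-- The coefficient of `ε` satisfies Leibniz's rule. -/
theorem coef₁_mul (X : ThCartSp) (x y : (X.ext D1).O) :
    X.coef₁ (x * y) = X.coef₀ x * X.coef₁ y + X.coef₀ y * X.coef₁ x := by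
  have key : ∀ {R S : Type} [CommRing R] [CommRing S] (i : R →+* S) (e : S) (_ : e * e = 0)
      (a b c d : R), (i a + i b * e) * (i c + i d * e) = i (a * c) + i (a * d + c * b) * e := by
    intro R S _ _ i e he a b c d
    simp only [map_add, map_mul]
    linear_combination (i b * i d) * he
  have h1 : X.snd eps * X.snd eps = 0 := by
    rw [← map_mul, TrivSqZeroExt.inr_mul_inr, map_zero]
  conv_lhs => rw [X.eq_coef₀_add_coef₁ x, X.eq_coef₀_add_coef₁ y]
  refine (congrArg X.coef₁ (key (X.fst D1).comorphism.toRingHom _ h1 _ _ _ _)).trans ?_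
  exact X.coef₁_add _ _

theorem point_comorphism (X : ThCartSp) (x : (X.ext D1).O) :
    (X.point (TrivSqZeroExt.fstHom ℝ ℝ ℝ)).comorphism x = X.coef₀ x := by
  induction x using fst_mul_snd_induction with
  | h0 => rw [map_zero, map_zero]
  | hadd x y hx hy => rw [map_add, map_add, hx, hy]
  | h a d =>
    have h1 : X.point (TrivSqZeroExt.fstHom ℝ ℝ ℝ) ≫ X.fst D1 = 𝟙 X := pair_fst _ _
    have h2 := DFunLike.congr_fun (pair_snd (𝟙 X)
      ((Algebra.ofId ℝ X.O).comp (TrivSqZeroExt.fstHom ℝ ℝ ℝ))) d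
    rw [coef_fst_mul_snd]
    refine (map_mul _ _ _).trans ((congrArg₂ (· * ·) (congrArg (fun f : X ⟶ X => f.comorphism a) h1)
      h2).trans ?_)
    change a * algebraMap ℝ X.O _ = _
    rw [mul_comm, ← Algebra.smul_def]
    rfl

theorem scale_comorphism (X : ThCartSp) (r : X.O) (x : (X.ext D1).O) :
    (X.scale r).comorphism x = (X.fst D1).comorphism (X.coef₀ x) +
      (X.fst D1).comorphism (r * X.coef₁ x) * X.snd eps := by
  have h1 : ∀ a, (X.scale r).comorphism ((X.fst D1).comorphism a) = (X.fst D1).comorphism a :=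
    fun a => congrArg (fun f : X.ext D1 ⟶ X => f.comorphism a) (pair_fst (X.fst D1) _)
  have h2 : (X.scale r).comorphism (X.snd eps) = (X.fst D1).comorphism r * X.snd eps := by
    refine (DFunLike.congr_fun (pair_snd (X.fst D1) _) eps).trans ?_
    exact DualNumber.lift_apply_eps _
  conv_lhs => rw [X.eq_coef₀_add_coef₁ x]
  rw [map_add, map_mul, h1, h1, h2, map_mul]
  ring

/-- The functional `a + b ε₁ + c ε₂ ↦ l (b, c)`. -/
abbrev coefD2 (l : ℝ × ℝ →ₗ[ℝ] ℝ) : D2 →ₗ[ℝ] ℝ := l ∘ₗ TrivSqZeroExt.sndHom ℝ (ℝ × ℝ)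

theorem coef₀_d2Map (X : ThCartSp) (l : ℝ × ℝ →ₗ[ℝ] ℝ) (x : (X.ext D2).O) :
    X.coef₀ ((extMap (𝟙 X) (d2Map l)).comorphism x) =
      X.coef (TrivSqZeroExt.fstHom ℝ ℝ (ℝ × ℝ)).toLinearMap x := by
  rw [coef_extMap]
  refine congrArg (fun ℓ => X.coef ℓ x) (LinearMap.ext fun d => ?_)
  simp [d2Map]

theorem coef₁_d2Map (X : ThCartSp) (l : ℝ × ℝ →ₗ[ℝ] ℝ) (x : (X.ext D2).O) :
    X.coef₁ ((extMap (𝟙 X) (d2Map l)).comorphism x) = X.coef (coefD2 l) x := by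
  rw [coef_extMap]
  refine congrArg (fun ℓ => X.coef ℓ x) (LinearMap.ext fun d => ?_)
  simp [d2Map]

theorem ext_coef_D2 {X : ThCartSp} {x y : (X.ext D2).O}
    (h₀ : X.coef (TrivSqZeroExt.fstHom ℝ ℝ (ℝ × ℝ)).toLinearMap x =
      X.coef (TrivSqZeroExt.fstHom ℝ ℝ (ℝ × ℝ)).toLinearMap y)
    (h₁ : X.coef (coefD2 (LinearMap.fst ℝ ℝ ℝ)) x = X.coef (coefD2 (LinearMap.fst ℝ ℝ ℝ)) y)
    (h₂ : X.coef (coefD2 (LinearMap.snd ℝ ℝ ℝ)) x = X.coef (coefD2 (LinearMap.snd ℝ ℝ ℝ)) y) :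
    x = y := by
  have h : ∀ d : D2, ∑ i, (![(TrivSqZeroExt.fstHom ℝ ℝ (ℝ × ℝ)).toLinearMap,
      coefD2 (LinearMap.fst ℝ ℝ ℝ), coefD2 (LinearMap.snd ℝ ℝ ℝ)] i) d •
      (![1, TrivSqZeroExt.inr (1, 0), TrivSqZeroExt.inr (0, 1)] : Fin 3 → D2) i = d := fun d => by
    rw [Fin.sum_univ_three]
    refine TrivSqZeroExt.ext ?_ (Prod.ext ?_ ?_) <;> simp
  rw [X.eq_sum_coef _ _ h x, X.eq_sum_coef _ _ h y, Fin.sum_univ_three, Fin.sum_univ_three]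
  change (X.fst D2).comorphism (X.coef _ x) * _ + (X.fst D2).comorphism (X.coef _ x) * _ +
    (X.fst D2).comorphism (X.coef _ x) * _ = (X.fst D2).comorphism (X.coef _ y) * _ +
    (X.fst D2).comorphism (X.coef _ y) * _ + (X.fst D2).comorphism (X.coef _ y) * _
  exact congrArg₂ _ (congrArg₂ _ (congrArg (fun t => (X.fst D2).comorphism t * _) h₀)
    (congrArg (fun t => (X.fst D2).comorphism t * _) h₁))
    (congrArg (fun t => (X.fst D2).comorphism t * _) h₂)

end ThCartSp

section Derivations

variable {A R : Type} [CommRing A] [Algebra ℝ A] [CommRing R] [Algebra ℝ R]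

/-- `δ` is a derivation along the algebra map `φ`. -/
structure IsDerivationAlong (φ : A →ₐ[ℝ] R) (δ : A → R) : Prop where
  map_add : ∀ a b, δ (a + b) = δ a + δ b
  map_mul : ∀ a b, δ (a * b) = φ a * δ b + φ b * δ a
  map_algebraMap : ∀ r, δ (algebraMap ℝ A r) = 0

/-- The algebra map `a ↦ φ a + e₁ δ₁ a + e₂ δ₂ a` given by derivations `δ₁`, `δ₂` along `φ` and by
elements `e₁`, `e₂` whose products vanish. -/
def IsDerivationAlong.algHom {S : Type} [CommRing S] [Algebra ℝ S] {φ : A →ₐ[ℝ] R} {δ₁ δ₂ : A → R}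
    (h₁ : IsDerivationAlong φ δ₁) (h₂ : IsDerivationAlong φ δ₂) (i : R →ₐ[ℝ] S) {e₁ e₂ : S}
    (h₁₁ : e₁ * e₁ = 0) (h₁₂ : e₁ * e₂ = 0) (h₂₂ : e₂ * e₂ = 0) : A →ₐ[ℝ] S where
  toFun a := i (φ a) + i (δ₁ a) * e₁ + i (δ₂ a) * e₂
  map_one' := by
    have h3 := h₁.map_algebraMap 1
    have h4 := h₂.map_algebraMap 1
    rw [map_one] at h3 h4
    rw [h3, h4, map_one, map_one, map_zero]
    ring
  map_zero' := by
    have h3 := h₁.map_algebraMap 0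
    have h4 := h₂.map_algebraMap 0
    rw [map_zero] at h3 h4
    rw [h3, h4, map_zero, map_zero]
    ring
  map_add' a b := by
    rw [h₁.map_add, h₂.map_add]
    simp only [_root_.map_add]
    ring
  map_mul' a b := by
    rw [h₁.map_mul, h₂.map_mul]
    simp only [_root_.map_add, _root_.map_mul]
    linear_combination -(i (δ₁ a) * i (δ₁ b)) * h₁₁ - (i (δ₁ a) * i (δ₂ b) +
      i (δ₂ a) * i (δ₁ b)) * h₁₂ - (i (δ₂ a) * i (δ₂ b)) * h₂₂
  commutes' r := by
    rw [h₁.map_algebraMap, h₂.map_algebraMap, AlgHom.commutes, AlgHom.commutes, map_zero]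
    ring

theorem ThCartSp.snd_inr_mul_snd_inr {Q : Type} [AddCommGroup Q] [Module ℝ Q] [Module ℝᵐᵒᵖ Q]
    [IsCentralScalar ℝ Q] [Module.Finite ℝ Q] (X : ThCartSp) (x y : Q) :
    X.snd (TrivSqZeroExt.inr x : TrivSqZeroExt ℝ Q) * X.snd (TrivSqZeroExt.inr y) = 0 := by
  rw [← map_mul, TrivSqZeroExt.inr_mul_inr, map_zero]

/-- The algebra map `a ↦ φ a + ε₁ δ₁ a + ε₂ δ₂ a` given by two derivations along `φ`. -/
def d2AlgHom {X : ThCartSp} (φ : A →ₐ[ℝ] X.O) {δ₁ δ₂ : A → X.O} (h₁ : IsDerivationAlong φ δ₁)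
    (h₂ : IsDerivationAlong φ δ₂) : A →ₐ[ℝ] (X.ext D2).O :=
  h₁.algHom h₂ (X.fst D2).comorphism (X.snd_inr_mul_snd_inr (1, 0) (1, 0))
    (X.snd_inr_mul_snd_inr (1, 0) (0, 1)) (X.snd_inr_mul_snd_inr (0, 1) (0, 1))

theorem coef_d2AlgHom {X : ThCartSp} (φ : A →ₐ[ℝ] X.O) {δ₁ δ₂ : A → X.O}
    (h₁ : IsDerivationAlong φ δ₁) (h₂ : IsDerivationAlong φ δ₂) (ℓ : D2 →ₗ[ℝ] ℝ) (a : A) :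
    X.coef ℓ (d2AlgHom φ h₁ h₂ a) = ℓ 1 • φ a + ℓ (TrivSqZeroExt.inr (1, 0)) • δ₁ a +
      ℓ (TrivSqZeroExt.inr (0, 1)) • δ₂ a := by
  change X.coef ℓ ((X.fst D2).comorphism (φ a) + (X.fst D2).comorphism (δ₁ a) *
    X.snd (TrivSqZeroExt.inr (1, 0)) + (X.fst D2).comorphism (δ₂ a) *
    X.snd (TrivSqZeroExt.inr (0, 1))) = _
  rw [map_add, map_add, ThCartSp.coef_fst, ThCartSp.coef_fst_mul_snd, ThCartSp.coef_fst_mul_snd]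

end Derivations

/-- The plots of `G` are the compatible families of algebra maps out of the tower of algebras
`A 0 → A 1 → ⋯`. -/
structure PlotTower (G : ThSmthSet) {A : ℕ → Type} [∀ n, CommRing (A n)] [∀ n, Algebra ℝ (A n)]
    (t : ∀ n, A n →ₐ[ℝ] A (n + 1)) where
  /-- The algebra maps given by a plot. -/
  ev : ∀ {X : ThCartSp}, Plots G X → ∀ n, A n →ₐ[ℝ] X.O
  ev_res : ∀ {X Y : ThCartSp} (f : Y ⟶ X) (x : Plots G X) (n : ℕ) (a : A n),
    ev (res G f x) n a = f.comorphism (ev x n a)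
  ev_t : ∀ {X : ThCartSp} (x : Plots G X) (n : ℕ) (a : A n), ev x (n + 1) (t n a) = ev x n a
  ext : ∀ {X : ThCartSp} {x y : Plots G X}, (∀ n a, ev x n a = ev y n a) → x = y
  exists_plot : ∀ {X : ThCartSp} (φ : ∀ n, A n →ₐ[ℝ] X.O),
    (∀ n a, φ (n + 1) (t n a) = φ n a) → ∃ x : Plots G X, ∀ n a, ev x n a = φ n a

namespace PlotTower

variable {G : ThSmthSet} {A : ℕ → Type} [∀ n, CommRing (A n)] [∀ n, Algebra ℝ (A n)]
  {t : ∀ n, A n →ₐ[ℝ] A (n + 1)} (P : PlotTower G t) {X : ThCartSp} (g : Plots G X)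

/-- The compatible families of derivations along a plot. -/
def derivations : Submodule X.O (∀ n, A n → X.O) where
  carrier := {δ | (∀ n, IsDerivationAlong (P.ev g n) (δ n)) ∧ ∀ n a, δ (n + 1) (t n a) = δ n a}
  zero_mem' := ⟨fun n => ⟨fun _ _ => (add_zero _).symm,
    fun _ _ => by simp, fun _ => rfl⟩, fun _ _ => rfl⟩
  add_mem' {δ δ'} h h' := by
    refine ⟨fun n => ⟨fun a b => ?_, fun a b => ?_, fun r => ?_⟩, fun n a => ?_⟩
    · simp only [Pi.add_apply, (h.1 n).map_add, (h'.1 n).map_add]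
      ring
    · simp only [Pi.add_apply, (h.1 n).map_mul, (h'.1 n).map_mul]
      ring
    · simp only [Pi.add_apply, (h.1 n).map_algebraMap, (h'.1 n).map_algebraMap, add_zero]
    · simp only [Pi.add_apply, h.2, h'.2]
  smul_mem' r δ h := by
    refine ⟨fun n => ⟨fun a b => ?_, fun a b => ?_, fun c => ?_⟩, fun n a => ?_⟩
    · simp only [Pi.smul_apply, smul_eq_mul, (h.1 n).map_add]
      ring
    · simp only [Pi.smul_apply, smul_eq_mul, (h.1 n).map_mul]
      ring
    · simp only [Pi.smul_apply, (h.1 n).map_algebraMap, smul_zero]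
    · simp only [Pi.smul_apply, h.2]

variable {g}

/-- The algebra maps given by a tangent plot. -/
def tev (v : Plots (synT.obj G) X) (n : ℕ) : A n →ₐ[ℝ] (X.ext D1).O := P.ev (X := X.ext D1) v n

theorem coef₀_tev (v : Plots (synT.obj G) X) (n : ℕ) (a : A n) :
    X.coef₀ (P.tev v n a) = P.ev (ap (synTProj G) v) n a := by
  rw [← ThCartSp.point_comorphism]
  exact (P.ev_res (X.point (TrivSqZeroExt.fstHom ℝ ℝ ℝ)) v n a).symm

theorem coef₀_tev_fiber (v : TFiber G g) (n : ℕ) (a : A n) :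
    X.coef₀ (P.tev v.1 n a) = P.ev g n a := by
  rw [P.coef₀_tev, v.2]

theorem tev_t (v : Plots (synT.obj G) X) (n : ℕ) (a : A n) :
    P.tev v (n + 1) (t n a) = P.tev v n a :=
  P.ev_t (X := X.ext D1) v n a

theorem tangent_plot_ext {v w : Plots (synT.obj G) X} (h : ∀ n a, P.tev v n a = P.tev w n a) : v = w :=
  P.ext (X := X.ext D1) h

/-- The derivations along `g` given by a tangent plot over `g`. -/
def derivative (v : TFiber G g) : P.derivations g :=
  ⟨fun n a => X.coef₁ (P.tev v.1 n a), fun n =>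
    ⟨fun a b => by simp only [map_add], fun a b => by
      simp only [map_mul, ThCartSp.coef₁_mul, P.coef₀_tev_fiber], fun r => by
      have h1 : algebraMap ℝ (X.ext D1).O r = (X.fst D1).comorphism (algebraMap ℝ X.O r) :=
        ((X.fst D1).comorphism.commutes r).symm
      change X.coef₁ (P.tev v.1 n (algebraMap ℝ (A n) r)) = 0
      rw [AlgHom.commutes, h1, ThCartSp.coef_fst]
      simp⟩, fun n a => congrArg X.coef₁ (P.tev_t v.1 n a)⟩

theorem ev_d2Res (l : ℝ × ℝ →ₗ[ℝ] ℝ) (u : Plots G (X.ext D2)) (n : ℕ) (a : A n) :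
    P.tev (d2Res G l u) n a =
      (ThCartSp.extMap (𝟙 X) (d2Map l)).comorphism (P.ev u n a) :=
  P.ev_res _ _ _ _

theorem exists_d2Plot (δ₁ δ₂ : P.derivations g) : ∃ u : Plots G (X.ext D2), ∀ n a,
    P.ev u n a = d2AlgHom (P.ev g n) (δ₁.2.1 n) (δ₂.2.1 n) a := by
  refine P.exists_plot (fun n => d2AlgHom (P.ev g n) (δ₁.2.1 n) (δ₂.2.1 n)) fun n a => ?_
  change (X.fst D2).comorphism (P.ev g (n + 1) (t n a)) +
      (X.fst D2).comorphism (δ₁.1 (n + 1) (t n a)) * X.snd (TrivSqZeroExt.inr (1, 0)) +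
      (X.fst D2).comorphism (δ₂.1 (n + 1) (t n a)) * X.snd (TrivSqZeroExt.inr (0, 1)) =
    (X.fst D2).comorphism (P.ev g n a) +
      (X.fst D2).comorphism (δ₁.1 n a) * X.snd (TrivSqZeroExt.inr (1, 0)) +
      (X.fst D2).comorphism (δ₂.1 n a) * X.snd (TrivSqZeroExt.inr (0, 1))
  rw [P.ev_t, δ₁.2.2, δ₂.2.2]

/-- The derivative along `𝔻¹(1) → 𝔻²(1)` of the plot given by two derivations. -/
theorem exists_tangent_of_derivations (δ₁ δ₂ : P.derivations g) : ∃ u : Plots G (X.ext D2),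
    ∀ l : ℝ × ℝ →ₗ[ℝ] ℝ, ∃ v : TFiber G g, v.1 = d2Res G l u ∧
      ∀ n a, (P.derivative v).1 n a = l (1, 0) • δ₁.1 n a + l (0, 1) • δ₂.1 n a := by
  obtain ⟨u, hu⟩ := P.exists_d2Plot δ₁ δ₂
  refine ⟨u, fun l => ⟨⟨d2Res G l u, P.ext fun n a => ?_⟩, rfl, fun n a => ?_⟩⟩
  · rw [← P.coef₀_tev, P.ev_d2Res, ThCartSp.coef₀_d2Map, hu, coef_d2AlgHom]
    simp
  · change X.coef₁ (P.tev (d2Res G l u) n a) = _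
    rw [P.ev_d2Res, ThCartSp.coef₁_d2Map, hu, coef_d2AlgHom]
    simp

/-- A tangent plot over `g` is an algebra map `g + ε δ`, which amounts to a derivation `δ` along `g`. -/
theorem bijective_derivative : Function.Bijective (P.derivative (g := g)) := by
  refine ⟨fun v w h => Subtype.ext (P.tangent_plot_ext fun n a => ThCartSp.ext_coef ?_ ?_), fun δ => ?_⟩
  · rw [P.coef₀_tev_fiber, P.coef₀_tev_fiber]
  · exact congrFun (congrFun (congrArg Subtype.val h) n) a
  · obtain ⟨u, hu⟩ := P.exists_tangent_of_derivations δ 0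
    obtain ⟨v, -, hv⟩ := hu (LinearMap.fst ℝ ℝ ℝ)
    refine ⟨v, Subtype.ext (funext fun n => funext fun a => (hv n a).trans ?_)⟩
    simp

variable (g)

/-- The tangent plots over a plot `g` are the derivations along `g`. -/
def tangentEquiv : TFiber G g ≃ P.derivations g := Equiv.ofBijective _ P.bijective_derivative

/-- The addition of tangent plots, transported from derivations. -/
abbrev addCommGroup : AddCommGroup (TFiber G g) := (P.tangentEquiv g).addCommGroup

/-- The scalar multiplication of tangent plots, transported from derivations. -/
abbrev module : letI := P.addCommGroup g; Module X.O (TFiber G g) :=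
  (P.tangentEquiv g).module X.O

theorem derivative_add (v w : TFiber G g) (n : ℕ) (a : A n) : letI := P.addCommGroup g
    (P.derivative (v + w)).1 n a = (P.derivative v).1 n a + (P.derivative w).1 n a := by
  let := P.addCommGroup g
  have h1 : P.derivative (v + w) = P.derivative v + P.derivative w :=
    (P.tangentEquiv g).apply_symm_apply _
  rw [h1]
  rfl

theorem derivative_smul (r : X.O) (v : TFiber G g) (n : ℕ) (a : A n) :
    letI := P.addCommGroup g; letI := P.module g
    (P.derivative (r • v)).1 n a = r * (P.derivative v).1 n a := by
  let := P.addCommGroup g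
  let := P.module g
  have h1 : P.derivative (r • v) = r • P.derivative v :=
    (P.tangentEquiv g).apply_symm_apply _
  rw [h1]
  rfl

variable {g} in
theorem tangent_ext {v w : TFiber G g}
    (h : ∀ n a, (P.derivative v).1 n a = (P.derivative w).1 n a) : v = w :=
  P.bijective_derivative.injective (Subtype.ext (funext fun n => funext fun a => h n a))

/-- The operations transported from derivations are the synthetic ones: two derivations along `g`
define the plot `g + ε₁ δ₁ + ε₂ δ₂`, which restricts to `g + ε (δ₁ + δ₂)` on the diagonal. -/
theorem isSyntheticModule : letI := P.addCommGroup g; letI := P.module g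
    IsSyntheticModule G g := by
  let := P.addCommGroup g
  let := P.module g
  have key : ∀ v w : TFiber G g, ∃ u : Plots G (X.ext D2),
      d2Res G (LinearMap.fst ℝ ℝ ℝ) u = v.1 ∧ d2Res G (LinearMap.snd ℝ ℝ ℝ) u = w.1 ∧
      d2Res G (LinearMap.fst ℝ ℝ ℝ + LinearMap.snd ℝ ℝ ℝ) u = (v + w).1 := by
    intro v w
    obtain ⟨u, hu⟩ := P.exists_tangent_of_derivations (P.derivative v) (P.derivative w)
    refine ⟨u, ?_, ?_, ?_⟩
    · obtain ⟨z, hz, h⟩ := hu (LinearMap.fst ℝ ℝ ℝ)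
      rw [← hz]
      refine congrArg Subtype.val (P.tangent_ext fun n a => (h n a).trans ?_)
      simp
    · obtain ⟨z, hz, h⟩ := hu (LinearMap.snd ℝ ℝ ℝ)
      rw [← hz]
      refine congrArg Subtype.val (P.tangent_ext fun n a => (h n a).trans ?_)
      simp
    · obtain ⟨z, hz, h⟩ := hu (LinearMap.fst ℝ ℝ ℝ + LinearMap.snd ℝ ℝ ℝ)
      rw [← hz]
      refine congrArg Subtype.val (P.tangent_ext fun n a => (h n a).trans ?_)
      rw [P.derivative_add]
      simp
  refine ⟨fun v w => ?_, fun v w => key v w, fun r v => ?_⟩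
  · obtain ⟨u, h1, h2, -⟩ := key v w
    refine ⟨u, ⟨h1, h2⟩, fun u' hu' => P.ext fun n a => ?_⟩
    have h3 := congrArg (fun z => P.tev z n a) (hu'.1.trans h1.symm)
    have h4 := congrArg (fun z => P.tev z n a) (hu'.2.trans h2.symm)
    rw [P.ev_d2Res, P.ev_d2Res] at h3 h4
    have h5 := congrArg X.coef₀ h3
    have h6 := congrArg X.coef₁ h3
    have h7 := congrArg X.coef₁ h4
    rw [ThCartSp.coef₀_d2Map, ThCartSp.coef₀_d2Map] at h5
    rw [ThCartSp.coef₁_d2Map, ThCartSp.coef₁_d2Map] at h6 h7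
    exact ThCartSp.ext_coef_D2 h5 h6 h7
  · refine P.tangent_plot_ext fun n a => ?_
    refine Eq.trans ?_ (P.ev_res (X.scale r) v.1 n a).symm
    refine Eq.trans ?_ (X.scale_comorphism r (P.tev v.1 n a)).symm
    rw [X.eq_coef₀_add_coef₁ (P.tev (r • v).1 n a), P.coef₀_tev_fiber, P.coef₀_tev_fiber]
    exact congrArg (fun c => _ + (X.fst D1).comorphism c * X.snd eps) (P.derivative_smul g r v n a)

end PlotTower

/-! ### Naturality of the module structures -/

theorem IsTangentSum.map {G H : ThSmthSet} (f : G ⟶ H) {X : ThCartSp} {v w z : Plots (synT.obj G) X}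
    (h : IsTangentSum v w z) :
    IsTangentSum (ap (synT.map f) v) (ap (synT.map f) w) (ap (synT.map f) z) := by
  obtain ⟨u, rfl, rfl, rfl⟩ := h
  exact ⟨ap f u, (ap_res f _ u).symm, (ap_res f _ u).symm, (ap_res f _ u).symm⟩

/-! ### Functions which are linear along the fibres of `J ×_M TM` -/

section FiberwiseLinear

variable {E₁ H₁ E H E₂ H₂ : Type} [NormedAddCommGroup E₁] [NormedSpace ℝ E₁]
  [FiniteDimensional ℝ E₁] [TopologicalSpace H₁] {I₁ : ModelWithCorners ℝ E₁ H₁}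
  [NormedAddCommGroup E] [NormedSpace ℝ E] [FiniteDimensional ℝ E] [TopologicalSpace H]
  {I : ModelWithCorners ℝ E H} [NormedAddCommGroup E₂] [NormedSpace ℝ E₂]
  [FiniteDimensional ℝ E₂] [TopologicalSpace H₂] {I₂ : ModelWithCorners ℝ E₂ H₂}
  {J M Z : Type} [TopologicalSpace J] [ChartedSpace H₁ J] [IsManifold I₁ ∞ J] [T2Space J]
  [TopologicalSpace M] [ChartedSpace H M] [IsManifold I ∞ M] [T2Space M]
  [TopologicalSpace Z] [ChartedSpace H₂ Z] [IsManifold I₂ ∞ Z] [T2Space Z]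
  [SecondCountableTopology J] [SecondCountableTopology M] [SecondCountableTopology Z]
  [I.Boundaryless] [I₁.Boundaryless] {P : C^∞⟮I₁, J; I, M⟯} {F₁ : C^∞⟮I₂, Z; I₁, J⟯}
  {F₂ : C^∞⟮I₂, Z; I.tangent, TangentBundle I M⟯}

variable (F₁ F₂) in
/-- The function `G` on `Z = J ×_M TM` is linear along the fibres of `Z → J`. Linear combinations of
tangent vectors with the same foot point are expressed through the differentials of functions. -/
def IsFiberwiseLinear (G : C^∞⟮I₂, Z; ℝ⟯) : Prop :=
  ∀ (z z₁ z₂ : Z) (a b : ℝ), F₁ z = F₁ z₁ → F₁ z = F₁ z₂ →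
    (∀ f : C^∞⟮I, M; ℝ⟯, dFun f (F₂ z) = a * dFun f (F₂ z₁) + b * dFun f (F₂ z₂)) →
      G z = a * G z₁ + b * G z₂

theorem clm_combination (L : E →L[ℝ] ℝ) (y₁ y₂ : E) (a b : ℝ) :
    L (a • y₁ + b • y₂) = a * L y₁ + b * L y₂ := by
  rw [map_add, map_smul, map_smul, smul_eq_mul, smul_eq_mul]

theorem dFun_tanParam_combination (s : C^∞⟮𝓘(ℝ, E), E; I, M⟯) (f : C^∞⟮I, M; ℝ⟯) (x y₁ y₂ : E)
    (a b : ℝ) : dFun f (tanParam s (x, a • y₁ + b • y₂)) =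
      a * dFun f (tanParam s (x, y₁)) + b * dFun f (tanParam s (x, y₂)) := by
  obtain ⟨L, hL⟩ : ∃ L : E →L[ℝ] ℝ, ∀ y, dFun f (tanParam s (x, y)) = L y :=
    ⟨mfderiv 𝓘(ℝ, E) 𝓘(ℝ, ℝ) (smoothPullback s f) x,
      fun y => (dFun_smoothPullback s f (x, y)).symm⟩
  rw [hL, hL, hL]
  exact clm_combination L y₁ y₂ a b

namespace IsTangentPullback

/-- A fibrewise linear function is locally a combination, with coefficients in the functions on `J`, of
the differentials of coordinates of `M`. -/
theorem exists_expansion (hZ : IsTangentPullback P F₁ F₂) {G : C^∞⟮I₂, Z; ℝ⟯}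
    (hG : IsFiberwiseLinear F₁ F₂ G) (j₀ : J) :
    ∃ (c : Fin (Module.finrank ℝ E) → C^∞⟮I, M; ℝ⟯)
      (A : Fin (Module.finrank ℝ E) → C^∞⟮I₁, J; ℝ⟯), ∀ᶠ j in 𝓝 j₀, ∀ z, F₁ z = j →
        G z = (∑ i, smoothPullback F₁ (A i) * smoothPullback F₂ (dFun (c i))) z := by
  obtain ⟨r, r', s, hs⟩ := hZ.exists_param (rfl : P j₀ = P j₀)
  let A : Fin (Module.finrank ℝ E) → C^∞⟮I₁, J; ℝ⟯ := fun i =>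
    ⟨fun j => G (s (r.c j, Module.finBasis ℝ E i)), G.contMDiff.comp (s.contMDiff.comp
      (r.c.contMDiff.prodMk_space contMDiff_const))⟩
  refine ⟨fun i => coordFun r'.c (coordCLM E i), A, ?_⟩
  filter_upwards [r.retract, P.contMDiff.continuous.continuousAt.eventually r'.eventually_tangent]
    with j hj hj' z hz
  subst hz
  have hfoot := hZ.foot z
  -- The point `z` is parametrized by its own coordinates.
  have h1 : z = s (r.c (F₁ z), dMap r'.c (F₂ z)) := by
    refine hZ.ext _ _ ?_ ?_
    · rw [(hs _).1]
      exact hj.symm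
    · rw [(hs _).2]
      have h2 := hj'
      rw [← hfoot] at h2
      refine (h2 (F₂ z).2).symm.trans (congrArg (tanParam r'.s) (Prod.ext ?_ rfl))
      change r'.c (F₂ z).1 = r'.c (P (r.s (r.c (F₁ z))))
      rw [hj, hfoot]
  have h2 : IsLinearMap ℝ fun y : E => G (s (r.c (F₁ z), y)) := by
    have key : ∀ (y₁ y₂ : E) (a b : ℝ), G (s (r.c (F₁ z), a • y₁ + b • y₂)) =
        a * G (s (r.c (F₁ z), y₁)) + b * G (s (r.c (F₁ z), y₂)) := by
      intro y₁ y₂ a b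
      refine hG _ _ _ a b ?_ ?_ fun f => ?_
      · rw [(hs _).1, (hs _).1]
      · rw [(hs _).1, (hs _).1]
      · rw [(hs _).2, (hs _).2, (hs _).2]
        exact dFun_tanParam_combination r'.s f _ y₁ y₂ a b
    refine ⟨fun y₁ y₂ => ?_, fun a y => ?_⟩
    · have h3 := key y₁ y₂ 1 1
      rwa [one_smul, one_smul, one_mul, one_mul] at h3
    · have h3 := key y 0 a 0
      rwa [zero_smul, add_zero, zero_mul, add_zero] at h3
  -- Expand the linear function `y ↦ G (s (c, y))` in the basis of `E`.
  have h3 : G z = ∑ i, coordCLM E i (dMap r'.c (F₂ z)) *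
      G (s (r.c (F₁ z), Module.finBasis ℝ E i)) := by
    conv_lhs => rw [h1, ← sum_coordCLM (dMap r'.c (F₂ z))]
    refine (map_sum h2.mk' _ _).trans (Finset.sum_congr rfl fun i _ => ?_)
    exact h2.map_smul _ _
  have h4 : (∑ i, smoothPullback F₁ (A i) *
      smoothPullback F₂ (dFun (coordFun r'.c (coordCLM E i)))) z =
      ∑ i, (smoothPullback F₁ (A i) *
        smoothPullback F₂ (dFun (coordFun r'.c (coordCLM E i)))) z :=
    map_sum (ContMDiffMap.evalRingHom (n := ∞) z) _ _
  rw [h3, h4]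
  refine Finset.sum_congr rfl fun i _ => ?_
  change _ = A i (F₁ z) * dFun (coordFun r'.c (coordCLM E i)) (F₂ z)
  rw [dFun_coordFun, mul_comm]
  rfl

/-- Fibrewise linear functions are linear on plots. -/
theorem apply_combination (hZ : IsTangentPullback P F₁ F₂) {G : C^∞⟮I₂, Z; ℝ⟯}
    (hG : IsFiberwiseLinear F₁ F₂ G) {X : ThCartSp} {ψ ψ₁ ψ₂ : C^∞⟮I₂, Z; ℝ⟯ →ₐ[ℝ] X.O}
    (h₁ : ∀ f, ψ (smoothPullback F₁ f) = ψ₁ (smoothPullback F₁ f))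
    (h₂ : ∀ f, ψ (smoothPullback F₁ f) = ψ₂ (smoothPullback F₁ f)) (a b : X.O)
    (h : ∀ f : C^∞⟮I, M; ℝ⟯, ψ (smoothPullback F₂ (dFun f)) =
      a * ψ₁ (smoothPullback F₂ (dFun f)) + b * ψ₂ (smoothPullback F₂ (dFun f))) :
    ψ G = a * ψ₁ G + b * ψ₂ G := by
  refine evalPoint_ext X fun p => ?_
  have hbody : ∀ φ : C^∞⟮I₂, Z; ℝ⟯ →ₐ[ℝ] X.O,
      (∀ f, ψ (smoothPullback F₁ f) = φ (smoothPullback F₁ f)) →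
      F₁ (bodyMap φ p) = F₁ (bodyMap ψ p) := fun φ hφ => by
    refine eq_of_forall_apply_eq (I := I₁) fun f => ?_
    have h1 := body_apply φ (smoothPullback F₁ f) p
    have h2 := body_apply ψ (smoothPullback F₁ f) p
    rw [← hφ] at h1
    exact h1.symm.trans h2
  -- Near the point of `J` underlying the three plots at `p`, the function `G` is the same combination
  -- of differentials.
  obtain ⟨c, A, hcA⟩ := hZ.exists_expansion hG (F₁ (bodyMap ψ p))
  have key : ∀ φ : C^∞⟮I₂, Z; ℝ⟯ →ₐ[ℝ] X.O,
      (∀ f, ψ (smoothPullback F₁ f) = φ (smoothPullback F₁ f)) →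
      evalPoint X p (φ G) = evalPoint X p (∑ i, ψ (smoothPullback F₁ (A i)) *
        φ (smoothPullback F₂ (dFun (c i)))) := fun φ hφ => by
    have h1 := hcA
    rw [← hbody φ hφ] at h1
    refine (evalPoint_eq_of_eventuallyEq φ ((F₁.contMDiff.continuous.continuousAt.eventually
      h1).mono fun z hz => hz z rfl)).trans (congrArg (evalPoint X p) ?_)
    rw [map_sum]
    refine Finset.sum_congr rfl fun i _ => ?_
    rw [map_mul, hφ]
  rw [key ψ fun _ => rfl, map_add, map_mul, map_mul, key ψ₁ h₁, key ψ₂ h₂, ← map_mul, ← map_mul,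
    ← map_add]
  refine congrArg (evalPoint X p) ?_
  rw [Finset.mul_sum, Finset.mul_sum, ← Finset.sum_add_distrib]
  refine Finset.sum_congr rfl fun i _ => ?_
  rw [h]
  ring

end IsTangentPullback

end FiberwiseLinear

/-! ### The horizontal lift -/

section HorizontalLift

variable {E EF V : Type} [NormedAddCommGroup E] [NormedSpace ℝ E] [NormedAddCommGroup EF]
  [NormedSpace ℝ EF] [NormedAddCommGroup V] [NormedSpace ℝ V] [FiniteDimensional ℝ E]
  [FiniteDimensional ℝ V]
  {M F : Type} [TopologicalSpace M] [ChartedSpace E M] [TopologicalSpace F] [ChartedSpace EF F]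
  [IsManifold 𝓘(ℝ, E) ∞ M] [IsManifold 𝓘(ℝ, EF) ∞ F] {π : F → M} (h : IsFibered E EF V π)
  [T2Space M] [SecondCountableTopology M] [T2Space F] [SecondCountableTopology F]

open JetBundle

/-- The manifold `JⁿF ×_M TM` as a thickened smooth set. -/
def yJetTM (n : ℕ) : ThSmthSet := yMan ((jetI E V n).prod 𝓘(ℝ, E)) (JetTM h n)

/-- The projection `JⁿF ×_M TM ⟶ JⁿF`. -/
def yJetTMFst (n : ℕ) : yJetTM h n ⟶ yJet h n := yMap (jetTMFst h n)

/-- The projection from `JⁿF ×_M TM` to the synthetic tangent bundle of `M`. -/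
def yJetTMSnd (n : ℕ) : yJetTM h n ⟶ synT.obj (yMan 𝓘(ℝ, E) M) :=
  yMap (jetTMSnd h n) ≫ kappa 𝓘(ℝ, E) M

/-- The projection `Jⁿ⁺¹F ×_M TM ⟶ JⁿF ×_M TM`. -/
def yJetTMTrunc (n : ℕ) : yJetTM h (n + 1) ⟶ yJetTM h n := yMap (truncTM h n)

/-- The pushforward `Jⁿ⁺¹F ×_M TM ⟶ T(JⁿF)`. -/
def yJetPush (n : ℕ) : yJetTM h (n + 1) ⟶ yTanJet h n := yMap (jetPushCM h n)

theorem yJetTMTrunc_fst (n : ℕ) :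
    yJetTMTrunc h n ≫ yJetTMFst h n = yJetTMFst h (n + 1) ≫ yMap (truncCM h n) := rfl

theorem yJetTMTrunc_snd (n : ℕ) : yJetTMTrunc h n ≫ yJetTMSnd h n = yJetTMSnd h (n + 1) := rfl

theorem yJetPush_trunc (n : ℕ) : yJetPush h (n + 1) ≫ yTanTrunc h n =
    yJetTMTrunc h (n + 1) ≫ yJetPush h n :=
  congrArg yMap (tangentCM_trunc_comp_jetPushCM h n)

theorem yJetPush_proj (n : ℕ) : yJetPush h n ≫ kappaJet h n ≫ synTProj (yJet h n) =
    yJetTMFst h (n + 1) ≫ yMap (truncCM h n) := by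
  rw [kappa_proj]
  exact congrArg yMap (tangentProj_comp_jetPushCM h n)

theorem yJetPush_pt : yJetPush h 0 ≫ kappaJet h 0 ≫ synT.map (yMap (ptCM h 0)) =
    yJetTMSnd h 1 := by
  have h1 : kappaJet h 0 ≫ synT.map (yMap (ptCM h 0)) =
      yMap (tangentCM (ptCM h 0)) ≫ kappa 𝓘(ℝ, E) M := kappa_naturality (ptCM h 0)
  have h2 : yJetPush h 0 ≫ yMap (tangentCM (ptCM h 0)) = yMap (jetTMSnd h 1) :=
    congrArg yMap (tangentCM_pt_comp_jetPushCM h 0)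
  rw [h1, ← Category.assoc, h2]
  rfl

/-- The identification of the manifold `JⁿF ×_M TM` with the fibre product. -/
def yJetTMCompare (n : ℕ) : yJetTM h n ⟶
    pullback (yMap (ptCM h n)) (synTProj (yMan 𝓘(ℝ, E) M)) := jetTMCompare h n

theorem yJetTMCompare_fst (n : ℕ) : yJetTMCompare h n ≫ pullback.fst _ _ = yJetTMFst h n :=
  pullback.lift_fst _ _ _

theorem yJetTMCompare_snd (n : ℕ) : yJetTMCompare h n ≫ pullback.snd _ _ = yJetTMSnd h n :=
  pullback.lift_snd _ _ _

instance isIso_yJetTMCompare (n : ℕ) : IsIso (yJetTMCompare h n) :=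
  (isTangentPullback_jetTM h n).isIso_lift (yJetTMCompare_fst h n) (yJetTMCompare_snd h n)

/-- The map `J^∞F ×_M TM ⟶ JⁿF ×_M TM` to the manifold. -/
def jetInfTMJet (n : ℕ) : jetInfTM h ⟶ yJetTM h n := jetInfTMProj h n ≫ inv (yJetTMCompare h n)

theorem jetInfTMJet_fst (n : ℕ) :
    jetInfTMJet h n ≫ yJetTMFst h n = jetInfTMFst h ≫ jetInfProj h n := by
  rw [jetInfTMJet, ← yJetTMCompare_fst, Category.assoc, IsIso.inv_hom_id_assoc]
  exact pullback.lift_fst _ _ _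

theorem jetInfTMJet_snd (n : ℕ) : jetInfTMJet h n ≫ yJetTMSnd h n = jetInfTMSnd h := by
  rw [jetInfTMJet, ← yJetTMCompare_snd, Category.assoc, IsIso.inv_hom_id_assoc]
  exact pullback.lift_snd _ _ _

variable {h} in
theorem yJetTM_hom_ext {G : ThSmthSet} {n : ℕ} {f g : G ⟶ yJetTM h n}
    (h₁ : f ≫ yJetTMFst h n = g ≫ yJetTMFst h n) (h₂ : f ≫ yJetTMSnd h n = g ≫ yJetTMSnd h n) :
    f = g := by
  rw [← cancel_mono (yJetTMCompare h n)]
  refine pullback.hom_ext ?_ ?_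
  · rwa [Category.assoc, Category.assoc, yJetTMCompare_fst]
  · rwa [Category.assoc, Category.assoc, yJetTMCompare_snd]

theorem jetInfTMJet_trunc (n : ℕ) :
    jetInfTMJet h (n + 1) ≫ yJetTMTrunc h n = jetInfTMJet h n := by
  refine yJetTM_hom_ext ?_ ?_
  · rw [Category.assoc, yJetTMTrunc_fst, ← Category.assoc, jetInfTMJet_fst, jetInfTMJet_fst,
      Category.assoc, jetInfProj_succ]
  · rw [Category.assoc, yJetTMTrunc_snd, jetInfTMJet_snd, jetInfTMJet_snd]

/-- The map `J^∞F ×_M TM ⟶ T(J^∞F)` given by the pushforwards along jet prolongations. -/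
theorem exists_horizontalLift : ∃ H : jetInfTM h ⟶ synT.obj (jetInf h), ∀ n,
    H ≫ synT.map (jetInfProj h n) = jetInfTMJet h (n + 1) ≫ yJetPush h n ≫ kappaJet h n := by
  obtain ⟨H, hH⟩ := exists_lift_synT_jetInf h
    (fun n => jetInfTMJet h (n + 1) ≫ yJetPush h n) fun n => by
      rw [Category.assoc, yJetPush_trunc, ← Category.assoc, jetInfTMJet_trunc]
  exact ⟨H, fun n => (hH n).trans (Category.assoc _ _ _)⟩

variable {h}

theorem jetInfTM_hom_ext {G : ThSmthSet} {f g : G ⟶ jetInfTM h}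
    (h₁ : f ≫ jetInfTMFst h = g ≫ jetInfTMFst h) (h₂ : f ≫ jetInfTMSnd h = g ≫ jetInfTMSnd h) :
    f = g :=
  pullback.hom_ext h₁ h₂

theorem jetInfDiff_fst : jetInfDiff h ≫ jetInfTMFst h = synTProj (jetInf h) :=
  pullback.lift_fst _ _ _

theorem jetInfDiff_snd : jetInfDiff h ≫ jetInfTMSnd h = synT.map (jetInfPt h) :=
  pullback.lift_snd _ _ _

theorem horizontalLift_proj {H : jetInfTM h ⟶ synT.obj (jetInf h)}
    (hH : ∀ n, H ≫ synT.map (jetInfProj h n) =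
      jetInfTMJet h (n + 1) ≫ yJetPush h n ≫ kappaJet h n) :
    H ≫ synTProj (jetInf h) = jetInfTMFst h := by
  have h1 : ∀ n, (H ≫ synTProj (jetInf h)) ≫ jetInfProj h n =
      jetInfTMFst h ≫ jetInfProj h n := fun n => by
    rw [Category.assoc, synTProj_naturality, ← Category.assoc, hH, Category.assoc, Category.assoc,
      yJetPush_proj, ← Category.assoc, jetInfTMJet_fst, Category.assoc, jetInfProj_succ]
  exact thSmthSet_hom_ext fun X x => jetInf_plot_ext fun n =>
    congrArg (fun t : jetInfTM h ⟶ yJet h n => ap t x) (h1 n)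

theorem horizontalLift_pt {H : jetInfTM h ⟶ synT.obj (jetInf h)}
    (hH : ∀ n, H ≫ synT.map (jetInfProj h n) =
      jetInfTMJet h (n + 1) ≫ yJetPush h n ≫ kappaJet h n) :
    H ≫ synT.map (jetInfPt h) = jetInfTMSnd h := by
  rw [jetInfPt, Functor.map_comp, ← Category.assoc, hH, Category.assoc, Category.assoc,
    yJetPush_pt, jetInfTMJet_snd]

/-- The horizontal lift is a section of the differential of the projection to `M`. -/
theorem horizontalLift_jetInfDiff {H : jetInfTM h ⟶ synT.obj (jetInf h)}
    (hH : ∀ n, H ≫ synT.map (jetInfProj h n) =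
      jetInfTMJet h (n + 1) ≫ yJetPush h n ≫ kappaJet h n) :
    H ≫ jetInfDiff h = 𝟙 (jetInfTM h) := by
  refine jetInfTM_hom_ext ?_ ?_
  · rw [Category.assoc, jetInfDiff_fst, Category.id_comp]
    exact horizontalLift_proj hH
  · rw [Category.assoc, jetInfDiff_snd, Category.id_comp]
    exact horizontalLift_pt hH

end HorizontalLift

/-! ### Linearity of the horizontal lift -/

section

variable {E H N : Type} [NormedAddCommGroup E] [NormedSpace ℝ E] [TopologicalSpace H]
  {I : ModelWithCorners ℝ E H} [TopologicalSpace N] [ChartedSpace H N] [IsManifold I ∞ N]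
  [FiniteDimensional ℝ E] [T2Space N] [I.Boundaryless]

/-- Linear combinations in a tangent space are detected by the differentials of functions. -/
theorem eq_combination_of_dFun {x : N} {X X₁ X₂ : E} {a b : ℝ}
    (h : ∀ f : C^∞⟮I, N; ℝ⟯, dFun f (⟨x, X⟩ : TangentBundle I N) =
      a * dFun f (⟨x, X₁⟩ : TangentBundle I N) + b * dFun f (⟨x, X₂⟩ : TangentBundle I N)) :
    X = a • X₁ + b • X₂ := by
  have h1 : (⟨x, X⟩ : TangentBundle I N) = (⟨x, a • X₁ + b • X₂⟩ : TangentBundle I N) := by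
    refine tangent_ext_of_dFun (fun _ => rfl) fun f => (h f).trans ?_
    obtain ⟨L, hL⟩ : ∃ L : E →L[ℝ] ℝ, ∀ y : E, dFun f (⟨x, y⟩ : TangentBundle I N) = L y :=
      ⟨mfderiv I 𝓘(ℝ, ℝ) f x, fun _ => rfl⟩
    rw [hL, hL, hL]
    exact (clm_combination L X₁ X₂ a b).symm
  exact eq_of_heq (Bundle.TotalSpace.mk.inj h1).2

end

section JetPushLinear

variable {E EF V : Type} [NormedAddCommGroup E] [NormedSpace ℝ E] [NormedAddCommGroup EF]
  [NormedSpace ℝ EF] [NormedAddCommGroup V] [NormedSpace ℝ V] [FiniteDimensional ℝ E]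
  [FiniteDimensional ℝ V]
  {M F : Type} [TopologicalSpace M] [ChartedSpace E M] [TopologicalSpace F] [ChartedSpace EF F]
  [IsManifold 𝓘(ℝ, E) ∞ M] [IsManifold 𝓘(ℝ, EF) ∞ F] {π : F → M} {h : IsFibered E EF V π} {n : ℕ}
  [T2Space M] [T2Space F]

open JetBundle

/-- For a fixed jet, the pushforward is linear in the tangent vector. -/
theorem dFun_jetPush {p : M} {s : M → F} (hs : IsLocSec E EF π p s)
    (f : C^∞⟮jetI E V n, JetBundle h n; ℝ⟯) : ∃ L : E →L[ℝ] ℝ, ∀ X : E,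
      dFun f (jetPush h n ⟨jet h (n + 1) p s hs, X⟩) = L X :=
  ⟨(mfderiv (jetI E V n) 𝓘(ℝ, ℝ) f (jetOr (jet h n p s hs) s p) :
      E × JetFiber E V n →L[ℝ] ℝ).comp
    (mfderiv 𝓘(ℝ, E) (jetI E V n) (jetOr (jet h n p s hs) s) p : E →L[ℝ] E × JetFiber E V n),
    fun X => congrArg (dFun f) (jetPush_jet hs X).2⟩

theorem dFun_jetPush_combination (f : C^∞⟮jetI E V n, JetBundle h n; ℝ⟯) (j : JetBundle h (n + 1))
    (X₁ X₂ : E) (a b : ℝ) : dFun f (jetPush h n ⟨j, (a • X₁ + b • X₂ : E)⟩) =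
      a * dFun f (jetPush h n ⟨j, X₁⟩) + b * dFun f (jetPush h n ⟨j, X₂⟩) := by
  obtain ⟨p, s, hs, rfl⟩ := j.exists_rep
  obtain ⟨L, hL⟩ := dFun_jetPush (n := n) hs f
  exact (hL (a • X₁ + b • X₂)).trans ((clm_combination L X₁ X₂ a b).trans
    (congrArg₂ (fun x y => a * x + b * y) (hL X₁).symm (hL X₂).symm))

set_option maxHeartbeats 1000000 in
theorem isFiberwiseLinear_jetPush (f : C^∞⟮jetI E V n, JetBundle h n; ℝ⟯) :
    IsFiberwiseLinear (jetTMFst h (n + 1)) (jetTMSnd h (n + 1))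
      (smoothPullback (jetPushCM h n) (dFun f)) := by
  rintro ⟨j, X⟩ ⟨j₁, X₁⟩ ⟨j₂, X₂⟩ a b h₁ h₂ hz
  obtain rfl : j = j₁ := h₁
  obtain rfl : j = j₂ := h₂
  obtain rfl : X = (a • X₁ + b • X₂ : E) :=
    eq_combination_of_dFun (I := 𝓘(ℝ, E)) (x := j.pt) hz
  exact dFun_jetPush_combination f j X₁ X₂ a b

end JetPushLinear

/-! ### Addition of tangent plots as a map -/

section TangentSum

variable {G : ThSmthSet} {X Y : ThCartSp}

theorem ThCartSp.extMap_d2Map_comm (f : Y ⟶ X) (l : ℝ × ℝ →ₗ[ℝ] ℝ) :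
    extMap (𝟙 Y) (d2Map l) ≫ extMap f (AlgHom.id ℝ D2) =
      extMap f (AlgHom.id ℝ D1) ≫ extMap (𝟙 X) (d2Map l) := by
  refine ext_hom ?_ ?_
  · rw [Category.assoc, Category.assoc]
    simp only [extMap, pair_fst]
    rw [← Category.assoc, ← Category.assoc, pair_fst, pair_fst, Category.comp_id, Category.comp_id]
  · rw [comp_comorphism, comp_comorphism, AlgHom.comp_assoc, AlgHom.comp_assoc, extMap_snd,
      extMap_snd, ← AlgHom.comp_assoc, extMap_snd, AlgHom.comp_id, ← AlgHom.comp_assoc, extMap_snd,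
      AlgHom.comp_id]

/-- Restriction along a line in `𝔻²(1)` is natural in the probe. -/
theorem d2Res_res (f : Y ⟶ X) (l : ℝ × ℝ →ₗ[ℝ] ℝ) (u : Plots G (X.ext D2)) :
    d2Res G l (res G (ThCartSp.extMap f (AlgHom.id ℝ D2)) u) = res (synT.obj G) f (d2Res G l u) := by
  change res G (ThCartSp.extMap (𝟙 Y) (d2Map l)) (res G (ThCartSp.extMap f (AlgHom.id ℝ D2)) u) =
    res G (ThCartSp.extMap f (AlgHom.id ℝ D1)) (res G (ThCartSp.extMap (𝟙 X) (d2Map l)) u)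
  have h1 : ∀ {X Y Z : ThCartSp} (f : Y ⟶ X) (g : Z ⟶ Y) (u : Plots G X),
      res G g (res G f u) = res G (g ≫ f) u := fun f g u =>
    (congrArg (fun t : G.obj.obj _ ⟶ G.obj.obj _ => t u) (G.obj.map_comp f.op g.op)).symm
  rw [h1, h1, ThCartSp.extMap_d2Map_comm]

theorem IsTangentSum.res {v w z : Plots (synT.obj G) X} (h : IsTangentSum v w z) (f : Y ⟶ X) :
    IsTangentSum (res (synT.obj G) f v) (res (synT.obj G) f w) (res (synT.obj G) f z) := by
  obtain ⟨u, rfl, rfl, rfl⟩ := h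
  exact ⟨_, d2Res_res f _ u, d2Res_res f _ u, d2Res_res f _ u⟩

/-- The synthetic sum of two tangent plots is unique. -/
theorem IsSyntheticModule.eq_add {g : Plots G X}
    [AddCommGroup (TFiber G g)] [Module X.O (TFiber G g)] (h : IsSyntheticModule G g)
    {v w : TFiber G g} {z : Plots (synT.obj G) X} (hz : IsTangentSum v.1 w.1 z) :
    z = (v + w).1 := by
  obtain ⟨u, h1, h2, h3⟩ := hz
  obtain ⟨u', h1', h2', h3'⟩ := h.add_eq v w
  obtain rfl := (h.existsUnique v w).unique ⟨h1, h2⟩ ⟨h1', h2'⟩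
  exact h3.symm.trans h3'

/-- The map induced on the fibres of the synthetic tangent bundles is linear. -/
theorem exists_linearMap_tFiberMap {K : ThSmthSet} (f : G ⟶ K) {g : Plots G X}
    [AddCommGroup (TFiber G g)] [Module X.O (TFiber G g)] (hG : IsSyntheticModule G g)
    [AddCommGroup (TFiber K (ap f g))] [Module X.O (TFiber K (ap f g))]
    (hK : IsSyntheticModule K (ap f g)) :
    ∃ q : TFiber G g →ₗ[X.O] TFiber K (ap f g), ∀ v, q v = tFiberMap f g v :=
  ⟨{  toFun := tFiberMap f g
      map_add' := fun v w => Subtype.ext (hK.eq_add (v := tFiberMap f g v) (w := tFiberMap f g w)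
        ((hG.add_eq v w).map f))
      map_smul' := fun r v => Subtype.ext (by
        rw [RingHom.id_apply, hK.smul_eq]
        change ap f (r • v).1 = _
        rw [hG.smul_eq]
        exact ap_res f _ _) }, fun _ => rfl⟩

variable {A : ℕ → Type} [∀ n, CommRing (A n)] [∀ n, Algebra ℝ (A n)]
  {t : ∀ n, A n →ₐ[ℝ] A (n + 1)}

/-- Two tangent plots over the same plot have exactly one sum. -/
theorem PlotTower.existsUnique_isTangentSum (P : PlotTower G t) {v w : Plots (synT.obj G) X}
    (h : ap (synTProj G) v = ap (synTProj G) w) : ∃! z, IsTangentSum v w z := by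
  let := P.addCommGroup (ap (synTProj G) w)
  let := P.module (ap (synTProj G) w)
  let v' : TFiber G (ap (synTProj G) w) := ⟨v, h⟩
  let w' : TFiber G (ap (synTProj G) w) := ⟨w, rfl⟩
  have hs := P.isSyntheticModule (ap (synTProj G) w)
  exact ⟨(v' + w').1, hs.add_eq v' w', fun z hz => hs.eq_add (v := v') (w := w') hz⟩

/-- The fibrewise sum of two maps into a synthetic tangent bundle. -/
theorem PlotTower.exists_sum_hom (P : PlotTower G t) {K : ThSmthSet} (a b : K ⟶ synT.obj G)
    (hab : a ≫ synTProj G = b ≫ synTProj G) :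
    ∃ c : K ⟶ synT.obj G, ∀ (X : ThCartSp) (x : Plots K X), IsTangentSum (ap a x) (ap b x) (ap c x) := by
  have h1 : ∀ (X : ThCartSp) (x : Plots K X), ∃! z, IsTangentSum (ap a x) (ap b x) z := fun X x =>
    P.existsUnique_isTangentSum (congrArg (fun t : K ⟶ G => ap t x) hab)
  choose c hc hc' using h1
  refine ⟨ObjectProperty.homMk
    { app := fun X => ↾(c X.unop)
      naturality := fun X Y f => ?_ }, hc⟩
  ext x
  refine (hc' Y.unop (res K f.unop x) _ ?_).symm
  have h2 := (hc X.unop x).res f.unop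
  rw [← ap_res a f.unop, ← ap_res b f.unop] at h2
  exact h2

end TangentSum

/-! ### Splittings of the differential of a map -/

theorem isCompl_ker_range_of_leftInverse {R V W : Type} [Ring R] [AddCommGroup V] [Module R V]
    [AddCommGroup W] [Module R W] (q : V →ₗ[R] W) (η : W →ₗ[R] V) (h : q ∘ₗ η = LinearMap.id) :
    IsCompl (LinearMap.ker q) (LinearMap.range η) := by
  have h1 : ∀ w, q (η w) = w := fun w => LinearMap.congr_fun h w
  constructor
  · rw [Submodule.disjoint_def]
    rintro _ hv ⟨w, rfl⟩
    rw [LinearMap.mem_ker, h1] at hv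
    rw [hv, map_zero]
  · rw [codisjoint_iff, eq_top_iff]
    intro v _
    rw [← sub_add_cancel v (η (q v))]
    refine Submodule.add_mem_sup ?_ ⟨q v, rfl⟩
    rw [LinearMap.mem_ker, map_sub, h1, sub_self]

section Splitting

variable {G K : ThSmthSet} {A B : ℕ → Type} [∀ n, CommRing (A n)] [∀ n, Algebra ℝ (A n)]
  {t : ∀ n, A n →ₐ[ℝ] A (n + 1)} [∀ n, CommRing (B n)] [∀ n, Algebra ℝ (B n)]
  {t' : ∀ n, B n →ₐ[ℝ] B (n + 1)} (P : PlotTower G t) (Q : PlotTower K t')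
  {p : G ⟶ K}

/-- A map `H : G ×_K TK ⟶ TG` is linear along the fibres. Linear combinations are expressed through the
derivations given by tangent plots. -/
def IsLinearLift (H : pullback p (synTProj K) ⟶ synT.obj G) : Prop :=
  ∀ (X : ThCartSp) (z z₁ z₂ : Plots (pullback p (synTProj K)) X) (a b : X.O),
    ap (pullback.fst p (synTProj K)) z = ap (pullback.fst p (synTProj K)) z₁ →
    ap (pullback.fst p (synTProj K)) z = ap (pullback.fst p (synTProj K)) z₂ →
    (∀ n f, X.coef₁ (Q.tev (ap (pullback.snd p (synTProj K)) z) n f) =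
      a * X.coef₁ (Q.tev (ap (pullback.snd p (synTProj K)) z₁) n f) +
      b * X.coef₁ (Q.tev (ap (pullback.snd p (synTProj K)) z₂) n f)) →
    ∀ n f, X.coef₁ (P.tev (ap H z) n f) =
      a * X.coef₁ (P.tev (ap H z₁) n f) + b * X.coef₁ (P.tev (ap H z₂) n f)

variable {P Q} {H : pullback p (synTProj K) ⟶ synT.obj G} {X : ThCartSp} {s : Plots G X}

theorem exists_plot_of_tFiber (w : TFiber K (ap p s)) : ∃ z : Plots (pullback p (synTProj K)) X,
    ap (pullback.fst p (synTProj K)) z = s ∧ ap (pullback.snd p (synTProj K)) z = w.1 :=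
  exists_plot_pullback p (synTProj K) s w.1 w.2.symm

theorem ap_synTProj_lift (h₁ : H ≫ synTProj G = pullback.fst p (synTProj K))
    (z : Plots (pullback p (synTProj K)) X) :
    ap (synTProj G) (ap H z) = ap (pullback.fst p (synTProj K)) z := by
  rw [← ap_comp, h₁]

/-- A linear lift induces linear maps on the fibres over plots. -/
theorem IsLinearLift.exists_linearMap (hH : IsLinearLift P Q H)
    (h₁ : H ≫ synTProj G = pullback.fst p (synTProj K)) :
    letI := P.addCommGroup s; letI := P.module s
    letI := Q.addCommGroup (ap p s); letI := Q.module (ap p s)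
    ∃ η : TFiber K (ap p s) →ₗ[X.O] TFiber G s, ∀ w, ∃ z : Plots (pullback p (synTProj K)) X,
      ap (pullback.fst p (synTProj K)) z = s ∧ ap (pullback.snd p (synTProj K)) z = w.1 ∧
        ap H z = (η w).1 := by
  let := P.addCommGroup s
  let := P.module s
  let := Q.addCommGroup (ap p s)
  let := Q.module (ap p s)
  choose l hl hl' using fun w : TFiber K (ap p s) => exists_plot_of_tFiber w
  let η : TFiber K (ap p s) → TFiber G s := fun w => ⟨ap H (l w), by
    rw [ap_synTProj_lift h₁, hl]⟩
  have key : ∀ (w w₁ w₂ : TFiber K (ap p s)) (a b : X.O), (∀ n f, (Q.derivative w).1 n f =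
      a * (Q.derivative w₁).1 n f + b * (Q.derivative w₂).1 n f) → ∀ n f,
      (P.derivative (η w)).1 n f =
        a * (P.derivative (η w₁)).1 n f + b * (P.derivative (η w₂)).1 n f := by
    intro w w₁ w₂ a b h
    refine hH X (l w) (l w₁) (l w₂) a b ((hl w).trans (hl w₁).symm) ((hl w).trans (hl w₂).symm) ?_
    rw [hl', hl', hl']
    exact h
  exact ⟨{  toFun := η
            map_add' := fun w₁ w₂ => P.tangent_ext fun n f => by
              rw [P.derivative_add, key (w₁ + w₂) w₁ w₂ 1 1 (fun n f => by
                rw [Q.derivative_add, one_mul, one_mul]), one_mul, one_mul]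
            map_smul' := fun r w => P.tangent_ext fun n f => by
              rw [RingHom.id_apply, P.derivative_smul, key (r • w) w w r 0 (fun n f => by
                rw [Q.derivative_smul, zero_mul, add_zero]), zero_mul, add_zero] },
    fun w => ⟨l w, hl w, hl' w, rfl⟩⟩

/-- The zero of the module of tangent plots over `g` is the plot given by the zero section. -/
theorem PlotTower.zero_val (g : Plots G X) : letI := P.addCommGroup g
    ((0 : TFiber G g)).1 = ap (synTZero G) g := by
  let := P.addCommGroup g
  let z : TFiber G g := ⟨ap (synTZero G) g, by
    rw [← ap_comp, synTZero_proj]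
    rfl⟩
  have h1 : ∀ n a, (P.derivative z).1 n a = 0 := fun n a => by
    change X.coef₁ (P.ev (X := X.ext D1) (res G (X.fst D1) g) n a) = 0
    rw [P.ev_res, ThCartSp.coef_fst]
    simp
  have h2 : z = z + z := P.tangent_ext fun n a => by
    rw [P.derivative_add, h1, add_zero]
  have h3 : z = 0 := by simpa using h2
  rw [← h3]

/-- The kernel of the differential of `p` consists of the plots of the vertical bundle. -/
theorem mem_ker_iff_vertical (v : TFiber G s) :
    letI := Q.addCommGroup (ap p s)
    tFiberMap p s v = 0 ↔ ∃ z : Plots (pullback (synTZero K) (synT.map p)) X,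
      ap (pullback.snd (synTZero K) (synT.map p)) z = v.1 := by
  let := Q.addCommGroup (ap p s)
  have h0 : ∀ w : TFiber K (ap p s), w = 0 ↔ w.1 = ap (synTZero K) (ap p s) := fun w => by
    rw [← Q.zero_val, Subtype.ext_iff]
  rw [h0]
  refine ⟨fun h => ?_, fun ⟨z, hz⟩ => ?_⟩
  · obtain ⟨z, -, hz⟩ := exists_plot_pullback (synTZero K) (synT.map p) (ap p s) v.1 h.symm
    exact ⟨z, hz⟩
  · have h1 := ap_pullback_condition (synTZero K) (synT.map p) z
    rw [hz] at h1
    have h2 := congrArg (fun x => ap (synTProj K) x) h1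
    have h3 : ap (synTProj K) (ap (synT.map p) v.1) = ap p s := (tFiberMap p s v).2
    have h5 : ∀ y : Plots K X, ap (synTProj K) (ap (synTZero K) y) = y := fun y => by
      rw [← ap_comp, synTZero_proj]
      rfl
    have h4 : ap (pullback.fst (synTZero K) (synT.map p)) z = ap p s :=
      (h5 _).symm.trans (h2.trans h3)
    rw [h4] at h1
    exact h1.symm

/-- A linear lift splits the sequence of the fibres over a plot. -/
theorem IsLinearLift.exists_splitting (hH : IsLinearLift P Q H)
    (h₁ : H ≫ synTProj G = pullback.fst p (synTProj K))
    (h₂ : H ≫ synT.map p = pullback.snd p (synTProj K)) (s : Plots G X) :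
    ∃ (_ : AddCommGroup (TFiber G s)) (_ : Module X.O (TFiber G s))
      (_ : AddCommGroup (TFiber K (ap p s))) (_ : Module X.O (TFiber K (ap p s))),
      IsSyntheticModule G s ∧ IsSyntheticModule K (ap p s) ∧
      ∃ (q : TFiber G s →ₗ[X.O] TFiber K (ap p s)) (η : TFiber K (ap p s) →ₗ[X.O] TFiber G s),
        (∀ v, q v = tFiberMap p s v) ∧
        (∀ w, ∃ z : Plots (pullback p (synTProj K)) X,
          ap (pullback.fst p (synTProj K)) z = s ∧
          ap (pullback.snd p (synTProj K)) z = w.1 ∧ ap H z = (η w).1) ∧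
        (∀ v, v ∈ LinearMap.ker q ↔ ∃ z : Plots (pullback (synTZero K) (synT.map p)) X,
          ap (pullback.snd (synTZero K) (synT.map p)) z = v.1) ∧
        (∀ v, v ∈ LinearMap.range η ↔ ∃ z : Plots (pullback p (synTProj K)) X, ap H z = v.1) ∧
        q ∘ₗ η = LinearMap.id ∧ IsCompl (LinearMap.ker q) (LinearMap.range η) := by
  let := P.addCommGroup s
  let := P.module s
  let := Q.addCommGroup (ap p s)
  let := Q.module (ap p s)
  obtain ⟨q, hq⟩ := exists_linearMap_tFiberMap p (P.isSyntheticModule s)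
    (Q.isSyntheticModule (ap p s))
  obtain ⟨η, hη⟩ := hH.exists_linearMap (s := s) h₁
  have hqη : q ∘ₗ η = LinearMap.id := by
    refine LinearMap.ext fun w => Subtype.ext ?_
    obtain ⟨z, -, hz₂, hz⟩ := hη w
    rw [LinearMap.comp_apply, hq, LinearMap.id_apply, ← hz₂, ← h₂]
    exact congrArg (fun x => ap (synT.map p) x) hz.symm
  refine ⟨inferInstance, inferInstance, inferInstance, inferInstance, P.isSyntheticModule s,
    Q.isSyntheticModule (ap p s), q, η, hq, hη, fun v => ?_, fun v => ⟨?_, ?_⟩, hqη,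
    isCompl_ker_range_of_leftInverse q η hqη⟩
  · rw [LinearMap.mem_ker, hq]
    exact mem_ker_iff_vertical v
  · rintro ⟨w, rfl⟩
    obtain ⟨z, -, -, hz⟩ := hη w
    exact ⟨z, hz⟩
  · rintro ⟨z, hz⟩
    have h3 : ap (pullback.fst p (synTProj K)) z = s := by
      rw [← ap_synTProj_lift h₁, hz, v.2]
    have h4 : ap (synTProj K) (ap (pullback.snd p (synTProj K)) z) = ap p s := by
      rw [← ap_pullback_condition, h3]
    obtain ⟨z', hz₁', hz₂', hz'⟩ := hη ⟨_, h4⟩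
    obtain rfl : z' = z := plot_pullback_ext (hz₁'.trans h3.symm) hz₂'
    exact ⟨_, Subtype.ext (hz'.symm.trans hz)⟩

end Splitting

/-! ### The direct sum decomposition -/

section DirectSum

variable {G A B : ThSmthSet} {i : A ⟶ synT.obj G} {j : B ⟶ synT.obj G}

variable (i j) in
/-- The fibres over plots of the images of `i` and `j` are complementary submodules of the fibres of
the synthetic tangent bundle. -/
def AreFiberwiseComplements : Prop :=
  ∀ (X : ThCartSp) (s : Plots G X), ∃ (_ : AddCommGroup (TFiber G s)) (_ : Module X.O (TFiber G s)),
    IsSyntheticModule G s ∧ ∃ S T : Submodule X.O (TFiber G s),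
      (∀ v, v ∈ S ↔ ∃ z : Plots A X, ap i z = v.1) ∧
      (∀ v, v ∈ T ↔ ∃ z : Plots B X, ap j z = v.1) ∧ IsCompl S T

variable {X : ThCartSp}

/-- Addition is a bijection from the sum of complementary subbundles to the tangent bundle. -/
theorem AreFiberwiseComplements.bijective (h : AreFiberwiseComplements i j)
    (hi : ∀ X, Function.Injective fun x : Plots A X => ap i x)
    (hj : ∀ X, Function.Injective fun x : Plots B X => ap j x)
    {c : pullback (i ≫ synTProj G) (j ≫ synTProj G) ⟶ synT.obj G}
    (hc : ∀ (X : ThCartSp) (z : Plots (pullback (i ≫ synTProj G) (j ≫ synTProj G)) X),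
      IsTangentSum (ap (pullback.fst _ _ ≫ i) z) (ap (pullback.snd _ _ ≫ j) z) (ap c z))
    (hcp : c ≫ synTProj G = pullback.fst _ _ ≫ i ≫ synTProj G) (X : ThCartSp) :
    Function.Bijective fun z : Plots (pullback (i ≫ synTProj G) (j ≫ synTProj G)) X => ap c z := by
  have hp₁ : ∀ z : Plots (pullback (i ≫ synTProj G) (j ≫ synTProj G)) X,
      ap (synTProj G) (ap (pullback.fst _ _ ≫ i) z) = ap (synTProj G) (ap c z) := fun z => by
    rw [← ap_comp, ← ap_comp, hcp, Category.assoc]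
  have hp₂ : ∀ z : Plots (pullback (i ≫ synTProj G) (j ≫ synTProj G)) X,
      ap (synTProj G) (ap (pullback.snd _ _ ≫ j) z) = ap (synTProj G) (ap c z) := fun z => by
    rw [← ap_comp, ← ap_comp, hcp, Category.assoc, pullback.condition]
  constructor
  · intro z z' hz
    have hz : ap c z = ap c z' := hz
    obtain ⟨_, _, hs, S, T, hS, hT, hST⟩ := h X (ap (synTProj G) (ap c z))
    let v : TFiber G (ap (synTProj G) (ap c z)) := ⟨_, hp₁ z⟩
    let w : TFiber G (ap (synTProj G) (ap c z)) := ⟨_, hp₂ z⟩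
    let v' : TFiber G (ap (synTProj G) (ap c z)) := ⟨_, (hp₁ z').trans (by rw [hz])⟩
    let w' : TFiber G (ap (synTProj G) (ap c z)) := ⟨_, (hp₂ z').trans (by rw [hz])⟩
    have h1 : v + w = v' + w' := Subtype.ext ((hs.eq_add (v := v) (w := w) (hc X z)).symm.trans
      (hz.trans (hs.eq_add (v := v') (w := w') (hc X z'))))
    -- The difference lies in both submodules.
    have h2 : v - v' = w' - w := by
      rw [sub_eq_sub_iff_add_eq_add, h1, add_comm]
    have h3 : v - v' = 0 := by
      refine (Submodule.disjoint_def.1 hST.disjoint) _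
        (S.sub_mem ((hS v).2 ⟨_, rfl⟩) ((hS v').2 ⟨_, rfl⟩)) ?_
      rw [h2]
      exact T.sub_mem ((hT w').2 ⟨_, rfl⟩) ((hT w).2 ⟨_, rfl⟩)
    have h4 : w' - w = 0 := h2.symm.trans h3
    refine plot_pullback_ext (hi X ?_) (hj X ?_)
    · exact congrArg Subtype.val (sub_eq_zero.1 h3)
    · exact congrArg Subtype.val (sub_eq_zero.1 h4).symm
  · intro y
    obtain ⟨_, _, hs, S, T, hS, hT, hST⟩ := h X (ap (synTProj G) y)
    let u : TFiber G (ap (synTProj G) y) := ⟨y, rfl⟩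
    have hu : u ∈ S ⊔ T := by
      rw [hST.sup_eq_top]
      exact Submodule.mem_top
    obtain ⟨v, hv, w, hw, hvw⟩ := Submodule.mem_sup.1 hu
    obtain ⟨x₁, hx₁⟩ := (hS v).1 hv
    obtain ⟨x₂, hx₂⟩ := (hT w).1 hw
    obtain ⟨z, hz₁, hz₂⟩ := exists_plot_pullback (i ≫ synTProj G) (j ≫ synTProj G) x₁ x₂ (by
      rw [ap_comp, ap_comp, hx₁, hx₂, v.2, w.2])
    have h1 := hc X z
    rw [ap_comp, ap_comp, hz₁, hz₂, hx₁, hx₂] at h1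
    refine ⟨z, (hs.eq_add h1).trans ?_⟩
    rw [hvw]

variable {C : ℕ → Type} [∀ n, CommRing (C n)] [∀ n, Algebra ℝ (C n)]
  {t : ∀ n, C n →ₐ[ℝ] C (n + 1)}

theorem PlotTower.proj_of_isTangentSum (P : PlotTower G t) {v w z : Plots (synT.obj G) X}
    (hvw : ap (synTProj G) v = ap (synTProj G) w) (hz : IsTangentSum v w z) :
    ap (synTProj G) z = ap (synTProj G) w := by
  let := P.addCommGroup (ap (synTProj G) w)
  let := P.module (ap (synTProj G) w)
  let v' : TFiber G (ap (synTProj G) w) := ⟨v, hvw⟩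
  let w' : TFiber G (ap (synTProj G) w) := ⟨w, rfl⟩
  rw [(P.isSyntheticModule (ap (synTProj G) w)).eq_add (v := v') (w := w') hz]
  exact (v' + w').2

/-- Addition is an isomorphism from the sum of complementary subbundles to the tangent bundle. -/
theorem AreFiberwiseComplements.exists_iso (h : AreFiberwiseComplements i j) (P : PlotTower G t)
    (hi : ∀ X, Function.Injective fun x : Plots A X => ap i x)
    (hj : ∀ X, Function.Injective fun x : Plots B X => ap j x) :
    ∃ Ψ : synT.obj G ≅ pullback (i ≫ synTProj G) (j ≫ synTProj G),
      Ψ.inv ≫ synTProj G = pullback.fst _ _ ≫ i ≫ synTProj G ∧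
      ∀ (X : ThCartSp) (z : Plots (pullback (i ≫ synTProj G) (j ≫ synTProj G)) X),
        IsTangentSum (ap (pullback.fst _ _ ≫ i) z) (ap (pullback.snd _ _ ≫ j) z) (ap Ψ.inv z) := by
  have hab : (pullback.fst (i ≫ synTProj G) (j ≫ synTProj G) ≫ i) ≫ synTProj G =
      (pullback.snd (i ≫ synTProj G) (j ≫ synTProj G) ≫ j) ≫ synTProj G := by
    rw [Category.assoc, Category.assoc, pullback.condition]
  obtain ⟨c, hc⟩ := P.exists_sum_hom _ _ hab
  have hcp : c ≫ synTProj G = pullback.fst _ _ ≫ i ≫ synTProj G := by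
    rw [← Category.assoc, hab]
    exact thSmthSet_hom_ext fun X x => P.proj_of_isTangentSum
      (congrArg (fun t : _ ⟶ G => ap t x) hab) (hc X x)
  have := isIso_of_bijective c fun X => h.bijective hi hj hc hcp X
  exact ⟨(asIso c).symm, hcp, hc⟩

end DirectSum

/-! ### Images of split monomorphisms -/

/-- The plot-wise image of a map with a left inverse is isomorphic to its source, hence a sheaf. -/
theorem isThickenedSmoothSet_range {G H : ThSmthSet} (f : G ⟶ H) (g : H ⟶ G) (hfg : f ≫ g = 𝟙 G) :
    IsThickenedSmoothSet (Subfunctor.range f.hom).toFunctor := by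
  have h1 : f.hom ≫ g.hom = 𝟙 G.obj := congrArg (fun t : G ⟶ G => t.hom) hfg
  have : Mono f.hom := (SplitMono.mk g.hom h1).mono
  intro X c
  exact Presieve.isSheafFor_iso (asIso (Subfunctor.toRange f.hom)) (G.property X c)

/-! ### The splitting of the tangent bundle of the infinite jet bundle -/

section ManifoldTower

variable {E H N : Type} [NormedAddCommGroup E] [NormedSpace ℝ E] [TopologicalSpace H]
  (I : ModelWithCorners ℝ E H) (N) [TopologicalSpace N] [ChartedSpace H N]

/-- A manifold as a constant tower. -/
def PlotTower.ofMan : PlotTower (yMan I N) (A := fun _ => C^∞⟮I, N; ℝ⟯) fun _ => AlgHom.id ℝ _ where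
  ev x _ := x
  ev_res _ _ _ _ := rfl
  ev_t _ _ _ := rfl
  ext h := AlgHom.ext fun a => h 0 a
  exists_plot φ h := ⟨φ 0, fun n a => by
    induction n with
    | zero => rfl
    | succ n ih => exact ih.trans (h n a).symm⟩

end ManifoldTower

section JetSplitting

variable {E EF V : Type} [NormedAddCommGroup E] [NormedSpace ℝ E] [NormedAddCommGroup EF]
  [NormedSpace ℝ EF] [NormedAddCommGroup V] [NormedSpace ℝ V] [FiniteDimensional ℝ E]
  [FiniteDimensional ℝ V]
  {M F : Type} [TopologicalSpace M] [ChartedSpace E M] [TopologicalSpace F] [ChartedSpace EF F]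
  {π : F → M} (h : IsFibered E EF V π)

open JetBundle

/-- The infinite jet bundle as the limit of the tower of the finite jet bundles. -/
def PlotTower.ofJetInf : PlotTower (jetInf h) (A := fun n => C^∞⟮jetI E V n, JetBundle h n; ℝ⟯)
    fun n => smoothPullback (truncCM h n) where
  ev x n := ap (jetInfProj h n) x
  ev_res f x n a := DFunLike.congr_fun (F := C^∞⟮jetI E V n, JetBundle h n; ℝ⟯ →ₐ[ℝ] _)
    (ap_res (jetInfProj h n) f x) a
  ev_t x n a := DFunLike.congr_fun (F := C^∞⟮jetI E V n, JetBundle h n; ℝ⟯ →ₐ[ℝ] _)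
    (ap_jetInfProj_succ h n x) a
  ext hxy := jetInf_plot_ext fun n => AlgHom.ext fun a => hxy n a
  exists_plot φ hφ := by
    obtain ⟨x, hx⟩ := exists_jetInf_plot h φ fun n => AlgHom.ext fun a => hφ n a
    exact ⟨x, fun n a => DFunLike.congr_fun (F := C^∞⟮jetI E V n, JetBundle h n; ℝ⟯ →ₐ[ℝ] _) (hx n) a⟩

variable [IsManifold 𝓘(ℝ, E) ∞ M] [IsManifold 𝓘(ℝ, EF) ∞ F] [T2Space M] [SecondCountableTopology M]
  [T2Space F] [SecondCountableTopology F] {h} {H : jetInfTM h ⟶ synT.obj (jetInf h)}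

theorem coef₁_tev_horizontalLift (hH : ∀ n, H ≫ synT.map (jetInfProj h n) =
      jetInfTMJet h (n + 1) ≫ yJetPush h n ≫ kappaJet h n) {X : ThCartSp}
    (z : Plots (jetInfTM h) X) (n : ℕ) (f : C^∞⟮jetI E V n, JetBundle h n; ℝ⟯) :
    X.coef₁ ((PlotTower.ofJetInf h).tev (ap H z) n f) =
      (show C^∞⟮(jetI E V (n + 1)).prod 𝓘(ℝ, E), JetTM h (n + 1); ℝ⟯ →ₐ[ℝ] X.O from
        ap (jetInfTMJet h (n + 1)) z) (smoothPullback (jetPushCM h n) (dFun f)) := by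
  have h1 : ap (synT.map (jetInfProj h n)) (ap H z) =
      ap (kappaJet h n) (ap (yJetPush h n) (ap (jetInfTMJet h (n + 1)) z)) :=
    congrArg (fun t : jetInfTM h ⟶ synT.obj (yJet h n) => ap t z) (hH n)
  exact (congrArg (fun φ : C^∞⟮jetI E V n, JetBundle h n; ℝ⟯ →ₐ[ℝ] (X.ext D1).O => X.coef₁ (φ f))
    h1).trans (coef₁_kappa _ f)

theorem apply_jetTMFst {X : ThCartSp} (z : Plots (jetInfTM h) X) (n : ℕ)
    (f : C^∞⟮jetI E V n, JetBundle h n; ℝ⟯) :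
    (show C^∞⟮(jetI E V n).prod 𝓘(ℝ, E), JetTM h n; ℝ⟯ →ₐ[ℝ] X.O from
        ap (jetInfTMJet h n) z) (smoothPullback (jetTMFst h n) f) =
      (show C^∞⟮jetI E V n, JetBundle h n; ℝ⟯ →ₐ[ℝ] X.O from
        ap (jetInfProj h n) (ap (jetInfTMFst h) z)) f :=
  DFunLike.congr_fun (F := C^∞⟮jetI E V n, JetBundle h n; ℝ⟯ →ₐ[ℝ] X.O)
    (congrArg (fun t : jetInfTM h ⟶ yJet h n => ap t z) (jetInfTMJet_fst h n)) f

theorem apply_jetTMSnd {X : ThCartSp} (z : Plots (jetInfTM h) X) (n : ℕ)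
    (f : C^∞⟮𝓘(ℝ, E), M; ℝ⟯) :
    (show C^∞⟮(jetI E V n).prod 𝓘(ℝ, E), JetTM h n; ℝ⟯ →ₐ[ℝ] X.O from
        ap (jetInfTMJet h n) z) (smoothPullback (jetTMSnd h n) (dFun f)) =
      X.coef₁ ((PlotTower.ofMan 𝓘(ℝ, E) M).tev (ap (jetInfTMSnd h) z) 0 f) := by
  have h1 : ap (kappa 𝓘(ℝ, E) M) (ap (yMap (jetTMSnd h n)) (ap (jetInfTMJet h n) z)) =
      ap (jetInfTMSnd h) z :=
    congrArg (fun t : jetInfTM h ⟶ synT.obj (yMan 𝓘(ℝ, E) M) => ap t z) (jetInfTMJet_snd h n)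
  exact (coef₁_kappa _ f).symm.trans
    (congrArg (fun φ : C^∞⟮𝓘(ℝ, E), M; ℝ⟯ →ₐ[ℝ] (X.ext D1).O => X.coef₁ (φ f)) h1)

/-- The horizontal lift is linear along the fibres. -/
theorem isLinearLift_horizontalLift (hH : ∀ n, H ≫ synT.map (jetInfProj h n) =
      jetInfTMJet h (n + 1) ≫ yJetPush h n ≫ kappaJet h n) :
    IsLinearLift (p := jetInfPt h) (PlotTower.ofJetInf h) (PlotTower.ofMan 𝓘(ℝ, E) M) H := by
  intro X z z₁ z₂ a b h₁ h₂ hz n f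
  refine (coef₁_tev_horizontalLift hH z n f).trans (Eq.trans ?_ (congrArg₂ (fun x y => a * x + b * y)
    (coef₁_tev_horizontalLift hH z₁ n f).symm (coef₁_tev_horizontalLift hH z₂ n f).symm))
  refine (isTangentPullback_jetTM h (n + 1)).apply_combination (isFiberwiseLinear_jetPush f)
    (fun f => ?_) (fun f => ?_) a b fun f => ?_
  · refine (apply_jetTMFst z (n + 1) f).trans (Eq.trans ?_ (apply_jetTMFst z₁ (n + 1) f).symm)
    exact congrArg (fun s => (show C^∞⟮jetI E V (n + 1), JetBundle h (n + 1); ℝ⟯ →ₐ[ℝ] X.O from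
      ap (jetInfProj h (n + 1)) s) f) h₁
  · refine (apply_jetTMFst z (n + 1) f).trans (Eq.trans ?_ (apply_jetTMFst z₂ (n + 1) f).symm)
    exact congrArg (fun s => (show C^∞⟮jetI E V (n + 1), JetBundle h (n + 1); ℝ⟯ →ₐ[ℝ] X.O from
      ap (jetInfProj h (n + 1)) s) f) h₂
  · refine (apply_jetTMSnd z (n + 1) f).trans (Eq.trans (hz 0 f) ?_)
    exact congrArg₂ (fun x y => a * x + b * y) (apply_jetTMSnd z₁ (n + 1) f).symm
      (apply_jetTMSnd z₂ (n + 1) f).symm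

theorem isFiberwiseSplitting_horizontalLift (hH : ∀ n, H ≫ synT.map (jetInfProj h n) =
      jetInfTMJet h (n + 1) ≫ yJetPush h n ≫ kappaJet h n) : IsFiberwiseSplitting h H :=
  fun _ s => (isLinearLift_horizontalLift hH).exists_splitting (horizontalLift_proj hH)
    (horizontalLift_pt hH) s

/-- The vertical and the horizontal bundle are complementary. -/
theorem exists_iso_vertSumHor (hs : IsFiberwiseSplitting h H)
    (hH : IsThickenedSmoothSet (Subfunctor.range H.hom).toFunctor) :
    ∃ Ψ : synT.obj (jetInf h) ≅ vertSumHor h H hH,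
      Ψ.inv ≫ synTProj (jetInf h) = pullback.fst _ _ ≫ vertInfIncl h ≫ synTProj (jetInf h) ∧
      ∀ (X : ThCartSp) (z : Plots (vertSumHor h H hH) X),
        IsTangentSum (ap (pullback.fst _ _ ≫ vertInfIncl h) z)
          (ap (pullback.snd _ _ ≫ horInfIncl h H hH) z) (ap Ψ.inv z) := by
  have h1 : AreFiberwiseComplements (vertInfIncl h) (horInfIncl h H hH) := fun X s => by
    obtain ⟨a₁, a₂, _, _, h₁, -, q, η, -, -, hker, hrange, -, hc⟩ := hs X s
    refine ⟨a₁, a₂, h₁, LinearMap.ker q, LinearMap.range η, hker, fun v => ?_, hc⟩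
    rw [hrange]
    constructor
    · rintro ⟨z, hz⟩
      exact ⟨⟨v.1, z, hz⟩, rfl⟩
    · rintro ⟨⟨_, z, hz⟩, rfl⟩
      exact ⟨z, hz⟩
  exact h1.exists_iso (PlotTower.ofJetInf h) (fun _ _ _ hxy => vertInf_plot_ext hxy)
    fun _ _ _ hxy => Subtype.ext hxy

end JetSplitting

end

theorem mainTheorem11 {E EF V M F N : Type}
    [NormedAddCommGroup E] [NormedSpace ℝ E] [FiniteDimensional ℝ E]
    [NormedAddCommGroup EF] [NormedSpace ℝ EF] [FiniteDimensional ℝ EF]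
    [NormedAddCommGroup V] [NormedSpace ℝ V] [FiniteDimensional ℝ V]
    [TopologicalSpace M] [ChartedSpace E M] [IsManifold 𝓘(ℝ, E) ∞ M]
    [T2Space M] [SecondCountableTopology M]
    [TopologicalSpace F] [ChartedSpace EF F] [IsManifold 𝓘(ℝ, EF) ∞ F]
    [T2Space F] [SecondCountableTopology F]
    [TopologicalSpace N] [ChartedSpace V N] [IsManifold 𝓘(ℝ, V) ∞ N]
    (π : F → M) (hπ : IsSmoothFiberBundle E EF V N π) :
    let h : IsFibered E EF V π := hπ.isFibered
    let hV : IsFibered E (E × (V × V)) (V × V) (VertBundle.proj h) := VertBundle.isFibered h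
    -- the synthetic tangent bundles of manifolds are the usual ones
    (IsIso (kappa 𝓘(ℝ, E) M) ∧ ∀ n, IsIso (kappa (jetI E V n) (JetBundle h n))) ∧
    -- the tangent bundle of the infinite jet bundle is the limit of the finite-order ones
    (∃ Λ : synT.obj (jetInf h) ≅ tanLim h, ∀ n,
      Λ.hom ≫ tanLimProj h n ≫ kappa (jetI E V n) (JetBundle h n) =
        synT.map (jetInfProj h n)) ∧
    -- the vertical bundle is the infinite jet bundle of the vertical bundle, over `F` and `M`
    (∃ θ : ∀ n, C^∞⟮jetI E (V × V) n, JetBundle hV n;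
        (jetI E V n).tangent, TangentBundle (jetI E V n) (JetBundle h n)⟯,
      (∀ n, IsJetVelocityMap h n (θ n)) ∧
      ∃ Θ : vertInf h ≅ jetInf hV,
        (∀ n, Θ.inv ≫ vertInfIncl h ≫ synT.map (jetInfProj h n) =
          jetInfProj hV n ≫ yMap (θ n) ≫ kappa (jetI E V n) (JetBundle h n)) ∧
        Θ.inv ≫ vertInfIncl h ≫ synTProj (jetInf h) ≫ jetInfValue h =
          jetInfValue hV ≫ yMap (VertBundle.footCM h) ∧
        Θ.inv ≫ vertInfIncl h ≫ synTProj (jetInf h) ≫ jetInfPt h = jetInfPt hV) ∧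
    -- the splitting by the pushforwards along jet prolongations
    (∃ Hn : ∀ n, C^∞⟮(jetI E V (n + 1)).prod 𝓘(ℝ, E), JetTM h (n + 1);
        (jetI E V n).tangent, TangentBundle (jetI E V n) (JetBundle h n)⟯,
      (∀ n, IsHolonomicPushforward h n (Hn n)) ∧
      ∃ e : ∀ n, yMan ((jetI E V n).prod 𝓘(ℝ, E)) (JetTM h n) ≅
          pullback (yMap (JetBundle.ptCM h n)) (synTProj (yMan 𝓘(ℝ, E) M)),
        (∀ n, (e n).hom = jetTMCompare h n) ∧
        ∃ H : jetInfTM h ⟶ synT.obj (jetInf h),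
          (∀ H' : jetInfTM h ⟶ synT.obj (jetInf h),
            (∀ n, H' ≫ synT.map (jetInfProj h n) =
              jetInfTMProj h (n + 1) ≫ (e (n + 1)).inv ≫ yMap (Hn n) ≫
                kappa (jetI E V n) (JetBundle h n)) ↔ H' = H) ∧
          Mono (vertInfIncl h) ∧
          H ≫ jetInfDiff h = 𝟙 (jetInfTM h) ∧
          IsFiberwiseSplitting h H ∧
          ∃ hH : IsThickenedSmoothSet (Subfunctor.range H.hom).toFunctor,
            ∃ Ψ : synT.obj (jetInf h) ≅ vertSumHor h H hH,
              Ψ.inv ≫ synTProj (jetInf h) =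
                pullback.fst _ _ ≫ vertInfIncl h ≫ synTProj (jetInf h) ∧
              ∀ (X : ThCartSp) (z : Plots (vertSumHor h H hH) X),
                IsTangentSum (ap (pullback.fst _ _ ≫ vertInfIncl h) z)
                  (ap (pullback.snd _ _ ≫ horInfIncl h H hH) z) (ap Ψ.inv z)) := by
  intro h hV
  obtain ⟨H, hH⟩ := exists_horizontalLift h
  refine ⟨⟨isIso_kappa, fun n => isIso_kappa⟩, exists_iso_tanLim h,
    ⟨fun n => jetVelocityCM h n, fun n => isJetVelocityMap_jetVelocityCM, exists_iso_vertInf h⟩,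
    fun n => jetPushCM h n, fun n => isHolonomicPushforward_jetPushCM h n,
    fun n => @asIso _ _ _ _ (yJetTMCompare h n) (isIso_yJetTMCompare h n), fun n => rfl, H, fun H' => ⟨fun hH' => ?_, ?_⟩,
    mono_vertInfIncl h, horizontalLift_jetInfDiff hH, isFiberwiseSplitting_horizontalLift hH,
    isThickenedSmoothSet_range H _ (horizontalLift_jetInfDiff hH),
    exists_iso_vertSumHor (isFiberwiseSplitting_horizontalLift hH) _⟩
  · exact synT_jetInf_hom_ext h fun n => (hH' n).trans (hH n).symm
  · rintro rfl
    exact hH
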